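/- Let $B_3=\langle\sigma_1,\sigma_2\mid\sigma_1\sigma_2\sigma_1=\sigma_2\sigma_1\sigma_2\rangle$ be the three string braid group, and for $g\in B_3$ let $g'$ be the reversed braid, i.e. $g\mapsto g'$ is the anti-automorphism of $B_3$ fixing $\sigma_1$ and $\sigma_2$. Let $\mathrm{iss}_n B_3=\mathrm{rep}_n B_3/\!/GL_n$ be the affine variety whose points are the isomorphism classes of semisimple $n$-dimensional complex representations of $B_3$ (regular functions: the $GL_n$-invariant regular functions on $\mathrm{rep}_n B_3$; Zariski topology). Let $\rho$ be a primitive third root of unity. For $\beta=(a,b;x,y,z)$ with $a+b=x+y+z=n$ let $\mathrm{iss}_\beta B_3\subset\mathrm{iss}_n B_3$ be the set of classes of semisimple representations of the form $\sigma_i\mapsto t\,W(\sigma_i)$, where $t\in\mathbb{C}^*$ and $W$ is an $n$-dimensional representation of the modular group $B_3/\langle(\sigma_1\sigma_2)^3\rangle$ in which $\sigma_1\sigma_2\sigma_1$ has eigenvalues $1,-1$ with multiplicities $a,b$ and $\sigma_1\sigma_2$ has eigenvalues $1,\rho,\rho^2$ with multiplicities $x,y,z$. Consider the flype $\sigma_1^{-1}\sigma_2^{2}\sigma_1^{-2}\sigma_2$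 and the braid $\sigma_1^{-2}\sigma_2\sigma_1^{-1}\sigma_2\sigma_1^{-1}\sigma_2^{2}$, whose closure is the knot $8_{17}$. 1. There are exactly four irreducible components of $\mathrm{iss}_6 B_3$ that contain a simple representation: $6a$ with $\beta=(3,3;3,2,1)$, its mirror with $\beta=(3,3;3,1,2)$, $6b$ with $\beta=(3,3;2,2,2)$ and $6c$ with $\beta=(4,2;2,2,2)$. Their dimensions are $6,6,8,6$ respectively. 2. For every representation $V$ in one of the three components of dimension 6, $Tr_V(g)=Tr_V(g')$ for every $g\in B_3$ (in particular for the flype and for the braid of $8_{17}$). 3. If $b$ is the flype or the braid of $8_{17}$, then $Tr(b)\neq Tr(b')$ on a nonempty, dense, Zariski open subset of $6b$. Explicitly, $$\sigma_1\mapsto\begin{bmatrix}\rho+1&\rho-1&\rho-1&\rho-1&-\rho+1&-\rho+1\\-2\rho-1&-1&-2\rho-1&2\rho+1&-2\rho-1&2\rho+1\\\rho+2&\rho+2&-\rho&-\rho-2&-\rho-2&\rho+2\\-\rho-2&-3\rho&\rho+2&-\rho+2&3\rho&-\rho-2\\\rho-1&-\rho+1&3\rho+3&-\rho+1&3\rho+1&-3\rho-3\\-3&-2\rho-1&2\rho+1&3&2\rho+1&-2\rho-3\end{bmatrix},$$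 $$\sigma_2\mapsto\begin{bmatrix}\rho+1&\rho-1&\rho-1&-\rho+1&\rho-1&\rho-1\\-2\rho-1&-1&-2\rho-1&-2\rho-1&2\rho+1&-2\rho-1\\\rho+2&\rho+2&-\rho&\rho+2&\rho+2&-\rho-2\\\rho+2&3\rho&-\rho-2&-\rho+2&3\rho&-\rho-2\\-\rho+1&\rho-1&-3\rho-3&-\rho+1&3\rho+1&-3\rho-3\\3&2\rho+1&-2\rho-1&3&2\rho+1&-2\rho-3\end{bmatrix}$$ defines a simple representation of $B_3$ belonging to $6b$, with $Tr(b)=-7128\rho-1092$ and $Tr(b')=7128\rho+6036$ for the braid $b$ of $8_{17}$, and $Tr(b)=648\rho-228$ and $Tr(b')=-648\rho-876$ for the flype $b$. 4. The least $n$ for which there are an $n$-dimensional complex representation $V$ of $B_3$ and a braid $g\in B_3$ with $Tr_V(g)\neq Tr_V(g')$ is $n=6$. 5. $6b$ is the only irreducible component of $\mathrm{iss}_6 B_3$ that contains a representation $V$ with $Tr_V(g)\neq Tr_V(g')$ for some $g\in B_3$. -/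

import Mathlib

noncomputable section

namespace BraidReversal

/-! ### The three string braid group and braid reversal -/

/-- The relator of the braid relation `s₁ s₂ s₁ = s₂ s₁ s₂`. -/
def braidRels : Set (FreeGroup (Fin 2)) :=
  {FreeGroup.of 0 * FreeGroup.of 1 * FreeGroup.of 0 *
    (FreeGroup.of 1 * FreeGroup.of 0 * FreeGroup.of 1)⁻¹}

/-- The three string braid group. -/
abbrev B3 : Type := PresentedGroup braidRels

def s1 : B3 := PresentedGroup.of 0

def s2 : B3 := PresentedGroup.of 1

theorem braid_relation : s1 * s2 * s1 = s2 * s1 * s2 := by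
  have h : PresentedGroup.mk braidRels
      (FreeGroup.of 0 * FreeGroup.of 1 * FreeGroup.of 0 *
        (FreeGroup.of 1 * FreeGroup.of 0 * FreeGroup.of 1)⁻¹) = 1 :=
    (QuotientGroup.eq_one_iff _).2 (Subgroup.subset_normalClosure rfl)
  rw [map_mul, map_inv, mul_inv_eq_one, map_mul, map_mul, map_mul, map_mul] at h
  exact h

/-- Reading a braid word backwards, as a homomorphism to the opposite group. -/
def reverseHom : B3 →* B3ᵐᵒᵖ :=
  PresentedGroup.toGroup (f := fun i : Fin 2 => MulOpposite.op (PresentedGroup.of i : B3)) (by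
    intro r hr
    rw [Set.mem_singleton_iff.1 hr]
    have h := braid_relation
    simp only [map_mul, map_inv, FreeGroup.lift_apply_of, mul_inv_eq_one]
    apply MulOpposite.unop_injective
    simpa only [MulOpposite.unop_mul, MulOpposite.unop_op, s1, s2, mul_assoc] using h)

/-- The reversed braid: the anti-automorphism of `B3` that fixes both generators. -/
def reverse (g : B3) : B3 := (reverseHom g).unop

/-- A non-degenerate flype of minimal length. -/
def flype : B3 := s1⁻¹ * s2 ^ 2 * (s1 ^ 2)⁻¹ * s2

/-- A three string braid whose closure is the knot `8₁₇`. -/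
def braid817 : B3 := (s1 ^ 2)⁻¹ * s2 * s1⁻¹ * s2 * s1⁻¹ * s2 ^ 2

/-! ### Representations, and the variety of semisimple representations -/

/-- The points of the variety of `n`-dimensional complex representations of `B3`. -/
abbrev Rep (n : ℕ) : Type := B3 →* GL (Fin n) ℂ

/-- The matrix by which a braid acts. -/
def Rep.mat {n : ℕ} (V : Rep n) (g : B3) : Matrix (Fin n) (Fin n) ℂ :=
  (V g : Matrix (Fin n) (Fin n) ℂ)

/-- The same representation, as an action on the space `ℂⁿ`. -/
def Rep.toRepresentation {n : ℕ} (V : Rep n) : Representation ℂ B3 (Fin n → ℂ) :=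
  ((Matrix.toLinAlgEquiv' : Matrix (Fin n) (Fin n) ℂ ≃ₐ[ℂ] _) : _ →* _).comp
    ((Units.coeHom _).comp V)

def Rep.IsSimple {n : ℕ} (V : Rep n) : Prop := V.toRepresentation.IsIrreducible

def Rep.IsSemisimple {n : ℕ} (V : Rep n) : Prop :=
  V.toRepresentation.IsSemisimpleRepresentation

/-- Base change: `g ↦ P (V g) P⁻¹`. -/
def Rep.conj {n : ℕ} (P : GL (Fin n) ℂ) (V : Rep n) : Rep n :=
  (MulAut.conj P).toMonoidHom.comp V

/-- Isomorphism of (semisimple) representations. -/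
def isoSetoid (n : ℕ) : Setoid {V : Rep n // V.IsSemisimple} where
  r V W := ∃ P : GL (Fin n) ℂ, W.1 = V.1.conj P
  iseqv :=
    { refl := fun V => ⟨1, by ext1 g; simp [Rep.conj]⟩
      symm := by
        rintro V W ⟨P, h⟩
        refine ⟨P⁻¹, ?_⟩
        rw [h]
        ext1 g
        simp [Rep.conj, mul_assoc]
      trans := by
        rintro U V W ⟨P, h⟩ ⟨Q, k⟩
        refine ⟨Q * P, ?_⟩
        rw [k, h]
        ext1 g
        simp [Rep.conj, mul_assoc] }

/-- The points of `iss_n B₃`: isomorphism classes of semisimple `n`-dimensional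
representations. -/
def Iss (n : ℕ) : Type := Quotient (isoSetoid n)

/-- The isomorphism class of a semisimple representation. -/
def Iss.mk {n : ℕ} (V : Rep n) (hV : V.IsSemisimple) : Iss n :=
  Quotient.mk (isoSetoid n) ⟨V, hV⟩

/-- The ring of regular functions on the variety of `n`-dimensional representations, generated by
the matrix coefficients (that is, by the entries of `σ₁`, `σ₂` and of their inverses). -/
def regularFunctions (n : ℕ) : Subalgebra ℂ (Rep n → ℂ) :=
  Algebra.adjoin ℂ {f | ∃ (g : B3) (i j : Fin n), f = fun V => V.mat g i j}

/-- The regular functions that are invariant under base change by `GL_n`. -/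
def invariants (n : ℕ) : Subalgebra ℂ (Rep n → ℂ) where
  carrier := {f | f ∈ regularFunctions n ∧
    ∀ (P : GL (Fin n) ℂ) (V : Rep n), f (V.conj P) = f V}
  mul_mem' := fun {f g} hf hg => ⟨mul_mem hf.1 hg.1, fun P V => by
    simp only [Pi.mul_apply, hf.2 P V, hg.2 P V]⟩
  add_mem' := fun {f g} hf hg => ⟨add_mem hf.1 hg.1, fun P V => by
    simp only [Pi.add_apply, hf.2 P V, hg.2 P V]⟩
  algebraMap_mem' := fun c => ⟨Subalgebra.algebraMap_mem _ c, fun _ _ => rfl⟩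

/-- The coordinate ring of the quotient variety `iss_n B₃ = rep_n B₃ // GL_n`: the invariant
regular functions, as functions on the set of isomorphism classes of semisimple representations. -/
def issRing (n : ℕ) : Subalgebra ℂ (Iss n → ℂ) where
  carrier := {F | ∃ f ∈ invariants n, ∀ (V : Rep n) (hV : V.IsSemisimple), F (Iss.mk V hV) = f V}
  mul_mem' := by
    rintro F G ⟨f, hf, h⟩ ⟨g, hg, k⟩
    exact ⟨f * g, mul_mem hf hg, fun V hV => by simp only [Pi.mul_apply, h V hV, k V hV]⟩
  add_mem' := by
    rintro F G ⟨f, hf, h⟩ ⟨g, hg, k⟩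
    exact ⟨f + g, add_mem hf hg, fun V hV => by simp only [Pi.add_apply, h V hV, k V hV]⟩
  algebraMap_mem' := fun c => ⟨algebraMap ℂ _ c, Subalgebra.algebraMap_mem _ c, fun _ _ => rfl⟩

/-- The Zariski topology of `iss_n B₃`. -/
instance zariskiTopology (n : ℕ) : TopologicalSpace (Iss n) :=
  TopologicalSpace.generateFrom {U | ∃ F ∈ issRing n, U = {x | F x ≠ 0}}

/-- Restriction of functions to a subset. -/
def restrictHom {X : Type} (Z : Set X) : (X → ℂ) →ₐ[ℂ] (Z → ℂ) where
  toFun F := fun z => F z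
  map_one' := rfl
  map_mul' _ _ := rfl
  map_zero' := rfl
  map_add' _ _ := rfl
  commutes' _ := rfl

/-- The coordinate ring of a subvariety of `iss_n B₃`. -/
def coordinateRing {n : ℕ} (Z : Set (Iss n)) : Subalgebra ℂ (Z → ℂ) :=
  (issRing n).map (restrictHom Z)

/-- The dimension of an irreducible subvariety: the transcendence degree over `ℂ` of its
coordinate ring. -/
def dimension {n : ℕ} (Z : Set (Iss n)) : Cardinal := Algebra.trdeg ℂ (coordinateRing Z)

/-- The trace of a braid on an isomorphism class of semisimple representations. -/
def Iss.trace {n : ℕ} (x : Iss n) (g : B3) : ℂ :=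
  Quotient.lift (fun V : {V : Rep n // V.IsSemisimple} => (V.1.mat g).trace) (by
    rintro V W ⟨P, h⟩
    have e : W.1.mat g = (P : Matrix (Fin n) (Fin n) ℂ) * V.1.mat g *
        ((P⁻¹ : GL (Fin n) ℂ) : Matrix (Fin n) (Fin n) ℂ) := by
      rw [h]; rfl
    change (V.1.mat g).trace = (W.1.mat g).trace
    rw [e, Matrix.trace_mul_cycle, ← Units.val_mul]
    simp) x

/-- The isomorphism class consists of simple representations. -/
def Iss.IsSimple {n : ℕ} (x : Iss n) : Prop :=
  ∃ (V : Rep n) (hV : V.IsSemisimple), V.IsSimple ∧ x = Iss.mk V hV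

/-! ### The components -/

/-- The dimension of the eigenspace of a braid for the eigenvalue `μ`. -/
def Rep.eigenDim {n : ℕ} (V : Rep n) (g : B3) (μ : ℂ) : ℕ :=
  Module.finrank ℂ (Module.End.eigenspace (Matrix.toLin' (V.mat g)) μ)

/-- `W` factors through the modular group, the quotient of `B3` by its centre (generated by
`(σ₁σ₂)³`), and has dimension vector `(a, b; x, y, z)`: these are the dimensions of the eigenspaces
of `S = σ₁σ₂σ₁` for `1, -1` and of `T = σ₁σ₂` for `1, ρ, ρ²`. -/
def Rep.IsModular (ρ : ℂ) {n : ℕ} (W : Rep n) (a b x y z : ℕ) : Prop :=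
  W ((s1 * s2) ^ 3) = 1 ∧
  W.eigenDim (s1 * s2 * s1) 1 = a ∧ W.eigenDim (s1 * s2 * s1) (-1) = b ∧
  W.eigenDim (s1 * s2) 1 = x ∧ W.eigenDim (s1 * s2) ρ = y ∧ W.eigenDim (s1 * s2) (ρ ^ 2) = z

/-- `iss_β B₃` for `β = (a, b; x, y, z)`: the classes of the semisimple representations
`σᵢ ↦ t W(σᵢ)`, where `t ≠ 0` is a scalar and `W` is a representation of the modular group with
dimension vector `β`. -/
def issBeta (ρ : ℂ) (n a b x y z : ℕ) : Set (Iss n) :=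
  {p | ∃ (V : Rep n) (hV : V.IsSemisimple) (W : Rep n) (t : ℂ), p = Iss.mk V hV ∧
    W.IsModular ρ a b x y z ∧ t ≠ 0 ∧
    V.mat s1 = t • W.mat s1 ∧ V.mat s2 = t • W.mat s2}

def comp6a (ρ : ℂ) : Set (Iss 6) := issBeta ρ 6 3 3 3 2 1

/-- The mirror image of `6a`. -/
def comp6aMirror (ρ : ℂ) : Set (Iss 6) := issBeta ρ 6 3 3 3 1 2

def comp6b (ρ : ℂ) : Set (Iss 6) := issBeta ρ 6 3 3 2 2 2

def comp6c (ρ : ℂ) : Set (Iss 6) := issBeta ρ 6 4 2 2 2 2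

/-! ### An explicit representation -/

def explicitS1 (ρ : ℂ) : Matrix (Fin 6) (Fin 6) ℂ :=
  !![ρ + 1, ρ - 1, ρ - 1, ρ - 1, -ρ + 1, -ρ + 1;
     -2 * ρ - 1, -1, -2 * ρ - 1, 2 * ρ + 1, -2 * ρ - 1, 2 * ρ + 1;
     ρ + 2, ρ + 2, -ρ, -ρ - 2, -ρ - 2, ρ + 2;
     -ρ - 2, -3 * ρ, ρ + 2, -ρ + 2, 3 * ρ, -ρ - 2;
     ρ - 1, -ρ + 1, 3 * ρ + 3, -ρ + 1, 3 * ρ + 1, -3 * ρ - 3;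
     -3, -2 * ρ - 1, 2 * ρ + 1, 3, 2 * ρ + 1, -2 * ρ - 3]

def explicitS2 (ρ : ℂ) : Matrix (Fin 6) (Fin 6) ℂ :=
  !![ρ + 1, ρ - 1, ρ - 1, -ρ + 1, ρ - 1, ρ - 1;
     -2 * ρ - 1, -1, -2 * ρ - 1, -2 * ρ - 1, 2 * ρ + 1, -2 * ρ - 1;
     ρ + 2, ρ + 2, -ρ, ρ + 2, ρ + 2, -ρ - 2;
     ρ + 2, 3 * ρ, -ρ - 2, -ρ + 2, 3 * ρ, -ρ - 2;
     -ρ + 1, ρ - 1, -3 * ρ - 3, -ρ + 1, 3 * ρ + 1, -3 * ρ - 3;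
     3, 2 * ρ + 1, -2 * ρ - 1, 3, 2 * ρ + 1, -2 * ρ - 3]

end BraidReversal

end

noncomputable section

namespace BraidReversal

open MulOpposite Module

/-! ### Generators of the braid group -/

/-! Write S and T for the images of Δ = σ₁σ₂σ₁ and of σ₁σ₂. These two braids generate, and Δ² =
(σ₁σ₂)³ is central, so by Schur's lemma it acts on a simple representation as a scalar
(`exists_center_scalar`). After a twist σᵢ ↦ tσᵢ, S is an involution and T has order three. Reversal
followed by conjugation by Δ fixes both Δ and σ₁σ₂ (`twist_bS`, `twist_bT`). So the question becomes
whether a word in S and T has the same trace as the word read backwards.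

Two situations force equality. If some eigenvalue of T occurs at most once, its projector e
satisfies e x e = c e. Words then break up at e into words in two idempotents, and these are
insensitive to reversal between copies of e (`trace_reverse_of_rank_one`). If S has an eigenspace of
dimension two, words compress to words in two 2 × 2 matrices, and the Cayley–Hamilton identities
reduce those to 1, A, B, AB, BA (`trace_reverse_of_rank_two`). The first criterion covers simple
representations of dimension at most five, because three multiplicities with sum at most five cannot
all be at least two. Additivity of the trace on extensions then covers all representations of
dimension at most five and the reducible ones of dimension six. The two criteria also cover 6a, its
mirror and 6c.

For the classification, in a simple representation of dimension six no eigenvector is common to S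
and T, and T satisfies no quadratic equation. Up to the choice of t, this leaves exactly the four
dimension vectors (`dimensionVector_cases`, `Rep.IsSimple.mem_comp`). Each family is cut out by
equations between invariant functions, hence is closed. Traces of S, T and S² show that the families
are pairwise disjoint. Each is parametrized by GL₆ × ℂˣ through normal forms, hence irreducible
(`Parametrizes.isIrreducible`). The simple locus is open by Burnside's theorem and a Gram
determinant, so an irreducible set with a simple point lies in one family
(`subset_of_isIrreducible`). Hence the families are the components in question.

For the dimensions, each family has a slice: polynomial matrices in 6 or 8 parameters onto which the
generic normal form can be conjugated. If the parameters are algebraic over the restricted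
invariants, the coordinate ring has transcendence degree equal to their number
(`IsSlice.dimension_eq`). The parameters are recovered from traces of words in the blocks of S
(`recover6a`, `recover6b`, `recover6c`).

Finally, the explicit representation is defined over ℤ[ω]. Its simplicity is certified by a rank one
matrix in the algebra it spans, and the traces are computed there. One separated point makes the
separating locus dense in the irreducible set 6b. A component that separates some braid from its
reversal contains a simple representation by the reducible case, so it is one of the four, and only
6b is left. -/

/-- The braid `σ₁σ₂σ₁`. -/
abbrev bS : B3 := s1 * s2 * s1

/-- The braid `σ₁σ₂`. -/
abbrev bT : B3 := s1 * s2

theorem bS_mul_bS : bS * bS = bT ^ 3 := by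
  calc bS * bS = s1 * s2 * s1 * (s2 * s1 * s2) := by rw [bS, ← braid_relation]
    _ = bT ^ 3 := by simp only [bT, pow_succ, pow_zero, one_mul, mul_assoc]

theorem bS_mul_s1 : bS * s1 = s2 * bS := by
  rw [bS, braid_relation]; simp only [mul_assoc]; rw [← mul_assoc s1 s2 s1, braid_relation, mul_assoc]

theorem bS_mul_s2 : bS * s2 = s1 * bS := by
  rw [bS]; simp only [mul_assoc]; rw [← mul_assoc s2 s1 s2, ← braid_relation, mul_assoc]

theorem s1_eq : s1 = bT⁻¹ * bS := by
  simp [bS, bT, mul_assoc]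

theorem s2_eq : s2 = bS * bT⁻¹ := by
  rw [bS, braid_relation]; simp [bT, mul_assoc]

theorem closure_s1_s2 : Subgroup.closure {s1, s2} = (⊤ : Subgroup B3) := by
  rw [← PresentedGroup.closure_range_of braidRels]
  congr 1
  ext x
  simp [s1, s2, Fin.exists_fin_two, eq_comm]

theorem closure_bS_bT : Subgroup.closure {bS, bT} = (⊤ : Subgroup B3) := by
  rw [eq_top_iff, ← closure_s1_s2, Subgroup.closure_le]
  have hS : bS ∈ Subgroup.closure {bS, bT} := Subgroup.subset_closure (by simp)
  have hT : bT ∈ Subgroup.closure {bS, bT} := Subgroup.subset_closure (by simp)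
  rintro x (rfl | rfl)
  · rw [s1_eq]; exact mul_mem (inv_mem hT) hS
  · rw [s2_eq]; exact mul_mem hS (inv_mem hT)

/-- A homomorphism to a monoid takes values in a submonoid as soon as the images of
`σ₁σ₂σ₁`, `σ₁σ₂` and of their inverses belong to it. -/
theorem hom_mem_of_bS_bT {M : Type*} [Monoid M] (f : B3 →* M) (N : Submonoid M)
    (h1 : f bS ∈ N) (h2 : f bS⁻¹ ∈ N) (h3 : f bT ∈ N) (h4 : f bT⁻¹ ∈ N) (g : B3) : f g ∈ N := by
  have hg : g ∈ Subgroup.closure {bS, bT} := closure_bS_bT ▸ Subgroup.mem_top g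
  -- Closure induction has a case for inverses, and `N` need not be stable under inversion; hence
  -- `g` and `g⁻¹` are carried together.
  have key : f g ∈ N ∧ f g⁻¹ ∈ N := by
    induction hg using Subgroup.closure_induction with
    | mem x hx =>
      rcases hx with rfl | rfl
      exacts [⟨h1, h2⟩, ⟨h3, h4⟩]
    | one => simp
    | mul x y _ _ hx hy => simpa using ⟨mul_mem hx.1 hy.1, mul_mem hy.2 hx.2⟩
    | inv x _ hx => simpa using hx.symm
  exact key.1

@[simp] theorem reverse_mul (g h : B3) : reverse (g * h) = reverse h * reverse g := by
  simp [reverse]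

@[simp] theorem reverse_one : reverse 1 = 1 := by simp [reverse]

@[simp] theorem reverse_inv (g : B3) : reverse g⁻¹ = (reverse g)⁻¹ := by simp [reverse]

@[simp] theorem reverse_pow (g : B3) (n : ℕ) : reverse (g ^ n) = reverse g ^ n := by
  simp [reverse]

@[simp] theorem reverse_s1 : reverse s1 = s1 := by
  simp [reverse, reverseHom, s1]

@[simp] theorem reverse_s2 : reverse s2 = s2 := by
  simp [reverse, reverseHom, s2]

/-- Reversal followed by conjugation, normalised so that `σ₁σ₂σ₁` and `σ₁σ₂` are fixed. -/
def twist : B3 →* B3ᵐᵒᵖ where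
  toFun g := op (bS * reverse g * bS⁻¹)
  map_one' := by simp
  map_mul' g h := by
    rw [← op_mul]
    congr 1
    rw [reverse_mul]
    group

theorem twist_bS : twist bS = op bS := by
  simp only [twist, MonoidHom.coe_mk, OneHom.coe_mk]
  congr 1
  simp [bS, mul_assoc]

/-- Reversal turns σ₁σ₂ into σ₂σ₁, and conjugation by Δ exchanges the two generators again. -/
theorem twist_bT : twist bT = op bT := by
  simp only [twist, MonoidHom.coe_mk, OneHom.coe_mk]
  congr 1
  rw [bT, reverse_mul, reverse_s1, reverse_s2, mul_inv_eq_iff_eq_mul]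
  rw [← mul_assoc, bS_mul_s2, mul_assoc, bS_mul_s1, mul_assoc]

end BraidReversal

namespace BraidReversal

open MulOpposite Module

/-! ### Traces of reversed braids -/

section Pairs

variable {A : Type*} [Ring A] [Algebra ℂ A]

/-- If `S` and `T` are multiples of the images of `σ₁σ₂σ₁` and `σ₁σ₂`, of orders dividing two and
three, and if noncommutative polynomials in `S` and `T` have the same trace as their reversals,
then braids have the same trace as their reversals. -/
theorem trace_reverse_of_adjoin (tr : A →ₗ[ℂ] ℂ) (htr : ∀ x y, tr (x * y) = tr (y * x))
    (r : B3 →* A) {S T : A} {a b : ℂ} (ha : a ≠ 0) (hb : b ≠ 0)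
    (hS : r bS = a • S) (hT : r bT = b • T) (hS2 : S * S = 1) (hT3 : T ^ 3 = 1)
    (h : ∀ z ∈ Algebra.adjoin ℂ {(S, op S), (T, op T)}, tr z.1 = tr (unop z.2)) (g : B3) :
    tr (r g) = tr (r (reverse g)) := by
  have inv_eq : ∀ (x : B3) (y : A), r x * y = 1 → r x⁻¹ = y := by
    intro x y hxy
    calc r x⁻¹ = r x⁻¹ * (r x * y) := by rw [hxy, mul_one]
      _ = y := by rw [← mul_assoc, ← map_mul]; simp
  have hS' : r bS⁻¹ = a⁻¹ • S := inv_eq _ _ (by rw [hS]; simp [hS2, ha])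
  have hT' : r bT⁻¹ = b⁻¹ • T ^ 2 := inv_eq _ _ (by
    rw [hT, smul_mul_smul_comm, ← pow_succ', hT3, mul_inv_cancel₀ hb, one_smul])
  -- A braid is recorded together with its normalised reversal. The opposite algebra makes the
  -- second coordinate multiplicative, so membership in the subalgebra is checked on generators
  -- only.
  let Φ : B3 →* A × Aᵐᵒᵖ := r.prod ((MonoidHom.op r).comp twist)
  have hΦ : ∀ x y, twist x = op y → Φ x = (r x, op (r y)) := by
    intro x y hxy
    simp [Φ, hxy, MonoidHom.op]
  have hS₀ : (S, op S) ∈ Algebra.adjoin ℂ {(S, op S), (T, op T)} :=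
    Algebra.subset_adjoin (by simp)
  have hT₀ : (T, op T) ∈ Algebra.adjoin ℂ {(S, op S), (T, op T)} :=
    Algebra.subset_adjoin (by simp)
  have mem : ∀ x, Φ x ∈ Algebra.adjoin ℂ {(S, op S), (T, op T)} := by
    intro x
    refine hom_mem_of_bS_bT Φ (Algebra.adjoin ℂ {(S, op S), (T, op T)}).toSubmonoid ?_ ?_ ?_ ?_ x
    · rw [hΦ _ _ twist_bS, hS]
      exact Subalgebra.smul_mem _ hS₀ a
    · rw [hΦ _ bS⁻¹ (by rw [map_inv, twist_bS, op_inv]), hS']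
      exact Subalgebra.smul_mem _ hS₀ a⁻¹
    · rw [hΦ _ _ twist_bT, hT]
      exact Subalgebra.smul_mem _ hT₀ b
    · rw [hΦ _ bT⁻¹ (by rw [map_inv, twist_bT, op_inv]), hT']
      exact Subalgebra.smul_mem _ (pow_mem hT₀ 2) b⁻¹
  have := h _ (mem g)
  rw [hΦ g (bS * reverse g * bS⁻¹) rfl] at this
  -- The conjugation by Δ built into `twist` disappears under the trace.
  rw [this, unop_op, map_mul, htr, ← map_mul, inv_mul_cancel_left]

/-- Words in two idempotents `p` and `f`: after multiplication by `f` on both sides they are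
palindromes, and they have the same trace as their reversals. -/
theorem word_two_idempotents (tr : A →ₗ[ℂ] ℂ) (htr : ∀ x y, tr (x * y) = tr (y * x))
    {p f : A} (hp : p * p = p) (hf : f * f = f) {z : A × Aᵐᵒᵖ}
    (hz : z ∈ Submonoid.closure {(p, op p), (f, op f)}) :
    f * z.1 * f = f * unop z.2 * f ∧ tr z.1 = tr (unop z.2) := by
  -- Repeated letters collapse, so a word alternates between p and f. The shapes of odd length are
  -- palindromes; those of even length are exchanged by reversal.
  have key : ∃ k : ℕ, z = ((p * f) ^ k, op ((f * p) ^ k)) ∨ z = ((f * p) ^ k, op ((p * f) ^ k)) ∨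
      z = ((p * f) ^ k * p, op ((p * f) ^ k * p)) ∨ z = ((f * p) ^ k * f, op ((f * p) ^ k * f)) := by
    induction hz using Submonoid.closure_induction_right with
    | one => exact ⟨0, .inl (by simp only [pow_zero]; rfl)⟩
    | mul_right x hx y hy ih =>
      -- The empty word has no last letter that could absorb the new one; this is the exception k =
      -- 0 in the four absorption rules.
      have pp : ∀ k, (f * p) ^ k * p = (f * p) ^ k ∨ k = 0 := by
        rintro (_ | k)
        · exact .inr rfl
        · left; rw [pow_succ, mul_assoc, mul_assoc f p p, hp]
      have ff : ∀ k, (p * f) ^ k * f = (p * f) ^ k ∨ k = 0 := by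
        rintro (_ | k)
        · exact .inr rfl
        · left; rw [pow_succ, mul_assoc, mul_assoc p f f, hf]
      have pp' : ∀ k, p * (p * f) ^ k = (p * f) ^ k ∨ k = 0 := by
        rintro (_ | k)
        · exact .inr rfl
        · left; rw [pow_succ', ← mul_assoc, ← mul_assoc p p f, hp]
      have ff' : ∀ k, f * (f * p) ^ k = (f * p) ^ k ∨ k = 0 := by
        rintro (_ | k)
        · exact .inr rfl
        · left; rw [pow_succ', ← mul_assoc, ← mul_assoc f f p, hf]
      have comm1 : ∀ k, p * (f * p) ^ k = (p * f) ^ k * p := fun k => by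
        induction k with
        | zero => simp
        | succ k ih => rw [pow_succ, ← mul_assoc, ih, pow_succ]; simp only [mul_assoc]
      have comm2 : ∀ k, f * (p * f) ^ k = (f * p) ^ k * f := fun k => by
        induction k with
        | zero => simp
        | succ k ih => rw [pow_succ, ← mul_assoc, ih, pow_succ]; simp only [mul_assoc]
      obtain ⟨k, rfl | rfl | rfl | rfl⟩ := ih <;> rcases hy with rfl | rfl <;>
        simp only [Prod.mk_mul_mk, ← op_mul]
      · exact ⟨k, .inr (.inr (.inl (by rw [comm1])))⟩
      · rcases ff k with h | rfl
        · rcases ff' k with h' | rfl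
          · exact ⟨k, .inl (by rw [h, h'])⟩
          · exact ⟨0, .inr (.inr (.inr (by simp)))⟩
        · exact ⟨0, .inr (.inr (.inr (by simp)))⟩
      · rcases pp k with h | rfl
        · rcases pp' k with h' | rfl
          · exact ⟨k, .inr (.inl (by rw [h, h']))⟩
          · exact ⟨0, .inr (.inr (.inl (by simp)))⟩
        · exact ⟨0, .inr (.inr (.inl (by simp)))⟩
      · exact ⟨k, .inr (.inr (.inr (by rw [comm2])))⟩
      · refine ⟨k, .inr (.inr (.inl ?_))⟩
        rw [mul_assoc, hp, ← comm1, ← mul_assoc, hp]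
      · refine ⟨k + 1, .inl ?_⟩
        rw [mul_assoc, ← pow_succ, ← comm1, ← mul_assoc, ← pow_succ']
      · refine ⟨k + 1, .inr (.inl ?_)⟩
        rw [mul_assoc, ← pow_succ, ← comm2, ← mul_assoc, ← pow_succ']
      · refine ⟨k, .inr (.inr (.inr ?_))⟩
        rw [mul_assoc, hf, ← comm2, ← mul_assoc, hf]
  have comm2 : ∀ k, f * (p * f) ^ k = (f * p) ^ k * f := fun k => by
    induction k with
    | zero => simp
    | succ k ih => rw [pow_succ, ← mul_assoc, ih, pow_succ]; simp only [mul_assoc]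
  have trk : ∀ k, tr ((p * f) ^ k) = tr ((f * p) ^ k) := by
    rintro (_ | k)
    · simp
    · rw [pow_succ', mul_assoc, htr, comm2, mul_assoc, ← pow_succ]
  have fk : ∀ k, f * (p * f) ^ k * f = f * (f * p) ^ k * f := by
    intro k
    rw [comm2, mul_assoc, hf]
    rcases k with _ | k
    · simp [hf]
    · rw [pow_succ', ← mul_assoc f (f * p), ← mul_assoc f f p, hf]
  obtain ⟨k, rfl | rfl | rfl | rfl⟩ := key
  · exact ⟨fk k, trk k⟩
  · exact ⟨(fk k).symm, (trk k).symm⟩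
  · exact ⟨rfl, rfl⟩
  · exact ⟨rfl, rfl⟩

/-- Noncommutative polynomials in two idempotents `p`, `f` and a rank one idempotent `e` below `f`
have the same trace as their reversals. -/
theorem trace_reverse_of_rank_one (tr : A →ₗ[ℂ] ℂ) (htr : ∀ x y, tr (x * y) = tr (y * x))
    {p f e : A} (hp : p * p = p) (hf : f * f = f) (he : e * e = e) (hfe : f * e = e)
    (hef : e * f = e) (hrank : ∀ x, ∃ c : ℂ, e * x * e = c • e) {z : A × Aᵐᵒᵖ}
    (hz : z ∈ Algebra.adjoin ℂ {(p, op p), (f, op f), (e, op e)}) : tr z.1 = tr (unop z.2) := by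
  let H : Submonoid (A × Aᵐᵒᵖ) := Submonoid.closure {(p, op p), (f, op f)}
  -- Everything between the first and the last e of a word contributes a scalar, so at most one e
  -- has to be kept.
  let G : Set (A × Aᵐᵒᵖ) := {z | z ∈ H ∨ ∃ u ∈ H, ∃ w ∈ H, ∃ c : ℂ, z = c • (u * (e, op e) * w)}
  -- Since e lies below f, a factor f can be inserted next to each e; between two f's a word and its
  -- reversal agree.
  have sand : ∀ u ∈ H, e * u.1 * e = e * unop u.2 * e := by
    intro u hu
    calc e * u.1 * e = e * (f * u.1 * f) * e := by
          rw [← mul_assoc, ← mul_assoc, hef, mul_assoc _ f e, hfe]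
      _ = e * (f * unop u.2 * f) * e := by rw [(word_two_idempotents tr htr hp hf hu).1]
      _ = e * unop u.2 * e := by rw [← mul_assoc, ← mul_assoc, hef, mul_assoc _ f e, hfe]
  have clos : ∀ z ∈ Submonoid.closure {(p, op p), (f, op f), (e, op e)}, z ∈ G := by
    intro z hz
    induction hz using Submonoid.closure_induction_right with
    | one => exact .inl (one_mem H)
    | mul_right x hx y hy ih =>
      have hy' : y ∈ H ∨ y = (e, op e) := by
        rcases hy with rfl | rfl | rfl
        · exact .inl (Submonoid.subset_closure (by simp))
        · exact .inl (Submonoid.subset_closure (by simp))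
        · exact .inr rfl
      rcases ih with hxH | ⟨u, hu, w, hw, c, rfl⟩ <;> rcases hy' with hyH | rfl
      · exact .inl (mul_mem hxH hyH)
      · exact .inr ⟨x, hxH, 1, one_mem H, 1, by simp⟩
      · exact .inr ⟨u, hu, w * y, mul_mem hw hyH, c, by simp [mul_assoc]⟩
      · obtain ⟨d, hd⟩ := hrank w.1
        refine .inr ⟨u, hu, 1, one_mem H, c * d, ?_⟩
        -- The same scalar d has to serve both coordinates, which is what `sand` provides.
        have : (e, op e) * w * (e, op e) = d • (e, op e) := by
          ext
          · simpa using hd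
          · simp only [Prod.snd_mul]
            rw [← op_unop w.2, ← op_mul, ← op_mul]
            change _ = op (d • e)
            rw [← hd, sand w hw, mul_assoc]
        rw [smul_mul_assoc, mul_assoc, mul_assoc, ← mul_assoc (e, op e), this, mul_one,
          mul_smul_comm, smul_smul]
  rw [← Subalgebra.mem_toSubmodule, Algebra.adjoin_eq_span] at hz
  induction hz using Submodule.span_induction with
  | zero => simp
  | add x y _ _ hx hy => simp [hx, hy]
  | smul c x _ hx => simp [hx]
  | mem x hx =>
    rcases clos x hx with hxH | ⟨u, hu, w, hw, c, rfl⟩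
    · exact (word_two_idempotents tr htr hp hf hxH).2
    · have h1 : ∀ a b : A, tr (a * e * b) = tr (e * (b * a) * e) := by
        intro a b
        rw [htr (e * (b * a)), ← mul_assoc, he, mul_assoc, htr, mul_assoc]
      have h2 := sand (w * u) (mul_mem hw hu)
      simp only [Prod.fst_mul, Prod.snd_mul, unop_mul] at h2
      simp only [Prod.smul_fst, Prod.smul_snd, unop_smul, map_smul, Prod.fst_mul, Prod.snd_mul,
        unop_mul, unop_op]
      rw [h1, h2, ← h1, mul_assoc]

end Pairs

/-- Words in two `2 × 2` matrices have the same trace as their reversals: the pairs formed by a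
word and its reversal span the space spanned by the pairs of the words `1, A, B, AB, BA`. -/
def pairSpan (A B : Matrix (Fin 2) (Fin 2) ℂ) :
    Submodule ℂ (Matrix (Fin 2) (Fin 2) ℂ × (Matrix (Fin 2) (Fin 2) ℂ)ᵐᵒᵖ) :=
  Submodule.span ℂ {1, (A, op A), (B, op B), (A * B, op (B * A)), (B * A, op (A * B))}

theorem trace_eq_of_mem_pairSpan {A B : Matrix (Fin 2) (Fin 2) ℂ}
    {z : Matrix (Fin 2) (Fin 2) ℂ × (Matrix (Fin 2) (Fin 2) ℂ)ᵐᵒᵖ} (hz : z ∈ pairSpan A B) :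
    z.1.trace = (unop z.2).trace := by
  induction hz using Submodule.span_induction with
  | zero => simp
  | add x y _ _ hx hy => simp [Matrix.trace_add, hx, hy]
  | smul c x _ hx => simp [Matrix.trace_smul, hx]
  | mem x hx =>
    rcases hx with rfl | rfl | rfl | rfl | rfl
    · rfl
    · rfl
    · rfl
    · exact Matrix.trace_mul_comm A B
    · exact Matrix.trace_mul_comm B A

theorem pairSpan_comm (A B : Matrix (Fin 2) (Fin 2) ℂ) : pairSpan A B = pairSpan B A := by
  unfold pairSpan
  congr 1
  ext z
  simp only [Set.mem_insert_iff, Set.mem_singleton_iff]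
  tauto

/-- Cayley–Hamilton gives A² in terms of A and 1, and its polarised form gives ABA in terms of A², A
and B. Both left-hand sides are palindromes, so the relations hold in the two coordinates with the
same coefficients, and right multiplication by A does not leave the span. -/
theorem mul_mem_pairSpan {A B : Matrix (Fin 2) (Fin 2) ℂ}
    {z : Matrix (Fin 2) (Fin 2) ℂ × (Matrix (Fin 2) (Fin 2) ℂ)ᵐᵒᵖ} (hz : z ∈ pairSpan A B) :
    z * (A, op A) ∈ pairSpan A B := by
  have m1 : (1 : Matrix (Fin 2) (Fin 2) ℂ × (Matrix (Fin 2) (Fin 2) ℂ)ᵐᵒᵖ) ∈ pairSpan A B :=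
    Submodule.subset_span (by simp)
  have mA : (A, op A) ∈ pairSpan A B := Submodule.subset_span (by simp)
  have mB : (B, op B) ∈ pairSpan A B := Submodule.subset_span (by simp)
  have mBA : (B * A, op (A * B)) ∈ pairSpan A B := Submodule.subset_span (by simp)
  have sq : A * A = A.trace • A - A.det • (1 : Matrix (Fin 2) (Fin 2) ℂ) := by
    ext i j
    fin_cases i <;> fin_cases j <;>
      simp [Matrix.mul_apply, Matrix.trace_fin_two, Matrix.det_fin_two] <;> ring
  have aba : A * B * A = B.trace • (A * A) + ((A * B).trace - A.trace * B.trace) • A + A.det • B := by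
    ext i j
    fin_cases i <;> fin_cases j <;>
      simp [Matrix.mul_apply, Matrix.trace_fin_two, Matrix.det_fin_two] <;> ring
  have mAA : (A * A, op (A * A)) ∈ pairSpan A B := by
    have : (A * A, op (A * A)) = A.trace • (A, op A) - A.det • 1 := by
      rw [sq]; rfl
    rw [this]
    exact sub_mem (Submodule.smul_mem _ _ mA) (Submodule.smul_mem _ _ m1)
  induction hz using Submodule.span_induction with
  | zero => simp
  | add x y _ _ hx hy => rw [add_mul]; exact add_mem hx hy
  | smul c x _ hx => rw [smul_mul_assoc]; exact Submodule.smul_mem _ _ hx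
  | mem x hx =>
    rcases hx with rfl | rfl | rfl | rfl | rfl
    · rw [one_mul]; exact mA
    · exact mAA
    · exact mBA
    · have : (A * B, op (B * A)) * (A, op A) = B.trace • (A * A, op (A * A)) +
          ((A * B).trace - A.trace * B.trace) • (A, op A) + A.det • (B, op B) := by
        simp only [Prod.mk_mul_mk, ← op_mul, ← mul_assoc, aba]; rfl
      rw [this]
      exact add_mem (add_mem (Submodule.smul_mem _ _ mAA) (Submodule.smul_mem _ _ mA))
        (Submodule.smul_mem _ _ mB)
    · have : (B * A, op (A * B)) * (A, op A) = A.trace • (B * A, op (A * B)) - A.det • (B, op B) := by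
        simp only [Prod.mk_mul_mk, ← op_mul]
        rw [mul_assoc, ← mul_assoc A A B, sq, mul_sub, sub_mul, mul_smul_comm, smul_mul_assoc,
          mul_smul_comm, smul_mul_assoc, mul_one, one_mul]
        rfl
      rw [this]
      exact sub_mem (Submodule.smul_mem _ _ mBA) (Submodule.smul_mem _ _ mB)

/-- Noncommutative polynomials in a rank two idempotent and an operator of order three have the
same trace as their reversals. -/
theorem trace_reverse_of_rank_two {n : ℕ} {ι : Matrix (Fin n) (Fin 2) ℂ}
    {π : Matrix (Fin 2) (Fin n) ℂ} {T : Matrix (Fin n) (Fin n) ℂ} (hT : T ^ 3 = 1)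
    {z : Matrix (Fin n) (Fin n) ℂ × (Matrix (Fin n) (Fin n) ℂ)ᵐᵒᵖ} (hπ : π * ι = 1)
    (hz : z ∈ Algebra.adjoin ℂ {(ι * π, op (ι * π)), (T, op T)}) :
    z.1.trace = (unop z.2).trace := by
  -- Between two copies of the idempotent only the compressions of powers of T matter. The
  -- compression of T⁰ is 1 and exponents count modulo 3, so two matrices of size 2 remain.
  let A : ℕ → Matrix (Fin 2) (Fin 2) ℂ := fun k => π * T ^ k * ι
  let L := pairSpan (A 1) (A 2)
  have hA : ∀ k, ∀ x ∈ L, x * (A k, op (A k)) ∈ L := by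
    intro k x hx
    induction k using Nat.strong_induction_on with
    | _ k ih =>
      match k with
      | 0 =>
        have : A 0 = 1 := by simp [A, hπ]
        rw [this]
        exact (mul_one x).symm ▸ hx
      | 1 => exact mul_mem_pairSpan hx
      | 2 =>
        -- `mul_mem_pairSpan` multiplies by the first matrix of the pair; the second one is reached
        -- by the symmetry of the span.
        have hx' := hx
        simp only [L] at hx' ⊢
        rw [pairSpan_comm] at hx' ⊢
        exact mul_mem_pairSpan hx'
      | k + 3 =>
        have : A (k + 3) = A k := by simp only [A, pow_add T k 3, hT, mul_one]
        rw [this]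
        exact ih k (by omega)
  let G : Set (Matrix (Fin n) (Fin n) ℂ × (Matrix (Fin n) (Fin n) ℂ)ᵐᵒᵖ) :=
    {z | (∃ i : ℕ, z = (T ^ i, op (T ^ i))) ∨ ∃ (i j : ℕ), ∃ m ∈ L,
      z = (T ^ i * ι * m.1 * π * T ^ j, op (T ^ j * ι * unop m.2 * π * T ^ i))}
  have m1 : 1 ∈ L := Submodule.subset_span (by simp)
  have clos : ∀ z ∈ Submonoid.closure {(ι * π, op (ι * π)), (T, op T)}, z ∈ G := by
    intro z hz
    induction hz using Submonoid.closure_induction_right with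
    | one => exact .inl ⟨0, by simp only [pow_zero]; rfl⟩
    | mul_right x hx y hy ih =>
      rcases ih with ⟨i, rfl⟩ | ⟨i, j, m, hm, rfl⟩ <;> rcases hy with rfl | rfl <;>
        simp only [Prod.mk_mul_mk, ← op_mul]
      · exact .inr ⟨i, 0, 1, m1, by simp [Matrix.mul_assoc]⟩
      · exact .inl ⟨i + 1, by rw [← pow_succ, ← pow_succ']⟩
      · exact .inr ⟨i, 0, _, hA j m hm, by simp [A, Matrix.mul_assoc]⟩
      · refine .inr ⟨i, j + 1, m, hm, ?_⟩
        refine Prod.ext ?_ (congrArg op ?_)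
        · simp only [pow_succ, Matrix.mul_assoc]
        · simp only [pow_succ', Matrix.mul_assoc]
  rw [← Subalgebra.mem_toSubmodule, Algebra.adjoin_eq_span] at hz
  induction hz using Submodule.span_induction with
  | zero => simp
  | add x y _ _ hx hy => simp [Matrix.trace_add, hx, hy]
  | smul c x _ hx => simp [Matrix.trace_smul, hx]
  | mem x hx =>
    rcases clos x hx with ⟨i, rfl⟩ | ⟨i, j, m, hm, rfl⟩
    · rfl
    · have h1 : ∀ (a : Matrix (Fin 2) (Fin 2) ℂ) (i j : ℕ),
          (T ^ i * ι * a * π * T ^ j).trace = (a * A (j + i)).trace := by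
        intro a i j
        have : T ^ i * ι * a * π * T ^ j = (T ^ i * ι) * (a * (π * T ^ j)) := by
          simp only [Matrix.mul_assoc]
        rw [this, Matrix.trace_mul_comm]
        simp only [A, pow_add, Matrix.mul_assoc]
      rw [unop_op]
      dsimp only
      rw [h1, h1, Matrix.trace_mul_comm (unop m.2), add_comm i j]
      exact trace_eq_of_mem_pairSpan (hA (j + i) m hm)

end BraidReversal

/-! ### An eigenvalue of multiplicity at most one -/

namespace BraidReversal

open MulOpposite Module

theorem rank_one_of_diagonal {n : ℕ} {κ : Fin n → Fin 3} {k : Fin 3}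
    (hk : (Finset.univ.filter fun i => κ i = k).card ≤ 1) (x : Matrix (Fin n) (Fin n) ℂ) :
    ∃ c : ℂ, Matrix.diagonal (fun i => if κ i = k then (1 : ℂ) else 0) * x *
      Matrix.diagonal (fun i => if κ i = k then (1 : ℂ) else 0) =
        c • Matrix.diagonal (fun i => if κ i = k then (1 : ℂ) else 0) := by
  have uniq : ∀ i j, κ i = k → κ j = k → i = j := fun i j hi hj =>
    Finset.card_le_one.1 hk i (by simpa) j (by simpa)
  by_cases h : ∃ i, κ i = k
  · obtain ⟨i₀, h₀⟩ := h
    refine ⟨x i₀ i₀, ?_⟩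
    ext i j
    by_cases hi : κ i = k
    · obtain rfl := uniq i i₀ hi h₀
      by_cases hj : κ j = k
      · obtain rfl := uniq j i hj hi
        simp [h₀]
      · have : i ≠ j := fun h => hj (h ▸ hi)
        simp [hj, this]
    · by_cases hij : i = j
      · subst hij; simp [hi]
      · simp [hi, hij]
  · push Not at h
    exact ⟨0, by simp [h]⟩

/-- Braid reversal is not detected by a representation for which `σ₁σ₂σ₁` and `σ₁σ₂` act, up to
scalars, as an involution and as a diagonal matrix with cubic roots of unity as entries, one of
which occurs at most once. -/
theorem trace_reverse_of_diagonal {n : ℕ} (ρ : ℂ) (r : B3 →* Matrix (Fin n) (Fin n) ℂ)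
    {S : Matrix (Fin n) (Fin n) ℂ} {a b : ℂ} (ha : a ≠ 0) (hb : b ≠ 0)
    (hS2 : S * S = 1) (hS : r bS = a • S) {κ : Fin n → Fin 3} (hρ : ρ ^ 3 = 1)
    (hT : r bT = b • Matrix.diagonal fun i => ρ ^ (κ i : ℕ)) {k : Fin 3}
    (hk : (Finset.univ.filter fun i => κ i = k).card ≤ 1) (g : B3) :
    (r g).trace = (r (reverse g)).trace := by
  set T : Matrix (Fin n) (Fin n) ℂ := Matrix.diagonal fun i => ρ ^ (κ i : ℕ) with hTdef
  have hT3 : T ^ 3 = 1 := by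
    rw [hTdef, Matrix.diagonal_pow, ← Matrix.diagonal_one]
    congr 1
    ext i
    simp only [Pi.pow_apply]
    rw [← pow_mul, mul_comm, pow_mul, hρ, one_pow]
  -- p projects to the 1-eigenspace of S. The projectors of T are e, f − e and 1 − f, so f removes a
  -- single eigenspace, e lies below f, and both S and T are linear combinations of 1, p, f, e.
  let p : Matrix (Fin n) (Fin n) ℂ := (2⁻¹ : ℂ) • (1 + S)
  let e : Matrix (Fin n) (Fin n) ℂ := Matrix.diagonal fun i => if κ i = k then 1 else 0
  let f : Matrix (Fin n) (Fin n) ℂ := Matrix.diagonal fun i => if κ i = k + 1 then 0 else 1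
  have hk1 : k ≠ k + 1 := by fin_cases k <;> decide
  have hp : p * p = p := by
    have h4 : (1 + S) * (1 + S) = (2 : ℂ) • (1 + S) := by
      rw [mul_add, add_mul, add_mul, hS2, two_smul]; simp; abel
    simp only [p, smul_mul_assoc, mul_smul_comm, h4, smul_smul]
    norm_num
  have hf : f * f = f := by simp [f, Matrix.diagonal_mul_diagonal]
  have he : e * e = e := by simp [e, Matrix.diagonal_mul_diagonal]
  have hfe : f * e = e := by
    simp only [f, e, Matrix.diagonal_mul_diagonal]
    congr 1; ext i
    by_cases h : κ i = k <;> simp [h, hk1]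
  have hef : e * f = e := by
    simp only [f, e, Matrix.diagonal_mul_diagonal]
    congr 1; ext i
    by_cases h : κ i = k <;> simp [h, hk1]
  have hTc : T = ρ ^ ((k + 1 : Fin 3) : ℕ) • (1 - f) + ρ ^ (k : ℕ) • e +
      ρ ^ ((k + 2 : Fin 3) : ℕ) • (f - e) := by
    have h3 : ∀ j : Fin 3, j = k ∨ j = k + 1 ∨ j = k + 2 := by
      intro j; fin_cases k <;> fin_cases j <;> decide
    have hk2 : k + 2 ≠ k := by fin_cases k <;> decide
    have hk3 : k + 2 ≠ k + 1 := by fin_cases k <;> decide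
    ext i j
    by_cases hij : i = j
    · subst hij
      rcases h3 (κ i) with h | h | h <;> simp [T, e, f, h, hk1, hk1.symm, hk2, hk3]
    · simp [T, e, f, hij]
  refine trace_reverse_of_adjoin (Matrix.traceLinearMap (Fin n) ℂ ℂ)
    (fun x y => Matrix.trace_mul_comm x y) r ha hb hS hT hS2 hT3 (fun z hz => ?_) g
  refine trace_reverse_of_rank_one (Matrix.traceLinearMap (Fin n) ℂ ℂ)
    (fun x y => Matrix.trace_mul_comm x y) hp hf he hfe hef (rank_one_of_diagonal hk) ?_
  have mp : (p, op p) ∈ Algebra.adjoin ℂ {(p, op p), (f, op f), (e, op e)} :=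
    Algebra.subset_adjoin (by simp)
  have mf : (f, op f) ∈ Algebra.adjoin ℂ {(p, op p), (f, op f), (e, op e)} :=
    Algebra.subset_adjoin (by simp)
  have me : (e, op e) ∈ Algebra.adjoin ℂ {(p, op p), (f, op f), (e, op e)} :=
    Algebra.subset_adjoin (by simp)
  refine Algebra.adjoin_le ?_ hz
  rintro z (rfl | rfl)
  · have : (S, op S) = (2 : ℂ) • (p, op p) - 1 := by
      have : S = (2 : ℂ) • p - 1 := by simp [p, smul_smul]
      conv_lhs => rw [this]
      rfl
    rw [this]
    exact sub_mem (Subalgebra.smul_mem _ mp _) (one_mem _)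
  · have : (T, op T) = ρ ^ ((k + 1 : Fin 3) : ℕ) • (1 - (f, op f)) + ρ ^ (k : ℕ) • (e, op e) +
        ρ ^ ((k + 2 : Fin 3) : ℕ) • ((f, op f) - (e, op e)) := by
      rw [hTc]; rfl
    rw [this]
    exact add_mem (add_mem (Subalgebra.smul_mem _ (sub_mem (one_mem _) mf) _)
      (Subalgebra.smul_mem _ me _)) (Subalgebra.smul_mem _ (sub_mem mf me) _)

/-! ### Eigenbases and additivity of the trace -/

section Linear

variable {V : Type} [AddCommGroup V] [Module ℂ V] [FiniteDimensional ℂ V]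

theorem exists_eigenbasis_of_isSemisimple {T : End ℂ V} (hT : T.IsSemisimple) :
    ∃ (b : Basis (Fin (finrank ℂ V)) ℂ V) (μ : Fin (finrank ℂ V) → ℂ),
      ∀ i, T (b i) = μ i • b i := by
  classical
  have h := DirectSum.isInternal_submodule_of_iSupIndep_of_iSup_eq_top
    T.eigenspaces_iSupIndep hT.iSup_eigenspace_eq_top
  let b := h.collectedBasis fun μ => finBasis ℂ (T.eigenspace μ)
  have hb : ∀ i, T (b i) = i.1 • b i := fun i =>
    End.mem_eigenspace_iff.1 (h.collectedBasis_mem (fun μ => finBasis ℂ (T.eigenspace μ)) i)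
  have := FiniteDimensional.fintypeBasisIndex b
  let e := Fintype.equivFinOfCardEq (finrank_eq_card_basis b).symm
  exact ⟨b.reindex e, fun i => (e.symm i).1, fun i => by simp [hb]⟩

omit [FiniteDimensional ℂ V] in
theorem isSemisimple_of_pow_eq_one {T : End ℂ V} {n : ℕ} (hn : n ≠ 0) (hT : T ^ n = 1) :
    T.IsSemisimple := by
  refine End.isSemisimple_of_squarefree_aeval_eq_zero (p := Polynomial.X ^ n - 1) ?_ (by simp [hT])
  have := (Polynomial.X_pow_sub_one_separable_iff (F := ℂ) (n := n)).2 (by exact_mod_cast hn)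
  exact this.squarefree

theorem exists_eigenbasis_of_pow_eq_one {T : End ℂ V} {n : ℕ} (hn : n ≠ 0) (hT : T ^ n = 1) :
    ∃ (b : Basis (Fin (finrank ℂ V)) ℂ V) (μ : Fin (finrank ℂ V) → ℂ),
      (∀ i, T (b i) = μ i • b i) ∧ ∀ i, μ i ^ n = 1 := by
  obtain ⟨b, μ, h⟩ := exists_eigenbasis_of_isSemisimple (isSemisimple_of_pow_eq_one hn hT)
  refine ⟨b, μ, h, fun i => ?_⟩
  have key : ∀ k, (T ^ k) (b i) = μ i ^ k • b i := by
    intro k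
    induction k with
    | zero => simp
    | succ k ih => rw [pow_succ', Module.End.mul_apply, ih, map_smul, h, smul_smul, ← pow_succ]
  have := key n
  rw [hT, Module.End.one_apply] at this
  by_contra hne
  have h0 : (μ i ^ n - 1) • b i = 0 := by rw [sub_smul, ← this, one_smul, sub_self]
  exact (smul_ne_zero (sub_ne_zero.2 hne) (b.ne_zero i)) h0

/-- The trace is additive on extensions. -/
theorem trace_eq_restrict_add_mapQ (N : Submodule ℂ V) (f : End ℂ V) (hf : ∀ x ∈ N, f x ∈ N) :
    LinearMap.trace ℂ V f = LinearMap.trace ℂ N (f.restrict hf) +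
      LinearMap.trace ℂ (V ⧸ N) (N.mapQ N f hf) := by
  obtain ⟨N', hN'⟩ := N.exists_isCompl
  let π : End ℂ V := N.subtype ∘ₗ N.projectionOnto N' hN'
  obtain ⟨s, hs⟩ := N.mkQ.exists_rightInverse_of_surjective N.range_mkQ
  -- For a section s of the quotient map, this is a projection onto N. In f = fπ' + f s q, with q
  -- the quotient map, the first term has the trace of the restriction, and cyclicity moves the
  -- second to the quotient.
  let π' : End ℂ V := 1 - s ∘ₗ N.mkQ
  have hπ' : ∀ x, π' x ∈ N := by
    intro x
    rw [← Submodule.Quotient.mk_eq_zero, ← Submodule.mkQ_apply]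
    have := LinearMap.congr_fun hs (N.mkQ x)
    simp only [LinearMap.comp_apply, LinearMap.id_apply, Submodule.mkQ_apply] at this
    simp [π', this]
  have hπ'' : ∀ x ∈ N, π' x = x := by
    intro x hx
    simp [π', (Submodule.Quotient.mk_eq_zero N).2 hx]
  have h1 : LinearMap.trace ℂ V (f ∘ₗ π') = LinearMap.trace ℂ N (f.restrict hf) := by
    rw [← LinearMap.trace_restrict_eq_of_forall_mem N (f ∘ₗ π') (fun x => hf _ (hπ' x))]
    congr 1
    ext x
    simp [hπ'' x x.2]
  have h2 : LinearMap.trace ℂ V (f ∘ₗ s ∘ₗ N.mkQ) = LinearMap.trace ℂ (V ⧸ N) (N.mapQ N f hf) := by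
    rw [← LinearMap.comp_assoc, LinearMap.trace_comp_comm']
    congr 1
    rw [← LinearMap.comp_assoc, ← Submodule.mapQ_mkQ N N f (h := hf), LinearMap.comp_assoc, hs,
      LinearMap.comp_id]
  rw [← h1, ← h2, ← map_add]
  congr 1
  ext x
  simp [π']

end Linear

/-- Δ² is a power of each of the generators Δ and σ₁σ₂, so it commutes with both. -/
theorem center_comm (g : B3) : Commute (bS * bS) g := by
  have h : g ∈ Subgroup.centralizer {bS * bS} := by
    have : Subgroup.closure {bS, bT} ≤ Subgroup.centralizer {bS * bS} := by
      rw [Subgroup.closure_le]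
      rintro x (rfl | rfl)
      · rw [SetLike.mem_coe, Subgroup.mem_centralizer_singleton_iff]
        exact mul_assoc _ _ _
      · rw [SetLike.mem_coe, Subgroup.mem_centralizer_singleton_iff, bS_mul_bS]
        exact (pow_succ' _ _).symm.trans (pow_succ _ _)
    exact this (closure_bS_bT ▸ Subgroup.mem_top g)
  exact (Subgroup.mem_centralizer_singleton_iff.1 h).symm

/-! ### Schur's lemma and dimensions at most five -/

section Representations

variable {V : Type} [AddCommGroup V] [Module ℂ V] [FiniteDimensional ℂ V]

/-- Schur's lemma for the centre of the braid group. -/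
theorem exists_center_scalar (R : Representation ℂ B3 V) (hR : R.IsIrreducible) :
    ∃ c : ℂ, c ≠ 0 ∧ R (bS * bS) = c • 1 := by
  let f : Representation.IntertwiningMap R R :=
    (R (bS * bS)).intertwiningMap_of_isIntertwiningMap R R fun g v => by
      have := (center_comm g).map R
      exact LinearMap.congr_fun this v
  obtain ⟨c, hc⟩ :=
    (Representation.IsIrreducible.algebraMap_intertwiningMap_bijective_of_isAlgClosed (ρ := R)).2 f
  have hc' : R (bS * bS) = c • 1 := by
    have := congrArg Representation.IntertwiningMap.toLinearMap hc
    exact this.symm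
  refine ⟨c, ?_, hc'⟩
  rintro rfl
  have h0 : R 1 = 0 := by
    rw [← inv_mul_cancel (bS * bS), map_mul, hc', zero_smul, mul_zero]
  rw [map_one] at h0
  have : Subsingleton V := subsingleton_of_forall_eq 0 fun v => by
    simpa using LinearMap.congr_fun h0 v
  have hne : (⊥ : Subrepresentation R) ≠ ⊤ := bot_ne_top
  apply hne
  ext v
  simp [Subsingleton.elim v 0]

/-- A representation does not detect braid reversal. -/
def ReversalSymmetric (R : Representation ℂ B3 V) : Prop :=
  ∀ g, LinearMap.trace ℂ V (R g) = LinearMap.trace ℂ V (R (reverse g))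

omit [FiniteDimensional ℂ V] in
theorem exists_proper_of_not_isIrreducible (R : Representation ℂ B3 V) [Nontrivial V]
    (hR : ¬ R.IsIrreducible) :
    ∃ N : Submodule ℂ V, N ≠ ⊥ ∧ N ≠ ⊤ ∧ ∀ g, ∀ x ∈ N, R g x ∈ N := by
  by_contra! h
  apply hR
  have : Nontrivial (Subrepresentation R) := by
    refine ⟨⊥, ⊤, fun h => ?_⟩
    obtain ⟨v, hv⟩ := exists_ne (0 : V)
    have : v ∈ (⊥ : Subrepresentation R) := h ▸ trivial
    exact hv this
  refine ⟨fun N => ?_⟩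
  by_cases h0 : N.toSubmodule = ⊥
  · left; exact Subrepresentation.toSubmodule_injective h0
  · right
    apply Subrepresentation.toSubmodule_injective
    by_contra h1
    obtain ⟨g, x, hx, hgx⟩ := h _ h0 h1
    exact hgx (N.apply_mem_toSubmodule g hx)

theorem reversalSymmetric_of_invariant (R : Representation ℂ B3 V) {N : Submodule ℂ V}
    (hN : ∀ g, ∀ x ∈ N, R g x ∈ N)
    (h1 : ReversalSymmetric (Subrepresentation.toRepresentation (ρ := R) ⟨N, hN⟩))
    (h2 : ReversalSymmetric (R.quotient N hN)) : ReversalSymmetric R := by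
  intro g
  rw [trace_eq_restrict_add_mapQ N (R g) (hN g),
    trace_eq_restrict_add_mapQ N (R (reverse g)) (hN (reverse g))]
  exact congrArg₂ _ (h1 g) (h2 g)

/-- Three classes with at least two elements each need six elements. This is where dimension five is
the limit of the rank one argument. -/
theorem exists_card_filter_le_one {n : ℕ} (hn : n ≤ 5) (κ : Fin n → Fin 3) :
    ∃ k, (Finset.univ.filter fun i => κ i = k).card ≤ 1 := by
  by_contra! h
  have : ∑ k, (Finset.univ.filter fun i => κ i = k).card = n := by
    rw [← Finset.card_eq_sum_card_fiberwise (fun _ _ => Finset.mem_coe.2 (Finset.mem_univ _))]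
    simp
  have h6 : ∑ k : Fin 3, 2 ≤ ∑ k, (Finset.univ.filter fun i => κ i = k).card :=
    Finset.sum_le_sum fun k _ => h k
  simp at h6
  omega

theorem exists_pow_fin_three {ρ : ℂ} (hρ : IsPrimitiveRoot ρ 3) {μ : ℂ} (h : μ ^ 3 = 1) :
    ∃ k : Fin 3, ρ ^ (k : ℕ) = μ := by
  obtain ⟨i, hi, h⟩ := hρ.eq_pow_of_pow_eq_one h
  exact ⟨⟨i, hi⟩, h⟩

/-- A twist by t multiplies Δ by t³ and σ₁σ₂ by t², hence the central element by t⁶. A sixth root of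
the central scalar thus normalises both at once. -/
theorem exists_pow_six_eq (c : ℂ) : ∃ t : ℂ, t ^ 6 = c := by
  obtain ⟨t, ht⟩ := IsAlgClosed.exists_pow_nat_eq c (n := 6) (by norm_num)
  exact ⟨t, ht⟩

/-- Representations of dimension at most five do not detect braid reversal. -/
theorem reversalSymmetric_of_finrank_le {n : ℕ} :
    ∀ (V : Type) [AddCommGroup V] [Module ℂ V] [FiniteDimensional ℂ V]
      (R : Representation ℂ B3 V), finrank ℂ V = n → n ≤ 5 → ReversalSymmetric R := by
  induction n using Nat.strong_induction_on with
  | _ n ih =>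
  intro V _ _ _ R hV hn
  rcases subsingleton_or_nontrivial V with hsub | hnon
  · intro g
    rw [Subsingleton.elim (R g) (R (reverse g))]
  by_cases hR : R.IsIrreducible
  · obtain ⟨c, hc0, hc⟩ := exists_center_scalar R hR
    obtain ⟨t, rfl⟩ := exists_pow_six_eq c
    have ht : t ≠ 0 := by rintro rfl; simp at hc0
    have hρ := Complex.isPrimitiveRoot_exp 3 (by norm_num)
    set ρ := Complex.exp (2 * Real.pi * Complex.I / (3 : ℕ))
    have hT3 : ((t ^ 2)⁻¹ • R bT) ^ 3 = 1 := by
      rw [smul_pow, ← map_pow, ← bS_mul_bS, hc, smul_smul, inv_pow, ← pow_mul,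
        inv_mul_cancel₀ (pow_ne_zero _ ht), one_smul]
    obtain ⟨b, μ, hb, hμ⟩ := exists_eigenbasis_of_pow_eq_one (by norm_num) hT3
    choose κ hκ using fun i => exists_pow_fin_three hρ (hμ i)
    obtain ⟨k, hk⟩ := exists_card_filter_le_one (hV ▸ hn) κ
    let r : B3 →* Matrix _ _ ℂ := (LinearMap.toMatrixAlgEquiv b).toMulEquiv.toMonoidHom.comp R
    have hr : ∀ g, (r g).trace = LinearMap.trace ℂ V (R g) := fun g =>
      (LinearMap.trace_eq_matrix_trace ℂ b (R g)).symm
    intro g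
    rw [← hr, ← hr]
    refine trace_reverse_of_diagonal ρ r (S := (t ^ 3)⁻¹ • r bS) (pow_ne_zero 3 ht)
      (pow_ne_zero 2 ht) ?_ ?_ (κ := κ) hρ.pow_eq_one ?_ hk g
    · rw [smul_mul_smul_comm, ← map_mul, MonoidHom.comp_apply, hc]
      have : (LinearMap.toMatrixAlgEquiv b).toMulEquiv.toMonoidHom (t ^ 6 • (1 : End ℂ V)) =
          t ^ 6 • 1 := by
        change LinearMap.toMatrixAlgEquiv b (t ^ 6 • (1 : End ℂ V)) = _
        rw [map_smul, map_one]
      rw [this, smul_smul, ← mul_inv, ← pow_add, inv_mul_cancel₀ (pow_ne_zero _ ht), one_smul]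
    · rw [smul_smul, mul_inv_cancel₀ (pow_ne_zero _ ht), one_smul]
    · ext i j
      have : r bT i j = b.repr (R bT (b j)) i := by
        simp [r, LinearMap.toMatrixAlgEquiv_apply]
      rw [this]
      have h2 : R bT (b j) = (t ^ 2 * ρ ^ (κ j : ℕ)) • b j := by
        rw [hκ, mul_smul, ← hb, LinearMap.smul_apply, smul_smul,
          mul_inv_cancel₀ (pow_ne_zero _ ht), one_smul]
      rw [h2]
      by_cases hij : i = j
      · subst hij; simp
      · simp [hij]
  · obtain ⟨N, hN0, hN1, hN⟩ := exists_proper_of_not_isIrreducible R hR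
    have hlt : finrank ℂ N < finrank ℂ V := Submodule.finrank_lt hN1
    have hpos : 0 < finrank ℂ N := Submodule.one_le_finrank_iff.2 hN0
    have hadd := N.finrank_quotient_add_finrank
    exact reversalSymmetric_of_invariant R hN
      (ih (finrank ℂ N) (by omega) _ _ rfl (by omega))
      (ih (finrank ℂ (V ⧸ N)) (by omega) _ _ rfl (by omega))

/-- A reducible representation of dimension six does not detect braid reversal. -/
theorem reversalSymmetric_of_not_isIrreducible (R : Representation ℂ B3 V)
    (hV : finrank ℂ V = 6) (hR : ¬ R.IsIrreducible) : ReversalSymmetric R := by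
  have : Nontrivial V := Module.nontrivial_of_finrank_pos (R := ℂ) (by omega)
  obtain ⟨N, hN0, hN1, hN⟩ := exists_proper_of_not_isIrreducible R hR
  have hlt : finrank ℂ N < finrank ℂ V := Submodule.finrank_lt hN1
  have hpos : 0 < finrank ℂ N := Submodule.one_le_finrank_iff.2 hN0
  have hadd := N.finrank_quotient_add_finrank
  exact reversalSymmetric_of_invariant R hN
    (reversalSymmetric_of_finrank_le (n := finrank ℂ N) _ _ rfl (by omega))
    (reversalSymmetric_of_finrank_le (n := finrank ℂ (V ⧸ N)) _ _ rfl (by omega))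

end Representations

end BraidReversal

namespace BraidReversal

open Module Matrix

/-! ### Matrix representations -/

section Diagonal

theorem finrank_eigenspace_of_basis {V : Type} [AddCommGroup V] [Module ℂ V] {n : ℕ}
    (b : Basis (Fin n) ℂ V) {T : End ℂ V} {μ : Fin n → ℂ} (hb : ∀ i, T (b i) = μ i • b i) (c : ℂ) :
    finrank ℂ (T.eigenspace c) = (Finset.univ.filter fun i => μ i = c).card := by
  have hT : ∀ x i, b.repr (T x) i = μ i * b.repr x i := by
    intro x i
    have : T x = ∑ j, b.repr x j • μ j • b j := by
      conv_lhs => rw [← b.sum_repr x, map_sum]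
      simp [hb]
    rw [this]
    simp [Finsupp.single_apply, mul_comm]
  have h : T.eigenspace c = Submodule.span ℂ (Set.range fun i : {i // μ i = c} => b i) := by
    apply le_antisymm
    · intro x hx
      rw [End.mem_eigenspace_iff] at hx
      rw [← b.sum_repr x]
      refine Submodule.sum_mem _ fun i _ => ?_
      by_cases hi : μ i = c
      · exact Submodule.smul_mem _ _ (Submodule.subset_span ⟨⟨i, hi⟩, rfl⟩)
      · have := hT x i
        rw [hx, map_smul, Finsupp.smul_apply, smul_eq_mul] at this
        have h0 : (μ i - c) * b.repr x i = 0 := by rw [sub_mul, this, sub_self]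
        rw [(mul_eq_zero.1 h0).resolve_left (sub_ne_zero.2 hi), zero_smul]
        exact zero_mem _
    · rw [Submodule.span_le]
      rintro _ ⟨⟨i, hi⟩, rfl⟩
      exact End.mem_eigenspace_iff.2 (hi ▸ hb i)
  rw [h, finrank_span_eq_card]
  · rw [Fintype.card_subtype]
  · exact b.linearIndependent.comp _ Subtype.val_injective

variable {n : ℕ}

/-- The equation AQ = QD says that the columns of Q form an eigenbasis of A, and eigenspace
dimensions can be counted in an eigenbasis. -/
theorem finrank_eigenspace_of_mul_eq (A : Matrix (Fin n) (Fin n) ℂ) (Q : GL (Fin n) ℂ)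
    {μ : Fin n → ℂ} (h : A * Q.val = Q.val * diagonal μ) (c : ℂ) :
    finrank ℂ (End.eigenspace (toLin' A) c) = (Finset.univ.filter fun i => μ i = c).card := by
  let b : Basis (Fin n) ℂ (Fin n → ℂ) :=
    (Pi.basisFun ℂ (Fin n)).map (toLin'OfInv (M := (Q⁻¹).val) (M' := Q.val)
      (by rw [← Units.val_mul]; simp) (by rw [← Units.val_mul]; simp))
  have hb : ∀ i, b i = Q.val.col i := by
    intro i
    simp only [b, Basis.map_apply, Pi.basisFun_apply]
    change toLin' Q.val (Pi.single i 1) = _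
    simp
  refine finrank_eigenspace_of_basis b (fun i => ?_) c
  rw [hb, toLin'_apply]
  ext j
  have := congrFun (congrFun h j) i
  rw [mul_diagonal] at this
  simp only [Pi.smul_apply, smul_eq_mul, col_apply]
  rw [mul_comm, ← this]
  rfl

theorem exists_diagonalization {m : ℕ} (hm : m ≠ 0) {A : Matrix (Fin n) (Fin n) ℂ}
    (hA : A ^ m = 1) : ∃ (Q : GL (Fin n) ℂ) (μ : Fin n → ℂ),
      A * Q.val = Q.val * diagonal μ ∧ ∀ i, μ i ^ m = 1 := by
  have hA' : (toLin' A) ^ m = 1 := by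
    rw [← toLin'_pow, hA]; exact toLin'_one
  obtain ⟨b, μ, hb, hμ⟩ := exists_eigenbasis_of_pow_eq_one hm hA'
  have hn : finrank ℂ (Fin n → ℂ) = n := by simp
  obtain ⟨b, μ, hb, hμ⟩ : ∃ (b : Basis (Fin n) ℂ (Fin n → ℂ)) (μ : Fin n → ℂ),
      (∀ i, toLin' A (b i) = μ i • b i) ∧ ∀ i, μ i ^ m = 1 := by
    refine ⟨b.reindex (finCongr hn), fun i => μ (Fin.cast hn.symm i), fun i => ?_, fun i => hμ _⟩
    rw [Basis.reindex_apply]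
    exact hb _
  refine ⟨⟨(Pi.basisFun ℂ (Fin n)).toMatrix b, b.toMatrix (Pi.basisFun ℂ (Fin n)),
    Basis.toMatrix_mul_toMatrix_flip _ _, Basis.toMatrix_mul_toMatrix_flip _ _⟩, μ, ?_, hμ⟩
  ext j i
  rw [mul_diagonal]
  have := congrFun (hb i) j
  rw [toLin'_apply] at this
  change _ = b i j * μ i
  rw [mul_comm]
  exact this

/-- Diagonal matrices with equal multiplicities differ by a permutation of the coordinates, so it
suffices to permute the columns of Q. -/
theorem exists_mul_eq_diagonal_of_card {A : Matrix (Fin n) (Fin n) ℂ} {Q : GL (Fin n) ℂ}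
    {μ ν : Fin n → ℂ} (h : A * Q.val = Q.val * diagonal μ)
    (hμν : ∀ c, (Finset.univ.filter fun i => μ i = c).card =
      (Finset.univ.filter fun i => ν i = c).card) :
    ∃ Q : GL (Fin n) ℂ, A * Q.val = Q.val * diagonal ν := by
  have e : ∀ c, Nonempty ({i // ν i = c} ≃ {i // μ i = c}) := fun c => by
    rw [← Fintype.card_eq, Fintype.card_subtype, Fintype.card_subtype, hμν]
  let σ : Equiv.Perm (Fin n) := Equiv.ofFiberEquiv fun c => (e c).some
  have hσ : ∀ i, μ (σ i) = ν i := Equiv.ofFiberEquiv_map _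
  refine ⟨⟨Q.val.submatrix id σ, (Q⁻¹).val.submatrix σ id, ?_, ?_⟩, ?_⟩
  · rw [submatrix_mul_equiv, ← Units.val_mul]; simp
  · rw [← submatrix_mul _ _ σ id σ Function.bijective_id, ← Units.val_mul]; simp
  · ext i j
    have := congrFun (congrFun h i) (σ j)
    rw [mul_diagonal, hσ] at this
    rw [mul_diagonal]
    exact this

theorem trace_of_mul_eq {A D : Matrix (Fin n) (Fin n) ℂ} {Q : GL (Fin n) ℂ}
    (h : A * Q.val = Q.val * D) : A.trace = D.trace := by
  have : A = Q.val * D * (Q⁻¹).val := by rw [← h, Matrix.mul_assoc, ← Units.val_mul]; simp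
  rw [this, trace_mul_comm, ← Matrix.mul_assoc, ← Units.val_mul]
  simp

theorem sum_eq_sum_card {m : ℕ} {ρ : ℂ} (hρ : IsPrimitiveRoot ρ m) [NeZero m] {μ : Fin n → ℂ}
    (hμ : ∀ i, μ i ^ m = 1) : ∑ i, μ i =
      ∑ k : Fin m, ((Finset.univ.filter fun i => μ i = ρ ^ (k : ℕ)).card : ℂ) * ρ ^ (k : ℕ) := by
  have hex : ∀ i, ∃ k : Fin m, ρ ^ (k : ℕ) = μ i := fun i => by
    obtain ⟨k, hk, h⟩ := hρ.eq_pow_of_pow_eq_one (hμ i)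
    exact ⟨⟨k, hk⟩, h⟩
  choose κ hκ using hex
  rw [← Finset.sum_fiberwise Finset.univ κ μ]
  refine Finset.sum_congr rfl fun k _ => ?_
  have : (Finset.univ.filter fun i => μ i = ρ ^ (k : ℕ)) = Finset.univ.filter fun i => κ i = k := by
    ext i
    simp only [Finset.mem_filter, Finset.mem_univ, true_and, ← hκ]
    constructor
    · intro h; exact Fin.ext (hρ.pow_inj (κ i).2 k.2 h)
    · rintro rfl; rfl
  rw [this, Finset.sum_congr rfl (g := fun _ => ρ ^ (k : ℕ)), Finset.sum_const, nsmul_eq_mul]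
  intro i hi
  rw [← hκ, (Finset.mem_filter.1 hi).2]

theorem card_filter_eq_of_forall_pow {m : ℕ} {ρ : ℂ} (hρ : IsPrimitiveRoot ρ m) [NeZero m]
    {μ ν : Fin n → ℂ} (hμ : ∀ i, μ i ^ m = 1) (hν : ∀ i, ν i ^ m = 1)
    (h : ∀ k : Fin m, (Finset.univ.filter fun i => μ i = ρ ^ (k : ℕ)).card =
      (Finset.univ.filter fun i => ν i = ρ ^ (k : ℕ)).card) (c : ℂ) :
    (Finset.univ.filter fun i => μ i = c).card = (Finset.univ.filter fun i => ν i = c).card := by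
  by_cases hc : c ^ m = 1
  · obtain ⟨k, hk, rfl⟩ := hρ.eq_pow_of_pow_eq_one hc
    exact h ⟨k, hk⟩
  · rw [Finset.filter_false_of_mem, Finset.filter_false_of_mem]
    · rintro i - rfl; exact hc (hν i)
    · rintro i - rfl; exact hc (hμ i)

theorem sum_card_filter_eq {m : ℕ} {ρ : ℂ} (hρ : IsPrimitiveRoot ρ m) [NeZero m] {μ : Fin n → ℂ}
    (hμ : ∀ i, μ i ^ m = 1) :
    ∑ k : Fin m, (Finset.univ.filter fun i => μ i = ρ ^ (k : ℕ)).card = n := by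
  have hex : ∀ i, ∃ k : Fin m, ρ ^ (k : ℕ) = μ i := fun i => by
    obtain ⟨k, hk, h⟩ := hρ.eq_pow_of_pow_eq_one (hμ i)
    exact ⟨⟨k, hk⟩, h⟩
  choose κ hκ using hex
  have : ∀ k : Fin m, (Finset.univ.filter fun i => μ i = ρ ^ (k : ℕ)) =
      Finset.univ.filter fun i => κ i = k := by
    intro k
    ext i
    simp only [Finset.mem_filter, Finset.mem_univ, true_and, ← hκ]
    constructor
    · intro h; exact Fin.ext (hρ.pow_inj (κ i).2 k.2 h)
    · rintro rfl; rfl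
  simp only [this]
  rw [← Finset.card_eq_sum_card_fiberwise (fun _ _ => Finset.mem_coe.2 (Finset.mem_univ _))]
  simp

theorem one_add_add_sq {ρ : ℂ} (hρ : IsPrimitiveRoot ρ 3) : ρ ^ 2 = -1 - ρ := by
  have h := hρ.geom_sum_eq_zero (by norm_num)
  simp only [Finset.sum_range_succ, Finset.sum_range_zero, pow_zero, pow_one, zero_add] at h
  linear_combination h

/-- Multiplying by the conjugate u + vρ² = u − v − vρ gives the norm u² − uv + v², a positive
definite form. -/
theorem int_eq_zero_of_add_mul {ρ : ℂ} (hρ : IsPrimitiveRoot ρ 3) {u v : ℤ}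
    (h : (u : ℂ) + v * ρ = 0) : u = 0 ∧ v = 0 := by
  have h2 := one_add_add_sq hρ
  have key : ((u ^ 2 - u * v + v ^ 2 : ℤ) : ℂ) = 0 := by
    push_cast
    linear_combination (u - v - v * ρ) * h + v ^ 2 * h2
  have key' : u ^ 2 - u * v + v ^ 2 = 0 := by exact_mod_cast key
  constructor <;> nlinarith [sq_nonneg (2 * u - v), sq_nonneg (2 * v - u), sq_nonneg u, sq_nonneg v]

/-- After replacing ρ² by −1 − ρ, independence of 1 and ρ over ℤ shows that the three differences of
multiplicities are equal. They sum to zero, so they vanish. Thus the trace of a matrix of order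
three determines its spectrum. -/
theorem card_filter_eq_of_sum_three {ρ : ℂ} (hρ : IsPrimitiveRoot ρ 3) {μ ν : Fin n → ℂ}
    (hμ : ∀ i, μ i ^ 3 = 1) (hν : ∀ i, ν i ^ 3 = 1) (h : ∑ i, μ i = ∑ i, ν i) (c : ℂ) :
    (Finset.univ.filter fun i => μ i = c).card = (Finset.univ.filter fun i => ν i = c).card := by
  have h2 := one_add_add_sq hρ
  refine card_filter_eq_of_forall_pow hρ hμ hν ?_ c
  have cμ := sum_card_filter_eq hρ hμ
  have cν := sum_card_filter_eq hρ hν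
  rw [sum_eq_sum_card hρ hμ, sum_eq_sum_card hρ hν] at h
  simp only [Fin.sum_univ_three, Fin.val_zero, Fin.val_one, Fin.val_two] at h cμ cν
  obtain ⟨e1, e2⟩ := int_eq_zero_of_add_mul hρ
    (u := ((Finset.univ.filter fun i => μ i = ρ ^ 0).card - (Finset.univ.filter fun i => ν i = ρ ^ 0).card : ℤ)
      - ((Finset.univ.filter fun i => μ i = ρ ^ 2).card - (Finset.univ.filter fun i => ν i = ρ ^ 2).card : ℤ))
    (v := ((Finset.univ.filter fun i => μ i = ρ ^ 1).card - (Finset.univ.filter fun i => ν i = ρ ^ 1).card : ℤ)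
      - ((Finset.univ.filter fun i => μ i = ρ ^ 2).card - (Finset.univ.filter fun i => ν i = ρ ^ 2).card : ℤ))
    (by
      push_cast
      linear_combination h - ((Finset.univ.filter fun i => μ i = ρ ^ 2).card -
        (Finset.univ.filter fun i => ν i = ρ ^ 2).card : ℂ) * h2)
  intro k
  fin_cases k <;> dsimp only <;> omega

theorem card_filter_eq_of_sum_two {μ ν : Fin n → ℂ}
    (hμ : ∀ i, μ i ^ 2 = 1) (hν : ∀ i, ν i ^ 2 = 1) (h : ∑ i, μ i = ∑ i, ν i) (c : ℂ) :
    (Finset.univ.filter fun i => μ i = c).card = (Finset.univ.filter fun i => ν i = c).card := by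
  have hρ : IsPrimitiveRoot (-1 : ℂ) 2 := IsPrimitiveRoot.neg_one 0 (by norm_num)
  refine card_filter_eq_of_forall_pow hρ hμ hν ?_ c
  have cμ := sum_card_filter_eq hρ hμ
  have cν := sum_card_filter_eq hρ hν
  rw [sum_eq_sum_card hρ hμ, sum_eq_sum_card hρ hν] at h
  simp only [Fin.sum_univ_two, Fin.val_zero, Fin.val_one, pow_zero, pow_one] at h cμ cν ⊢
  have e : ((Finset.univ.filter fun i => μ i = 1).card : ℤ) - (Finset.univ.filter fun i => μ i = -1).card
      = (Finset.univ.filter fun i => ν i = 1).card - (Finset.univ.filter fun i => ν i = -1).card := by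
    have : (((Finset.univ.filter fun i => μ i = 1).card : ℤ) - (Finset.univ.filter fun i => μ i = -1).card : ℂ)
      = (Finset.univ.filter fun i => ν i = 1).card - (Finset.univ.filter fun i => ν i = -1).card := by
      push_cast
      linear_combination h
    exact_mod_cast this
  intro k
  fin_cases k <;> simp <;> omega

end Diagonal

/-! ### Base change, twists, and representations built from S and T -/

section Rep

variable {n : ℕ}

theorem Rep.mat_mul (V : Rep n) (g h : B3) : V.mat (g * h) = V.mat g * V.mat h := by
  simp [Rep.mat]

@[simp] theorem Rep.mat_one (V : Rep n) : V.mat 1 = 1 := by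
  simp [Rep.mat]

theorem Rep.mat_pow (V : Rep n) (g : B3) (k : ℕ) : V.mat (g ^ k) = V.mat g ^ k := by
  simp [Rep.mat]

theorem Rep.mat_inv_eq (V : Rep n) {g : B3} {A : Matrix (Fin n) (Fin n) ℂ} (h : V.mat g * A = 1) :
    V.mat g⁻¹ = A := by
  calc V.mat g⁻¹ = V.mat g⁻¹ * (V.mat g * A) := by rw [h, mul_one]
    _ = A := by rw [← mul_assoc, ← Rep.mat_mul]; simp

/-- The action by matrices, as a homomorphism. -/
def Rep.matHom (V : Rep n) : B3 →* Matrix (Fin n) (Fin n) ℂ := (Units.coeHom _).comp V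

theorem Rep.matHom_apply (V : Rep n) (g : B3) : V.matHom g = V.mat g := rfl

theorem Rep.ext_mat {V W : Rep n} (h1 : V.mat s1 = W.mat s1) (h2 : V.mat s2 = W.mat s2) :
    V = W := by
  apply PresentedGroup.ext
  intro i
  fin_cases i
  · exact Units.ext h1
  · exact Units.ext h2

theorem Rep.ext_bS_bT {V W : Rep n} (h1 : V.mat bS = W.mat bS) (h2 : V.mat bT = W.mat bT) :
    V = W := by
  have e1 : V bS = W bS := Units.ext h1
  have e2 : V bT = W bT := Units.ext h2
  refine Rep.ext_mat ?_ ?_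
  · exact congrArg Units.val (a₁ := V s1) (a₂ := W s1) (by
      rw [s1_eq, map_mul V bT⁻¹ bS, map_mul W bT⁻¹ bS, map_inv V bT, map_inv W bT, e1, e2])
  · exact congrArg Units.val (a₁ := V s2) (a₂ := W s2) (by
      rw [s2_eq, map_mul V bS bT⁻¹, map_mul W bS bT⁻¹, map_inv V bT, map_inv W bT, e1, e2])

theorem Rep.toRepresentation_apply (V : Rep n) (g : B3) :
    V.toRepresentation g = toLin' (V.mat g) := rfl

theorem Rep.trace_toRepresentation (V : Rep n) (g : B3) :
    LinearMap.trace ℂ _ (V.toRepresentation g) = (V.mat g).trace := by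
  rw [Rep.toRepresentation_apply, trace_toLin'_eq]

theorem Rep.mat_conj (P : GL (Fin n) ℂ) (V : Rep n) (g : B3) :
    (V.conj P).mat g = P.val * V.mat g * (P⁻¹).val := rfl

theorem Rep.conj_conj (P Q : GL (Fin n) ℂ) (V : Rep n) : (V.conj P).conj Q = V.conj (Q * P) := by
  ext1 g
  simp [Rep.conj, mul_assoc]

theorem Rep.conj_one (V : Rep n) : V.conj 1 = V := by
  ext1 g
  simp [Rep.conj]

theorem Rep.conj_eq_of_mul_eq {V W : Rep n} {Q : GL (Fin n) ℂ}
    (hS : V.mat bS * Q.val = Q.val * W.mat bS) (hT : V.mat bT * Q.val = Q.val * W.mat bT) :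
    V = W.conj Q := by
  have : Q.val * (Q⁻¹).val = 1 := by rw [← Units.val_mul]; simp
  refine Rep.ext_bS_bT ?_ ?_
  · rw [Rep.mat_conj, ← hS, mul_assoc, this, mul_one]
  · rw [Rep.mat_conj, ← hT, mul_assoc, this, mul_one]

theorem Rep.trace_conj (P : GL (Fin n) ℂ) (V : Rep n) (g : B3) :
    ((V.conj P).mat g).trace = (V.mat g).trace := by
  rw [Rep.mat_conj, trace_mul_comm, ← mul_assoc, ← Units.val_mul]
  simp

theorem Iss.trace_mk (V : Rep n) (hV : V.IsSemisimple) (g : B3) :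
    (Iss.mk V hV).trace g = (V.mat g).trace := rfl

/-- The representation of the modular group with prescribed images of `σ₁σ₂σ₁` and `σ₁σ₂`. -/
def Rep.ofST (S T : Matrix (Fin n) (Fin n) ℂ) (hS : S * S = 1) (hT : T ^ 3 = 1) : Rep n :=
  let s : GL (Fin n) ℂ := ⟨S, S, hS, hS⟩
  let t : GL (Fin n) ℂ := ⟨T, T ^ 2, by rw [← pow_succ', hT], by rw [← pow_succ, hT]⟩
  -- These are the formulas of `s1_eq` and `s2_eq`; with s² = t³ = 1 both sides of the braid
  -- relation reduce to s.
  PresentedGroup.toGroup (f := ![t⁻¹ * s, s * t⁻¹]) (by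
    have hs : s * s = 1 := Units.ext hS
    have ht : t ^ 3 = 1 := Units.ext (by simp [t, hT])
    intro r hr
    rw [Set.mem_singleton_iff.1 hr]
    simp only [map_mul, map_inv, FreeGroup.lift_apply_of, mul_inv_eq_one]
    change t⁻¹ * s * (s * t⁻¹) * (t⁻¹ * s) = s * t⁻¹ * (t⁻¹ * s) * (s * t⁻¹)
    have h3 : t⁻¹ * t⁻¹ * t⁻¹ = 1 := by
      rw [← _root_.mul_inv_rev, ← _root_.mul_inv_rev, inv_eq_one, ← ht]; simp [pow_succ, mul_assoc]
    calc t⁻¹ * s * (s * t⁻¹) * (t⁻¹ * s) = t⁻¹ * (s * s) * t⁻¹ * t⁻¹ * s := by group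
      _ = t⁻¹ * t⁻¹ * t⁻¹ * s := by rw [hs, mul_one]
      _ = s * (t⁻¹ * t⁻¹ * t⁻¹) := by rw [h3, one_mul, mul_one]
      _ = s * t⁻¹ * t⁻¹ * (s * s) * t⁻¹ := by rw [hs, mul_one]; group
      _ = _ := by group)

theorem Rep.ofST_s1 (S T : Matrix (Fin n) (Fin n) ℂ) (hS : S * S = 1) (hT : T ^ 3 = 1) :
    (Rep.ofST S T hS hT).mat s1 = T ^ 2 * S := by
  unfold Rep.ofST Rep.mat s1
  rw [PresentedGroup.toGroup.of]
  rfl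

theorem Rep.ofST_s2 (S T : Matrix (Fin n) (Fin n) ℂ) (hS : S * S = 1) (hT : T ^ 3 = 1) :
    (Rep.ofST S T hS hT).mat s2 = S * T ^ 2 := by
  unfold Rep.ofST Rep.mat s2
  rw [PresentedGroup.toGroup.of]
  rfl

theorem Rep.ofST_bS (S T : Matrix (Fin n) (Fin n) ℂ) (hS : S * S = 1) (hT : T ^ 3 = 1) :
    (Rep.ofST S T hS hT).mat bS = S := by
  rw [bS, Rep.mat_mul, Rep.mat_mul, Rep.ofST_s1, Rep.ofST_s2]
  calc T ^ 2 * S * (S * T ^ 2) * (T ^ 2 * S) = T ^ 2 * (S * S) * T ^ 2 * T ^ 2 * S := by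
        simp only [mul_assoc]
    _ = S := by
        rw [hS, mul_one, ← pow_add, ← pow_add, show 2 + 2 + 2 = 3 * 2 by norm_num, pow_mul, hT,
          one_pow, one_mul]

theorem Rep.ofST_bT (S T : Matrix (Fin n) (Fin n) ℂ) (hS : S * S = 1) (hT : T ^ 3 = 1) :
    (Rep.ofST S T hS hT).mat bT = T := by
  rw [bT, Rep.mat_mul, Rep.ofST_s1, Rep.ofST_s2]
  calc T ^ 2 * S * (S * T ^ 2) = T ^ 2 * (S * S) * T ^ 2 := by simp only [mul_assoc]
    _ = T := by rw [hS, mul_one, ← pow_add, show 2 + 2 = 3 + 1 by norm_num, pow_add, hT, one_mul,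
                  pow_one]

/-- The character of the braid group that maps both generators to `t`. -/
def scalarChar (t : ℂˣ) : B3 →* ℂˣ :=
  PresentedGroup.toGroup (f := fun _ => t) (by
    intro r hr
    rw [Set.mem_singleton_iff.1 hr]
    simp)

@[simp] theorem scalarChar_s1 (t : ℂˣ) : scalarChar t s1 = t := PresentedGroup.toGroup.of _

@[simp] theorem scalarChar_s2 (t : ℂˣ) : scalarChar t s2 = t := PresentedGroup.toGroup.of _

/-- The twist `σᵢ ↦ t V(σᵢ)` of a representation. -/
def Rep.scale (t : ℂˣ) (V : Rep n) : Rep n where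
  toFun g := Units.map (algebraMap ℂ (Matrix (Fin n) (Fin n) ℂ)).toMonoidHom (scalarChar t g) * V g
  map_one' := by simp
  map_mul' g h := by
    ext1
    simp only [map_mul, Units.val_mul, Units.coe_map]
    have := Algebra.commutes (scalarChar t h).val (V g).val
    simp only [RingHom.toMonoidHom_eq_coe, MonoidHom.coe_coe]
    rw [mul_assoc, mul_assoc, ← mul_assoc _ (V g).val, this]
    simp only [mul_assoc]

theorem Rep.mat_scale (t : ℂˣ) (V : Rep n) (g : B3) :
    (V.scale t).mat g = (scalarChar t g).val • V.mat g := by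
  rw [Algebra.smul_def]; rfl

theorem Rep.mat_scale_bS (t : ℂˣ) (V : Rep n) : (V.scale t).mat bS = (t : ℂ) ^ 3 • V.mat bS := by
  rw [Rep.mat_scale]; simp [bS, pow_succ]

theorem Rep.mat_scale_bT (t : ℂˣ) (V : Rep n) : (V.scale t).mat bT = (t : ℂ) ^ 2 • V.mat bT := by
  rw [Rep.mat_scale]; simp [bT, pow_succ]

theorem Rep.scale_scale (t u : ℂˣ) (V : Rep n) : (V.scale t).scale u = V.scale (t * u) := by
  refine Rep.ext_mat ?_ ?_ <;> simp [Rep.mat_scale, smul_smul, mul_comm]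

theorem Rep.scale_one (V : Rep n) : V.scale 1 = V := by
  refine Rep.ext_mat ?_ ?_ <;> simp [Rep.mat_scale]

theorem Rep.scale_conj (t : ℂˣ) (P : GL (Fin n) ℂ) (V : Rep n) :
    (V.conj P).scale t = (V.scale t).conj P := by
  refine Rep.ext_mat ?_ ?_ <;> simp [Rep.mat_scale, Rep.mat_conj]

end Rep

end BraidReversal

namespace BraidReversal

open Module Matrix

/-! ### Dimension vectors and normal forms -/

/-- The dimension vector `(a, b; x, y, z)` is that of the modular representations for which
`σ₁σ₂σ₁` and `σ₁σ₂` are diagonalizable with diagonal entries `νS` and `νT`. -/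
structure HasDimVector (ρ : ℂ) {n : ℕ} (νS νT : Fin n → ℂ) (a b x y z : ℕ) : Prop where
  sq : ∀ i, νS i ^ 2 = 1
  cube : ∀ i, νT i ^ 3 = 1
  card_a : (Finset.univ.filter fun i => νS i = 1).card = a
  card_b : (Finset.univ.filter fun i => νS i = -1).card = b
  card_x : (Finset.univ.filter fun i => νT i = 1).card = x
  card_y : (Finset.univ.filter fun i => νT i = ρ).card = y
  card_z : (Finset.univ.filter fun i => νT i = ρ ^ 2).card = z

variable {ρ : ℂ} {n : ℕ} {νS νT : Fin n → ℂ} {a b x y z : ℕ}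

theorem bT_pow_three : bT ^ 3 = bS * bS := bS_mul_bS.symm

/-- S and T have finite order, hence are diagonalizable, and the dimension vector fixes their
spectra with multiplicity. The two diagonalizing matrices need not be equal. -/
theorem Rep.IsModular.exists_diagonal (hρ : IsPrimitiveRoot ρ 3)
    (D : HasDimVector ρ νS νT a b x y z) {W : Rep n} (h : W.IsModular ρ a b x y z) :
    (∃ Q : GL (Fin n) ℂ, W.mat bS * Q.val = Q.val * diagonal νS) ∧
      ∃ Q : GL (Fin n) ℂ, W.mat bT * Q.val = Q.val * diagonal νT := by
  obtain ⟨hC, ha, hb, hx, hy, hz⟩ := h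
  constructor
  · have h2 : W.mat bS ^ 2 = 1 := by
      rw [← Rep.mat_pow, pow_two, bS_mul_bS]; exact congrArg Units.val hC
    obtain ⟨Q, μ, hQ, hμ⟩ := exists_diagonalization two_ne_zero h2
    refine exists_mul_eq_diagonal_of_card hQ
      (card_filter_eq_of_forall_pow (IsPrimitiveRoot.neg_one (R := ℂ) 0 (by norm_num)) hμ D.sq ?_)
    intro k
    fin_cases k
    · simp only [pow_zero]
      rw [D.card_a, ← ha, ← finrank_eigenspace_of_mul_eq _ Q hQ]; rfl
    · simp only [pow_one]
      rw [D.card_b, ← hb, ← finrank_eigenspace_of_mul_eq _ Q hQ]; rfl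
  · have h3 : W.mat bT ^ 3 = 1 := by
      rw [← Rep.mat_pow]; exact congrArg Units.val hC
    obtain ⟨Q, μ, hQ, hμ⟩ := exists_diagonalization three_ne_zero h3
    refine exists_mul_eq_diagonal_of_card hQ (card_filter_eq_of_forall_pow hρ hμ D.cube ?_)
    intro k
    fin_cases k
    · simp only [pow_zero]
      rw [D.card_x, ← hx, ← finrank_eigenspace_of_mul_eq _ Q hQ]; rfl
    · simp only [pow_one]
      rw [D.card_y, ← hy, ← finrank_eigenspace_of_mul_eq _ Q hQ]; rfl
    · simp only
      rw [D.card_z, ← hz, ← finrank_eigenspace_of_mul_eq _ Q hQ]; rfl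

/-- Eigenspace dimensions are not regular functions, but traces are. For matrices of order two and
three the trace determines the multiplicities, so nothing is lost. -/
theorem isModular_iff_trace (hρ : IsPrimitiveRoot ρ 3) (D : HasDimVector ρ νS νT a b x y z)
    (W : Rep n) : W.IsModular ρ a b x y z ↔ W.mat (bS * bS) = 1 ∧
      (W.mat bS).trace = ∑ i, νS i ∧ (W.mat bT).trace = ∑ i, νT i := by
  constructor
  · intro h
    obtain ⟨⟨Q, hQ⟩, R, hR⟩ := h.exists_diagonal hρ D
    refine ⟨?_, ?_, ?_⟩
    · rw [bS_mul_bS]; exact congrArg Units.val h.1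
    · rw [trace_of_mul_eq hQ, trace_diagonal]
    · rw [trace_of_mul_eq hR, trace_diagonal]
  · rintro ⟨hC, hS, hT⟩
    have h2 : W.mat bS ^ 2 = 1 := by rw [← Rep.mat_pow, pow_two, hC]
    have h3 : W.mat bT ^ 3 = 1 := by rw [← Rep.mat_pow, ← bS_mul_bS, hC]
    obtain ⟨Q, μ, hQ, hμ⟩ := exists_diagonalization two_ne_zero h2
    obtain ⟨R, η, hR, hη⟩ := exists_diagonalization three_ne_zero h3
    have eS : ∀ c, W.eigenDim bS c = (Finset.univ.filter fun i => νS i = c).card := fun c => by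
      rw [Rep.eigenDim, finrank_eigenspace_of_mul_eq _ Q hQ]
      refine card_filter_eq_of_sum_two hμ D.sq ?_ c
      rw [← hS, trace_of_mul_eq hQ, trace_diagonal]
    have eT : ∀ c, W.eigenDim bT c = (Finset.univ.filter fun i => νT i = c).card := fun c => by
      rw [Rep.eigenDim, finrank_eigenspace_of_mul_eq _ R hR]
      refine card_filter_eq_of_sum_three hρ hη D.cube ?_ c
      rw [← hT, trace_of_mul_eq hR, trace_diagonal]
    refine ⟨?_, (eS 1).trans D.card_a, (eS (-1)).trans D.card_b, (eT 1).trans D.card_x,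
      (eT ρ).trans D.card_y, (eT (ρ ^ 2)).trans D.card_z⟩
    change W (bT ^ 3) = 1
    rw [bT_pow_three]
    exact Units.ext hC

/-- The representation is the twist by `t` of a modular representation whose dimension vector is
given by `νS` and `νT`. -/
def Rep.HasType (V : Rep n) (νS νT : Fin n → ℂ) (t : ℂˣ) : Prop :=
  V.mat (bS * bS) = (t : ℂ) ^ 6 • (1 : Matrix (Fin n) (Fin n) ℂ) ∧
    (V.mat bS).trace = (t : ℂ) ^ 3 * ∑ i, νS i ∧ (V.mat bT).trace = (t : ℂ) ^ 2 * ∑ i, νT i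

theorem Rep.HasType.conj {V : Rep n} {t : ℂˣ} (h : V.HasType νS νT t) (P : GL (Fin n) ℂ) :
    (V.conj P).HasType νS νT t := by
  refine ⟨?_, by rw [Rep.trace_conj, h.2.1], by rw [Rep.trace_conj, h.2.2]⟩
  rw [Rep.mat_conj, h.1, mul_smul_comm, smul_mul_assoc, mul_one, ← Units.val_mul]
  simp

theorem Rep.HasType.scale {V : Rep n} {t : ℂˣ} (h : V.HasType νS νT t) (u : ℂˣ) :
    (V.scale u).HasType νS νT (u * t) := by
  refine ⟨?_, ?_, ?_⟩
  · rw [Rep.mat_mul, Rep.mat_scale_bS, smul_mul_smul_comm, ← Rep.mat_mul, h.1, smul_smul]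
    congr 1
    push_cast
    ring
  · rw [Rep.mat_scale_bS, trace_smul, h.2.1, smul_eq_mul]
    push_cast
    ring
  · rw [Rep.mat_scale_bT, trace_smul, h.2.2, smul_eq_mul]
    push_cast
    ring

theorem isModular_iff_hasType (hρ : IsPrimitiveRoot ρ 3) (D : HasDimVector ρ νS νT a b x y z)
    (W : Rep n) : W.IsModular ρ a b x y z ↔ W.HasType νS νT 1 := by
  rw [isModular_iff_trace hρ D, Rep.HasType]
  simp

theorem exists_conj_of_mk_eq {V W : Rep n} {hV : V.IsSemisimple} {hW : W.IsSemisimple}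
    (h : Iss.mk V hV = Iss.mk W hW) : ∃ P : GL (Fin n) ℂ, W = V.conj P :=
  Quotient.exact h

/-- The type is stable under base change and only its parameter moves under twists. Hence V itself
can be tested, the auxiliary modular representation being the twist of V by t⁻¹. -/
theorem mk_mem_issBeta_iff (hρ : IsPrimitiveRoot ρ 3) (D : HasDimVector ρ νS νT a b x y z)
    (V : Rep n) (hV : V.IsSemisimple) :
    Iss.mk V hV ∈ issBeta ρ n a b x y z ↔ ∃ t, V.HasType νS νT t := by
  constructor
  · rintro ⟨V', hV', W, t, h, hW, ht, h1, h2⟩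
    obtain ⟨P, rfl⟩ := exists_conj_of_mk_eq h.symm
    have : V' = W.scale (Units.mk0 t ht) := by
      refine Rep.ext_mat ?_ ?_ <;> simp [Rep.mat_scale, h1, h2]
    refine ⟨Units.mk0 t ht, Rep.HasType.conj ?_ P⟩
    rw [this]
    simpa using ((isModular_iff_hasType hρ D W).1 hW).scale (Units.mk0 t ht)
  · rintro ⟨t, h⟩
    refine ⟨V, hV, V.scale t⁻¹, t, rfl, (isModular_iff_hasType hρ D _).2 ?_, t.ne_zero, ?_, ?_⟩
    · simpa using h.scale t⁻¹
    · simp [Rep.mat_scale]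
    · simp [Rep.mat_scale]

theorem conj_diagonal_sq (hS : ∀ i, νS i ^ 2 = 1) (P : GL (Fin n) ℂ) :
    (P.val * diagonal νS * (P⁻¹).val) * (P.val * diagonal νS * (P⁻¹).val) = 1 := by
  have h1 : (P⁻¹).val * P.val = 1 := by rw [← Units.val_mul]; simp
  have h2 : P.val * (P⁻¹).val = 1 := by rw [← Units.val_mul]; simp
  calc _ = P.val * (diagonal νS * ((P⁻¹).val * P.val) * diagonal νS) * (P⁻¹).val := by
        simp only [mul_assoc]
    _ = 1 := by
        rw [h1, mul_one, diagonal_mul_diagonal]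
        simp only [← pow_two, hS, diagonal_one, mul_one, h2]

theorem diagonal_cube (hT : ∀ i, νT i ^ 3 = 1) : diagonal νT ^ 3 = 1 := by
  rw [diagonal_pow, ← diagonal_one]
  congr 1
  exact funext hT

/-- The normal form of the representations with a given dimension vector. -/
def normalRep (hS : ∀ i, νS i ^ 2 = 1) (hT : ∀ i, νT i ^ 3 = 1) (P : GL (Fin n) ℂ) (t : ℂˣ) :
    Rep n :=
  (Rep.ofST _ _ (conj_diagonal_sq hS P) (diagonal_cube hT)).scale t

theorem normalRep_bS (hS : ∀ i, νS i ^ 2 = 1) (hT : ∀ i, νT i ^ 3 = 1) (P : GL (Fin n) ℂ)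
    (t : ℂˣ) : (normalRep hS hT P t).mat bS =
      (t : ℂ) ^ 3 • (P.val * diagonal νS * (P⁻¹).val) := by
  rw [normalRep, Rep.mat_scale_bS, Rep.ofST_bS]

theorem normalRep_bT (hS : ∀ i, νS i ^ 2 = 1) (hT : ∀ i, νT i ^ 3 = 1) (P : GL (Fin n) ℂ)
    (t : ℂˣ) : (normalRep hS hT P t).mat bT = (t : ℂ) ^ 2 • diagonal νT := by
  rw [normalRep, Rep.mat_scale_bT, Rep.ofST_bT]

theorem normalRep_hasType (hS : ∀ i, νS i ^ 2 = 1) (hT : ∀ i, νT i ^ 3 = 1) (P : GL (Fin n) ℂ)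
    (t : ℂˣ) : (normalRep hS hT P t).HasType νS νT t := by
  refine ⟨?_, ?_, ?_⟩
  · rw [Rep.mat_mul, normalRep_bS, smul_mul_smul_comm, conj_diagonal_sq hS, ← pow_add]
  · rw [normalRep_bS, trace_smul, trace_mul_comm, ← mul_assoc, ← Units.val_mul]
    simp
  · rw [normalRep_bT, trace_smul, trace_diagonal, smul_eq_mul]

/-- If Q diagonalizes T and R diagonalizes S, then base change by Q makes T diagonal and turns S
into the conjugate of its diagonal form by Q⁻¹R. So GL_n × ℂˣ reaches every representation of the
type. -/
theorem Rep.HasType.exists_normalRep (hρ : IsPrimitiveRoot ρ 3)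
    (D : HasDimVector ρ νS νT a b x y z) {V : Rep n} {t : ℂˣ} (h : V.HasType νS νT t) :
    ∃ P Q : GL (Fin n) ℂ, V = (normalRep D.sq D.cube P t).conj Q := by
  have hW : (V.scale t⁻¹).IsModular ρ a b x y z :=
    (isModular_iff_hasType hρ D _).2 (by simpa using h.scale t⁻¹)
  obtain ⟨⟨R, hR⟩, Q, hQ⟩ := hW.exists_diagonal hρ D
  have hQ1 : Q.val * (Q⁻¹).val = 1 := by rw [← Units.val_mul]; simp
  have hR1 : R.val * (R⁻¹).val = 1 := by rw [← Units.val_mul]; simp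
  refine ⟨Q⁻¹ * R, Q, ?_⟩
  have key : V.scale t⁻¹ =
      (Rep.ofST _ _ (conj_diagonal_sq D.sq (Q⁻¹ * R)) (diagonal_cube D.cube)).conj Q := by
    refine Rep.conj_eq_of_mul_eq ?_ ?_
    · rw [Rep.ofST_bS]
      have : (Q⁻¹ * R)⁻¹ = R⁻¹ * Q := by group
      rw [this, Units.val_mul, Units.val_mul]
      calc (V.scale t⁻¹).mat bS * Q.val
          = (V.scale t⁻¹).mat bS * (R.val * (R⁻¹).val) * Q.val := by rw [hR1, mul_one]
        _ = (V.scale t⁻¹).mat bS * R.val * (R⁻¹).val * Q.val := by simp only [mul_assoc]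
        _ = (Q.val * (Q⁻¹).val) * R.val * diagonal νS * (R⁻¹).val * Q.val := by
            rw [hR, hQ1, one_mul]
        _ = _ := by simp only [mul_assoc]
    · rw [Rep.ofST_bT, hQ]
  calc V = (V.scale t⁻¹).scale t := by rw [Rep.scale_scale]; simp [Rep.scale_one]
    _ = _ := by rw [key, Rep.scale_conj, normalRep]

/-! ### The four dimension vectors -/

/-- Diagonal entries for the dimension vector `(3, 3; 3, 2, 1)`. -/
def nuT6a (ρ : ℂ) : Fin 6 → ℂ := ![ρ ^ 2, ρ, ρ, 1, 1, 1]

/-- Diagonal entries for the dimension vectors `(3, 3; 2, 2, 2)` and `(4, 2; 2, 2, 2)`. -/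
def nuT6b (ρ : ℂ) : Fin 6 → ℂ := ![1, 1, ρ, ρ, ρ ^ 2, ρ ^ 2]

/-- Three positive and three negative signs. -/
def nuS33 : Fin 6 → ℂ := ![1, 1, 1, -1, -1, -1]

/-- Two negative and four positive signs. -/
def nuS42 : Fin 6 → ℂ := ![-1, -1, 1, 1, 1, 1]

theorem card_filter_fin_six {μ : Fin 6 → ℂ} {c : ℂ} : (Finset.univ.filter fun i => μ i = c).card =
    (if μ 0 = c then 1 else 0) + (if μ 1 = c then 1 else 0) + (if μ 2 = c then 1 else 0) +
    (if μ 3 = c then 1 else 0) + (if μ 4 = c then 1 else 0) + (if μ 5 = c then 1 else 0) := by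
  rw [Finset.card_filter, Fin.sum_univ_six]

theorem rho_ne (hρ : IsPrimitiveRoot ρ 3) :
    ρ ≠ 1 ∧ ρ ^ 2 ≠ 1 ∧ ρ ^ 2 ≠ ρ ∧ ρ ≠ 0 := by
  have h1 := hρ.ne_one (by norm_num)
  have h2 : ρ ^ 2 ≠ 1 := fun h => by
    have := (hρ.pow_eq_one_iff_dvd 2).1 h
    omega
  have h0 := hρ.ne_zero (by norm_num)
  exact ⟨h1, h2, fun h => h1 (mul_left_cancel₀ h0 (by rw [← pow_two, h, mul_one])), h0⟩

theorem hasDimVector_6a (hρ : IsPrimitiveRoot ρ 3) :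
    HasDimVector ρ nuS33 (nuT6a ρ) 3 3 3 2 1 := by
  obtain ⟨h1, h2, h3, h4⟩ := rho_ne hρ
  have h5 : (ρ ^ 2) ^ 3 = 1 := by rw [← pow_mul, mul_comm, pow_mul, hρ.pow_eq_one, one_pow]
  have h6 : ¬ ((-1 : ℂ) = 1) := by norm_num
  have h7 : ¬ ((1 : ℂ) = -1) := by norm_num
  constructor
  · intro i; fin_cases i <;> simp [nuS33]
  · intro i; fin_cases i <;> simp [nuT6a, h5, hρ.pow_eq_one]
  all_goals
    rw [card_filter_fin_six]
    simp [nuS33, nuT6a, h1, h2, h3, h6, h7, h1.symm, h2.symm, h3.symm]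

theorem hasDimVector_6b (hρ : IsPrimitiveRoot ρ 3) :
    HasDimVector ρ nuS33 (nuT6b ρ) 3 3 2 2 2 := by
  obtain ⟨h1, h2, h3, h4⟩ := rho_ne hρ
  have h5 : (ρ ^ 2) ^ 3 = 1 := by rw [← pow_mul, mul_comm, pow_mul, hρ.pow_eq_one, one_pow]
  have h6 : ¬ ((-1 : ℂ) = 1) := by norm_num
  have h7 : ¬ ((1 : ℂ) = -1) := by norm_num
  constructor
  · intro i; fin_cases i <;> simp [nuS33]
  · intro i; fin_cases i <;> simp [nuT6b, h5, hρ.pow_eq_one]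
  all_goals
    rw [card_filter_fin_six]
    simp [nuS33, nuT6b, h1, h2, h3, h6, h7, h1.symm, h2.symm, h3.symm]

theorem hasDimVector_6c (hρ : IsPrimitiveRoot ρ 3) :
    HasDimVector ρ nuS42 (nuT6b ρ) 4 2 2 2 2 := by
  obtain ⟨h1, h2, h3, h4⟩ := rho_ne hρ
  have h5 : (ρ ^ 2) ^ 3 = 1 := by rw [← pow_mul, mul_comm, pow_mul, hρ.pow_eq_one, one_pow]
  have h6 : ¬ ((-1 : ℂ) = 1) := by norm_num
  have h7 : ¬ ((1 : ℂ) = -1) := by norm_num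
  constructor
  · intro i; fin_cases i <;> simp [nuS42]
  · intro i; fin_cases i <;> simp [nuT6b, h5, hρ.pow_eq_one]
  all_goals
    rw [card_filter_fin_six]
    simp [nuS42, nuT6b, h1, h2, h3, h6, h7, h1.symm, h2.symm, h3.symm]

theorem sum_nuS33 : ∑ i, nuS33 i = 0 := by simp [nuS33, Fin.sum_univ_six]

theorem sum_nuS42 : ∑ i, nuS42 i = 2 := by simp [nuS42, Fin.sum_univ_six]; norm_num

theorem sum_nuT6b (hρ : IsPrimitiveRoot ρ 3) : ∑ i, nuT6b ρ i = 0 := by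
  have := one_add_add_sq hρ
  simp [nuT6b, Fin.sum_univ_six]
  linear_combination 2 * this

theorem sum_nuT6a (hρ : IsPrimitiveRoot ρ 3) : ∑ i, nuT6a ρ i = 2 + ρ := by
  have := one_add_add_sq hρ
  simp [nuT6a, Fin.sum_univ_six]
  linear_combination this

/-- Replacing ρ by ρ² exchanges the last two multiplicities of T. Statements about 6a for an
arbitrary primitive root therefore apply to the mirror. -/
theorem comp6aMirror_eq (hρ : IsPrimitiveRoot ρ 3) : comp6aMirror ρ = comp6a (ρ ^ 2) := by
  have h : (ρ ^ 2) ^ 2 = ρ := by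
    rw [← pow_mul, show 2 * 2 = 3 + 1 by norm_num, pow_add, hρ.pow_eq_one, one_mul, pow_one]
  have : ∀ W : Rep 6, W.IsModular ρ 3 3 3 1 2 ↔ W.IsModular (ρ ^ 2) 3 3 3 2 1 := by
    intro W
    simp only [Rep.IsModular, h]
    tauto
  simp only [comp6aMirror, comp6a, issBeta, this]

theorem isPrimitiveRoot_sq (hρ : IsPrimitiveRoot ρ 3) : IsPrimitiveRoot (ρ ^ 2) 3 :=
  hρ.pow_of_coprime 2 (by norm_num)

theorem center_scalar_ne_zero {V : Rep 6} {c : ℂ}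
    (hc : V.mat (bS * bS) = c • (1 : Matrix (Fin 6) (Fin 6) ℂ)) : c ≠ 0 := by
  rintro rfl
  have : V.mat (bS * bS) * V.mat (bS * bS)⁻¹ = 1 := by
    rw [← Rep.mat_mul, mul_inv_cancel, Rep.mat_one]
  rw [hc] at this
  simp at this

section Membership

variable (V : Rep 6) (hV : V.IsSemisimple)

/-- The parameter t is eliminated. The trace of T is t²(2 + ρ) with 2 + ρ ≠ 0, so t must be a square
root of tr T/(2 + ρ). The cubic equation then says that t⁶ is the central scalar, the factor 6 being
the trace of the identity. The trace of S vanishes, so it imposes nothing on t³. -/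
theorem mk_mem_comp6a_iff (hρ : IsPrimitiveRoot ρ 3) : Iss.mk V hV ∈ comp6a ρ ↔
    (∃ c : ℂ, V.mat (bS * bS) = c • (1 : Matrix (Fin 6) (Fin 6) ℂ)) ∧ (V.mat bS).trace = 0 ∧
      6 * (V.mat bT).trace ^ 3 = (2 + ρ) ^ 3 * (V.mat (bS * bS)).trace := by
  rw [comp6a, mk_mem_issBeta_iff hρ (hasDimVector_6a hρ)]
  constructor
  · rintro ⟨t, h1, h2, h3⟩
    refine ⟨⟨_, h1⟩, by rw [h2, sum_nuS33, mul_zero], ?_⟩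
    rw [h3, h1, sum_nuT6a hρ, trace_smul, trace_one]
    simp
    ring
  · rintro ⟨⟨c, hc⟩, h2, h3⟩
    have hc0 := center_scalar_ne_zero hc
    have hκ : 2 + ρ ≠ 0 := fun h => by
      have := one_add_add_sq hρ
      have : (3 : ℂ) = 0 := by linear_combination this - (ρ - 1) * h
      norm_num at this
    rw [hc, trace_smul, trace_one] at h3
    have h3' : (V.mat bT).trace ^ 3 = (2 + ρ) ^ 3 * c := by
      simp at h3
      linear_combination h3 / 6
    obtain ⟨t, ht⟩ := IsAlgClosed.exists_pow_nat_eq ((V.mat bT).trace / (2 + ρ)) (n := 2)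
      (by norm_num)
    have ht6 : t ^ 6 = c := by
      rw [show 6 = 2 * 3 by norm_num, pow_mul, ht, div_pow, h3', mul_comm,
        mul_div_assoc, div_self (pow_ne_zero 3 hκ), mul_one]
    have ht0 : t ≠ 0 := by rintro rfl; simp at ht6; exact hc0 ht6.symm
    refine ⟨Units.mk0 t ht0, ?_, ?_, ?_⟩
    · rw [hc, Units.val_mk0, ht6]
    · rw [h2, sum_nuS33, mul_zero]
    · rw [sum_nuT6a hρ, Units.val_mk0, ht, div_mul_cancel₀ _ hκ]

/-- Both traces vanish for every t, so any sixth root of the central scalar serves as the parameter.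
-/
theorem mk_mem_comp6b_iff (hρ : IsPrimitiveRoot ρ 3) : Iss.mk V hV ∈ comp6b ρ ↔
    (∃ c : ℂ, V.mat (bS * bS) = c • (1 : Matrix (Fin 6) (Fin 6) ℂ)) ∧ (V.mat bS).trace = 0 ∧
      (V.mat bT).trace = 0 := by
  rw [comp6b, mk_mem_issBeta_iff hρ (hasDimVector_6b hρ)]
  constructor
  · rintro ⟨t, h1, h2, h3⟩
    exact ⟨⟨_, h1⟩, by rw [h2, sum_nuS33, mul_zero], by rw [h3, sum_nuT6b hρ, mul_zero]⟩
  · rintro ⟨⟨c, hc⟩, h2, h3⟩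
    have hc0 := center_scalar_ne_zero hc
    obtain ⟨t, ht6⟩ := exists_pow_six_eq c
    have ht0 : t ≠ 0 := by rintro rfl; simp at ht6; exact hc0 ht6.symm
    refine ⟨Units.mk0 t ht0, ?_, ?_, ?_⟩
    · rw [hc, Units.val_mk0, ht6]
    · rw [h2, sum_nuS33, mul_zero]
    · rw [h3, sum_nuT6b hρ, mul_zero]

/-- Here tr S = 2t³ determines t³, and the quadratic equation says that its square is the central
scalar. -/
theorem mk_mem_comp6c_iff (hρ : IsPrimitiveRoot ρ 3) : Iss.mk V hV ∈ comp6c ρ ↔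
    (∃ c : ℂ, V.mat (bS * bS) = c • (1 : Matrix (Fin 6) (Fin 6) ℂ)) ∧
      6 * (V.mat bS).trace ^ 2 = 4 * (V.mat (bS * bS)).trace ∧ (V.mat bT).trace = 0 := by
  rw [comp6c, mk_mem_issBeta_iff hρ (hasDimVector_6c hρ)]
  constructor
  · rintro ⟨t, h1, h2, h3⟩
    refine ⟨⟨_, h1⟩, ?_, by rw [h3, sum_nuT6b hρ, mul_zero]⟩
    rw [h2, h1, sum_nuS42, trace_smul, trace_one]
    simp
    ring
  · rintro ⟨⟨c, hc⟩, h2, h3⟩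
    have hc0 := center_scalar_ne_zero hc
    rw [hc, trace_smul, trace_one] at h2
    obtain ⟨t, ht⟩ := IsAlgClosed.exists_pow_nat_eq ((V.mat bS).trace / 2) (n := 3) (by norm_num)
    have ht6 : t ^ 6 = c := by
      rw [show 6 = 3 * 2 by norm_num, pow_mul, ht]
      simp at h2
      linear_combination h2 / 24
    have ht0 : t ≠ 0 := by rintro rfl; simp at ht6; exact hc0 ht6.symm
    refine ⟨Units.mk0 t ht0, ?_, ?_, ?_⟩
    · rw [hc, Units.val_mk0, ht6]
    · rw [sum_nuS42, Units.val_mk0, ht]; ring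
    · rw [h3, sum_nuT6b hρ, mul_zero]

end Membership

/-! ### The components of dimension six do not detect reversal -/

theorem trace_reverse_of_hasType_6a (hρ : IsPrimitiveRoot ρ 3) {V : Rep 6} {t : ℂˣ}
    (h : V.HasType nuS33 (nuT6a ρ) t) (g : B3) :
    (V.mat g).trace = (V.mat (reverse g)).trace := by
  obtain ⟨P, Q, rfl⟩ := h.exists_normalRep hρ (hasDimVector_6a hρ)
  rw [Rep.trace_conj, Rep.trace_conj]
  -- The eigenvalue ρ² of T has multiplicity one: this is the class k = 2 below.
  refine trace_reverse_of_diagonal ρ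
    (Rep.matHom (normalRep (hasDimVector_6a hρ).sq (hasDimVector_6a hρ).cube P t))
    (pow_ne_zero 3 t.ne_zero) (pow_ne_zero 2 t.ne_zero) (conj_diagonal_sq (hasDimVector_6a hρ).sq P)
    (normalRep_bS (hasDimVector_6a hρ).sq (hasDimVector_6a hρ).cube P t) (κ := ![2, 1, 1, 0, 0, 0]) hρ.pow_eq_one ?_ (k := 2) (by decide) g
  rw [Rep.matHom_apply, normalRep_bT]
  congr 2
  ext i
  fin_cases i <;> simp [nuT6a]

/-- The (−1)-eigenspace of S is two-dimensional, so S = 1 − 2ιπ for a projector ιπ of rank two, and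
the rank two criterion applies. -/
theorem trace_reverse_of_hasType_6c (hρ : IsPrimitiveRoot ρ 3) {V : Rep 6} {t : ℂˣ}
    (h : V.HasType nuS42 (nuT6b ρ) t) (g : B3) :
    (V.mat g).trace = (V.mat (reverse g)).trace := by
  obtain ⟨P, Q, rfl⟩ := h.exists_normalRep hρ (hasDimVector_6c hρ)
  rw [Rep.trace_conj, Rep.trace_conj]
  let ι : Matrix (Fin 6) (Fin 2) ℂ := P.val.submatrix id (Fin.castLE (by norm_num))
  let π : Matrix (Fin 2) (Fin 6) ℂ := (P⁻¹).val.submatrix (Fin.castLE (by norm_num)) id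
  have hPP : (P⁻¹).val * P.val = 1 := by rw [← Units.val_mul]; simp
  have hPP' : P.val * (P⁻¹).val = 1 := by rw [← Units.val_mul]; simp
  have hπ : π * ι = 1 := by
    rw [← submatrix_mul _ _ _ id _ Function.bijective_id, hPP]
    exact submatrix_one _ (Fin.castLE_injective _)
  have hS : P.val * diagonal nuS42 * (P⁻¹).val = 1 - (2 : ℂ) • (ι * π) := by
    have : ι * π = P.val * diagonal ![1, 1, 0, 0, 0, 0] * (P⁻¹).val := by
      ext i j
      simp only [mul_apply, Fin.sum_univ_two, Fin.sum_univ_six]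
      simp [ι, π]
    rw [this]
    have hd : diagonal nuS42 = 1 - (2 : ℂ) • diagonal ![1, 1, 0, 0, 0, 0] := by
      rw [← diagonal_one, ← diagonal_smul, diagonal_sub]
      congr 1
      ext i
      fin_cases i <;> simp [nuS42] <;> norm_num
    rw [hd, mul_sub, sub_mul, mul_one, hPP']
    simp
  refine trace_reverse_of_adjoin (traceLinearMap (Fin 6) ℂ ℂ)
    (fun x y => trace_mul_comm x y) 
    (Rep.matHom (normalRep (hasDimVector_6c hρ).sq (hasDimVector_6c hρ).cube P t))
    (pow_ne_zero 3 t.ne_zero) (pow_ne_zero 2 t.ne_zero) (normalRep_bS (hasDimVector_6c hρ).sq (hasDimVector_6c hρ).cube P t)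
    (normalRep_bT (hasDimVector_6c hρ).sq (hasDimVector_6c hρ).cube P t)
    (conj_diagonal_sq (hasDimVector_6c hρ).sq P) (diagonal_cube (hasDimVector_6c hρ).cube)
    (fun z hz => ?_) g
  refine trace_reverse_of_rank_two (diagonal_cube (hasDimVector_6c hρ).cube) hπ
    (Algebra.adjoin_le ?_ hz)
  rintro z (rfl | rfl)
  · have : (P.val * diagonal nuS42 * (P⁻¹).val, MulOpposite.op (P.val * diagonal nuS42 * (P⁻¹).val)) =
        1 - (2 : ℂ) • (ι * π, MulOpposite.op (ι * π)) := by
      rw [hS]; rfl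
    rw [SetLike.mem_coe, this]
    exact sub_mem (one_mem _) (Subalgebra.smul_mem _ (Algebra.subset_adjoin (by simp)) _)
  · exact Algebra.subset_adjoin (by simp)

theorem Iss.trace_reverse_of_mem {x : Iss 6} (hρ : IsPrimitiveRoot ρ 3)
    (hx : x ∈ comp6a ρ ∪ comp6aMirror ρ ∪ comp6c ρ) (g : B3) :
    x.trace g = x.trace (reverse g) := by
  induction x using Quotient.inductionOn with
  | _ V =>
  obtain ⟨V, hV⟩ := V
  rcases hx with (hx | hx) | hx
  · obtain ⟨t, ht⟩ := (mk_mem_issBeta_iff hρ (hasDimVector_6a hρ) V hV).1 hx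
    exact trace_reverse_of_hasType_6a hρ ht g
  · rw [comp6aMirror_eq hρ] at hx
    have hρ' := isPrimitiveRoot_sq hρ
    obtain ⟨t, ht⟩ := (mk_mem_issBeta_iff hρ' (hasDimVector_6a hρ') V hV).1 hx
    exact trace_reverse_of_hasType_6a hρ' ht g
  · obtain ⟨t, ht⟩ := (mk_mem_issBeta_iff hρ (hasDimVector_6c hρ) V hV).1 hx
    exact trace_reverse_of_hasType_6c hρ ht g

end BraidReversal

namespace BraidReversal

open Module Matrix

/-! ### Burnside's theorem and the simple locus -/

section Burnside

open scoped MonoidAlgebra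

/-- Burnside's theorem: an irreducible representation over `ℂ` spans the endomorphism algebra. -/
theorem span_range_eq_top_of_isIrreducible {G V : Type} [Monoid G] [AddCommGroup V] [Module ℂ V]
    [FiniteDimensional ℂ V] (R : Representation ℂ G V) (hR : R.IsIrreducible) :
    Submodule.span ℂ (Set.range R) = ⊤ := by
  have : IsSimpleModule ℂ[G] R.asModule := (R.irreducible_iff_isSimpleModule_asModule).1 hR
  have hfin : FiniteDimensional ℂ R.asModule := inferInstanceAs (FiniteDimensional ℂ V)
  have hschur := (IsSimpleModule.algebraMap_end_bijective_of_isAlgClosed (A := ℂ[G])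
    (V := R.asModule) ℂ).2
  rw [eq_top_iff]
  rintro f -
  -- By Schur's lemma the module endomorphisms are scalars, so every ℂ-linear f commutes with them.
  -- The density theorem then yields an element of the group algebra that agrees with f on a finite
  -- spanning set.
  let f' : Module.End (Module.End ℂ[G] R.asModule) R.asModule :=
    { toFun := fun m => f m
      map_add' := fun x y => map_add f x y
      map_smul' := fun e x => by
        obtain ⟨c, rfl⟩ := hschur e
        exact f.map_smul c x }
  obtain ⟨s, hs⟩ := Module.Finite.fg_top (R := ℂ) (M := V)
  obtain ⟨r, hr⟩ := jacobson_density (R := ℂ[G]) (M := R.asModule) f' s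
  have hfr : f = R.asAlgebraHom r := by
    refine LinearMap.ext_on hs fun m hm => ?_
    exact hr m hm
  rw [hfr]
  clear hfr hr
  induction r using MonoidAlgebra.induction_on with
  | of g => rw [Representation.asAlgebraHom_of]; exact Submodule.subset_span ⟨g, rfl⟩
  | add x y hx hy => rw [map_add]; exact add_mem hx hy
  | smul c x hx => rw [map_smul]; exact Submodule.smul_mem _ c hx

theorem isIrreducible_of_forall_invariant {G V : Type} [Monoid G] [AddCommGroup V] [Module ℂ V]
    [Nontrivial V] (R : Representation ℂ G V)
    (h : ∀ N : Submodule ℂ V, (∀ g, ∀ x ∈ N, R g x ∈ N) → N = ⊥ ∨ N = ⊤) : R.IsIrreducible := by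
  have : Nontrivial (Subrepresentation R) := by
    refine ⟨⊥, ⊤, fun h => ?_⟩
    obtain ⟨v, hv⟩ := exists_ne (0 : V)
    have : v ∈ (⊥ : Subrepresentation R) := h ▸ trivial
    exact hv this
  refine ⟨fun N => ?_⟩
  rcases h N.toSubmodule (fun g x hx => N.apply_mem_toSubmodule g hx) with h | h
  · left; exact Subrepresentation.toSubmodule_injective h
  · right; exact Subrepresentation.toSubmodule_injective h

end Burnside

variable {n : ℕ}

theorem Rep.toRepresentation_eq (V : Rep n) (g : B3) :
    V.toRepresentation g = Matrix.toLin' (V.mat g) := rfl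

theorem Rep.IsSimple.span_eq_top {V : Rep n} (h : V.IsSimple) :
    Submodule.span ℂ (Set.range V.mat) = ⊤ := by
  have h1 := span_range_eq_top_of_isIrreducible V.toRepresentation h
  have h2 : Set.range V.toRepresentation =
      (Matrix.toLin' : Matrix (Fin n) (Fin n) ℂ ≃ₗ[ℂ] _) '' Set.range V.mat := by
    rw [← Set.range_comp]; rfl
  rw [h2, ← LinearEquiv.coe_coe, Submodule.span_image] at h1
  apply Submodule.map_injective_of_injective (f := (Matrix.toLin' :
    Matrix (Fin n) (Fin n) ℂ ≃ₗ[ℂ] _).toLinearMap) (LinearEquiv.injective _)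
  rw [h1, Submodule.map_top, LinearEquiv.range]

theorem Rep.isSimple_of_forall_invariant [NeZero n] {V : Rep n}
    (h : ∀ N : Submodule ℂ (Fin n → ℂ), (∀ g, ∀ x ∈ N, V.mat g *ᵥ x ∈ N) → N = ⊥ ∨ N = ⊤) :
    V.IsSimple :=
  isIrreducible_of_forall_invariant _ fun N hN => h N fun g x hx => hN g x hx

theorem Rep.isSimple_of_span_eq_top [NeZero n] {V : Rep n}
    (h : Submodule.span ℂ (Set.range V.mat) = ⊤) : V.IsSimple := by
  refine Rep.isSimple_of_forall_invariant fun N hN => ?_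
  have hall : ∀ A : Matrix (Fin n) (Fin n) ℂ, ∀ x ∈ N, A *ᵥ x ∈ N := by
    intro A x hx
    have hA : A ∈ Submodule.span ℂ (Set.range V.mat) := h ▸ Submodule.mem_top
    induction hA using Submodule.span_induction with
    | mem A hA => obtain ⟨g, rfl⟩ := hA; exact hN g x hx
    | zero => simp
    | add A B _ _ hA hB => rw [add_mulVec]; exact add_mem hA hB
    | smul c A _ hA => rw [smul_mulVec]; exact N.smul_mem c hA
  by_cases h0 : N = ⊥
  · exact Or.inl h0
  right
  obtain ⟨x, hx, hx0⟩ := Submodule.exists_mem_ne_zero_of_ne_bot h0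
  obtain ⟨j, hj⟩ := Function.ne_iff.1 hx0
  rw [eq_top_iff]
  rintro y -
  -- This rank one matrix sends x to y, so N contains every vector.
  have := hall (vecMulVec y (Pi.single j (x j)⁻¹)) x hx
  rwa [vecMulVec_mulVec, single_dotProduct, inv_mul_cancel₀ hj, MulOpposite.op_one, one_smul] at this

theorem Rep.IsSimple.isSemisimple {V : Rep n} (h : V.IsSimple) : V.IsSemisimple := by
  have : V.toRepresentation.IsIrreducible := h
  exact (inferInstance : ComplementedLattice (Subrepresentation V.toRepresentation))

/-! ### Invariant functions -/

theorem mat_mem_regularFunctions (g : B3) (i j : Fin n) :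
    (fun V : Rep n => V.mat g i j) ∈ regularFunctions n :=
  Algebra.subset_adjoin ⟨g, i, j, rfl⟩

/-- A matrix of regular functions. -/
def regularMatrix (n : ℕ) (g : B3) : Matrix (Fin n) (Fin n) (regularFunctions n) :=
  Matrix.of fun i j => ⟨_, mat_mem_regularFunctions g i j⟩

/-- Evaluation of regular functions at a representation. -/
def evalAt (V : Rep n) : regularFunctions n →ₐ[ℂ] ℂ :=
  (Pi.evalAlgHom ℂ (fun _ : Rep n => ℂ) V).comp (regularFunctions n).val

theorem map_regularMatrix (V : Rep n) (g : B3) :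
    (regularMatrix n g).map (evalAt V) = V.mat g := rfl

theorem trace_mem_invariants (g : B3) :
    (fun V : Rep n => (V.mat g).trace) ∈ invariants n := by
  refine ⟨?_, fun P V => Rep.trace_conj ..⟩
  have : (fun V : Rep n => (V.mat g).trace) = ∑ i, fun V : Rep n => V.mat g i i := by
    ext V; simp [Matrix.trace]
  rw [this]
  exact sum_mem fun i _ => mat_mem_regularFunctions g i i

theorem charpoly_coeff_mem_invariants (g : B3) (k : ℕ) :
    (fun V : Rep n => (V.mat g).charpoly.coeff k) ∈ invariants n := by
  refine ⟨?_, fun P V => ?_⟩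
  · have : (fun V : Rep n => (V.mat g).charpoly.coeff k) =
        ((regularMatrix n g).charpoly.coeff k : regularFunctions n) := by
      ext V
      rw [← map_regularMatrix V g]
      have := Matrix.charpoly_map (regularMatrix n g) (evalAt V).toRingHom
      have h := congrArg (fun p => p.coeff k) this
      simp only [Polynomial.coeff_map] at h
      exact h
    rw [this]
    exact Subtype.property _
  · beta_reduce
    rw [Rep.mat_conj, Matrix.coe_units_inv, Matrix.charpoly_units_conj]

/-- The Gram determinant of a finite family of braids with respect to the trace form. -/
def gram {ι : Type} [Fintype ι] [DecidableEq ι] (w : ι → B3) (V : Rep n) : ℂ :=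
  (Matrix.of fun i j => (V.mat (w i * w j)).trace).det

theorem gram_mem_invariants {ι : Type} [Fintype ι] [DecidableEq ι] (w : ι → B3) :
    gram (n := n) w ∈ invariants n := by
  have : gram (n := n) w = ∑ σ : Equiv.Perm ι, (Equiv.Perm.sign σ : ℤ) •
      ∏ i, fun V : Rep n => (V.mat (w (σ i) * w i)).trace := by
    ext V
    simp [gram, Matrix.det_apply', Finset.sum_apply, Finset.prod_apply]
  rw [this]
  exact sum_mem fun σ _ => zsmul_mem (prod_mem fun i _ => trace_mem_invariants _) _

/-- The trace form on the full matrix algebra is non-degenerate: a vector in the kernel of the Gram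
matrix gives a matrix orthogonal to everything, and pairing it with elementary matrices shows that
it is zero. -/
theorem gram_ne_zero {ι : Type} [Fintype ι] [DecidableEq ι] (w : ι → B3) (V : Rep n)
    (h : Submodule.span ℂ (Set.range fun i => V.mat (w i)) = ⊤)
    (hli : LinearIndependent ℂ fun i => V.mat (w i)) : gram w V ≠ 0 := by
  intro h0
  obtain ⟨v, hv, hv0⟩ := Matrix.exists_vecMul_eq_zero_iff.2 h0
  have key : ∀ A : Matrix (Fin n) (Fin n) ℂ, ((∑ i, v i • V.mat (w i)) * A).trace = 0 := by
    intro A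
    have hA : A ∈ Submodule.span ℂ (Set.range fun i => V.mat (w i)) := h ▸ Submodule.mem_top
    induction hA using Submodule.span_induction with
    | mem A hA =>
      obtain ⟨j, rfl⟩ := hA
      have := congrFun hv0 j
      simp only [vecMul, dotProduct, of_apply, Pi.zero_apply] at this
      rw [← this, Finset.sum_mul, trace_sum]
      refine Finset.sum_congr rfl fun i _ => ?_
      rw [smul_mul_assoc, trace_smul, ← Rep.mat_mul, smul_eq_mul]
    | zero => simp
    | add A B _ _ hA hB => rw [mul_add, trace_add, hA, hB, add_zero]
    | smul c A _ hA => rw [mul_smul_comm, trace_smul, hA, smul_zero]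
  have hz : ∑ i, v i • V.mat (w i) = 0 := by
    ext i j
    have := key (Matrix.single j i 1)
    rwa [trace_mul_single, MulOpposite.op_one, one_smul] at this
  exact hv (funext (Fintype.linearIndependent_iff.1 hli v hz))

/-- A linear relation between the matrices of the braids is a relation between the rows of the Gram
matrix. So a nonzero determinant makes the n² matrices independent, and they span. -/
theorem isSimple_of_gram_ne_zero [NeZero n] {ι : Type} [Fintype ι] [DecidableEq ι] (w : ι → B3)
    (hι : Fintype.card ι = n * n) (V : Rep n) (h : gram w V ≠ 0) : V.IsSimple := by
  have hli : LinearIndependent ℂ fun i => V.mat (w i) := by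
    rw [Fintype.linearIndependent_iff]
    intro v hv
    by_contra! hne
    obtain ⟨i, hi⟩ := hne
    refine h (Matrix.exists_vecMul_eq_zero_iff.1 ⟨v, fun h0 => hi (congrFun h0 i), ?_⟩)
    ext j
    have := congrArg (fun A => (A * V.mat (w j)).trace) hv
    simp only [zero_mul, trace_zero, Finset.sum_mul, trace_sum, smul_mul_assoc, trace_smul,
      ← Rep.mat_mul] at this
    simpa [vecMul, dotProduct] using this
  have : Nonempty ι := Fintype.card_pos_iff.1 (by rw [hι]; exact Nat.mul_pos (NeZero.pos n) (NeZero.pos n))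
  refine Rep.isSimple_of_span_eq_top (top_le_iff.1 ?_)
  rw [← hli.span_eq_top_of_card_eq_finrank (by rw [hι, finrank_matrix]; simp)]
  exact Submodule.span_mono (by rintro _ ⟨i, rfl⟩; exact ⟨_, rfl⟩)

/-- Near a simple representation all representations are simple. -/
theorem Rep.IsSimple.exists_invariant [NeZero n] {V : Rep n} (h : V.IsSimple) :
    ∃ D ∈ invariants n, D V ≠ 0 ∧ ∀ W : Rep n, D W ≠ 0 → W.IsSimple := by
  classical
  -- By Burnside a basis of the matrix algebra can be chosen among the matrices of braids. The Gram
  -- determinant of these fixed braids is the required invariant.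
  obtain ⟨b, hb, hspan, hli⟩ := exists_linearIndependent ℂ (Set.range V.mat)
  rw [h.span_eq_top] at hspan
  have : Finite b := hli.finite
  have := Fintype.ofFinite b
  choose w hw using fun i : b => hb i.2
  have hw' : (fun i : b => V.mat (w i)) = Subtype.val := funext hw
  refine ⟨gram w, gram_mem_invariants w, gram_ne_zero w V ?_ ?_, fun W hW =>
    isSimple_of_gram_ne_zero w ?_ W hW⟩
  · rw [hw', Subtype.range_coe, hspan]
  · rw [hw']; exact hli
  · have hB := Basis.mk hli (by rw [Subtype.range_coe, hspan])
    have := finrank_eq_card_basis hB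
    rw [← this, finrank_matrix]
    simp

/-! ### Regular functions on the quotient variety -/

/-- The function on isomorphism classes given by an invariant function. -/
def issFun (f : Rep n → ℂ) (hf : f ∈ invariants n) (x : Iss n) : ℂ :=
  Quotient.lift (fun V : {V : Rep n // V.IsSemisimple} => f V.1)
    (by rintro V W ⟨P, h⟩; rw [h, hf.2]) x

theorem issFun_mk {f : Rep n → ℂ} (hf : f ∈ invariants n) (V : Rep n) (hV : V.IsSemisimple) :
    issFun f hf (Iss.mk V hV) = f V := rfl

theorem issFun_mem {f : Rep n → ℂ} (hf : f ∈ invariants n) : issFun f hf ∈ issRing n :=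
  ⟨f, hf, fun _ _ => rfl⟩

theorem Iss.exists_rep (x : Iss n) : ∃ (V : Rep n) (hV : V.IsSemisimple), x = Iss.mk V hV := by
  induction x using Quotient.inductionOn with
  | _ V => exact ⟨V.1, V.2, rfl⟩

theorem trace_mem_issRing (g : B3) : (fun x : Iss n => x.trace g) ∈ issRing n :=
  ⟨_, trace_mem_invariants g, fun _ _ => Iss.trace_mk ..⟩

theorem isOpen_ne_zero {F : Iss n → ℂ} (hF : F ∈ issRing n) : IsOpen {x | F x ≠ 0} :=
  TopologicalSpace.isOpen_generateFrom_of_mem ⟨F, hF, rfl⟩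

theorem isClosed_eq_zero {F : Iss n → ℂ} (hF : F ∈ issRing n) : IsClosed {x | F x = 0} := by
  rw [← isOpen_compl_iff]; exact isOpen_ne_zero hF

theorem isTopologicalBasis_issRing : TopologicalSpace.IsTopologicalBasis
    {U : Set (Iss n) | ∃ F ∈ issRing n, U = {x | F x ≠ 0}} where
  exists_subset_inter := by
    rintro _ ⟨F, hF, rfl⟩ _ ⟨G, hG, rfl⟩ x ⟨hx, hx'⟩
    exact ⟨_, ⟨F * G, mul_mem hF hG, rfl⟩, mul_ne_zero hx hx', fun y hy =>
      ⟨left_ne_zero_of_mul hy, right_ne_zero_of_mul hy⟩⟩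
  sUnion_eq := Set.eq_univ_of_forall fun x =>
    ⟨_, ⟨1, one_mem _, rfl⟩, one_ne_zero⟩
  eq_generateFrom := rfl

theorem isOpen_setOf_isSimple [NeZero n] : IsOpen {x : Iss n | x.IsSimple} := by
  rw [isOpen_iff_forall_mem_open]
  rintro x ⟨V, hV, hs, rfl⟩
  obtain ⟨D, hD, hD0, hD1⟩ := hs.exists_invariant
  refine ⟨{x | issFun D hD x ≠ 0}, ?_, isOpen_ne_zero (issFun_mem hD), hD0⟩
  intro y hy
  obtain ⟨W, hW, rfl⟩ := y.exists_rep
  exact ⟨W, hW, hD1 W hy, rfl⟩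

end BraidReversal

namespace BraidReversal

open Module Matrix

/-! ### The four families are closed and pairwise disjoint -/

section Closed

variable {n : ℕ}

/-- For central z the kernel of z − c is a subrepresentation. On an invariant complement z − c is
both injective and nilpotent, so the complement is zero. -/
theorem mat_eq_smul_of_isSemisimple {V : Rep n} (hV : V.IsSemisimple) {z : B3}
    (hz : ∀ g, Commute z g) {c : ℂ} {k : ℕ} (h : (V.mat z - c • 1) ^ k = 0) :
    V.mat z = c • 1 := by
  have hcomm : ∀ g x, V.mat g *ᵥ ((V.mat z - c • 1) *ᵥ x) =
      (V.mat z - c • 1) *ᵥ (V.mat g *ᵥ x) := by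
    intro g x
    rw [mulVec_mulVec, mulVec_mulVec, mul_sub, sub_mul, ← Rep.mat_mul, ← Rep.mat_mul,
      (hz g).eq]
    simp
  let K : Subrepresentation V.toRepresentation :=
    { toSubmodule := LinearMap.ker (Matrix.toLin' (V.mat z - c • 1))
      apply_mem_toSubmodule := fun g x hx => by
        rw [LinearMap.mem_ker, Matrix.toLin'_apply] at hx ⊢
        rw [Rep.toRepresentation_eq, Matrix.toLin'_apply, ← hcomm, hx, mulVec_zero] }
  obtain ⟨N, hN⟩ := hV.exists_isCompl K
  have hNA : ∀ x ∈ N.toSubmodule, (V.mat z - c • 1) *ᵥ x ∈ N.toSubmodule := by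
    intro x hx
    rw [sub_mulVec, smul_mulVec, one_mulVec]
    exact sub_mem (N.apply_mem_toSubmodule z hx) (N.toSubmodule.smul_mem c hx)
  have hKN : ∀ x ∈ N.toSubmodule, (V.mat z - c • 1) *ᵥ x = 0 → x = 0 := by
    intro x hx hx0
    have : x ∈ K ⊓ N := ⟨hx0, hx⟩
    rw [hN.inf_eq_bot] at this
    exact this
  have hpow : ∀ m, ∀ x ∈ N.toSubmodule, (V.mat z - c • 1) ^ m *ᵥ x = 0 → x = 0 := by
    intro m
    induction m with
    | zero => intro x _ h; simpa using h
    | succ m ih =>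
      intro x hx hm
      rw [pow_succ, ← mulVec_mulVec] at hm
      exact hKN x hx (ih _ (hNA x hx) hm)
  have hNbot : N = ⊥ := by
    apply Subrepresentation.toSubmodule_injective
    refine (Submodule.eq_bot_iff _).2 fun x hx => hpow k x hx ?_
    rw [h, zero_mulVec]
  have hK : K = ⊤ := by simpa [hNbot] using hN.sup_eq_top
  have hz0 : V.mat z - c • 1 = 0 := by
    apply Matrix.toLin'.injective
    ext1 i
    ext1
    have : Pi.single i 1 ∈ K := hK ▸ trivial
    have h1 : (V.mat z - c • 1) *ᵥ (Pi.single i 1) = 0 := this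
    rw [sub_mulVec, smul_mulVec, one_mulVec] at h1
    simpa using h1
  exact sub_eq_zero.1 hz0

theorem charpoly_smul_one (c : ℂ) :
    (c • (1 : Matrix (Fin n) (Fin n) ℂ)).charpoly = (Polynomial.X - Polynomial.C c) ^ n := by
  rw [← Matrix.diagonal_one, ← Matrix.diagonal_smul, Matrix.charpoly_diagonal]
  simp

/-- The scalar can only be the normalised trace. On semisimple representations, being scalar amounts
to the characteristic polynomial being (X − c)⁶, and this is a system of equations between
invariants. For k > 6 the truncated exponent does no harm because the binomial coefficient is zero.
-/
theorem scalar_iff_charpoly {V : Rep 6} (hV : V.IsSemisimple) :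
    (∃ c : ℂ, V.mat (bS * bS) = c • (1 : Matrix (Fin 6) (Fin 6) ℂ)) ↔
      ∀ k, (V.mat (bS * bS)).charpoly.coeff k -
        (-((V.mat (bS * bS)).trace / 6)) ^ (6 - k) * (Nat.choose 6 k : ℂ) = 0 := by
  have key : ∀ c : ℂ, (V.mat (bS * bS)).trace / 6 = c →
      ((V.mat (bS * bS)).charpoly = (Polynomial.X - Polynomial.C c) ^ 6 ↔
      ∀ k, (V.mat (bS * bS)).charpoly.coeff k -
        (-((V.mat (bS * bS)).trace / 6)) ^ (6 - k) * (Nat.choose 6 k : ℂ) = 0) := by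
    intro c hc
    rw [hc, Polynomial.ext_iff, sub_eq_add_neg Polynomial.X, ← map_neg]
    simp only [Polynomial.coeff_X_add_C_pow, sub_eq_zero]
  constructor
  · rintro ⟨c, hc⟩
    refine (key c ?_).1 ?_
    · rw [hc, trace_smul, trace_one]; simp
    · rw [hc, charpoly_smul_one]
  · intro h
    have h1 := (key _ rfl).2 h
    refine ⟨(V.mat (bS * bS)).trace / 6, mat_eq_smul_of_isSemisimple hV center_comm (k := 6) ?_⟩
    have h2 := Matrix.aeval_self_charpoly (V.mat (bS * bS))
    rw [h1, map_pow, map_sub, Polynomial.aeval_X, Polynomial.aeval_C] at h2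
    rw [← h2, Algebra.algebraMap_eq_smul_one]

theorem isClosed_of_forall_mk_mem_iff {Z : Set (Iss 6)} {f g : Rep 6 → ℂ} (hf : f ∈ invariants 6)
    (hg : g ∈ invariants 6) (h : ∀ V hV, Iss.mk V hV ∈ Z ↔
      (∃ c : ℂ, V.mat (bS * bS) = c • (1 : Matrix (Fin 6) (Fin 6) ℂ)) ∧ f V = 0 ∧ g V = 0) :
    IsClosed Z := by
  have hcoeff : ∀ k : ℕ, (fun V : Rep 6 => (V.mat (bS * bS)).charpoly.coeff k -
      (-((V.mat (bS * bS)).trace / 6)) ^ (6 - k) * (Nat.choose 6 k : ℂ)) ∈ invariants 6 := by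
    intro k
    refine sub_mem (charpoly_coeff_mem_invariants _ k) (mul_mem (pow_mem (neg_mem ?_) _)
      ((invariants 6).algebraMap_mem _))
    have := Subalgebra.smul_mem _ (trace_mem_invariants (n := 6) (bS * bS)) ((1 : ℂ) / 6)
    convert this using 1
    ext V
    simp
    ring
  have hZ : Z = (⋂ k, {x | issFun _ (hcoeff k) x = 0}) ∩
      ({x | issFun f hf x = 0} ∩ {x | issFun g hg x = 0}) := by
    ext x
    obtain ⟨V, hV, rfl⟩ := x.exists_rep
    rw [h, scalar_iff_charpoly hV]
    simp only [Set.mem_inter_iff, Set.mem_iInter, Set.mem_ofPred_eq, issFun_mk]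
  rw [hZ]
  exact (isClosed_iInter fun k => isClosed_eq_zero (issFun_mem _)).inter
    ((isClosed_eq_zero (issFun_mem _)).inter (isClosed_eq_zero (issFun_mem _)))

variable {ρ : ℂ}

theorem isClosed_comp6a (hρ : IsPrimitiveRoot ρ 3) : IsClosed (comp6a ρ) := by
  refine isClosed_of_forall_mk_mem_iff (trace_mem_invariants bS)
    (sub_mem (Subalgebra.smul_mem _ (pow_mem (trace_mem_invariants bT) 3) (6 : ℂ))
      (Subalgebra.smul_mem _ (trace_mem_invariants (bS * bS)) ((2 + ρ) ^ 3))) fun V hV => ?_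
  rw [mk_mem_comp6a_iff V hV hρ]
  simp [sub_eq_zero]

theorem isClosed_comp6aMirror (hρ : IsPrimitiveRoot ρ 3) : IsClosed (comp6aMirror ρ) := by
  rw [comp6aMirror_eq hρ]
  exact isClosed_comp6a (isPrimitiveRoot_sq hρ)

theorem isClosed_comp6b (hρ : IsPrimitiveRoot ρ 3) : IsClosed (comp6b ρ) := by
  refine isClosed_of_forall_mk_mem_iff (trace_mem_invariants bS) (trace_mem_invariants bT)
    fun V hV => ?_
  rw [mk_mem_comp6b_iff V hV hρ]

theorem isClosed_comp6c (hρ : IsPrimitiveRoot ρ 3) : IsClosed (comp6c ρ) := by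
  refine isClosed_of_forall_mk_mem_iff (sub_mem
    (Subalgebra.smul_mem _ (pow_mem (trace_mem_invariants bS) 2) (6 : ℂ))
    (Subalgebra.smul_mem _ (trace_mem_invariants (bS * bS)) (4 : ℂ))) (trace_mem_invariants bT)
    fun V hV => ?_
  rw [mk_mem_comp6c_iff V hV hρ]
  simp [sub_eq_zero]

theorem trace_center_ne_zero {V : Rep 6}
    (h : ∃ c : ℂ, V.mat (bS * bS) = c • (1 : Matrix (Fin 6) (Fin 6) ℂ)) :
    (V.mat (bS * bS)).trace ≠ 0 := by
  obtain ⟨c, hc⟩ := h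
  rw [hc, trace_smul, trace_one]
  simpa using center_scalar_ne_zero hc

theorem two_add_ne_zero (hρ : IsPrimitiveRoot ρ 3) : 2 + ρ ≠ 0 := fun h => by
  have := one_add_add_sq hρ
  have : (3 : ℂ) = 0 := by linear_combination this - (ρ - 1) * h
  norm_num at this

/-- One has (2 + ρ)³ = 3(1 + 2ρ) and (2 + ρ²)³ = −3(1 + 2ρ), and these differ because (1 + 2ρ)² =
−3. So the ratio of (tr T)³ to tr S² separates the two families. -/
theorem disjoint_6a_mirror (hρ : IsPrimitiveRoot ρ 3) :
    Disjoint (comp6a ρ) (comp6aMirror ρ) := by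
  rw [Set.disjoint_left, comp6aMirror_eq hρ]
  intro x h1 h2
  obtain ⟨V, hV, rfl⟩ := x.exists_rep
  rw [mk_mem_comp6a_iff V hV hρ] at h1
  rw [mk_mem_comp6a_iff V hV (isPrimitiveRoot_sq hρ)] at h2
  have hC := trace_center_ne_zero h1.1
  have e := one_add_add_sq hρ
  have hT := h2.2.2
  rw [e] at hT
  have h0 : 6 * (2 * ρ + 1) * (V.mat (bS * bS)).trace = 0 := by
    linear_combination hT - h1.2.2 - (V.mat (bS * bS)).trace * (2 * ρ + 1) * e
  rcases mul_eq_zero.1 h0 with h0 | h0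
  · have : (3 : ℂ) = 0 := by linear_combination 4 * e - (2 * ρ + 1) / 6 * h0
    norm_num at this
  · exact hC h0

/-- This separates 6a from 6b and 6c, where the trace of T is zero. -/
theorem disjoint_6a_of_trace (hρ : IsPrimitiveRoot ρ 3) {V : Rep 6} {hV : V.IsSemisimple}
    (h : Iss.mk V hV ∈ comp6a ρ) : (V.mat bT).trace ≠ 0 := by
  rw [mk_mem_comp6a_iff V hV hρ] at h
  intro h0
  have := h.2.2
  rw [h0] at this
  have h3 := mul_ne_zero (pow_ne_zero 3 (two_add_ne_zero hρ)) (trace_center_ne_zero h.1)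
  exact h3 (by rw [← this]; norm_num)

theorem disjoint_6a_6b (hρ : IsPrimitiveRoot ρ 3) : Disjoint (comp6a ρ) (comp6b ρ) := by
  rw [Set.disjoint_left]
  intro x h1 h2
  obtain ⟨V, hV, rfl⟩ := x.exists_rep
  exact disjoint_6a_of_trace hρ h1 ((mk_mem_comp6b_iff V hV hρ).1 h2).2.2

theorem disjoint_6a_6c (hρ : IsPrimitiveRoot ρ 3) : Disjoint (comp6a ρ) (comp6c ρ) := by
  rw [Set.disjoint_left]
  intro x h1 h2
  obtain ⟨V, hV, rfl⟩ := x.exists_rep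
  exact disjoint_6a_of_trace hρ h1 ((mk_mem_comp6c_iff V hV hρ).1 h2).2.2

theorem disjoint_mirror_6b (hρ : IsPrimitiveRoot ρ 3) :
    Disjoint (comp6aMirror ρ) (comp6b ρ) := by
  rw [Set.disjoint_left, comp6aMirror_eq hρ]
  intro x h1 h2
  obtain ⟨V, hV, rfl⟩ := x.exists_rep
  exact disjoint_6a_of_trace (isPrimitiveRoot_sq hρ) h1 ((mk_mem_comp6b_iff V hV hρ).1 h2).2.2

theorem disjoint_mirror_6c (hρ : IsPrimitiveRoot ρ 3) :
    Disjoint (comp6aMirror ρ) (comp6c ρ) := by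
  rw [Set.disjoint_left, comp6aMirror_eq hρ]
  intro x h1 h2
  obtain ⟨V, hV, rfl⟩ := x.exists_rep
  exact disjoint_6a_of_trace (isPrimitiveRoot_sq hρ) h1 ((mk_mem_comp6c_iff V hV hρ).1 h2).2.2

theorem disjoint_6b_6c (hρ : IsPrimitiveRoot ρ 3) : Disjoint (comp6b ρ) (comp6c ρ) := by
  rw [Set.disjoint_left]
  intro x h1 h2
  obtain ⟨V, hV, rfl⟩ := x.exists_rep
  rw [mk_mem_comp6b_iff V hV hρ] at h1
  rw [mk_mem_comp6c_iff V hV hρ, h1.2.1] at h2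
  apply trace_center_ne_zero h2.1
  linear_combination -h2.2.1 / 4

end Closed

end BraidReversal

namespace BraidReversal

open Module Matrix

/-! ### Simple representations of dimension six lie in one of the four families -/

section Classification

variable {n : ℕ}

theorem inv_mulVec_mem {V : Rep n} {N : Submodule ℂ (Fin n → ℂ)} {g : B3}
    (h : ∀ x ∈ N, V.mat g *ᵥ x ∈ N) : ∀ x ∈ N, V.mat g⁻¹ *ᵥ x ∈ N := by
  have h1 : V.mat g⁻¹ * V.mat g = 1 := by rw [← Rep.mat_mul]; simp
  have hinj : Function.Injective (Matrix.toLin' (V.mat g)) := by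
    intro x y hxy
    have := congrArg (V.mat g⁻¹ *ᵥ ·) hxy
    simpa only [Matrix.toLin'_apply, mulVec_mulVec, h1, one_mulVec] using this
  have hmap : N.map (Matrix.toLin' (V.mat g)) = N := by
    -- An injective map that preserves a finite-dimensional subspace maps it onto itself, so the
    -- inverse preserves it too.
    refine Submodule.eq_of_le_of_finrank_eq (Submodule.map_le_iff_le_comap.2 fun x hx => h x hx) ?_
    exact ((Submodule.equivMapOfInjective _ hinj N).finrank_eq).symm
  intro x hx
  rw [← hmap] at hx
  obtain ⟨y, hy, rfl⟩ := hx
  rwa [Matrix.toLin'_apply, mulVec_mulVec, h1, one_mulVec]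

theorem Rep.IsSimple.eq_bot_or_eq_top {V : Rep n} (hV : V.IsSimple)
    {N : Submodule ℂ (Fin n → ℂ)} (hS : ∀ x ∈ N, V.mat bS *ᵥ x ∈ N)
    (hT : ∀ x ∈ N, V.mat bT *ᵥ x ∈ N) : N = ⊥ ∨ N = ⊤ := by
  let M : Submonoid (Matrix (Fin n) (Fin n) ℂ) :=
    { carrier := {A | ∀ x ∈ N, A *ᵥ x ∈ N}
      one_mem' := fun x hx => by rwa [one_mulVec]
      mul_mem' := fun {A B} hA hB x hx => by rw [← mulVec_mulVec]; exact hA _ (hB x hx) }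
  have hg : ∀ g, V.matHom g ∈ M := hom_mem_of_bS_bT V.matHom M hS (inv_mulVec_mem hS) hT
    (inv_mulVec_mem hT)
  let K : Subrepresentation V.toRepresentation := ⟨N, fun g x hx => hg g x hx⟩
  have : V.toRepresentation.IsIrreducible := hV
  rcases IsSimpleOrder.eq_bot_or_eq_top K with h | h
  · exact Or.inl (congrArg Subrepresentation.toSubmodule h)
  · exact Or.inr (congrArg Subrepresentation.toSubmodule h)

theorem Rep.IsSimple.false_of_invariant_span {V : Rep n} (hV : V.IsSimple) (s : Finset (Fin n → ℂ))
    (hs : s.card < n) {v : Fin n → ℂ} (hv : v ∈ s) (hv0 : v ≠ 0)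
    (hS : ∀ x ∈ s, V.mat bS *ᵥ x ∈ Submodule.span ℂ (s : Set (Fin n → ℂ)))
    (hT : ∀ x ∈ s, V.mat bT *ᵥ x ∈ Submodule.span ℂ (s : Set (Fin n → ℂ))) : False := by
  have hext : ∀ A : Matrix (Fin n) (Fin n) ℂ,
      (∀ x ∈ s, A *ᵥ x ∈ Submodule.span ℂ (s : Set (Fin n → ℂ))) →
      ∀ x ∈ Submodule.span ℂ (s : Set (Fin n → ℂ)),
        A *ᵥ x ∈ Submodule.span ℂ (s : Set (Fin n → ℂ)) := by
    intro A hA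
    have : Submodule.span ℂ (s : Set (Fin n → ℂ)) ≤
        (Submodule.span ℂ (s : Set (Fin n → ℂ))).comap (Matrix.toLin' A) :=
      Submodule.span_le.2 hA
    exact this
  rcases hV.eq_bot_or_eq_top (hext _ hS) (hext _ hT) with h | h
  · have := h ▸ Submodule.subset_span (R := ℂ) (Finset.mem_coe.2 hv)
    exact hv0 this
  · have h1 := finrank_span_finset_le_card (R := ℂ) s
    rw [Set.finrank, h, finrank_top] at h1
    simp at h1
    omega

theorem Rep.IsSimple.false_of_common_eigenvector {V : Rep n} (hV : V.IsSimple) (hn : 1 < n)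
    {v : Fin n → ℂ} (hv0 : v ≠ 0) {α β : ℂ} (hS : V.mat bS *ᵥ v = α • v)
    (hT : V.mat bT *ᵥ v = β • v) : False := by
  refine hV.false_of_invariant_span {v} (by simpa using hn) (v := v) (by simp) hv0 ?_ ?_
  · intro x hx
    rw [Finset.mem_singleton.1 hx, hS]
    exact Submodule.smul_mem _ _ (Submodule.subset_span (by simp))
  · intro x hx
    rw [Finset.mem_singleton.1 hx, hT]
    exact Submodule.smul_mem _ _ (Submodule.subset_span (by simp))

/-- Commuting with S and T means commuting with every braid, hence by Burnside with every matrix. -/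
theorem Rep.IsSimple.exists_eq_smul_of_commute {V : Rep n} (hV : V.IsSimple)
    {Z : Matrix (Fin n) (Fin n) ℂ} (hS : Commute Z (V.mat bS)) (hT : Commute Z (V.mat bT)) :
    ∃ ζ : ℂ, Z = ζ • 1 := by
  have hinv : ∀ g, Commute Z (V.mat g) → Commute Z (V.mat g⁻¹) := by
    intro g h
    have h1 : V.mat g⁻¹ * V.mat g = 1 := by rw [← Rep.mat_mul]; simp
    have h2 : V.mat g * V.mat g⁻¹ = 1 := by rw [← Rep.mat_mul]; simp
    calc Z * V.mat g⁻¹ = V.mat g⁻¹ * (V.mat g * Z) * V.mat g⁻¹ := by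
          rw [← mul_assoc, h1, one_mul]
      _ = V.mat g⁻¹ * Z * (V.mat g * V.mat g⁻¹) := by rw [← h.eq]; simp only [mul_assoc]
      _ = V.mat g⁻¹ * Z := by rw [h2, mul_one]
  have hmem : ∀ {A : Matrix (Fin n) (Fin n) ℂ}, A ∈ Submonoid.centralizer {Z} ↔ Commute A Z := by
    intro A
    rw [Submonoid.mem_centralizer_iff]
    simp [Commute, SemiconjBy, eq_comm]
  have hg : ∀ g, V.matHom g ∈ Submonoid.centralizer {Z} := hom_mem_of_bS_bT V.matHom _
    (hmem.2 hS.symm)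
    (hmem.2 (hinv _ hS).symm)
    (hmem.2 hT.symm)
    (hmem.2 (hinv _ hT).symm)
  have hall : ∀ A, Commute Z A := by
    intro A
    have hA : A ∈ Submodule.span ℂ (Set.range V.mat) := hV.span_eq_top ▸ Submodule.mem_top
    induction hA using Submodule.span_induction with
    | mem A hA =>
      obtain ⟨g, rfl⟩ := hA
      exact (hmem.1 (hg g)).symm
    | zero => exact Commute.zero_right _
    | add A B _ _ hA hB => exact hA.add_right hB
    | smul c A _ hA => exact hA.smul_right c
  obtain ⟨ζ, hζ⟩ := Matrix.mem_range_scalar_of_commute_single (M := Z) fun i j _ => (hall _).symm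
  exact ⟨ζ, by rw [← hζ, ← Algebra.algebraMap_eq_smul_one]; rfl⟩

/-- If T² = uT + w and S² = 1, then ST + TS − uS commutes with S and T, hence is a scalar. For an
eigenvector v of S the span of v and Tv is then invariant, which bounds the dimension by two. -/
theorem Rep.IsSimple.false_of_quadratic {V : Rep n} (hV : V.IsSimple) (hn : 2 < n)
    (hS : V.mat bS * V.mat bS = 1) {u w : ℂ}
    (hT : V.mat bT * V.mat bT = u • V.mat bT + w • (1 : Matrix (Fin n) (Fin n) ℂ)) : False := by
  set S := V.mat bS with hSdef
  set T := V.mat bT with hTdef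
  obtain ⟨ζ, hζ⟩ := hV.exists_eq_smul_of_commute (Z := S * T + T * S - u • S) (by
      rw [← hSdef, Commute, SemiconjBy]
      simp only [add_mul, sub_mul, mul_add, mul_sub, smul_mul_assoc, mul_smul_comm]
      rw [mul_assoc T S S, ← mul_assoc S S T, hS, mul_one, one_mul, ← mul_assoc S T S]
      abel) (by
      rw [← hTdef, Commute, SemiconjBy]
      simp only [add_mul, sub_mul, mul_add, mul_sub, smul_mul_assoc, mul_smul_comm]
      rw [mul_assoc S T T, ← mul_assoc T T S, hT, ← mul_assoc T S T]
      simp only [add_mul, mul_add, smul_mul_assoc, mul_smul_comm, mul_one, one_mul]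
      abel)
  obtain ⟨Q, μ, hQ, -⟩ := exists_diagonalization two_ne_zero (A := S) (by rw [pow_two, hS])
  let i0 : Fin n := ⟨0, by omega⟩
  set v := Q.val.col i0 with hv
  have hv0 : v ≠ 0 := by
    intro h0
    have h1 : (Q⁻¹).val * Q.val = 1 := by rw [← Units.val_mul]; simp
    have h2 := congrFun (congrFun h1 i0) i0
    have h3 : ∀ j, Q.val j i0 = 0 := fun j => congrFun h0 j
    rw [Matrix.mul_apply, one_apply_eq] at h2
    simp [h3] at h2
  have hSv : S *ᵥ v = μ i0 • v := by
    have h2 := congrArg (fun A : Matrix (Fin n) (Fin n) ℂ => A.col i0) hQ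
    ext i
    have h3 := congrFun h2 i
    simp only [Matrix.col_apply, mul_diagonal] at h3
    rw [Matrix.mul_apply] at h3
    simp only [mulVec, dotProduct, hv, Matrix.col_apply, Pi.smul_apply, smul_eq_mul]
    rw [h3, mul_comm]
  have hSTv : S *ᵥ (T *ᵥ v) = (u * μ i0 + ζ) • v + (-μ i0) • (T *ᵥ v) := by
    have := congrArg (fun A : Matrix (Fin n) (Fin n) ℂ => A *ᵥ v) hζ
    simp only [sub_mulVec, add_mulVec, ← mulVec_mulVec, smul_mulVec, hSv, mulVec_smul,
      one_mulVec] at this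
    rw [add_smul, mul_smul, ← this]
    module
  have hTTv : T *ᵥ (T *ᵥ v) = u • (T *ᵥ v) + w • v := by
    rw [mulVec_mulVec, hT, add_mulVec, smul_mulVec, smul_mulVec, one_mulVec]
  classical
  have hmem1 : v ∈ Submodule.span ℂ (({v, T *ᵥ v} : Finset (Fin n → ℂ)) : Set (Fin n → ℂ)) :=
    Submodule.subset_span (by simp)
  have hmem2 : T *ᵥ v ∈ Submodule.span ℂ
      (({v, T *ᵥ v} : Finset (Fin n → ℂ)) : Set (Fin n → ℂ)) :=
    Submodule.subset_span (by simp)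
  refine hV.false_of_invariant_span {v, T *ᵥ v} (lt_of_le_of_lt Finset.card_le_two hn) (v := v)
    (by simp) hv0 ?_ ?_
  · intro x hx
    rw [← hSdef]
    rcases Finset.mem_insert.1 hx with rfl | hx
    · rw [hSv]; exact Submodule.smul_mem _ _ hmem1
    · rw [Finset.mem_singleton.1 hx, hSTv]
      exact add_mem (Submodule.smul_mem _ _ hmem1) (Submodule.smul_mem _ _ hmem2)
  · intro x hx
    rw [← hTdef]
    rcases Finset.mem_insert.1 hx with rfl | hx
    · exact hmem2
    · rw [Finset.mem_singleton.1 hx, hTTv]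
      exact add_mem (Submodule.smul_mem _ _ hmem2) (Submodule.smul_mem _ _ hmem1)

/-- A common eigenvector of S and T would span a subrepresentation, so the two eigenspaces meet only
in zero. -/
theorem Rep.IsSimple.eigenDim_add_le {V : Rep n} (hV : V.IsSimple) (hn : 1 < n) (α β : ℂ) :
    V.eigenDim bS α + V.eigenDim bT β ≤ n := by
  have hdisj : Disjoint (Module.End.eigenspace (Matrix.toLin' (V.mat bS)) α)
      (Module.End.eigenspace (Matrix.toLin' (V.mat bT)) β) := by
    rw [Submodule.disjoint_def]
    intro x h1 h2
    by_contra hx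
    exact hV.false_of_common_eigenvector hn hx (Module.End.mem_eigenspace_iff.1 h1)
      (Module.End.mem_eigenspace_iff.1 h2)
  have := Submodule.finrank_add_finrank_le_of_disjoint hdisj
  simpa [Rep.eigenDim] using this

variable {ρ : ℂ}

theorem quadratic_of_forall_eq {T : Matrix (Fin n) (Fin n) ℂ} {R : GL (Fin n) ℂ} {η : Fin n → ℂ}
    (hR : T * R.val = R.val * diagonal η) {α β : ℂ} (h : ∀ i, η i = α ∨ η i = β) :
    T * T = (α + β) • T + (-(α * β)) • (1 : Matrix (Fin n) (Fin n) ℂ) := by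
  have h1 : R.val * (R⁻¹).val = 1 := by rw [← Units.val_mul]; simp
  have hd : diagonal η * diagonal η = (α + β) • diagonal η + (-(α * β)) • 1 := by
    rw [diagonal_mul_diagonal, ← diagonal_one, ← diagonal_smul, ← diagonal_smul, diagonal_add]
    congr 1
    ext i
    rcases h i with h | h <;> simp [h] <;> ring
  calc T * T = T * (T * R.val) * (R⁻¹).val := by rw [mul_assoc, mul_assoc, h1, mul_one]
    _ = (T * R.val) * diagonal η * (R⁻¹).val := by rw [hR, ← mul_assoc T, hR]
    _ = R.val * (diagonal η * diagonal η) * (R⁻¹).val := by rw [hR]; simp only [mul_assoc]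
    _ = (α + β) • (R.val * diagonal η * (R⁻¹).val) + (-(α * β)) • (R.val * (R⁻¹).val) := by
      rw [hd]; simp only [mul_add, add_mul, mul_smul_comm, smul_mul_assoc, mul_one]
    _ = _ := by rw [← hR, mul_assoc, h1, mul_one]

theorem Rep.IsSimple.scale [NeZero n] {V : Rep n} (hV : V.IsSimple) (t : ℂˣ) :
    (V.scale t).IsSimple := by
  refine Rep.isSimple_of_forall_invariant fun N hN => ?_
  have h : ∀ g, ∀ x ∈ N, V.mat g *ᵥ x ∈ N := by
    intro g x hx
    have := N.smul_mem (scalarChar t g)⁻¹.val (hN g x hx)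
    rwa [Rep.mat_scale, smul_mulVec, smul_smul, Units.inv_mul, one_smul] at this
  exact hV.eq_bot_or_eq_top (h _) (h _)

theorem Rep.IsSimple.exists_center_eq_smul {V : Rep n} (hV : V.IsSimple) :
    ∃ c : ℂ, c ≠ 0 ∧ V.mat (bS * bS) = c • 1 := by
  obtain ⟨c, hc0, hc⟩ := exists_center_scalar V.toRepresentation hV
  refine ⟨c, hc0, Matrix.toLin'.injective ?_⟩
  rw [map_smul, Matrix.toLin'_one]
  exact hc

/-- The largest of x, y, z is at least two, so a and b are at most four. If one of them is four,
then x, y, z are at most two and all equal two. If a = b = 3, then x, y, z are at most three. The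
six arrangements of 3, 2, 1 are grouped into two cyclic orbits because changing the root t rotates
the eigenvalues of T. -/
theorem dimensionVector_cases {a b x y z : ℕ} (hab : a + b = 6) (hxyz : x + y + z = 6) (hx : x ≠ 0)
    (hy : y ≠ 0) (hz : z ≠ 0) (h1x : a + x ≤ 6) (h1y : a + y ≤ 6) (h1z : a + z ≤ 6)
    (h2x : b + x ≤ 6) (h2y : b + y ≤ 6) (h2z : b + z ≤ 6) :
    (a = 3 ∧ b = 3 ∧ x = 2 ∧ y = 2 ∧ z = 2) ∨
      ((a = 4 ∧ b = 2 ∨ a = 2 ∧ b = 4) ∧ x = 2 ∧ y = 2 ∧ z = 2) ∨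
      (a = 3 ∧ b = 3 ∧ (x = 3 ∧ y = 2 ∧ z = 1 ∨ x = 1 ∧ y = 3 ∧ z = 2 ∨ x = 2 ∧ y = 1 ∧ z = 3)) ∨
      (a = 3 ∧ b = 3 ∧ (x = 3 ∧ y = 1 ∧ z = 2 ∨ x = 2 ∧ y = 3 ∧ z = 1 ∨
        x = 1 ∧ y = 2 ∧ z = 3)) := by
  have ha : 2 ≤ a := by omega
  have ha' : a ≤ 4 := by omega
  have hx' : x ≤ 4 := by omega
  have hy' : y ≤ 4 := by omega
  obtain rfl : b = 6 - a := by omega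
  obtain rfl : z = 6 - x - y := by omega
  have : 1 ≤ x := by omega
  have : 1 ≤ y := by omega
  interval_cases a <;> interval_cases x <;> interval_cases y <;> simp_all

/-- The traces of a simple representation of dimension six. -/
theorem Rep.IsSimple.exists_traces (hρ : IsPrimitiveRoot ρ 3) {V : Rep 6} (hV : V.IsSimple) :
    ∃ (t : ℂ) (a b x y z : ℕ), V.mat (bS * bS) = t ^ 6 • 1 ∧
      (V.mat bS).trace = t ^ 3 * (a - b) ∧
      (V.mat bT).trace = t ^ 2 * (x + y * ρ + z * ρ ^ 2) ∧
      ((a = 3 ∧ b = 3 ∧ x = 2 ∧ y = 2 ∧ z = 2) ∨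
      ((a = 4 ∧ b = 2 ∨ a = 2 ∧ b = 4) ∧ x = 2 ∧ y = 2 ∧ z = 2) ∨
      (a = 3 ∧ b = 3 ∧ (x = 3 ∧ y = 2 ∧ z = 1 ∨ x = 1 ∧ y = 3 ∧ z = 2 ∨ x = 2 ∧ y = 1 ∧ z = 3)) ∨
      (a = 3 ∧ b = 3 ∧ (x = 3 ∧ y = 1 ∧ z = 2 ∨ x = 2 ∧ y = 3 ∧ z = 1 ∨
        x = 1 ∧ y = 2 ∧ z = 3))) := by
  obtain ⟨c, hc0, hc⟩ := hV.exists_center_eq_smul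
  obtain ⟨t, ht6⟩ := exists_pow_six_eq c
  have ht0 : t ≠ 0 := by rintro rfl; simp at ht6; exact hc0 ht6.symm
  set u : ℂˣ := Units.mk0 t ht0 with hu
  have hut : (u : ℂ) = t := rfl
  set W := V.scale u⁻¹ with hWdef
  have hW : W.IsSimple := hV.scale _
  have hVW : V = W.scale u := by rw [hWdef, Rep.scale_scale]; simp [Rep.scale_one]
  have hSS : W.mat bS * W.mat bS = 1 := by
    rw [hWdef, Rep.mat_scale_bS, smul_mul_smul_comm, ← Rep.mat_mul, hc, smul_smul, ← ht6,
      Units.val_inv_eq_inv_val, hut, ← pow_add, inv_pow, inv_mul_cancel₀ (pow_ne_zero _ ht0),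
      one_smul]
  have hTTT : W.mat bT ^ 3 = 1 := by
    rw [← Rep.mat_pow, ← bS_mul_bS, Rep.mat_mul, hSS]
  obtain ⟨Q, μ, hQ, hμ⟩ := exists_diagonalization two_ne_zero (A := W.mat bS) (by rw [pow_two, hSS])
  obtain ⟨R, η, hR, hη⟩ := exists_diagonalization three_ne_zero hTTT
  have hle : ∀ α β : ℂ, (Finset.univ.filter fun i => μ i = α).card +
      (Finset.univ.filter fun i => η i = β).card ≤ 6 := by
    intro α β
    have := hW.eigenDim_add_le (by norm_num) α β
    rwa [Rep.eigenDim, Rep.eigenDim, finrank_eigenspace_of_mul_eq _ Q hQ,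
      finrank_eigenspace_of_mul_eq _ R hR] at this
  have hneg := IsPrimitiveRoot.neg_one (R := ℂ) 0 (by norm_num)
  have hab := sum_card_filter_eq hneg hμ
  have hxyz := sum_card_filter_eq hρ hη
  have hS := sum_eq_sum_card hneg hμ
  have hT := sum_eq_sum_card hρ hη
  have hη' : ∀ i, η i = 1 ∨ η i = ρ ∨ η i = ρ ^ 2 := by
    intro i
    obtain ⟨k, hk, h⟩ := hρ.eq_pow_of_pow_eq_one (hη i)
    interval_cases k <;> simp [← h]
  -- If one of the three cube roots of unity were missing from the spectrum, T would satisfy a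
  -- quadratic equation.
  have hx : (Finset.univ.filter fun i => η i = 1).card ≠ 0 := by
    intro h0
    rw [Finset.card_eq_zero, Finset.filter_eq_empty_iff] at h0
    exact hW.false_of_quadratic (by norm_num) hSS (quadratic_of_forall_eq hR (α := ρ)
      (β := ρ ^ 2) fun i => (hη' i).resolve_left (h0 (Finset.mem_univ i)))
  have hy : (Finset.univ.filter fun i => η i = ρ).card ≠ 0 := by
    intro h0
    rw [Finset.card_eq_zero, Finset.filter_eq_empty_iff] at h0
    refine hW.false_of_quadratic (by norm_num) hSS (quadratic_of_forall_eq hR (α := 1)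
      (β := ρ ^ 2) fun i => ?_)
    have := h0 (Finset.mem_univ i)
    have := hη' i
    tauto
  have hz : (Finset.univ.filter fun i => η i = ρ ^ 2).card ≠ 0 := by
    intro h0
    rw [Finset.card_eq_zero, Finset.filter_eq_empty_iff] at h0
    refine hW.false_of_quadratic (by norm_num) hSS (quadratic_of_forall_eq hR (α := 1)
      (β := ρ) fun i => ?_)
    have := h0 (Finset.mem_univ i)
    have := hη' i
    tauto
  have h1x := hle 1 1
  have h1y := hle 1 ρ
  have h1z := hle 1 (ρ ^ 2)
  have h2x := hle (-1) 1
  have h2y := hle (-1) ρ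
  have h2z := hle (-1) (ρ ^ 2)
  simp only [Fin.sum_univ_two, Fin.sum_univ_three, Fin.val_zero, Fin.val_one, Fin.val_two, pow_zero,
    pow_one, mul_one] at hab hxyz hS hT
  rw [← trace_diagonal, ← trace_of_mul_eq hQ] at hS
  rw [← trace_diagonal, ← trace_of_mul_eq hR] at hT
  clear hle hη' hη hμ hQ hR
  generalize (Finset.univ.filter fun i => μ i = 1).card = a at *
  generalize (Finset.univ.filter fun i => μ i = -1).card = b at *
  generalize (Finset.univ.filter fun i => η i = 1).card = x at *
  generalize (Finset.univ.filter fun i => η i = ρ).card = y at *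
  generalize (Finset.univ.filter fun i => η i = ρ ^ 2).card = z at *
  have hVS : (V.mat bS).trace = t ^ 3 * (a - b) := by
    rw [hVW, Rep.mat_scale_bS, trace_smul, hS, smul_eq_mul, hut]
    ring
  have hVT : (V.mat bT).trace = t ^ 2 * (x + y * ρ + z * ρ ^ 2) := by
    rw [hVW, Rep.mat_scale_bT, trace_smul, hT, smul_eq_mul, hut]
  refine ⟨t, a, b, x, y, z, by rw [hc, ht6], hVS, hVT, ?_⟩
  exact dimensionVector_cases hab hxyz hx hy hz h1x h1y h1z h2x h2y h2z

/-- Another sixth root t changes the sign of S and multiplies T by a cube root of unity. The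
equations of the families involve tr S only through its square or its vanishing, and tr T only
through its cube or its vanishing. Hence (2, 4) is identified with (4, 2), and cyclic shifts of (x,
y, z) with one another. -/
theorem Rep.IsSimple.mem_comp (hρ : IsPrimitiveRoot ρ 3) {V : Rep 6} (hV : V.IsSimple)
    (hV' : V.IsSemisimple) : Iss.mk V hV' ∈ comp6a ρ ∨ Iss.mk V hV' ∈ comp6aMirror ρ ∨
      Iss.mk V hV' ∈ comp6b ρ ∨ Iss.mk V hV' ∈ comp6c ρ := by
  obtain ⟨t, a, b, x, y, z, hc, hVS, hVT, cases⟩ := hV.exists_traces hρ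
  have hVC : (V.mat (bS * bS)).trace = 6 * t ^ 6 := by
    rw [hc, trace_smul, trace_one]
    simp
    ring
  have e := one_add_add_sq hρ
  have h3 : ρ ^ 3 = 1 := hρ.pow_eq_one
  have hcube : ∀ k : ℂ, k ^ 3 = 1 → ∀ w : ℂ, (k * w) ^ 3 = w ^ 3 := by
    intro k hk w
    rw [mul_pow, hk, one_mul]
  have hρ2 : (ρ ^ 2) ^ 3 = 1 := by rw [← pow_mul, mul_comm, pow_mul, h3, one_pow]
  rcases cases with ⟨rfl, rfl, rfl, rfl, rfl⟩ | ⟨hab', rfl, rfl, rfl⟩ | ⟨rfl, rfl, hh⟩ |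
    ⟨rfl, rfl, hh⟩
  · right; right; left
    rw [mk_mem_comp6b_iff V hV' hρ]
    refine ⟨⟨_, hc⟩, by rw [hVS]; simp, ?_⟩
    rw [hVT]
    push_cast
    linear_combination 2 * t ^ 2 * e
  · right; right; right
    rw [mk_mem_comp6c_iff V hV' hρ]
    refine ⟨⟨_, hc⟩, ?_, ?_⟩
    · rw [hVS, hVC]
      rcases hab' with ⟨rfl, rfl⟩ | ⟨rfl, rfl⟩ <;> push_cast <;> ring
    · rw [hVT]
      push_cast
      linear_combination 2 * t ^ 2 * e
  · left
    rw [mk_mem_comp6a_iff V hV' hρ]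
    refine ⟨⟨_, hc⟩, by rw [hVS]; simp, ?_⟩
    have : ((x : ℂ) + y * ρ + z * ρ ^ 2) ^ 3 = (2 + ρ) ^ 3 := by
      rcases hh with ⟨rfl, rfl, rfl⟩ | ⟨rfl, rfl, rfl⟩ | ⟨rfl, rfl, rfl⟩
      · congr 1; push_cast; linear_combination e
      · rw [← hcube ρ h3 (2 + ρ)]; congr 1; push_cast; linear_combination e
      · rw [← hcube (ρ ^ 2) hρ2 (2 + ρ)]; congr 1; push_cast; linear_combination e - h3
    rw [hVT, hVC, mul_pow, this]
    ring
  · right; left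
    rw [comp6aMirror_eq hρ, mk_mem_comp6a_iff V hV' (isPrimitiveRoot_sq hρ)]
    refine ⟨⟨_, hc⟩, by rw [hVS]; simp, ?_⟩
    have : ((x : ℂ) + y * ρ + z * ρ ^ 2) ^ 3 = (2 + ρ ^ 2) ^ 3 := by
      rcases hh with ⟨rfl, rfl, rfl⟩ | ⟨rfl, rfl, rfl⟩ | ⟨rfl, rfl, rfl⟩
      · congr 1; push_cast; linear_combination e
      · rw [← hcube ρ h3 (2 + ρ ^ 2)]; congr 1; push_cast; linear_combination e - h3
      · rw [← hcube (ρ ^ 2) hρ2 (2 + ρ ^ 2)]; congr 1; push_cast; linear_combination e - ρ * h3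
    rw [hVT, hVC, mul_pow, this]
    ring

/-! ### Irreducible components -/

theorem Iss.IsSimple.mem_comp (hρ : IsPrimitiveRoot ρ 3) {x : Iss 6} (hx : x.IsSimple) :
    x ∈ comp6a ρ ∪ (comp6aMirror ρ ∪ (comp6b ρ ∪ comp6c ρ)) := by
  obtain ⟨V, hV, hs, rfl⟩ := hx
  exact hs.mem_comp hρ hV

/-- The simple locus is open and meets Z, so it is dense in Z, and it lies in the union of four
closed sets. An irreducible set inside a finite union of closed sets lies in one of them. -/
theorem subset_of_isIrreducible (hρ : IsPrimitiveRoot ρ 3) {Z : Set (Iss 6)}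
    (hZ : IsIrreducible Z) (hs : ∃ x ∈ Z, x.IsSimple) : Z ⊆ comp6a ρ ∨ Z ⊆ comp6aMirror ρ ∨
      Z ⊆ comp6b ρ ∨ Z ⊆ comp6c ρ := by
  have ha := isClosed_comp6a hρ
  have hm := isClosed_comp6aMirror hρ
  have hb := isClosed_comp6b hρ
  have hc := isClosed_comp6c hρ
  have hsub : Z ⊆ comp6a ρ ∪ (comp6aMirror ρ ∪ (comp6b ρ ∪ comp6c ρ)) := by
    have hcl := ha.union (hm.union (hb.union hc))
    obtain ⟨x, hx, hxs⟩ := hs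
    refine (subset_closure_inter_of_isPreirreducible_of_isOpen hZ.isPreirreducible
      isOpen_setOf_isSimple ⟨x, hx, hxs⟩).trans (closure_minimal ?_ hcl)
    rintro y ⟨-, hy⟩
    exact hy.mem_comp hρ
  rcases isPreirreducible_iff_isClosed_union_isClosed.1 hZ.isPreirreducible _ _ ha
    (hm.union (hb.union hc)) hsub with h | h
  · exact Or.inl h
  rcases isPreirreducible_iff_isClosed_union_isClosed.1 hZ.isPreirreducible _ _ hm
    (hb.union hc) h with h | h
  · exact Or.inr (Or.inl h)
  rcases isPreirreducible_iff_isClosed_union_isClosed.1 hZ.isPreirreducible _ _ hb hc h with h | h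
  · exact Or.inr (Or.inr (Or.inl h))
  · exact Or.inr (Or.inr (Or.inr h))

end Classification

end BraidReversal

namespace BraidReversal

open Module Matrix

/-! ### Functions on a principal open subset of affine space -/

/-- The principal open subset `δ ≠ 0` of affine space. -/
abbrev PrincipalOpen {σ : Type} (δ : MvPolynomial σ ℂ) : Type := {x : σ → ℂ // MvPolynomial.eval x δ ≠ 0}

/-- The regular functions on a principal open subset of affine space. -/
def polyFun {σ : Type} (δ : MvPolynomial σ ℂ) : Subalgebra ℂ (PrincipalOpen δ → ℂ) where
  carrier := {h | ∃ (k : ℕ) (q : MvPolynomial σ ℂ),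
    ∀ x, h x * MvPolynomial.eval x.1 δ ^ k = MvPolynomial.eval x.1 q}
  mul_mem' := by
    rintro h₁ h₂ ⟨k₁, q₁, e₁⟩ ⟨k₂, q₂, e₂⟩
    refine ⟨k₁ + k₂, q₁ * q₂, fun x => ?_⟩
    rw [map_mul, ← e₁, ← e₂, Pi.mul_apply]
    ring
  add_mem' := by
    rintro h₁ h₂ ⟨k₁, q₁, e₁⟩ ⟨k₂, q₂, e₂⟩
    refine ⟨k₁ + k₂, q₁ * δ ^ k₂ + q₂ * δ ^ k₁, fun x => ?_⟩
    simp only [map_mul, map_add, map_pow, ← e₁, ← e₂, Pi.add_apply]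
    ring
  algebraMap_mem' := fun c => ⟨0, MvPolynomial.C c, fun x => by simp⟩

section PolyFun

variable {σ : Type} {δ : MvPolynomial σ ℂ}

theorem eval_mem_polyFun (q : MvPolynomial σ ℂ) :
    (fun x : PrincipalOpen δ => MvPolynomial.eval x.1 q) ∈ polyFun δ :=
  ⟨0, q, fun x => by simp⟩

theorem coord_mem_polyFun (i : σ) : (fun x : PrincipalOpen δ => x.1 i) ∈ polyFun δ := by
  simpa using eval_mem_polyFun (δ := δ) (MvPolynomial.X i)

theorem inv_mem_polyFun {q : MvPolynomial σ ℂ} (hq : q ∣ δ) :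
    (fun x : PrincipalOpen δ => (MvPolynomial.eval x.1 q)⁻¹) ∈ polyFun δ := by
  obtain ⟨r, hr⟩ := hq
  refine ⟨1, r, fun x => ?_⟩
  have e : MvPolynomial.eval x.1 δ = MvPolynomial.eval x.1 q * MvPolynomial.eval x.1 r := by
    rw [← map_mul]; exact congrArg _ hr
  have h : MvPolynomial.eval x.1 q ≠ 0 := left_ne_zero_of_mul (e ▸ x.2)
  rw [pow_one, e, inv_mul_cancel_left₀ h]

/-- After clearing denominators and multiplying by δ, the identity holds on all of affine space, and
polynomials over ℂ that vanish everywhere are zero. So the claim reduces to the polynomial ring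
being a domain. -/
theorem polyFun_eq_zero_or_eq_zero {f g : PrincipalOpen δ → ℂ} (hf : f ∈ polyFun δ)
    (hg : g ∈ polyFun δ) (h : f * g = 0) : f = 0 ∨ g = 0 := by
  obtain ⟨k, q, hq⟩ := hf
  obtain ⟨l, r, hr⟩ := hg
  have hz : q * r * δ = 0 := by
    refine MvPolynomial.funext fun x => ?_
    rw [map_mul, map_mul, map_zero]
    by_cases hx : MvPolynomial.eval x δ = 0
    · rw [hx, mul_zero]
    · have h1 := congrFun h ⟨x, hx⟩
      simp only [Pi.mul_apply, Pi.zero_apply] at h1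
      rw [← hq ⟨x, hx⟩, ← hr ⟨x, hx⟩]
      linear_combination MvPolynomial.eval x δ ^ k * MvPolynomial.eval x δ ^ l *
        MvPolynomial.eval x δ * h1
  have hcancel : ∀ (f : PrincipalOpen δ → ℂ) k q,
      (∀ x, f x * MvPolynomial.eval x.1 δ ^ k = MvPolynomial.eval x.1 q) → q = 0 → f = 0 := by
    rintro f k q hq rfl
    ext x
    have := hq x
    rw [map_zero] at this
    exact (mul_eq_zero.1 this).resolve_right (pow_ne_zero _ x.2)
  rcases mul_eq_zero.1 hz with hz | hz
  · rcases mul_eq_zero.1 hz with hz | hz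
    · exact Or.inl (hcancel f k q hq hz)
    · exact Or.inr (hcancel g l r hr hz)
  · left
    ext x
    exact absurd ((congrArg _ hz).trans (map_zero (MvPolynomial.eval x.1))) x.2

/-- This is irreducibility of the parameter space, in the form in which generic conditions are
combined later. -/
theorem polyFun_exists_ne_zero {f g : PrincipalOpen δ → ℂ} (hf : f ∈ polyFun δ)
    (hg : g ∈ polyFun δ) {x y : PrincipalOpen δ} (hx : f x ≠ 0) (hy : g y ≠ 0) :
    ∃ z, f z ≠ 0 ∧ g z ≠ 0 := by
  by_contra! h
  rcases polyFun_eq_zero_or_eq_zero hf hg (by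
    ext z
    by_cases hz : f z = 0
    · simp [hz]
    · simp [h z hz]) with h0 | h0
  · exact hx (congrFun h0 x)
  · exact hy (congrFun h0 y)

instance : NoZeroDivisors (polyFun δ) where
  eq_zero_or_eq_zero_of_mul_eq_zero := by
    rintro ⟨f, hf⟩ ⟨g, hg⟩ h
    rcases polyFun_eq_zero_or_eq_zero hf hg (congrArg Subtype.val h) with h | h
    · exact Or.inl (Subtype.ext h)
    · exact Or.inr (Subtype.ext h)

instance [Fact (δ ≠ 0)] : Nontrivial (polyFun δ) := by
  refine ⟨0, 1, fun h => ?_⟩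
  have hne : δ ≠ 0 := Fact.out
  refine hne (MvPolynomial.funext fun x => ?_)
  rw [map_zero]
  by_contra hx
  exact zero_ne_one (congrFun (congrArg Subtype.val h) ⟨x, hx⟩)

instance [Fact (δ ≠ 0)] : IsDomain (polyFun δ) :=
  (isDomain_iff_noZeroDivisors_and_nontrivial _).2 ⟨inferInstance, inferInstance⟩

/-- The coordinate functions. -/
def coordFun (δ : MvPolynomial σ ℂ) (i : σ) : polyFun δ := ⟨_, coord_mem_polyFun i⟩

theorem aeval_coordFun (q : MvPolynomial σ ℂ) :
    MvPolynomial.aeval (coordFun δ) q = ⟨_, eval_mem_polyFun q⟩ := by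
  apply Subtype.ext
  ext x
  induction q using MvPolynomial.induction_on with
  | C c => simp
  | add p q hp hq =>
    rw [map_add]
    exact (congrArg₂ (· + ·) hp hq).trans (map_add (MvPolynomial.eval x.1) p q).symm
  | mul_X p i hp =>
    rw [map_mul, MvPolynomial.aeval_X]
    refine (congrArg (· * x.1 i) hp).trans ?_
    simp

theorem algebraicIndependent_coordFun [Fact (δ ≠ 0)] :
    AlgebraicIndependent ℂ (coordFun δ) := by
  rw [algebraicIndependent_iff]
  intro q hq
  rw [aeval_coordFun] at hq
  have hne : δ ≠ 0 := Fact.out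
  have : q * δ = 0 := MvPolynomial.funext fun x => by
    rw [map_mul, map_zero]
    by_cases hx : MvPolynomial.eval x δ = 0
    · rw [hx, mul_zero]
    · have := congrFun (congrArg Subtype.val hq) ⟨x, hx⟩
      simp only at this
      rw [this]
      simp
  exact (mul_eq_zero.1 this).resolve_right hne

/-- The functions that are algebraic over a subalgebra. -/
def algebraicFunctions [Fact (δ ≠ 0)] (A : Subalgebra ℂ (polyFun δ)) :
    Subalgebra ℂ (PrincipalOpen δ → ℂ) :=
  ((Subalgebra.algebraicClosure A (polyFun δ)).restrictScalars ℂ).map (polyFun δ).val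

theorem mem_algebraicFunctions [Fact (δ ≠ 0)] {A : Subalgebra ℂ (polyFun δ)}
    {f : PrincipalOpen δ → ℂ} :
    f ∈ algebraicFunctions A ↔ ∃ hf : f ∈ polyFun δ, IsAlgebraic A (⟨f, hf⟩ : polyFun δ) := by
  constructor
  · rintro ⟨f, hf, rfl⟩; exact ⟨f.2, hf⟩
  · rintro ⟨hf, h⟩; exact ⟨⟨f, hf⟩, h, rfl⟩

theorem mem_algebraicFunctions_of_mul [Fact (δ ≠ 0)] {A : Subalgebra ℂ (polyFun δ)}
    {d f : PrincipalOpen δ → ℂ} (hf : f ∈ polyFun δ) (hd : d ∈ algebraicFunctions A)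
    (hd0 : d ≠ 0) (h : d * f ∈ algebraicFunctions A) : f ∈ algebraicFunctions A := by
  rw [mem_algebraicFunctions] at hd h ⊢
  obtain ⟨hd, hd'⟩ := hd
  obtain ⟨h, h'⟩ := h
  have hdne : (⟨d, hd⟩ : polyFun δ) ≠ 0 := fun h0 => hd0 (congrArg Subtype.val h0)
  exact ⟨hf, IsAlgebraic.of_mul (mem_nonZeroDivisors_of_ne_zero hdne) hd' h'⟩

theorem mem_algebraicFunctions_of_pow [Fact (δ ≠ 0)] {A : Subalgebra ℂ (polyFun δ)}
    {f : PrincipalOpen δ → ℂ} (hf : f ∈ polyFun δ) {k : ℕ} (hk : 0 < k)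
    (h : f ^ k ∈ algebraicFunctions A) : f ∈ algebraicFunctions A := by
  rw [mem_algebraicFunctions] at h ⊢
  obtain ⟨h, h'⟩ := h
  exact ⟨hf, IsAlgebraic.of_pow (r := (⟨f, hf⟩ : polyFun δ)) hk h'⟩

/-- Polynomials in algebraic coordinates are algebraic, in particular the powers of δ, and dividing
by those reaches every regular function. -/
theorem isAlgebraic_of_coord_mem [Fact (δ ≠ 0)] {A : Subalgebra ℂ (polyFun δ)}
    (h : ∀ i, (fun x : PrincipalOpen δ => x.1 i) ∈ algebraicFunctions A) :
    Algebra.IsAlgebraic A (polyFun δ) := by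
  have hpoly : ∀ q : MvPolynomial σ ℂ,
      (fun x : PrincipalOpen δ => MvPolynomial.eval x.1 q) ∈ algebraicFunctions A := by
    intro q
    induction q using MvPolynomial.induction_on with
    | C c =>
      simp only [MvPolynomial.eval_C]
      exact Subalgebra.algebraMap_mem (algebraicFunctions A) c
    | add p q hp hq => simp only [map_add]; exact add_mem hp hq
    | mul_X p i hp => simp only [map_mul, MvPolynomial.eval_X]; exact mul_mem hp (h i)
  refine ⟨fun f => ?_⟩
  obtain ⟨f, hf⟩ := f
  obtain ⟨k, q, hq⟩ := hf
  have hd0 : (fun x : PrincipalOpen δ => MvPolynomial.eval x.1 (δ ^ k)) ≠ 0 := by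
    intro h0
    obtain ⟨x, hx⟩ : ∃ x, MvPolynomial.eval x δ ≠ 0 := by
      by_contra! hall
      exact (Fact.out : δ ≠ 0) (MvPolynomial.funext fun x => by rw [hall, map_zero])
    have := congrFun h0 ⟨x, hx⟩
    simp only [map_pow, Pi.zero_apply] at this
    exact pow_ne_zero k hx this
  have : f ∈ algebraicFunctions A := by
    refine mem_algebraicFunctions_of_mul ⟨k, q, hq⟩ (hpoly (δ ^ k)) hd0 ?_
    convert hpoly q using 1
    ext x
    rw [← hq, Pi.mul_apply, map_pow, mul_comm]
  exact (mem_algebraicFunctions.1 this).2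

theorem trdeg_polyFun [Fintype σ] [Fact (δ ≠ 0)] :
    Algebra.trdeg ℂ (polyFun δ) = Fintype.card σ := by
  refine le_antisymm ?_ ?_
  · have : Algebra.IsAlgebraic (Algebra.adjoin ℂ (Set.range (coordFun δ))) (polyFun δ) :=
      isAlgebraic_of_coord_mem fun i => mem_algebraicFunctions.2 ⟨coord_mem_polyFun i,
        isAlgebraic_algebraMap (⟨coordFun δ i, Algebra.subset_adjoin ⟨i, rfl⟩⟩ :
          Algebra.adjoin ℂ (Set.range (coordFun δ)))⟩
    refine (Algebra.IsAlgebraic.trdeg_le_cardinalMk ℂ (Set.range (coordFun δ))).trans ?_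
    rw [← Cardinal.mk_fintype]
    exact Cardinal.mk_range_le
  · rw [← Cardinal.mk_fintype]
    exact (algebraicIndependent_coordFun (δ := δ)).cardinalMk_le_trdeg

/-- The ring of all regular functions is algebraic over A, so additivity of the transcendence degree
in towers leaves no difference between the two. -/
theorem trdeg_eq_of_coord_mem [Fintype σ] [Fact (δ ≠ 0)] {A : Subalgebra ℂ (polyFun δ)}
    (h : ∀ i, (fun x : PrincipalOpen δ => x.1 i) ∈ algebraicFunctions A) :
    Algebra.trdeg ℂ A = Fintype.card σ := by
  have := isAlgebraic_of_coord_mem h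
  have h2 := trdeg_add_eq (A := polyFun δ) ℂ A
  rw [trdeg_eq_zero (R := A) (A := polyFun δ), add_zero] at h2
  rw [h2, trdeg_polyFun]

end PolyFun

/-! ### Algebraic families of representations -/

section Families

variable {n : ℕ} {σ τ : Type} {δ : MvPolynomial σ ℂ} {ε : MvPolynomial τ ℂ}

/-- A family of representations whose matrix coefficients are regular functions on a principal
open subset of affine space. -/
def IsFamily (Φ : PrincipalOpen δ → Rep n) : Prop :=
  ∀ g i j, (fun x => (Φ x).mat g i j) ∈ polyFun δ

/-- The matrix functions with regular entries. -/
def polyMatrix (δ : MvPolynomial σ ℂ) (n : ℕ) : Submonoid (PrincipalOpen δ → Matrix (Fin n) (Fin n) ℂ) where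
  carrier := {M | ∀ i j, (fun x => M x i j) ∈ polyFun δ}
  one_mem' := fun i j => Subalgebra.algebraMap_mem (polyFun δ) ((1 : Matrix (Fin n) (Fin n) ℂ) i j)
  mul_mem' := by
    intro M N hM hN i j
    have : (fun x => (M * N) x i j) = ∑ k, (fun x => M x i k) * fun x => N x k j := by
      ext x
      simp [Matrix.mul_apply, Finset.sum_apply]
    rw [this]
    exact sum_mem fun k _ => mul_mem (hM i k) (hN k j)

theorem isFamily_of_bS_bT {Φ : PrincipalOpen δ → Rep n}
    (h1 : (fun x => (Φ x).mat bS) ∈ polyMatrix δ n) (h2 : (fun x => (Φ x).mat bS⁻¹) ∈ polyMatrix δ n)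
    (h3 : (fun x => (Φ x).mat bT) ∈ polyMatrix δ n)
    (h4 : (fun x => (Φ x).mat bT⁻¹) ∈ polyMatrix δ n) : IsFamily Φ := by
  let F : B3 →* (PrincipalOpen δ → Matrix (Fin n) (Fin n) ℂ) :=
    { toFun := fun g x => (Φ x).mat g
      map_one' := by ext1 x; simp
      map_mul' := fun g h => by ext1 x; exact Rep.mat_mul .. }
  exact fun g => hom_mem_of_bS_bT F (polyMatrix δ n) h1 h2 h3 h4 g

/-- Pullback of functions along a family. -/
def pullback (Φ : PrincipalOpen δ → Rep n) : (Rep n → ℂ) →ₐ[ℂ] (PrincipalOpen δ → ℂ) where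
  toFun f := fun x => f (Φ x)
  map_one' := rfl
  map_mul' _ _ := rfl
  map_zero' := rfl
  map_add' _ _ := rfl
  commutes' _ := rfl

theorem IsFamily.pullback_mem {Φ : PrincipalOpen δ → Rep n} (hΦ : IsFamily Φ) {f : Rep n → ℂ}
    (hf : f ∈ regularFunctions n) : pullback Φ f ∈ polyFun δ := by
  have : regularFunctions n ≤ (polyFun δ).comap (pullback Φ) := by
    refine Algebra.adjoin_le ?_
    rintro _ ⟨g, i, j, rfl⟩
    exact hΦ g i j
  exact this hf

/-- The family parametrizes all representations in `Z`, up to base change, and its semisimple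
members belong to `Z`. -/
structure Parametrizes (Φ : PrincipalOpen δ → Rep n) (Z : Set (Iss n)) : Prop where
  isFamily : IsFamily Φ
  exists_conj : ∀ V hV, Iss.mk V hV ∈ Z → ∃ x Q, V = (Φ x).conj Q
  mem : ∀ x hV, Iss.mk (Φ x) hV ∈ Z
  exists_simple : ∃ x, (Φ x).IsSimple

/-- Open subsets that meet Z pull back to nonzero regular functions on an irreducible parameter
space, which have a common non-zero. Members of the family need not be semisimple, so a third
function is added whose non-vanishing makes the member simple and thus a point of Z. -/
theorem Parametrizes.isIrreducible [NeZero n] {Φ : PrincipalOpen δ → Rep n} {Z : Set (Iss n)}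
    (h : Parametrizes Φ Z) : IsIrreducible Z := by
  obtain ⟨x₀, hx₀⟩ := h.exists_simple
  refine ⟨⟨_, h.mem x₀ hx₀.isSemisimple⟩, ?_⟩
  obtain ⟨D, hD, hD0, hD1⟩ := hx₀.exists_invariant
  have key : ∀ U : Set (Iss n), IsOpen U → (Z ∩ U).Nonempty → ∃ f ∈ invariants n,
      (∃ x, f (Φ x) ≠ 0) ∧ ∀ V hV, f V ≠ 0 → Iss.mk V hV ∈ U := by
    rintro U hU ⟨z, hz, hzU⟩
    obtain ⟨_, ⟨F, ⟨f, hf, hFf⟩, rfl⟩, hFz, hFU⟩ :=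
      isTopologicalBasis_issRing.exists_subset_of_mem_open hzU hU
    obtain ⟨V, hV, rfl⟩ := z.exists_rep
    obtain ⟨x, Q, hQ⟩ := h.exists_conj V hV hz
    refine ⟨f, hf, ⟨x, ?_⟩, fun W hW hW0 => hFU (by rw [Set.mem_ofPred_eq, hFf]; exact hW0)⟩
    rw [Set.mem_ofPred_eq, hFf, hQ, hf.2] at hFz
    exact hFz
  intro U W hU hW hZU hZW
  obtain ⟨f, hf, ⟨x, hx⟩, hfU⟩ := key U hU hZU
  obtain ⟨g, hg, ⟨y, hy⟩, hgW⟩ := key W hW hZW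
  obtain ⟨z, hz1, hz2⟩ := polyFun_exists_ne_zero (h.isFamily.pullback_mem hf.1)
    (h.isFamily.pullback_mem hg.1) (x := x) (y := y) hx hy
  obtain ⟨w, hw1, hw2⟩ := polyFun_exists_ne_zero (h.isFamily.pullback_mem (mul_mem hf.1 hg.1))
    (h.isFamily.pullback_mem hD.1) (x := z) (y := x₀) (mul_ne_zero hz1 hz2) hD0
  have hw : (Φ w).IsSimple := hD1 _ hw2
  exact ⟨_, h.mem w hw.isSemisimple, hfU _ _ (left_ne_zero_of_mul hw1),
    hgW _ _ (right_ne_zero_of_mul hw1)⟩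

/-- A family onto whose members the generic members of a parametrizing family can be conjugated. -/
structure IsSlice (Ψ : PrincipalOpen ε → Rep n) (Φ : PrincipalOpen δ → Rep n) (Z : Set (Iss n)) :
    Prop where
  isFamily : IsFamily Ψ
  mem : ∀ y hV, Iss.mk (Ψ y) hV ∈ Z
  generic : ∃ Δ ∈ polyFun δ, (∃ x, Δ x ≠ 0) ∧ ∀ x, Δ x ≠ 0 → ∃ y Q, Φ x = (Ψ y).conj Q

theorem IsSlice.exists_simple [NeZero n] {Φ : PrincipalOpen δ → Rep n}
    {Ψ : PrincipalOpen ε → Rep n} {Z : Set (Iss n)} (hΦ : Parametrizes Φ Z)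
    (hΨ : IsSlice Ψ Φ Z) : ∃ y, (Ψ y).IsSimple := by
  obtain ⟨x₀, hx₀⟩ := hΦ.exists_simple
  obtain ⟨D, hD, hD0, hD1⟩ := hx₀.exists_invariant
  obtain ⟨Δ, hΔ, ⟨x₁, hx₁⟩, hgen⟩ := hΨ.generic
  obtain ⟨x, h1, h2⟩ := polyFun_exists_ne_zero (hΦ.isFamily.pullback_mem hD.1) hΔ
    (x := x₀) (y := x₁) hD0 hx₁
  obtain ⟨y, Q, hQ⟩ := hgen x h2
  refine ⟨y, hD1 _ ?_⟩
  change D (Φ x) ≠ 0 at h1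
  rwa [hQ, hD.2] at h1

/-- The restrictions of invariant functions to a slice. -/
def sliceFunctions {Ψ : PrincipalOpen ε → Rep n} (hΨ : IsFamily Ψ) :
    invariants n →ₐ[ℂ] polyFun ε :=
  ((pullback Ψ).comp (invariants n).val).codRestrict (polyFun ε) fun f => hΨ.pullback_mem f.2.1

/-- Invariant functions as functions on the quotient variety. -/
def issFunHom (n : ℕ) : invariants n →ₐ[ℂ] (Iss n → ℂ) where
  toFun f := issFun f.1 f.2
  map_one' := funext fun z => by obtain ⟨V, hV, rfl⟩ := z.exists_rep; rfl
  map_mul' f g := funext fun z => by obtain ⟨V, hV, rfl⟩ := z.exists_rep; rfl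
  map_zero' := funext fun z => by obtain ⟨V, hV, rfl⟩ := z.exists_rep; rfl
  map_add' f g := funext fun z => by obtain ⟨V, hV, rfl⟩ := z.exists_rep; rfl
  commutes' c := funext fun z => by obtain ⟨V, hV, rfl⟩ := z.exists_rep; rfl

/-- The restrictions of invariant functions to a subset of the quotient variety. -/
def toCoordinateRing (Z : Set (Iss n)) : invariants n →ₐ[ℂ] coordinateRing Z :=
  ((restrictHom Z).comp (issFunHom n)).codRestrict (coordinateRing Z) fun f =>
    ⟨_, issFun_mem f.2, rfl⟩

theorem toCoordinateRing_surjective (Z : Set (Iss n)) :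
    Function.Surjective (toCoordinateRing Z) := by
  rintro ⟨_, F, ⟨f, hf, hFf⟩, rfl⟩
  refine ⟨⟨f, hf⟩, Subtype.ext ?_⟩
  ext z
  obtain ⟨V, hV, h⟩ := z.1.exists_rep
  change issFun f hf z.1 = F z.1
  rw [h, hFf, issFun_mk]

/-- Invariant functions restrict to Z and to the slice with the same kernel. So the coordinate ring
of Z is isomorphic to the algebra of restrictions to the slice, and the transcendence degree can be
computed there. -/
theorem IsSlice.dimension_eq [NeZero n] [Fintype τ] [Fact (ε ≠ 0)] {Φ : PrincipalOpen δ → Rep n}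
    {Ψ : PrincipalOpen ε → Rep n} {Z : Set (Iss n)} (hΦ : Parametrizes Φ Z) (hΨ : IsSlice Ψ Φ Z)
    (h : ∀ i, (fun x : PrincipalOpen ε => x.1 i) ∈
      algebraicFunctions (sliceFunctions hΨ.isFamily).range) :
    dimension Z = Fintype.card τ := by
  have hker : RingHom.ker (toCoordinateRing Z) = RingHom.ker (sliceFunctions hΨ.isFamily) := by
    ext f
    obtain ⟨f, hf⟩ := f
    rw [RingHom.mem_ker, RingHom.mem_ker]
    constructor
    -- A function that vanishes on Z vanishes at the simple members of the slice, since these are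
    -- points of Z. Simple members are generic, so it vanishes on the slice.
    · intro h0
      obtain ⟨y₀, hy₀⟩ := hΨ.exists_simple hΦ
      obtain ⟨D, hD, hD0, hD1⟩ := hy₀.exists_invariant
      by_contra hne
      obtain ⟨y, hy⟩ : ∃ y, f (Ψ y) ≠ 0 := by
        by_contra! hall
        exact hne (Subtype.ext (funext hall))
      obtain ⟨z, hz1, hz2⟩ := polyFun_exists_ne_zero (hΨ.isFamily.pullback_mem hf.1)
        (hΨ.isFamily.pullback_mem hD.1) (x := y) (y := y₀) hy hD0
      have hz : (Ψ z).IsSimple := hD1 _ hz2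
      exact hz1 (congrFun (congrArg Subtype.val h0) ⟨_, hΨ.mem z hz.isSemisimple⟩)
    -- Conversely, the generic member of the large family is conjugate to a member of the slice, so
    -- a function vanishing on the slice vanishes on the family, and hence on Z.
    · intro h0
      have h0' : ∀ y, f (Ψ y) = 0 := fun y => congrFun (congrArg Subtype.val h0) y
      obtain ⟨Δ, hΔ, ⟨x₁, hx₁⟩, hgen⟩ := hΨ.generic
      have hf0 : ∀ x, f (Φ x) = 0 := by
        by_contra! hne
        obtain ⟨x, hx⟩ := hne
        obtain ⟨z, hz1, hz2⟩ := polyFun_exists_ne_zero (hΦ.isFamily.pullback_mem hf.1) hΔ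
          (x := x) (y := x₁) hx hx₁
        obtain ⟨y, Q, hQ⟩ := hgen z hz2
        change f (Φ z) ≠ 0 at hz1
        rw [hQ, hf.2] at hz1
        exact hz1 (h0' y)
      refine Subtype.ext (funext fun z => ?_)
      obtain ⟨z, hz⟩ := z
      obtain ⟨V, hV, rfl⟩ := z.exists_rep
      obtain ⟨x, Q, hQ⟩ := hΦ.exists_conj V hV hz
      change f V = 0
      rw [hQ, hf.2, hf0]
  have e1 := Ideal.quotientKerAlgEquivOfSurjective (toCoordinateRing_surjective Z)
  have e2 := Ideal.quotientKerAlgEquivOfSurjective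
    (sliceFunctions hΨ.isFamily).rangeRestrict_surjective
  have hker' : RingHom.ker (sliceFunctions hΨ.isFamily).rangeRestrict =
      RingHom.ker (toCoordinateRing Z) := by
    rw [hker]
    ext f
    simp only [RingHom.mem_ker]
    exact Subtype.ext_iff
  have e3 := Ideal.quotientEquivAlgOfEq ℂ hker'
  have e := (e1.symm.trans e3.symm).trans e2
  rw [dimension, AlgEquiv.trdeg_eq (A := coordinateRing Z)
    (A' := (sliceFunctions hΨ.isFamily).range) e, trdeg_eq_of_coord_mem h]

end Families

end BraidReversal

namespace BraidReversal

open Module Matrix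

/-! ### Families with given S and T, up to a twist -/

section Families

variable {n : ℕ} {σ : Type} {δ : MvPolynomial σ ℂ}

theorem const_mem_polyMatrix (M : Matrix (Fin n) (Fin n) ℂ) : (fun _ => M) ∈ polyMatrix δ n :=
  fun i j => Subalgebra.algebraMap_mem (polyFun δ) (M i j)

theorem smul_mem_polyMatrix {c : PrincipalOpen δ → ℂ} (hc : c ∈ polyFun δ)
    {M : PrincipalOpen δ → Matrix (Fin n) (Fin n) ℂ} (hM : M ∈ polyMatrix δ n) :
    (fun x => c x • M x) ∈ polyMatrix δ n :=
  fun i j => mul_mem hc (hM i j)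

/-- The family of representations with `S = σ₁σ₂σ₁` and `T = σ₁σ₂` acting by given matrices, up to
a twist. -/
def familyOfST {S T : PrincipalOpen δ → Matrix (Fin n) (Fin n) ℂ} (hS : ∀ x, S x * S x = 1)
    (hT : ∀ x, T x ^ 3 = 1) (t : PrincipalOpen δ → ℂˣ) (x : PrincipalOpen δ) : Rep n :=
  (Rep.ofST (S x) (T x) (hS x) (hT x)).scale (t x)

section

variable {S T : PrincipalOpen δ → Matrix (Fin n) (Fin n) ℂ} (hS : ∀ x, S x * S x = 1)
    (hT : ∀ x, T x ^ 3 = 1) (t : PrincipalOpen δ → ℂˣ)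

theorem familyOfST_bS (x : PrincipalOpen δ) :
    (familyOfST hS hT t x).mat bS = (t x : ℂ) ^ 3 • S x := by
  rw [familyOfST, Rep.mat_scale_bS, Rep.ofST_bS]

theorem familyOfST_bT (x : PrincipalOpen δ) :
    (familyOfST hS hT t x).mat bT = (t x : ℂ) ^ 2 • T x := by
  rw [familyOfST, Rep.mat_scale_bT, Rep.ofST_bT]

theorem isFamily_familyOfST (hS' : S ∈ polyMatrix δ n) (hT' : T ∈ polyMatrix δ n)
    (ht : (fun x => (t x : ℂ)) ∈ polyFun δ) (ht' : (fun x => (t x : ℂ)⁻¹) ∈ polyFun δ) :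
    IsFamily (familyOfST hS hT t) := by
  refine isFamily_of_bS_bT ?_ ?_ ?_ ?_
  · simp only [familyOfST_bS]
    exact smul_mem_polyMatrix (pow_mem ht 3) hS'
  · have : (fun x => (familyOfST hS hT t x).mat bS⁻¹) = fun x => (t x : ℂ)⁻¹ ^ 3 • S x := by
      ext1 x
      refine Rep.mat_inv_eq _ ?_
      rw [familyOfST_bS, smul_mul_smul_comm, hS, ← mul_pow, mul_inv_cancel₀ (t x).ne_zero, one_pow,
        one_smul]
    rw [this]
    exact smul_mem_polyMatrix (pow_mem ht' 3) hS'
  · simp only [familyOfST_bT]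
    exact smul_mem_polyMatrix (pow_mem ht 2) hT'
  · have : (fun x => (familyOfST hS hT t x).mat bT⁻¹) = fun x => (t x : ℂ)⁻¹ ^ 2 • T x ^ 2 := by
      ext1 x
      refine Rep.mat_inv_eq _ ?_
      rw [familyOfST_bT, smul_mul_smul_comm, ← pow_succ', hT, ← mul_pow,
        mul_inv_cancel₀ (t x).ne_zero, one_pow, one_smul]
    rw [this]
    exact smul_mem_polyMatrix (pow_mem ht' 2) (pow_mem hT' 2)

end

theorem Rep.IsSimple.conj [NeZero n] {V : Rep n} (h : V.IsSimple) (P : GL (Fin n) ℂ) :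
    (V.conj P).IsSimple := by
  obtain ⟨D, hD, hD0, hD1⟩ := h.exists_invariant
  exact hD1 _ (by rwa [hD.2])

/-! ### The family of all normal forms -/

/-- The polynomial whose non-vanishing defines pairs of an invertible matrix and a unit. -/
def glPoly (n : ℕ) : MvPolynomial (Option (Fin n × Fin n)) ℂ :=
  MvPolynomial.rename some (Matrix.det (Matrix.mvPolynomialX (Fin n) (Fin n) ℂ)) *
    MvPolynomial.X none

/-- The generic matrix. -/
def glMat (x : PrincipalOpen (glPoly n)) : Matrix (Fin n) (Fin n) ℂ :=
  Matrix.of fun i j => x.1 (some (i, j))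

theorem eval_det (x : Option (Fin n × Fin n) → ℂ) :
    MvPolynomial.eval x (MvPolynomial.rename some
      (Matrix.det (Matrix.mvPolynomialX (Fin n) (Fin n) ℂ))) =
      (Matrix.of fun i j => x (some (i, j))).det := by
  rw [MvPolynomial.eval_rename, RingHom.map_det]
  congr 1
  ext i j
  simp

theorem eval_glPoly (x : Option (Fin n × Fin n) → ℂ) :
    MvPolynomial.eval x (glPoly n) = (Matrix.of fun i j => x (some (i, j))).det * x none := by
  rw [glPoly, map_mul, MvPolynomial.eval_X, eval_det]

theorem glMat_det_ne_zero (x : PrincipalOpen (glPoly n)) : (glMat x).det ≠ 0 :=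
  left_ne_zero_of_mul (eval_glPoly x.1 ▸ x.2)

theorem glUnit_ne_zero (x : PrincipalOpen (glPoly n)) : x.1 none ≠ 0 :=
  right_ne_zero_of_mul (eval_glPoly x.1 ▸ x.2)

/-- The generic invertible matrix. -/
def glGL (x : PrincipalOpen (glPoly n)) : GL (Fin n) ℂ :=
  Matrix.GeneralLinearGroup.mkOfDetNeZero (glMat x) (glMat_det_ne_zero x)

theorem exists_glGL (P : GL (Fin n) ℂ) (t : ℂˣ) :
    ∃ x : PrincipalOpen (glPoly n), glGL x = P ∧ Units.mk0 _ (glUnit_ne_zero x) = t := by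
  let x : Option (Fin n × Fin n) → ℂ := fun o => o.elim t fun ij => P.val ij.1 ij.2
  have hx : MvPolynomial.eval x (glPoly n) ≠ 0 := by
    rw [eval_glPoly]
    refine mul_ne_zero ?_ t.ne_zero
    exact ((Matrix.isUnit_iff_isUnit_det _).1 P.isUnit).ne_zero
  exact ⟨⟨x, hx⟩, Units.ext (by ext i j; rfl), Units.ext rfl⟩

theorem glMat_mem : (fun x => glMat x) ∈ polyMatrix (glPoly n) n :=
  fun i j => coord_mem_polyFun (some (i, j))

/-- Cramer's rule: the inverse is the adjugate divided by the determinant, and the determinant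
divides the polynomial that defines the parameter space. -/
theorem glInv_mem : (fun x => ((glGL x)⁻¹).val) ∈ polyMatrix (glPoly n) n := by
  intro i j
  have h : ∀ x : PrincipalOpen (glPoly n), ((glGL x)⁻¹).val i j =
      (MvPolynomial.eval x.1 (MvPolynomial.rename some
        (Matrix.det (Matrix.mvPolynomialX (Fin n) (Fin n) ℂ))))⁻¹ *
      MvPolynomial.eval x.1 (MvPolynomial.rename some
        ((Matrix.mvPolynomialX (Fin n) (Fin n) ℂ).adjugate i j)) := by
    intro x
    have h1 : ((glGL x)⁻¹).val = (glMat x).det⁻¹ • (glMat x).adjugate := by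
      rw [Matrix.coe_units_inv, Matrix.inv_def, Ring.inverse_eq_inv']
      rfl
    have h2 : MvPolynomial.eval x.1 (MvPolynomial.rename some
        ((Matrix.mvPolynomialX (Fin n) (Fin n) ℂ).adjugate i j)) = (glMat x).adjugate i j := by
      rw [MvPolynomial.eval_rename]
      have h3 := RingHom.map_adjugate (MvPolynomial.eval (x.1 ∘ some))
        (Matrix.mvPolynomialX (Fin n) (Fin n) ℂ)
      have h4 := congrFun (congrFun h3 i) j
      rw [RingHom.mapMatrix_apply, Matrix.map_apply] at h4
      have h5 : (Matrix.mvPolynomialX (Fin n) (Fin n) ℂ).map (MvPolynomial.eval (x.1 ∘ some)) =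
          glMat x := by
        ext i j
        simp [glMat]
      rw [h4, RingHom.mapMatrix_apply, h5]
    rw [h1, h2, eval_det]
    rfl
  simp only [h]
  exact mul_mem (inv_mem_polyFun (Dvd.intro _ rfl)) (eval_mem_polyFun _)

/-- The family of all normal forms of a given type. -/
def normalFamily {νS νT : Fin n → ℂ} (hS : ∀ i, νS i ^ 2 = 1) (hT : ∀ i, νT i ^ 3 = 1)
    (x : PrincipalOpen (glPoly n)) : Rep n :=
  normalRep hS hT (glGL x) (Units.mk0 _ (glUnit_ne_zero x))

/-- The matrix of `S` in the family of normal forms. -/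
def normalS (νS : Fin n → ℂ) (x : PrincipalOpen (glPoly n)) : Matrix (Fin n) (Fin n) ℂ :=
  (glGL x).val * diagonal νS * ((glGL x)⁻¹).val

theorem normalS_mem (νS : Fin n → ℂ) : normalS νS ∈ polyMatrix (glPoly n) n :=
  mul_mem (mul_mem glMat_mem (const_mem_polyMatrix _)) glInv_mem

theorem parametrizes_normalFamily [NeZero n] {ρ : ℂ} (hρ : IsPrimitiveRoot ρ 3) {νS νT : Fin n → ℂ}
    {a b x y z : ℕ} (D : HasDimVector ρ νS νT a b x y z)
    (hs : ∃ (V : Rep n) (t : ℂˣ), V.IsSimple ∧ V.HasType νS νT t) :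
    Parametrizes (normalFamily D.sq D.cube) (issBeta ρ n a b x y z) where
  isFamily := by
    refine isFamily_familyOfST (S := normalS νS) (T := fun _ => diagonal νT)
      (fun x => conj_diagonal_sq D.sq (glGL x)) (fun _ => diagonal_cube D.cube)
      (fun x => Units.mk0 _ (glUnit_ne_zero x)) (normalS_mem νS) (const_mem_polyMatrix _)
      (coord_mem_polyFun none) ?_
    have := inv_mem_polyFun (δ := glPoly n) (q := MvPolynomial.X none) (Dvd.intro_left _ rfl)
    simpa using this
  exists_conj := by
    intro V hV hmem
    obtain ⟨t, ht⟩ := (mk_mem_issBeta_iff hρ D V hV).1 hmem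
    obtain ⟨P, Q, hPQ⟩ := ht.exists_normalRep hρ D
    obtain ⟨x, hx1, hx2⟩ := exists_glGL P t
    refine ⟨x, Q, ?_⟩
    rw [normalFamily, hx1, hx2, hPQ]
  mem := fun x hV => (mk_mem_issBeta_iff hρ D _ hV).2 ⟨_, normalRep_hasType _ _ _ _⟩
  exists_simple := by
    obtain ⟨V, t, hV, ht⟩ := hs
    obtain ⟨P, Q, hPQ⟩ := ht.exists_normalRep hρ D
    obtain ⟨x, hx1, hx2⟩ := exists_glGL P t
    refine ⟨x, ?_⟩
    rw [normalFamily, hx1, hx2]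
    have := hV.conj Q⁻¹
    rwa [hPQ, Rep.conj_conj, inv_mul_cancel, Rep.conj_one] at this

end Families

end BraidReversal

namespace BraidReversal

open Module Matrix

/-! ### Corners of matrix algebras -/

section Corner

variable {n m : Type} [Fintype n] [DecidableEq n] [Fintype m] [DecidableEq m]
  {R : Type} [CommRing R] [Algebra ℂ R]

/-- The diagonal idempotent of a set of coordinates. -/
def cornerOne (R : Type) [CommRing R] (c : m → n) : Matrix n n R :=
  (1 : Matrix n n R).submatrix id c * (1 : Matrix n n R).submatrix c id

/-- A matrix placed in the corner given by a set of coordinates. -/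
def cornerEmb (c : m → n) (A : Matrix m m R) : Matrix n n R :=
  (1 : Matrix n n R).submatrix id c * A * (1 : Matrix n n R).submatrix c id

omit [Fintype m] [Algebra ℂ R] in
theorem corner_inv {c : m → n} (hc : Function.Injective c) :
    (1 : Matrix n n R).submatrix c id * (1 : Matrix n n R).submatrix id c = 1 := by
  rw [← submatrix_mul _ _ c id c Function.bijective_id, one_mul, submatrix_one _ hc]

omit [Fintype n] [Algebra ℂ R] in
theorem cornerEmb_one (c : m → n) : cornerEmb c (1 : Matrix m m R) = cornerOne R c := by
  rw [cornerEmb, cornerOne, Matrix.mul_one]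

omit [Algebra ℂ R] in
theorem cornerEmb_mul {c : m → n} (hc : Function.Injective c) (A B : Matrix m m R) :
    cornerEmb c (A * B) = cornerEmb c A * cornerEmb c B := by
  simp only [cornerEmb]
  calc _ = (1 : Matrix n n R).submatrix id c * A *
        ((1 : Matrix n n R).submatrix c id * (1 : Matrix n n R).submatrix id c) * B *
        (1 : Matrix n n R).submatrix c id := by
        rw [corner_inv hc]; simp only [Matrix.mul_one, Matrix.mul_assoc]
    _ = _ := by simp only [Matrix.mul_assoc]

omit [Algebra ℂ R] in
theorem trace_cornerEmb {c : m → n} (hc : Function.Injective c) (A : Matrix m m R) :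
    (cornerEmb c A).trace = A.trace := by
  rw [cornerEmb, trace_mul_comm, ← Matrix.mul_assoc, corner_inv hc, Matrix.one_mul]

omit [Algebra ℂ R] in
theorem submatrix_eq_mul {k l : Type} [Fintype k] [Fintype l] (c : k → n) (d : l → n)
    (A : Matrix n n R) : A.submatrix c d = (1 : Matrix n n R).submatrix c id * A *
      (1 : Matrix n n R).submatrix id d := by
  rw [← submatrix_id_id A, ← submatrix_mul _ _ c id id Function.bijective_id, one_mul,
    ← submatrix_mul _ _ c id d Function.bijective_id, mul_one]
  simp

omit [DecidableEq m] in
omit [Algebra ℂ R] in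
theorem cornerEmb_submatrix_mul {l : Type} [Fintype l] [DecidableEq l] (c : m → n) (d : l → n)
    (A B : Matrix n n R) : cornerEmb c (A.submatrix c d * B.submatrix d c) =
      cornerOne R c * A * cornerOne R d * B * cornerOne R c := by
  rw [cornerEmb, submatrix_eq_mul c d A, submatrix_eq_mul d c B]
  simp only [cornerOne, Matrix.mul_assoc]

omit [DecidableEq m] in
omit [Algebra ℂ R] in
theorem cornerEmb_submatrix (c : m → n) (A : Matrix n n R) :
    cornerEmb c (A.submatrix c c) = cornerOne R c * A * cornerOne R c := by
  rw [cornerEmb, submatrix_eq_mul c c A]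
  simp only [cornerOne, Matrix.mul_assoc]

variable {F : Subalgebra ℂ R}

/-- The corner of a matrix algebra. -/
def cornerAlgebra (𝔄 : Subalgebra F (Matrix n n R)) {c : m → n} (hc : Function.Injective c)
    (h1 : cornerOne R c ∈ 𝔄) : Subalgebra F (Matrix m m R) where
  carrier := {A | cornerEmb c A ∈ 𝔄}
  mul_mem' := fun {A B} hA hB => by
    rw [Set.mem_ofPred_eq, cornerEmb_mul hc]; exact mul_mem hA hB
  add_mem' := fun {A B} hA hB => by
    have : cornerEmb c (A + B) = cornerEmb c A + cornerEmb c B := by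
      simp only [cornerEmb, Matrix.mul_add, Matrix.add_mul]
    rw [Set.mem_ofPred_eq, this]; exact add_mem hA hB
  algebraMap_mem' := fun r => by
    have : cornerEmb c (algebraMap F (Matrix m m R) r) = r • cornerOne R c := by
      rw [Algebra.algebraMap_eq_smul_one, ← cornerEmb_one]
      simp only [cornerEmb, Matrix.mul_smul, Matrix.smul_mul]
    rw [Set.mem_ofPred_eq, this]
    exact Subalgebra.smul_mem _ h1 r

/-- Placing a block in its corner does not change its trace. This is how traces of words in small
blocks become available from those of the large matrices. -/
theorem trace_mem_of_mem_cornerAlgebra {𝔄 : Subalgebra F (Matrix n n R)}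
    (h : ∀ A ∈ 𝔄, A.trace ∈ F) {c : m → n} (hc : Function.Injective c)
    (h1 : cornerOne R c ∈ 𝔄) {A : Matrix m m R} (hA : A ∈ cornerAlgebra 𝔄 hc h1) :
    A.trace ∈ F := by
  rw [← trace_cornerEmb hc A]; exact h _ hA

theorem submatrix_mem_cornerAlgebra {𝔄 : Subalgebra F (Matrix n n R)} {c : m → n}
    (hc : Function.Injective c) (h1 : cornerOne R c ∈ 𝔄) {A : Matrix n n R} (hA : A ∈ 𝔄) :
    A.submatrix c c ∈ cornerAlgebra 𝔄 hc h1 := by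
  change cornerEmb c _ ∈ 𝔄
  rw [cornerEmb_submatrix]
  exact mul_mem (mul_mem h1 hA) h1

theorem submatrix_mul_mem_cornerAlgebra {l : Type} [Fintype l] [DecidableEq l]
    {𝔄 : Subalgebra F (Matrix n n R)} {c : m → n}
    (hc : Function.Injective c) (h1 : cornerOne R c ∈ 𝔄) {d : l → n} (h2 : cornerOne R d ∈ 𝔄)
    {A B : Matrix n n R} (hA : A ∈ 𝔄) (hB : B ∈ 𝔄) :
    A.submatrix c d * B.submatrix d c ∈ cornerAlgebra 𝔄 hc h1 := by
  change cornerEmb c _ ∈ 𝔄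
  rw [cornerEmb_submatrix_mul]
  exact mul_mem (mul_mem (mul_mem (mul_mem h1 hA) h2) hB) h1

/-- A closed path of blocks from c to d, around d and back to c is a product in the large algebra
with diagonal idempotents inserted. -/
theorem submatrix_mul_mul_mem_cornerAlgebra {l : Type} [Fintype l] [DecidableEq l]
    {𝔄 : Subalgebra F (Matrix n n R)} {c : m → n}
    (hc : Function.Injective c) (h1 : cornerOne R c ∈ 𝔄) {d : l → n} (h2 : cornerOne R d ∈ 𝔄)
    {A B C : Matrix n n R} (hA : A ∈ 𝔄) (hB : B ∈ 𝔄) (hC : C ∈ 𝔄) :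
    A.submatrix c d * B.submatrix d d * C.submatrix d c ∈ cornerAlgebra 𝔄 hc h1 := by
  have : A.submatrix c d * B.submatrix d d = (A * cornerOne R d * B).submatrix c d := by
    rw [submatrix_eq_mul c d A, submatrix_eq_mul d d B, submatrix_eq_mul c d (A * _ * _)]
    simp only [cornerOne, Matrix.mul_assoc]
  rw [this]
  exact submatrix_mul_mem_cornerAlgebra hc h1 h2 (mul_mem (mul_mem hA h2) hB) hC

end Corner

/-! ### Traces on a slice -/

section SliceTraces

variable {n : ℕ} {σ : Type} {δ : MvPolynomial σ ℂ} [Fact (δ ≠ 0)]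

/-- A matrix-valued function as a matrix of functions. -/
def liftMat {U : Type} (M : U → Matrix (Fin n) (Fin n) ℂ) : Matrix (Fin n) (Fin n) (U → ℂ) :=
  Matrix.of fun i j x => M x i j

theorem liftMat_mul {U : Type} (M N : U → Matrix (Fin n) (Fin n) ℂ) :
    liftMat (M * N) = liftMat M * liftMat N := by
  ext i j x
  simp [liftMat, Matrix.mul_apply, Finset.sum_apply]

theorem liftMat_one {U : Type} : liftMat (1 : U → Matrix (Fin n) (Fin n) ℂ) = 1 := by
  ext i j x
  by_cases h : i = j <;> simp [liftMat, Matrix.one_apply, h]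

theorem liftMat_trace {U : Type} (M : U → Matrix (Fin n) (Fin n) ℂ) :
    (liftMat M).trace = fun x => (M x).trace := by
  ext x
  simp [liftMat, Matrix.trace, Finset.sum_apply]

variable {S T : PrincipalOpen δ → Matrix (Fin n) (Fin n) ℂ} (hS : ∀ x, S x * S x = 1)
    (hT : ∀ x, T x ^ 3 = 1) (t : PrincipalOpen δ → ℂˣ) (hΨ : IsFamily (familyOfST hS hT t))

theorem trace_mem_algebraicFunctions (g : B3) :
    (fun x => ((familyOfST hS hT t x).mat g).trace) ∈
      algebraicFunctions (sliceFunctions hΨ).range := by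
  rw [mem_algebraicFunctions]
  refine ⟨hΨ.pullback_mem (trace_mem_invariants g).1, ?_⟩
  exact isAlgebraic_algebraMap (⟨_, ⟨⟨_, trace_mem_invariants g⟩, rfl⟩⟩ : (sliceFunctions hΨ).range)

theorem exists_principalOpen : Nonempty (PrincipalOpen δ) := by
  by_contra h
  refine (Fact.out : δ ≠ 0) (MvPolynomial.funext fun x => ?_)
  rw [map_zero]
  by_contra hx
  exact h ⟨⟨x, hx⟩⟩

/-- The trace of the central braid Δ² is n t⁶, so t is a sixth root of an invariant function. -/
theorem unit_mem_algebraicFunctions [NeZero n] (ht : (fun x => (t x : ℂ)) ∈ polyFun δ) :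
    (fun x => (t x : ℂ)) ∈ algebraicFunctions (sliceFunctions hΨ).range := by
  refine mem_algebraicFunctions_of_pow ht (k := 6) (by norm_num) ?_
  have h := Subalgebra.smul_mem _ (trace_mem_algebraicFunctions hS hT t hΨ (bS * bS)) ((n : ℂ)⁻¹)
  convert h using 1
  ext x
  have hn : (n : ℂ) ≠ 0 := Nat.cast_ne_zero.2 (NeZero.ne n)
  rw [Pi.pow_apply, Pi.smul_apply, Rep.mat_mul, familyOfST_bS, smul_mul_smul_comm, hS,
    trace_smul, trace_one, smul_eq_mul, smul_eq_mul, Fintype.card_fin]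
  field_simp

theorem unit_inv_mem_algebraicFunctions [NeZero n] (ht : (fun x => (t x : ℂ)) ∈ polyFun δ)
    (ht' : (fun x => (t x : ℂ)⁻¹) ∈ polyFun δ) :
    (fun x => (t x : ℂ)⁻¹) ∈ algebraicFunctions (sliceFunctions hΨ).range := by
  refine mem_algebraicFunctions_of_mul ht' (unit_mem_algebraicFunctions hS hT t hΨ ht) ?_ ?_
  · intro h0
    obtain ⟨x⟩ := exists_principalOpen (δ := δ)
    exact (t x).ne_zero (congrFun h0 x)
  · convert one_mem (algebraicFunctions (sliceFunctions hΨ).range) using 1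
    ext x
    simp

/-- The matrix algebra generated by `S` and `T` over the algebraic functions. -/
def wordAlgebra : Subalgebra (algebraicFunctions (sliceFunctions hΨ).range)
    (Matrix (Fin n) (Fin n) (PrincipalOpen δ → ℂ)) :=
  Algebra.adjoin _ {liftMat S, liftMat T}

/-- A word in S and T is the matrix of a braid times a power of t⁻¹. Its trace is thus an invariant
function times an algebraic one, and words span the algebra. -/
theorem trace_mem_of_mem_wordAlgebra [NeZero n] (ht : (fun x => (t x : ℂ)) ∈ polyFun δ)
    (ht' : (fun x => (t x : ℂ)⁻¹) ∈ polyFun δ)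
    {A : Matrix (Fin n) (Fin n) (PrincipalOpen δ → ℂ)} (hA : A ∈ wordAlgebra hS hT t hΨ) :
    A.trace ∈ algebraicFunctions (sliceFunctions hΨ).range := by
  rw [wordAlgebra, ← Subalgebra.mem_toSubmodule, Algebra.adjoin_eq_span] at hA
  induction hA using Submodule.span_induction with
  | mem A hA =>
    have key : ∃ (g : B3) (k : ℕ), A = liftMat fun x => (t x : ℂ)⁻¹ ^ k •
        (familyOfST hS hT t x).mat g := by
      induction hA using Submonoid.closure_induction with
      | mem A hA =>
        rcases hA with rfl | rfl
        · refine ⟨bS, 3, congrArg liftMat (funext fun x => ?_)⟩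
          rw [familyOfST_bS, smul_smul, ← mul_pow, inv_mul_cancel₀ (t x).ne_zero, one_pow, one_smul]
        · refine ⟨bT, 2, congrArg liftMat (funext fun x => ?_)⟩
          rw [familyOfST_bT, smul_smul, ← mul_pow, inv_mul_cancel₀ (t x).ne_zero, one_pow, one_smul]
      | one => exact ⟨1, 0, by rw [← liftMat_one]; congr 1; ext1 x; simp⟩
      | mul A B _ _ hA hB =>
        obtain ⟨g, k, rfl⟩ := hA
        obtain ⟨h, l, rfl⟩ := hB
        refine ⟨g * h, k + l, ?_⟩
        rw [← liftMat_mul]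
        congr 1
        ext1 x
        rw [Pi.mul_apply, smul_mul_smul_comm, ← Rep.mat_mul, pow_add]
    obtain ⟨g, k, rfl⟩ := key
    rw [liftMat_trace]
    simp only [trace_smul, smul_eq_mul]
    exact mul_mem (pow_mem (unit_inv_mem_algebraicFunctions hS hT t hΨ ht ht') k)
      (trace_mem_algebraicFunctions hS hT t hΨ g)
  | zero => rw [trace_zero]; exact zero_mem _
  | add A B _ _ hA hB => rw [trace_add]; exact add_mem hA hB
  | smul c A _ hA => rw [trace_smul]; exact mul_mem c.2 hA

end SliceTraces

end BraidReversal

namespace BraidReversal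

open Module Matrix

/-! ### Block matrices -/

section Block

variable {m o n : Type} [Fintype m] [DecidableEq m] [Fintype o] [DecidableEq o] [Fintype n]
  [DecidableEq n] {R : Type} [CommRing R] (e : m × o ≃ n)

/-- The blocks of a matrix. -/
def block (A : Matrix n n R) (k l : o) : Matrix m m R :=
  A.submatrix (fun a => e (a, k)) (fun b => e (b, l))

omit [DecidableEq m] [DecidableEq o] [DecidableEq n] in
theorem block_mul (A B : Matrix n n R) (k l : o) :
    block e (A * B) k l = ∑ j, block e A k j * block e B j l := by
  ext a b
  simp only [block, submatrix_apply, mul_apply, Matrix.sum_apply]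
  rw [← e.sum_comp, Fintype.sum_prod_type, Finset.sum_comm]

omit [Fintype m] [DecidableEq m] [Fintype o] [DecidableEq o] [Fintype n] [DecidableEq n] [CommRing R] in
theorem block_ext {A B : Matrix n n R} (h : ∀ k l, block e A k l = block e B k l) : A = B := by
  ext i j
  obtain ⟨⟨a, k⟩, rfl⟩ := e.surjective i
  obtain ⟨⟨b, l⟩, rfl⟩ := e.surjective j
  exact congrFun (congrFun (h k l) a) b

/-- The block diagonal matrix with given diagonal blocks. -/
def blockDiag' (D : o → Matrix m m R) : Matrix n n R :=
  Matrix.reindex e e (Matrix.blockDiagonal D)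

omit [Fintype m] [DecidableEq m] [Fintype o] [Fintype n] [DecidableEq n] in
theorem block_blockDiag' (D : o → Matrix m m R) (k l : o) :
    block e (blockDiag' e D) k l = if k = l then D k else 0 := by
  ext a b
  simp only [block, blockDiag', submatrix_apply, reindex_apply, Equiv.symm_apply_apply,
    blockDiagonal_apply]
  split_ifs <;> rfl

theorem det_blockDiag' (D : o → Matrix m m R) : (blockDiag' e D).det = ∏ k, (D k).det := by
  rw [blockDiag', det_reindex_self, det_blockDiagonal]

omit [DecidableEq n] in
theorem mul_blockDiag'_eq {A B : Matrix n n R} {D : o → Matrix m m R}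
    (h : ∀ k l, block e A k l * D l = D k * block e B k l) :
    A * blockDiag' e D = blockDiag' e D * B := by
  refine block_ext e fun k l => ?_
  rw [block_mul, block_mul]
  simp only [block_blockDiag', mul_ite, mul_zero, ite_mul, zero_mul]
  simpa using h k l

end Block

/-! ### Slices given by polynomial matrices -/

/-- A square matrix of polynomials in `d` variables, as a natural construction. -/
structure PolyMat (d n : ℕ) where
  mat : ∀ {R : Type} [CommRing R] [Algebra ℂ R], (Fin d → R) → Matrix (Fin n) (Fin n) R
  map_mat : ∀ {R R' : Type} [CommRing R] [Algebra ℂ R] [CommRing R'] [Algebra ℂ R']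
    (φ : R →ₐ[ℂ] R') (v : Fin d → R), (mat v).map φ = mat (fun i => φ (v i))

section PolyMat

variable {d n : ℕ} {δ : MvPolynomial (Fin d) ℂ}

/-- Evaluation of regular functions. -/
def evalHom {σ : Type} {δ : MvPolynomial σ ℂ} (x : PrincipalOpen δ) : polyFun δ →ₐ[ℂ] ℂ :=
  (Pi.evalAlgHom ℂ (fun _ : PrincipalOpen δ => ℂ) x).comp (polyFun δ).val

/-- By naturality, the value at a point is the evaluation of one matrix with entries in the ring of
regular functions. -/
theorem PolyMat.mem_polyMatrix (M : PolyMat d n) :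
    (fun x : PrincipalOpen δ => M.mat x.1) ∈ polyMatrix δ n := by
  intro i j
  have : (fun x : PrincipalOpen δ => M.mat x.1 i j) = (M.mat (coordFun δ) i j : polyFun δ) := by
    ext x
    exact (congrFun (congrFun (M.map_mat (evalHom x) (coordFun δ)) i) j).symm
  rw [this]
  exact Subtype.property _

theorem PolyMat.liftMat_eq (M : PolyMat d n) :
    liftMat (fun x : PrincipalOpen δ => M.mat x.1) = M.mat fun i (x : PrincipalOpen δ) => x.1 i := by
  ext i j x
  exact (congrFun (congrFun (M.map_mat (Pi.evalAlgHom ℂ (fun _ : PrincipalOpen δ => ℂ) x)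
    fun i (x : PrincipalOpen δ) => x.1 i) i) j).symm

instance : Fact ((MvPolynomial.X 0 : MvPolynomial (Fin (d + 1)) ℂ) ≠ 0) :=
  ⟨MvPolynomial.X_ne_zero 0⟩

/-- The parameter space `ℂˣ × ℂᵈ`. -/
abbrev SliceBase (d : ℕ) : Type := PrincipalOpen (MvPolynomial.X 0 : MvPolynomial (Fin (d + 1)) ℂ)

/-- The first coordinate. -/
def sliceUnit (x : SliceBase d) : ℂˣ :=
  Units.mk0 (x.1 0) (by simpa using x.2)

theorem sliceUnit_mem : (fun x : SliceBase d => (sliceUnit x : ℂ)) ∈ polyFun _ :=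
  coord_mem_polyFun 0

theorem sliceUnit_inv_mem : (fun x : SliceBase d => (sliceUnit x : ℂ)⁻¹) ∈ polyFun _ := by
  have := inv_mem_polyFun (dvd_refl (MvPolynomial.X 0 : MvPolynomial (Fin (d + 1)) ℂ))
  simpa [sliceUnit] using this

variable (M N : PolyMat (d + 1) n)
  (hM : ∀ v : Fin (d + 1) → ℂ, M.mat v * M.mat v = 1) (hN : ∀ v : Fin (d + 1) → ℂ, N.mat v ^ 3 = 1)

/-- The family of representations given by polynomial matrices for `S` and `T`. -/
def sliceFamily (x : SliceBase d) : Rep n :=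
  familyOfST (S := fun x : SliceBase d => M.mat x.1) (T := fun x : SliceBase d => N.mat x.1)
    (fun x => hM x.1) (fun x => hN x.1) sliceUnit x

theorem isFamily_sliceFamily : IsFamily (sliceFamily M N hM hN) :=
  isFamily_familyOfST _ _ _ M.mem_polyMatrix N.mem_polyMatrix sliceUnit_mem sliceUnit_inv_mem

variable {M N hM hN} {ρ : ℂ} {νS νT : Fin n → ℂ} {a b x y z : ℕ}

/-- Reduces the slice property to S and T alone: the genericity condition does not involve the
twist, which is carried along unchanged as the zeroth parameter. -/
theorem isSlice_sliceFamily (hρ : IsPrimitiveRoot ρ 3) (D : HasDimVector ρ νS νT a b x y z)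
    (hMtr : ∀ v : Fin (d + 1) → ℂ, (M.mat v).trace = ∑ i, νS i)
    (hNtr : ∀ v : Fin (d + 1) → ℂ, (N.mat v).trace = ∑ i, νT i)
    (hgen : ∃ Δ ∈ polyFun (glPoly n), (∃ x, Δ x ≠ 0) ∧ ∀ x, Δ x ≠ 0 → ∀ t : ℂ,
      ∃ (v : Fin (d + 1) → ℂ) (Q : Matrix (Fin n) (Fin n) ℂ), v 0 = t ∧ Q.det ≠ 0 ∧
        normalS νS x * Q = Q * M.mat v ∧ diagonal νT * Q = Q * N.mat v) :
    IsSlice (sliceFamily M N hM hN) (normalFamily D.sq D.cube) (issBeta ρ n a b x y z) where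
  isFamily := isFamily_sliceFamily M N hM hN
  mem := fun w hV => (mk_mem_issBeta_iff hρ D _ hV).2 ⟨sliceUnit w, by
    refine ⟨?_, ?_, ?_⟩
    · rw [Rep.mat_mul, sliceFamily, familyOfST_bS, smul_mul_smul_comm, hM, ← pow_add]
    · rw [sliceFamily, familyOfST_bS, trace_smul, hMtr, smul_eq_mul]
    · rw [sliceFamily, familyOfST_bT, trace_smul, hNtr, smul_eq_mul]⟩
  generic := by
    obtain ⟨Δ, hΔ, hΔ0, h⟩ := hgen
    refine ⟨Δ, hΔ, hΔ0, fun w hw => ?_⟩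
    obtain ⟨v, Q, hv, hQ, hS, hT⟩ := h w hw (w.1 none)
    refine ⟨⟨v, ?_⟩, Matrix.GeneralLinearGroup.mkOfDetNeZero Q hQ, Rep.conj_eq_of_mul_eq ?_ ?_⟩
    · rw [MvPolynomial.eval_X, hv]; exact glUnit_ne_zero w
    · rw [normalFamily, normalRep_bS, sliceFamily, familyOfST_bS, smul_mul_assoc, mul_smul_comm]
      exact congrArg₂ (· • ·) (by simp [sliceUnit, hv]) hS
    · rw [normalFamily, normalRep_bT, sliceFamily, familyOfST_bT, smul_mul_assoc, mul_smul_comm]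
      exact congrArg₂ (· • ·) (by simp [sliceUnit, hv]) hT

/-- Isolates what has to be done for each family. F stands for the functions algebraic over the
invariants and 𝔄 for the word algebra; besides membership of traces, only division and square roots
are made available. -/
theorem dimension_eq_of_sliceFamily [NeZero n] (hρ : IsPrimitiveRoot ρ 3)
    {D : HasDimVector ρ νS νT a b x y z}
    (hΦ : Parametrizes (normalFamily D.sq D.cube) (issBeta ρ n a b x y z))
    (hΨ : IsSlice (sliceFamily M N hM hN) (normalFamily D.sq D.cube) (issBeta ρ n a b x y z))
    (h : ∀ (F : Subalgebra ℂ (SliceBase d → ℂ))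
      (𝔄 : Subalgebra F (Matrix (Fin n) (Fin n) (SliceBase d → ℂ))),
      (fun x => x.1 0) ∈ F →
      M.mat (fun i (x : SliceBase d) => x.1 i) ∈ 𝔄 → N.mat (fun i (x : SliceBase d) => x.1 i) ∈ 𝔄 →
      (∀ A ∈ 𝔄, A.trace ∈ F) →
      (∀ f ∈ polyFun _, ∀ g ∈ F, g ≠ 0 → g * f ∈ F → f ∈ F) →
      (∀ f ∈ polyFun _, f ^ 2 ∈ F → f ∈ F) →
      ∀ i, (fun x => x.1 i) ∈ F) : dimension (issBeta ρ n a b x y z) = d + 1 := by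
  have := hΨ.dimension_eq hΦ (h _ (wordAlgebra (S := fun x : SliceBase d => M.mat x.1)
    (T := fun x : SliceBase d => N.mat x.1) (fun x => hM x.1) (fun x => hN x.1) sliceUnit
    hΨ.isFamily) ?_ ?_ ?_ ?_ ?_ ?_)
  · simpa using this
  · exact unit_mem_algebraicFunctions _ _ _ hΨ.isFamily sliceUnit_mem
  · rw [← M.liftMat_eq]; exact Algebra.subset_adjoin (by simp)
  · rw [← N.liftMat_eq]; exact Algebra.subset_adjoin (by simp)
  · exact fun A hA => trace_mem_of_mem_wordAlgebra _ _ _ hΨ.isFamily sliceUnit_mem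
      sliceUnit_inv_mem hA
  · exact fun f hf g hg hg0 hfg => mem_algebraicFunctions_of_mul hf hg hg0 hfg
  · exact fun f hf h2 => mem_algebraicFunctions_of_pow hf (by norm_num) h2

/-! ### Genericity conditions -/

/-- A polynomial in the entries of a matrix and its inverse, as a natural construction. -/
structure PolyCond (n : ℕ) where
  val : ∀ {R : Type} [CommRing R], Matrix (Fin n) (Fin n) R → Matrix (Fin n) (Fin n) R → R
  map_val : ∀ {R R' : Type} [CommRing R] [CommRing R'] (φ : R →+* R')
    (P Q : Matrix (Fin n) (Fin n) R), φ (val P Q) = val (P.map φ) (Q.map φ)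

/-- One pair of inverse integral matrices proves that a condition holds generically. Integers are
used so that the condition can be evaluated by computation. -/
theorem PolyCond.exists_generic (Δ : PolyCond n) {P Q : Matrix (Fin n) (Fin n) ℤ} (hPQ : P * Q = 1)
    (h : Δ.val P Q ≠ 0) : (fun x => Δ.val (glGL x).val ((glGL x)⁻¹).val) ∈ polyFun (glPoly n) ∧
      ∃ x : PrincipalOpen (glPoly n), Δ.val (glGL x).val ((glGL x)⁻¹).val ≠ 0 := by
  constructor
  · let P' : Matrix (Fin n) (Fin n) (polyFun (glPoly n)) := Matrix.of fun i j => ⟨_, glMat_mem i j⟩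
    let Q' : Matrix (Fin n) (Fin n) (polyFun (glPoly n)) := Matrix.of fun i j => ⟨_, glInv_mem i j⟩
    have : (fun x => Δ.val (glGL x).val ((glGL x)⁻¹).val) =
        (Δ.val P' Q' : polyFun (glPoly n)).1 := by
      ext x
      exact (Δ.map_val (evalHom x).toRingHom P' Q').symm
    rw [this]
    exact Subtype.property _
  · have hQP : Q * P = 1 := mul_eq_one_comm.1 hPQ
    have hmap : ∀ A B : Matrix (Fin n) (Fin n) ℤ, A * B = 1 →
        A.map (Int.castRingHom ℂ) * B.map (Int.castRingHom ℂ) = 1 := by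
      intro A B hAB
      rw [← Matrix.map_mul, hAB]
      simp
    let G : GL (Fin n) ℂ := ⟨P.map (Int.castRingHom ℂ), Q.map (Int.castRingHom ℂ),
      hmap _ _ hPQ, hmap _ _ hQP⟩
    obtain ⟨x, hx, -⟩ := exists_glGL G 1
    refine ⟨x, ?_⟩
    rw [hx]
    change Δ.val (P.map (Int.castRingHom ℂ)) (Q.map (Int.castRingHom ℂ)) ≠ 0
    rw [← Δ.map_val]
    simpa using h

end PolyMat

end BraidReversal

namespace BraidReversal

open Module Matrix

/-! ### Matrices with prescribed blocks -/

section OfBlocks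

variable {m o n : Type} [Fintype m] [DecidableEq m] [Fintype o] [DecidableEq o] [Fintype n]
  [DecidableEq n] {R : Type} [CommRing R] (e : m × o ≃ n)

/-- The matrix with prescribed blocks. -/
def ofBlocks (B : o → o → Matrix m m R) : Matrix n n R :=
  Matrix.of fun i j => B (e.symm i).2 (e.symm j).2 (e.symm i).1 (e.symm j).1

omit [Fintype m] [DecidableEq m] [Fintype o] [DecidableEq o] [Fintype n] [DecidableEq n] [CommRing R] in
theorem block_ofBlocks (B : o → o → Matrix m m R) (k l : o) : block e (ofBlocks e B) k l = B k l := by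
  ext a b
  simp [block, ofBlocks]

omit [DecidableEq m] [DecidableEq o] [DecidableEq n] in
theorem trace_ofBlocks (B : o → o → Matrix m m R) : (ofBlocks e B).trace = ∑ k, (B k k).trace := by
  simp only [Matrix.trace, diag_apply, ofBlocks, of_apply]
  rw [← e.sum_comp, Fintype.sum_prod_type, Finset.sum_comm]
  simp

omit [DecidableEq m] [DecidableEq o] [DecidableEq n] in
theorem ofBlocks_mul_self {B : o → o → Matrix m m R} (h : ∀ k l, ∑ j, B k j * B j l = B k l) :
    ofBlocks e B * ofBlocks e B = ofBlocks e B := by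
  refine block_ext e fun k l => ?_
  rw [block_mul]
  simp only [block_ofBlocks, h]

omit [Fintype m] [DecidableEq m] [Fintype o] [DecidableEq o] [Fintype n] [DecidableEq n] [CommRing R] in
theorem map_ofBlocks {R' : Type} [CommRing R'] (φ : R → R') (B : o → o → Matrix m m R) :
    (ofBlocks e B).map φ = ofBlocks e fun k l => (B k l).map φ := rfl

omit [Fintype m] [DecidableEq m] [Fintype o] in
theorem diagonal_mul_blockDiag' {ν : n → R} (h : ∀ a b k, ν (e (a, k)) = ν (e (b, k)))
    (D : o → Matrix m m R) : diagonal ν * blockDiag' e D = blockDiag' e D * diagonal ν := by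
  ext i j
  obtain ⟨⟨a, k⟩, rfl⟩ := e.surjective i
  obtain ⟨⟨b, l⟩, rfl⟩ := e.surjective j
  rw [diagonal_mul, mul_diagonal, mul_comm]
  by_cases hkl : k = l
  · subst hkl; rw [h a b]
  · have : blockDiag' e D (e (a, k)) (e (b, l)) = 0 := by
      have := congrFun (congrFun (block_blockDiag' e D k l) a) b
      simpa [hkl, block] using this
    rw [this, zero_mul, zero_mul]

end OfBlocks

/-- Six coordinates as three pairs. -/
def pairs : Fin 2 × Fin 3 ≃ Fin 6 where
  toFun p := ![![0, 2, 4], ![1, 3, 5]] p.1 p.2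
  invFun := ![(0, 0), (1, 0), (0, 1), (1, 1), (0, 2), (1, 2)]
  left_inv := by decide
  right_inv := by decide

/-- Six coordinates as two triples. -/
def triples : Fin 3 × Fin 2 ≃ Fin 6 where
  toFun p := ![![0, 3], ![1, 4], ![2, 5]] p.1 p.2
  invFun := ![(0, 0), (1, 0), (2, 0), (0, 1), (1, 1), (2, 1)]
  left_inv := by decide
  right_inv := by decide

/-- The spectral idempotents of an element of order three, from its powers. -/
theorem idempotents_mem {ρ : ℂ} (hρ : IsPrimitiveRoot ρ 3) {A : Type} [Ring A] [Algebra ℂ A]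
    {𝔅 : Subalgebra ℂ A} {e₀ e₁ e₂ : A} (h1 : e₀ + e₁ + e₂ = 1)
    (hT : e₀ + ρ • e₁ + ρ ^ 2 • e₂ ∈ 𝔅) (hT2 : e₀ + ρ ^ 2 • e₁ + ρ • e₂ ∈ 𝔅) :
    e₀ ∈ 𝔅 ∧ e₁ ∈ 𝔅 ∧ e₂ ∈ 𝔅 := by
  have h3 : ρ ^ 3 = 1 := hρ.pow_eq_one
  have h0 : ρ ^ 2 + ρ + 1 = 0 := by
    have := hρ.geom_sum_eq_zero (by norm_num)
    simp only [Finset.sum_range_succ, Finset.sum_range_zero] at this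
    linear_combination this
  have h4 : ρ ^ 4 = ρ := by linear_combination ρ * h3
  -- Discrete Fourier inversion: c = 1, ρ², ρ give the projectors for the eigenvalues 1, ρ, ρ².
  have key : ∀ c : ℂ, (3 : ℂ)⁻¹ • (1 + c • (e₀ + ρ • e₁ + ρ ^ 2 • e₂) +
      c ^ 2 • (e₀ + ρ ^ 2 • e₁ + ρ • e₂)) ∈ 𝔅 := fun c =>
    Subalgebra.smul_mem _ (add_mem (add_mem (one_mem _) (Subalgebra.smul_mem _ hT _))
      (Subalgebra.smul_mem _ hT2 _)) _
  refine ⟨?_, ?_, ?_⟩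
  · convert key 1 using 1
    rw [← h1]
    match_scalars
    · norm_num
    · linear_combination -(3 : ℂ)⁻¹ * h0
    · linear_combination -(3 : ℂ)⁻¹ * h0
  · convert key (ρ ^ 2) using 1
    rw [← h1]
    match_scalars
    · linear_combination -(3 : ℂ)⁻¹ * (2 + ρ ^ 3) * h3
    · linear_combination -(3 : ℂ)⁻¹ * h0 - (3 : ℂ)⁻¹ * ρ * h3
    · linear_combination -(3 : ℂ)⁻¹ * h0 - (3 : ℂ)⁻¹ * (ρ + ρ ^ 2) * h3
  · convert key ρ using 1
    rw [← h1]
    match_scalars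
    · linear_combination -(3 : ℂ)⁻¹ * 2 * h3
    · linear_combination -(3 : ℂ)⁻¹ * h0
    · linear_combination -(3 : ℂ)⁻¹ * h0 - (3 : ℂ)⁻¹ * ρ * h3

/-- A constant diagonal matrix. -/
def constDiag {n : ℕ} (ν : Fin n → ℂ) (d : ℕ) : PolyMat d n where
  mat {R} _ _ _ := diagonal fun i => algebraMap ℂ R (ν i)
  map_mat φ v := by
    rw [diagonal_map (map_zero φ)]
    simp

theorem constDiag_mat {n : ℕ} (ν : Fin n → ℂ) (d : ℕ) (v : Fin d → ℂ) :
    (constDiag ν d).mat v = diagonal ν := rfl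

theorem pairs_injective (k : Fin 3) : Function.Injective fun a => pairs (a, k) := fun a b h => by
  simpa using h

theorem triples_injective (k : Fin 2) : Function.Injective fun a => triples (a, k) :=
  fun a b h => by simpa using h

theorem cornerOne_eq_diagonal {m n : Type} [Fintype m] [DecidableEq m] [Fintype n] [DecidableEq n]
    {R : Type} [CommRing R] {c : m → n} (hc : Function.Injective c) :
    cornerOne R c = diagonal fun i => if i ∈ Set.range c then 1 else 0 := by
  classical
  ext i j
  simp only [cornerOne, mul_apply, submatrix_apply, one_apply, id, mul_ite, mul_one, mul_zero,
    diagonal_apply]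
  by_cases hi : i ∈ Set.range c
  · obtain ⟨a, rfl⟩ := hi
    simp only [hc.eq_iff, Set.mem_range_self, if_true]
    rw [Finset.sum_eq_single a (fun b _ hb => by simp [Ne.symm hb]) (by simp)]
    simp [eq_comm]
  · have : ∀ a, ¬ (i = c a) := fun a h => hi ⟨a, h.symm⟩
    simp [this, hi]

theorem cornerOne_pairs {R : Type} [CommRing R] (k : Fin 3) :
    cornerOne R (fun a => pairs (a, k)) =
      diagonal fun i => ![![1, 1, 0, 0, 0, 0], ![0, 0, 1, 1, 0, 0], ![0, 0, 0, 0, 1, 1]] k i := by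
  rw [cornerOne_eq_diagonal (pairs_injective k)]
  congr 1
  ext i
  fin_cases k <;> fin_cases i <;> simp [pairs]

theorem cornerOne_pairs_mem {ρ : ℂ} (hρ : IsPrimitiveRoot ρ 3) {R : Type} [CommRing R]
    [Algebra ℂ R] {d : ℕ} {F : Subalgebra ℂ R} {𝔄 : Subalgebra F (Matrix (Fin 6) (Fin 6) R)}
    (v : Fin d → R) (hT : (constDiag (nuT6b ρ) d).mat v ∈ 𝔄) (k : Fin 3) :
    cornerOne R (fun a => pairs (a, k)) ∈ 𝔄 := by
  have h := idempotents_mem hρ (𝔅 := 𝔄.restrictScalars ℂ)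
    (e₀ := cornerOne R fun a => pairs (a, 0)) (e₁ := cornerOne R fun a => pairs (a, 1))
    (e₂ := cornerOne R fun a => pairs (a, 2)) ?_ ?_ ?_
  · fin_cases k
    exacts [h.1, h.2.1, h.2.2]
  · simp only [cornerOne_pairs, diagonal_add, ← diagonal_one]
    congr 1
    ext i
    fin_cases i <;> simp
  · rw [Subalgebra.mem_restrictScalars]
    convert hT using 1
    simp only [cornerOne_pairs, diagonal_add, ← diagonal_smul, constDiag]
    congr 1
    ext i
    fin_cases i <;> simp [nuT6b, Algebra.smul_def]
  · rw [Subalgebra.mem_restrictScalars]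
    convert mul_mem hT hT using 1
    simp only [cornerOne_pairs, diagonal_add, ← diagonal_smul, constDiag, diagonal_mul_diagonal]
    congr 1
    ext i
    have h3 : ρ ^ 2 * ρ ^ 2 = ρ := by linear_combination ρ * hρ.pow_eq_one
    have h2 : ρ * ρ = ρ ^ 2 := by ring
    fin_cases i <;> simp [nuT6b, Algebra.smul_def, ← map_mul, ← map_pow, h3, h2]

end BraidReversal

namespace BraidReversal

open Module Matrix

/-! ### Reflections from idempotents -/

/-- The reflection `± (2q - 1)` attached to a matrix `q`. -/
def PolyMat.reflect {d n : ℕ} (ε : ℂ) (q : PolyMat d n) : PolyMat d n where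
  mat {R} _ _ v := algebraMap ℂ R ε • (q.mat v + q.mat v - 1)
  map_mat φ v := by
    rw [← q.map_mat φ v]
    ext i j
    simp only [map_apply, Matrix.smul_apply, smul_eq_mul, map_mul, φ.commutes, Matrix.sub_apply,
      Matrix.add_apply, map_sub, map_add, one_apply, apply_ite φ, map_one, map_zero]

section Reflect

variable {d n : ℕ} {ε : ℂ} {q : PolyMat d n}

theorem reflect_mul_self (hε : ε * ε = 1) (hq : ∀ v : Fin d → ℂ, q.mat v * q.mat v = q.mat v)
    (v : Fin d → ℂ) : (q.reflect ε).mat v * (q.reflect ε).mat v = 1 := by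
  simp only [PolyMat.reflect, Algebra.algebraMap_self, RingHom.id_apply, smul_mul_smul_comm, hε,
    one_smul, sub_mul, mul_sub, add_mul, mul_add, hq, one_mul, mul_one]
  abel

theorem trace_reflect {r : ℂ} (hq : ∀ v : Fin d → ℂ, (q.mat v).trace = r) (v : Fin d → ℂ) :
    ((q.reflect ε).mat v).trace = ε * (2 * r - n) := by
  simp only [PolyMat.reflect, Algebra.algebraMap_self, RingHom.id_apply, trace_smul, trace_sub,
    trace_add, hq, trace_one, Fintype.card_fin, smul_eq_mul]
  ring

theorem mem_of_reflect_mem {R : Type} [CommRing R] [Algebra ℂ R] {F : Subalgebra ℂ R}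
    {𝔄 : Subalgebra F (Matrix (Fin n) (Fin n) R)} (hε : ε * ε = 1) {v : Fin d → R}
    (h : (q.reflect ε).mat v ∈ 𝔄) : q.mat v ∈ 𝔄 := by
  have h1 : (2 : ℂ)⁻¹ • (ε • (q.reflect ε).mat v + 1) ∈ 𝔄.restrictScalars ℂ :=
    Subalgebra.smul_mem _ (add_mem ((𝔄.restrictScalars ℂ).smul_mem h ε) (one_mem _)) _
  have h2 : (q.reflect ε).mat v = ε • (q.mat v + q.mat v - 1) := by
    simp only [PolyMat.reflect, algebraMap_smul]
  rw [h2, smul_smul, hε, one_smul, sub_add_cancel, ← two_smul ℂ, smul_smul,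
    inv_mul_cancel₀ two_ne_zero, one_smul] at h1
  exact h1

/-- The image part of the idempotent of a normal form. -/
theorem normalS_eq {νS : Fin n → ℂ} {r : ℕ} {c : Fin r → Fin n} (hc : Function.Injective c)
    (h : ∀ i, νS i = ε * (if i ∈ Set.range c then 1 else -1)) (x : PrincipalOpen (glPoly n)) :
    normalS νS x = ε • ((glGL x).val.submatrix id c * ((glGL x)⁻¹).val.submatrix c id +
      (glGL x).val.submatrix id c * ((glGL x)⁻¹).val.submatrix c id - 1) := by
  have h1 : (glGL x).val.submatrix id c * ((glGL x)⁻¹).val.submatrix c id =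
      (glGL x).val * cornerOne ℂ c * ((glGL x)⁻¹).val := by
    rw [submatrix_eq_mul id c (glGL x).val, submatrix_eq_mul c id ((glGL x)⁻¹).val, cornerOne]
    simp [Matrix.mul_assoc]
  have h2 : diagonal νS = ε • (cornerOne ℂ c + cornerOne ℂ c - 1) := by
    rw [cornerOne_eq_diagonal hc, diagonal_add, ← diagonal_one, diagonal_sub, ← diagonal_smul]
    congr 1
    ext i
    rw [h, Pi.smul_apply, smul_eq_mul]
    split_ifs <;> norm_num
  have h3 : (glGL x).val * ((glGL x)⁻¹).val = 1 := by rw [← Units.val_mul]; simp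
  rw [normalS, h1, h2]
  simp only [Matrix.mul_smul, Matrix.smul_mul, Matrix.mul_sub, Matrix.mul_add, Matrix.sub_mul,
    Matrix.add_mul, Matrix.mul_one, h3]

theorem normalS_mul_eq {νS : Fin n → ℂ} {r : ℕ} {c : Fin r → Fin n} (hc : Function.Injective c)
    (h : ∀ i, νS i = ε * (if i ∈ Set.range c then 1 else -1)) {x : PrincipalOpen (glPoly n)}
    {Q : Matrix (Fin n) (Fin n) ℂ} {v : Fin d → ℂ}
    (hQ : (glGL x).val.submatrix id c * ((glGL x)⁻¹).val.submatrix c id * Q = Q * q.mat v) :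
    normalS νS x * Q = Q * (q.reflect ε).mat v := by
  rw [normalS_eq hc h, PolyMat.reflect]
  simp only [Algebra.algebraMap_self, RingHom.id_apply, Matrix.smul_mul, Matrix.mul_smul,
    Matrix.sub_mul, Matrix.add_mul, Matrix.mul_add, Matrix.mul_sub, hQ, one_mul, mul_one]

end Reflect

/-! ### Pairs of two by two matrices -/

/-- A nonzero discriminant allows A to be diagonalized, which leaves a rescaling of the basis. It is
used to make the upper right entry of B equal to 1, which is possible because AB − BA is invertible.
-/
theorem exists_pair_normalForm (A B : Matrix (Fin 2) (Fin 2) ℂ)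
    (h : A 1 0 * (A.trace ^ 2 - 4 * A.det) * (A * B - B * A).det ≠ 0) :
    ∃ (R : Matrix (Fin 2) (Fin 2) ℂ) (α β x y z : ℂ), R.det ≠ 0 ∧
      A * R = R * !![α, 0; 0, β] ∧ B * R = R * !![x, 1; y, z] := by
  obtain ⟨r, hr⟩ := IsAlgClosed.exists_pow_nat_eq (A.trace ^ 2 - 4 * A.det) two_pos
  have hc : A 1 0 ≠ 0 := left_ne_zero_of_mul (left_ne_zero_of_mul h)
  have hr0 : r ≠ 0 := by
    rintro rfl
    exact right_ne_zero_of_mul (left_ne_zero_of_mul h) (by rw [← hr]; norm_num)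
  have hcomm := right_ne_zero_of_mul h
  rw [trace_fin_two, det_fin_two] at hr
  set α := (A 0 0 + A 1 1 + r) / 2 with hα
  set β := (A 0 0 + A 1 1 - r) / 2 with hβ
  -- The columns are the first columns of A − β and A − α, which are eigenvectors for α and β by
  -- Cayley–Hamilton.
  let R : Matrix (Fin 2) (Fin 2) ℂ := !![A 0 0 - β, A 0 0 - α; A 1 0, A 1 0]
  have hR : R.det ≠ 0 := by
    have : R.det = A 1 0 * r := by
      simp only [R, det_fin_two_of, hα, hβ]; ring
    rw [this]; exact mul_ne_zero hc hr0
  have hAR : A * R = R * !![α, 0; 0, β] := by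
    ext i j
    fin_cases i <;> fin_cases j <;>
      simp only [R, mul_apply, Fin.sum_univ_two, Fin.zero_eta, Fin.mk_one, Fin.isValue, of_apply,
        cons_val', cons_val_zero, cons_val_one, cons_val_fin_one, hα, hβ]
    · linear_combination (-1 / 4 : ℂ) * hr
    · linear_combination (-1 / 4 : ℂ) * hr
    · ring
    · ring
  obtain ⟨b, hb⟩ : ∃ b : Matrix (Fin 2) (Fin 2) ℂ, B * R = R * b :=
    ⟨R⁻¹ * (B * R), by rw [← Matrix.mul_assoc, mul_nonsing_inv _ (isUnit_iff_ne_zero.2 hR),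
      Matrix.one_mul]⟩
  have hb01 : b 0 1 ≠ 0 := by
    intro h0
    have h1 : (A * B - B * A) * R = R * (!![α, 0; 0, β] * b - b * !![α, 0; 0, β]) := by
      rw [Matrix.sub_mul, Matrix.mul_assoc, Matrix.mul_assoc, hb, hAR, ← Matrix.mul_assoc,
        ← Matrix.mul_assoc, hb, hAR, Matrix.mul_sub, Matrix.mul_assoc, Matrix.mul_assoc]
    have h2 := congrArg Matrix.det h1
    have h3 : (!![α, 0; 0, β] * b - b * !![α, 0; 0, β]).det = 0 := by
      simp only [det_fin_two, Matrix.sub_apply, mul_apply, Fin.sum_univ_two]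
      simp [h0, mul_comm]
    rw [det_mul, det_mul, h3, mul_zero] at h2
    exact mul_ne_zero hcomm hR h2
  refine ⟨R * !![b 0 1, 0; 0, 1], α, β, b 0 0, b 1 0 * b 0 1, b 1 1, ?_, ?_, ?_⟩
  · rw [det_mul]
    refine mul_ne_zero hR ?_
    simpa [det_fin_two_of] using hb01
  · rw [← Matrix.mul_assoc, hAR, Matrix.mul_assoc, Matrix.mul_assoc]
    congr 1
    ext i j
    fin_cases i <;> fin_cases j <;> simp [mul_comm]
  · rw [← Matrix.mul_assoc, hb, Matrix.mul_assoc, Matrix.mul_assoc]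
    congr 1
    ext i j
    fin_cases i <;> fin_cases j <;> simp [mul_apply, Fin.sum_univ_two, mul_comm]

/-! ### A slice for the dimension vector `(4, 2; 2, 2, 2)` -/

/-- The blocks of the idempotent of the slice. -/
def blocks6c {R : Type} [CommRing R] (v : Fin 6 → R) : Fin 3 → Matrix (Fin 2) (Fin 2) R :=
  ![!![v 1, 0; 0, v 2], !![v 3, 1; v 4, v 5], !![1 - v 1 - v 3, -1; -v 4, 1 - v 2 - v 5]]

theorem sum_blocks6c {R : Type} [CommRing R] (v : Fin 6 → R) : ∑ k, blocks6c v k = 1 := by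
  rw [Fin.sum_univ_three]
  ext i j
  fin_cases i <;> fin_cases j <;> simp [blocks6c]

/-- The idempotent of the slice. -/
def slice6c : PolyMat 6 6 where
  mat v := ofBlocks pairs fun _ l => blocks6c v l
  map_mat φ v := by
    rw [map_ofBlocks]
    congr 1
    ext k l i j
    fin_cases l <;> fin_cases i <;> fin_cases j <;> simp [blocks6c]

/-- All block rows are equal, and the three blocks of a row sum to the identity. -/
theorem slice6c_mul_self (v : Fin 6 → ℂ) : slice6c.mat v * slice6c.mat v = slice6c.mat v := by
  refine ofBlocks_mul_self pairs fun k l => ?_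
  rw [← Finset.sum_mul, sum_blocks6c, one_mul]

theorem trace_slice6c (v : Fin 6 → ℂ) : (slice6c.mat v).trace = 2 := by
  rw [slice6c, trace_ofBlocks, ← trace_sum, sum_blocks6c, trace_one]
  simp

theorem constDiag_pow_three {n d : ℕ} {ν : Fin n → ℂ} (h : ∀ i, ν i ^ 3 = 1) (v : Fin d → ℂ) :
    (constDiag ν d).mat v ^ 3 = 1 := by
  rw [constDiag_mat, diagonal_pow, ← diagonal_one]
  congr 1
  ext i
  exact h i

/-- The genericity condition. -/
def cond6c : PolyCond 6 where
  val P Q :=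
    let I := fun k => P.submatrix (fun a => pairs (a, k)) (![0, 1] : Fin 2 → Fin 6)
    let J := fun k => Q.submatrix (![0, 1] : Fin 2 → Fin 6) (fun a => pairs (a, k))
    let A := J 0 * I 0
    let B := J 1 * I 1
    (I 0).det * (I 1).det * (I 2).det *
      (A 1 0 * (A.trace ^ 2 - 4 * A.det) * (A * B - B * A).det)
  map_val φ P Q := by
    simp only [det_fin_two, trace_fin_two, map_mul, map_sub, map_pow, map_add, map_ofNat,
      mul_apply, Fin.sum_univ_two, submatrix_apply, map_apply, Matrix.sub_apply]

/-- The rank two projector has blocks IₖJₗ with ∑ JₖIₖ = 1. The block diagonal base change by IₖR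
turns them into R⁻¹(JₗIₗ)R, independent of k. So only the pair J₀I₀, J₁I₁ up to conjugation matters:
five parameters, and t is the sixth. -/
theorem generic6c {ρ : ℂ} (x : PrincipalOpen (glPoly 6))
    (h : cond6c.val (glGL x).val ((glGL x)⁻¹).val ≠ 0) (t : ℂ) :
    ∃ (v : Fin 6 → ℂ) (Q : Matrix (Fin 6) (Fin 6) ℂ), v 0 = t ∧ Q.det ≠ 0 ∧
      normalS nuS42 x * Q = Q * (slice6c.reflect (-1)).mat v ∧
      diagonal (nuT6b ρ) * Q = Q * (constDiag (nuT6b ρ) 6).mat v := by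
  set P := (glGL x).val with hP
  set P' := ((glGL x)⁻¹).val with hP'
  set c : Fin 2 → Fin 6 := ![0, 1] with hc
  have hci : Function.Injective c := by decide
  set I := fun k => P.submatrix (fun a => pairs (a, k)) c with hI
  set J := fun k => P'.submatrix c (fun a => pairs (a, k)) with hJ
  have hsum : ∑ k, J k * I k = 1 := by
    have h1 : P' * P = 1 := by rw [hP, hP', ← Units.val_mul]; simp
    have h2 : (P' * P).submatrix c c = 1 := by rw [h1, submatrix_one _ hci]
    rw [← h2]
    ext i j
    simp only [hI, hJ, Matrix.sum_apply, mul_apply, submatrix_apply]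
    rw [← pairs.sum_comp, Fintype.sum_prod_type, Finset.sum_comm]
  have hdet : ∀ k, (I k).det ≠ 0 := by
    have h0 := left_ne_zero_of_mul h
    intro k
    fin_cases k
    · exact left_ne_zero_of_mul (left_ne_zero_of_mul h0)
    · exact right_ne_zero_of_mul (left_ne_zero_of_mul h0)
    · exact right_ne_zero_of_mul h0
  obtain ⟨R, α, β, y₁, y₂, y₃, hR, hA, hB⟩ :=
    exists_pair_normalForm (J 0 * I 0) (J 1 * I 1) (right_ne_zero_of_mul h)
  refine ⟨![t, α, β, y₁, y₂, y₃], blockDiag' pairs fun k => I k * R, rfl, ?_, ?_, ?_⟩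
  · rw [det_blockDiag']
    exact Finset.prod_ne_zero_iff.2 fun k _ => by rw [det_mul]; exact mul_ne_zero (hdet k) hR
  · refine normalS_mul_eq hci (fun i => by fin_cases i <;> simp [nuS42, hc]) ?_
    refine mul_blockDiag'_eq pairs fun k l => ?_
    have h1 : block pairs (P.submatrix id c * P'.submatrix c id) k l = I k * J l := by
      ext i j
      simp [block, hI, hJ, mul_apply]
    have h2 : ∀ l, J l * I l * R = R * blocks6c ![t, α, β, y₁, y₂, y₃] l := by
      intro l
      fin_cases l
      · exact hA
      · exact hB
      · have h3 : J 2 * I 2 = 1 - J 0 * I 0 - J 1 * I 1 := by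
          rw [← hsum, Fin.sum_univ_three]; abel
        have h4 : blocks6c ![t, α, β, y₁, y₂, y₃] 2 = 1 - blocks6c ![t, α, β, y₁, y₂, y₃] 0 -
            blocks6c ![t, α, β, y₁, y₂, y₃] 1 := by
          rw [← sum_blocks6c ![t, α, β, y₁, y₂, y₃], Fin.sum_univ_three]; abel
        change J 2 * I 2 * R = R * blocks6c ![t, α, β, y₁, y₂, y₃] 2
        rw [h3, h4, Matrix.sub_mul, Matrix.sub_mul, hA, hB, Matrix.mul_sub, Matrix.mul_sub,
          Matrix.one_mul, Matrix.mul_one]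
        rfl
    rw [h1, slice6c, block_ofBlocks, Matrix.mul_assoc, ← Matrix.mul_assoc (J l), h2,
      ← Matrix.mul_assoc]
  · exact diagonal_mul_blockDiag' pairs (fun a b k => by
      fin_cases a <;> fin_cases b <;> fin_cases k <;> rfl) _

theorem exists_generic6c : (fun x => cond6c.val (glGL x).val ((glGL x)⁻¹).val) ∈
    polyFun (glPoly 6) ∧ ∃ x : PrincipalOpen (glPoly 6),
      cond6c.val (glGL x).val ((glGL x)⁻¹).val ≠ 0 :=
  cond6c.exists_generic
    (P := !![1, 0, 0, 0, -1, 0; 1, 1, 1, 0, 0, 0; 1, 0, 1, 0, 0, 0; 0, 1, 0, 1, 0, 0;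
      1, -1, 0, -1, 0, 0; -1, 0, 0, 0, 0, 1])
    (Q := !![0, 0, 0, 1, 1, 0; 0, 1, -1, 0, 0, 0; 0, 0, 1, -1, -1, 0; 0, -1, 1, 1, 0, 0;
      -1, 0, 0, 1, 1, 0; 0, 0, 0, 1, 1, 1]) (by decide +kernel) (by decide +kernel)

/-- The slice for the dimension vector `(4, 2; 2, 2, 2)`. -/
def family6c (ρ : ℂ) (hρ : IsPrimitiveRoot ρ 3) : SliceBase 5 → Rep 6 :=
  sliceFamily (slice6c.reflect (-1)) (constDiag (nuT6b ρ) 6)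
    (reflect_mul_self (by norm_num) slice6c_mul_self)
    (constDiag_pow_three (hasDimVector_6c hρ).cube)

theorem isSlice_family6c {ρ : ℂ} (hρ : IsPrimitiveRoot ρ 3) :
    IsSlice (family6c ρ hρ) (normalFamily (hasDimVector_6c hρ).sq (hasDimVector_6c hρ).cube)
      (comp6c ρ) :=
  isSlice_sliceFamily hρ (hasDimVector_6c hρ)
    (fun v => by rw [trace_reflect trace_slice6c, sum_nuS42]; norm_num)
    (fun v => by rw [constDiag_mat, trace_diagonal])
    ⟨_, exists_generic6c.1, exists_generic6c.2, fun x hx t => generic6c x hx t⟩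

end BraidReversal

namespace BraidReversal

open Module Matrix

/-! ### Recovering the parameters of a slice from traces -/

section Recover

variable {d : ℕ}

theorem exists_sliceBase (v : Fin (d + 1) → ℂ) (h : v 0 ≠ 0) : ∃ x : SliceBase d, x.1 = v :=
  ⟨⟨v, by simpa using h⟩, rfl⟩

theorem half_mem {R : Type} [CommRing R] [Algebra ℂ R] {F : Subalgebra ℂ R} {a b : R}
    (h1 : a + b ∈ F) (h2 : a - b ∈ F) : a ∈ F ∧ b ∈ F := by
  have e1 : a = (2 : ℂ)⁻¹ • ((a + b) + (a - b)) := by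
    module
  have e2 : b = (2 : ℂ)⁻¹ • ((a + b) - (a - b)) := by
    module
  exact ⟨e1 ▸ F.smul_mem (add_mem h1 h2) _, e2 ▸ F.smul_mem (sub_mem h1 h2) _⟩

end Recover

/-- Let A and B be the first two blocks, with A diagonal. The traces of A and A² give its
eigenvalues up to order. The traces of B and AB form a linear system for the diagonal of B, of
determinant the difference of these eigenvalues. The trace of B² gives the last parameter. -/
theorem recover6c {ρ : ℂ} (hρ : IsPrimitiveRoot ρ 3) (F : Subalgebra ℂ (SliceBase 5 → ℂ))
    (𝔄 : Subalgebra F (Matrix (Fin 6) (Fin 6) (SliceBase 5 → ℂ)))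
    (h0 : (fun x => x.1 0) ∈ F)
    (hM : (slice6c.reflect (-1)).mat (fun i (x : SliceBase 5) => x.1 i) ∈ 𝔄)
    (hN : (constDiag (nuT6b ρ) 6).mat (fun i (x : SliceBase 5) => x.1 i) ∈ 𝔄)
    (htr : ∀ A ∈ 𝔄, A.trace ∈ F)
    (hdiv : ∀ f ∈ polyFun _, ∀ g ∈ F, g ≠ 0 → g * f ∈ F → f ∈ F)
    (hsqrt : ∀ f ∈ polyFun _, f ^ 2 ∈ F → f ∈ F) (i : Fin 6) : (fun x => x.1 i) ∈ F := by
  set v : Fin 6 → SliceBase 5 → ℂ := fun i x => x.1 i with hv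
  have hq : slice6c.mat v ∈ 𝔄 := mem_of_reflect_mem (by norm_num) hM
  have hE := cornerOne_pairs_mem hρ v hN
  have hpoly : ∀ i, v i ∈ polyFun (MvPolynomial.X 0) := fun i => coord_mem_polyFun i
  have hblock : ∀ k l, (slice6c.mat v).submatrix (fun a => pairs (a, k)) (fun a => pairs (a, l)) =
      blocks6c v l := fun k l =>
    block_ofBlocks pairs (fun _ l => blocks6c v l) k l
  have tr2 : ∀ k l, (blocks6c v l * blocks6c v k).trace ∈ F := fun k l => by
    have := trace_mem_of_mem_cornerAlgebra htr (pairs_injective k) (hE k)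
      (submatrix_mul_mem_cornerAlgebra (pairs_injective k) (hE k) (hE l) hq hq)
    rwa [hblock, hblock] at this
  have tr1 : ∀ k, (blocks6c v k).trace ∈ F := fun k => by
    have := trace_mem_of_mem_cornerAlgebra htr (pairs_injective k) (hE k)
      (submatrix_mem_cornerAlgebra (pairs_injective k) (hE k) hq)
    rwa [hblock] at this
  have a1 : v 1 + v 2 ∈ F := by simpa [blocks6c, trace_fin_two] using tr1 0
  have a2 : v 1 * v 1 + v 2 * v 2 ∈ F := by simpa [blocks6c, trace_fin_two] using tr2 0 0
  have a3 : v 3 + v 5 ∈ F := by simpa [blocks6c, trace_fin_two] using tr1 1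
  have a4 : v 1 * v 3 + v 2 * v 5 ∈ F := by simpa [blocks6c, trace_fin_two] using tr2 1 0
  have a5 : v 3 * v 3 + v 4 + (v 4 + v 5 * v 5) ∈ F := by
    simpa [blocks6c, trace_fin_two] using tr2 1 1
  -- The order of the eigenvalues is not an invariant, so only the square of their difference is a
  -- polynomial in traces.
  have b : v 1 - v 2 ∈ F := hsqrt _ (sub_mem (hpoly 1) (hpoly 2)) (by
    have : (v 1 - v 2) ^ 2 = (v 1 * v 1 + v 2 * v 2) + (v 1 * v 1 + v 2 * v 2) -
      (v 1 + v 2) * (v 1 + v 2) := by ring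
    rw [this]
    exact sub_mem (add_mem a2 a2) (mul_mem a1 a1))
  obtain ⟨c1, c2⟩ := half_mem a1 b
  have hne : v 1 - v 2 ≠ 0 := by
    obtain ⟨x, hx⟩ := exists_sliceBase (d := 5) ![1, 1, 0, 0, 0, 0] (by simp)
    intro h
    simpa [hv, hx] using congrFun h x
  have c3 : v 3 ∈ F := hdiv _ (hpoly 3) _ b hne (by
    have : (v 1 - v 2) * v 3 = v 1 * v 3 + v 2 * v 5 - v 2 * (v 3 + v 5) := by ring
    rw [this]
    exact sub_mem a4 (mul_mem c2 a3))
  have c5 : v 5 ∈ F := by simpa using sub_mem a3 c3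
  have c4 : v 4 ∈ F := (half_mem (b := v 4) (by
    have : v 4 + v 4 = (v 3 * v 3 + v 4 + (v 4 + v 5 * v 5)) - v 3 * v 3 - v 5 * v 5 := by ring
    rw [this]
    exact sub_mem (sub_mem a5 (mul_mem c3 c3)) (mul_mem c5 c5)) (by simp)).1
  fin_cases i
  exacts [h0, c1, c2, c3, c4, c5]

theorem dimension_comp6c {ρ : ℂ} (hρ : IsPrimitiveRoot ρ 3)
    (hs : ∃ (V : Rep 6) (t : ℂˣ), V.IsSimple ∧ V.HasType nuS42 (nuT6b ρ) t) :
    dimension (comp6c ρ) = 6 := by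
  have := dimension_eq_of_sliceFamily hρ (D := hasDimVector_6c hρ)
    (parametrizes_normalFamily hρ (hasDimVector_6c hρ) hs) (isSlice_family6c hρ) (recover6c hρ)
  rw [comp6c, this]
  norm_num

end BraidReversal

namespace BraidReversal

open Module Matrix

/-! ### Block diagonal matrices and idempotents in normal form -/

section BlockDiag

variable {m o n : Type} [Fintype m] [DecidableEq m] [Fintype o] [DecidableEq o] [Fintype n]
  [DecidableEq n] {R : Type} [CommRing R] (e : m × o ≃ n)

omit [DecidableEq m] [DecidableEq n] in
theorem blockDiag'_mul (D E : o → Matrix m m R) :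
    blockDiag' e D * blockDiag' e E = blockDiag' e fun k => D k * E k := by
  rw [blockDiag', blockDiag', blockDiag', blockDiagonal_mul, reindex_apply, reindex_apply,
    reindex_apply, submatrix_mul_equiv]

omit [Fintype m] [DecidableEq m] [Fintype o] [Fintype n] [DecidableEq n] in
theorem blockDiag'_add (D E : o → Matrix m m R) :
    blockDiag' e D + blockDiag' e E = blockDiag' e fun k => D k + E k := by
  change _ = blockDiag' e (D + E)
  rw [blockDiag', blockDiag', blockDiag', blockDiagonal_add, reindex_apply, reindex_apply,
    reindex_apply, submatrix_add]
  rfl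

omit [Fintype m] [DecidableEq m] [Fintype o] [Fintype n] [DecidableEq n] in
theorem blockDiag'_smul {K : Type} [CommRing K] [Algebra K R] (c : K) (D : o → Matrix m m R) :
    c • blockDiag' e D = blockDiag' e fun k => c • D k := by
  change _ = blockDiag' e (c • D)
  rw [blockDiag', blockDiag', blockDiagonal_smul, reindex_apply, reindex_apply, submatrix_smul]
  rfl

omit [Fintype m] [Fintype o] [Fintype n] in
theorem blockDiag'_one : blockDiag' e (fun _ => (1 : Matrix m m R)) = 1 := by
  change blockDiag' e (1 : o → Matrix m m R) = 1
  rw [blockDiag', blockDiagonal_one, reindex_apply, submatrix_one_equiv]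

omit [DecidableEq m] [DecidableEq n] in
theorem trace_blockDiag' (D : o → Matrix m m R) : (blockDiag' e D).trace = ∑ k, (D k).trace := by
  rw [← trace_blockDiagonal, blockDiag', reindex_apply, Matrix.trace, Matrix.trace,
    ← e.symm.sum_comp]
  rfl

omit [Fintype m] [DecidableEq m] [Fintype o] [Fintype n] [DecidableEq n] in
theorem map_blockDiag' {R' : Type} [CommRing R'] (φ : R →+* R') (D : o → Matrix m m R) :
    (blockDiag' e D).map φ = blockDiag' e fun k => (D k).map φ := by
  rw [blockDiag', blockDiag', reindex_apply, reindex_apply, ← submatrix_map,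
    blockDiagonal_map _ _ (map_zero φ)]

omit [Fintype o] [Fintype n] in
theorem cornerOne_eq_blockDiag' (k : o) : cornerOne R (fun a => e (a, k)) =
    blockDiag' e fun j => if j = k then (1 : Matrix m m R) else 0 := by
  refine block_ext e fun i j => ?_
  rw [block_blockDiag']
  ext a b
  simp only [block, cornerOne, submatrix_apply, mul_apply, one_apply, id,
    EmbeddingLike.apply_eq_iff_eq, Prod.mk.injEq]
  by_cases h1 : i = k
  · subst h1
    by_cases h2 : i = j
    · subst h2
      by_cases h3 : a = b <;> simp [h3, one_apply]
    · have : ¬ (j = i) := fun h => h2 h.symm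
      simp [h2, this]
  · have : ¬ (k = i) := fun h => h1 h.symm
    simp [h1, this]

end BlockDiag

section NormalIdempotent

variable {n r : ℕ} {m o : Type} [Fintype m] [DecidableEq m] [Fintype o] [DecidableEq o]
  (e : m × o ≃ Fin n) (x : PrincipalOpen (glPoly n)) {c : Fin r → Fin n}

theorem normalIdem_mul_self (hc : Function.Injective c) :
    (glGL x).val.submatrix id c * ((glGL x)⁻¹).val.submatrix c id *
      ((glGL x).val.submatrix id c * ((glGL x)⁻¹).val.submatrix c id) =
    (glGL x).val.submatrix id c * ((glGL x)⁻¹).val.submatrix c id := by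
  have h : ((glGL x)⁻¹).val.submatrix c id * (glGL x).val.submatrix id c = 1 := by
    rw [← submatrix_mul _ _ c id c Function.bijective_id, ← Units.val_mul, inv_mul_cancel,
      Units.val_one, submatrix_one _ hc]
  rw [Matrix.mul_assoc, ← Matrix.mul_assoc (((glGL x)⁻¹).val.submatrix c id), h, Matrix.one_mul]

omit [Fintype m] [DecidableEq m] [Fintype o] [DecidableEq o] in
theorem block_normalIdem (k l : o) :
    block e ((glGL x).val.submatrix id c * ((glGL x)⁻¹).val.submatrix c id) k l =
      (glGL x).val.submatrix (fun a => e (a, k)) c *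
        ((glGL x)⁻¹).val.submatrix c (fun a => e (a, l)) := by
  ext i j
  simp [block, mul_apply]

end NormalIdempotent

theorem idem_comb_mul {K A : Type} [CommRing K] [Ring A] [Algebra K A] {e : A} (h : e * e = e)
    (a b c d : K) : (a • (1 - e) + b • e) * (c • (1 - e) + d • e) =
      (a * c) • (1 - e) + (b * d) • e := by
  simp only [mul_add, add_mul, smul_mul_smul_comm, mul_sub, sub_mul, h, one_mul, mul_one, sub_self,
    smul_zero, zero_add, add_zero, sub_zero]

theorem idem_comb_comm {n : Type} [Fintype n] [DecidableEq n] {e f R : Matrix n n ℂ}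
    (h : e * R = R * f) (a b : ℂ) :
    (a • (1 - e) + b • e) * R = R * (a • (1 - f) + b • f) := by
  simp only [Matrix.add_mul, Matrix.mul_add, Matrix.smul_mul, Matrix.mul_smul, Matrix.sub_mul,
    Matrix.mul_sub, h, Matrix.one_mul, Matrix.mul_one]

theorem diagonal_comb (a b : ℂ) : diagonal ![b, a, a] = a • (1 - diagonal ![1, 0, 0]) +
    b • (diagonal ![1, 0, 0] : Matrix (Fin 3) (Fin 3) ℂ) := by
  ext i j
  fin_cases i <;> fin_cases j <;> simp

theorem mul_inv_eq_of_mul_eq {n : Type} [Fintype n] [DecidableEq n] {K A B : Matrix n n ℂ}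
    (hK : K.det ≠ 0) (h : K * A = B * K) : A * K⁻¹ = K⁻¹ * B := by
  have hu := isUnit_iff_ne_zero.2 hK
  have : K⁻¹ * (K * A) * K⁻¹ = K⁻¹ * (B * K) * K⁻¹ := by rw [h]
  rwa [← Matrix.mul_assoc, nonsing_inv_mul _ hu, Matrix.one_mul, Matrix.mul_assoc,
    Matrix.mul_assoc, mul_nonsing_inv _ hu, Matrix.mul_one] at this

/-! ### A slice for the dimension vector `(3, 3; 3, 2, 1)` -/

/-- A companion matrix. -/
def companion6a {R : Type} [CommRing R] (v : Fin 6 → R) : Matrix (Fin 3) (Fin 3) R :=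
  !![0, 1, 0; 0, 0, 1; v 1, v 2, v 3]

/-- The idempotent of rank one. -/
def rankOne6a {R : Type} [CommRing R] (v : Fin 6 → R) : Matrix (Fin 3) (Fin 3) R :=
  !![1, 0, 0; v 4, 0, 0; v 5, 0, 0]

theorem rankOne6a_mul_self {R : Type} [CommRing R] (v : Fin 6 → R) :
    rankOne6a v * rankOne6a v = rankOne6a v := by
  ext i j
  fin_cases i <;> fin_cases j <;> simp [rankOne6a]

/-- The idempotent of the slice. -/
def slice6a : PolyMat 6 6 where
  mat v := ofBlocks triples ![![companion6a v, 1],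
    ![companion6a v - companion6a v * companion6a v, 1 - companion6a v]]
  map_mat φ v := by
    rw [map_ofBlocks]
    congr 1
    have h : (companion6a v).map φ = companion6a fun i => φ (v i) := by
      ext i j
      fin_cases i <;> fin_cases j <;> simp [companion6a]
    funext k l
    fin_cases k <;> fin_cases l <;> simp [Matrix.map_sub, Matrix.map_mul, h, Matrix.map_one]

/-- An idempotent whose upper right block is 1 is determined by its upper left block C; the lower
blocks C − C² and 1 − C are the forced ones. -/
theorem slice6a_mul_self (v : Fin 6 → ℂ) : slice6a.mat v * slice6a.mat v = slice6a.mat v := by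
  refine ofBlocks_mul_self triples fun k l => ?_
  rw [Fin.sum_univ_two]
  fin_cases k <;> fin_cases l <;> simp <;> noncomm_ring

theorem trace_slice6a (v : Fin 6 → ℂ) : (slice6a.mat v).trace = 3 := by
  rw [slice6a, trace_ofBlocks, Fin.sum_univ_two]
  simp

/-- The matrix of `T` on the slice. -/
def sliceT6a (ρ : ℂ) : PolyMat 6 6 where
  mat {R} _ _ v := blockDiag' triples ![algebraMap ℂ R ρ • (1 - rankOne6a v) +
    algebraMap ℂ R (ρ ^ 2) • rankOne6a v, 1]
  map_mat φ v := by
    have := map_blockDiag' triples φ.toRingHom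
    refine (this _).trans ?_
    simp only [map_pow]
    congr 1
    funext k
    fin_cases k
    · ext i j
      fin_cases i <;> fin_cases j <;> simp [rankOne6a]
    · simp

theorem sliceT6a_pow_three {ρ : ℂ} (hρ : IsPrimitiveRoot ρ 3) (v : Fin 6 → ℂ) :
    (sliceT6a ρ).mat v ^ 3 = 1 := by
  have h := rankOne6a_mul_self v
  rw [pow_three, sliceT6a, blockDiag'_mul, blockDiag'_mul, ← blockDiag'_one triples]
  congr 1
  funext k
  fin_cases k
  · simp only [Fin.zero_eta, Fin.isValue, cons_val_zero, Algebra.algebraMap_self, RingHom.id_apply,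
      idem_comb_mul h]
    have h3 := hρ.pow_eq_one
    have h4 : ρ * (ρ * ρ) = 1 := by linear_combination h3
    have h5 : ρ ^ 2 * (ρ ^ 2 * ρ ^ 2) = 1 := by linear_combination (ρ ^ 3 + 1) * h3
    rw [h4, h5, one_smul, one_smul, sub_add_cancel]
  · simp

theorem trace_sliceT6a {ρ : ℂ} (hρ : IsPrimitiveRoot ρ 3) (v : Fin 6 → ℂ) :
    ((sliceT6a ρ).mat v).trace = ∑ i, nuT6a ρ i := by
  rw [sliceT6a, trace_blockDiag', Fin.sum_univ_two]
  simp [nuT6a, Fin.sum_univ_succ, trace_fin_three, rankOne6a]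
  ring

/-- The rows `φ`, `φM`, `φM²` for the first coordinate `φ`. -/
def krylov {R : Type} [CommRing R] (M : Matrix (Fin 3) (Fin 3) R) : Matrix (Fin 3) (Fin 3) R :=
  !![1, 0, 0; M 0 0, M 0 1, M 0 2; (M * M) 0 0, (M * M) 0 1, (M * M) 0 2]

theorem krylov_map {R R' : Type} [CommRing R] [CommRing R'] (φ : R →+* R')
    (M : Matrix (Fin 3) (Fin 3) R) : (krylov M).map φ = krylov (M.map φ) := by
  rw [krylov, krylov, ← Matrix.map_mul]
  ext i j
  fin_cases i <;> fin_cases j <;> simp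

/-- The first row of the Krylov matrix is the first coordinate form and its first column is (1, M₀₀,
(M²)₀₀). So the coordinate projector becomes this column times the first coordinate form. -/
theorem krylov_mul_diagonal {R : Type} [CommRing R] (M : Matrix (Fin 3) (Fin 3) R)
    (t c₀ c₁ c₂ : R) : krylov M * diagonal ![1, 0, 0] =
      rankOne6a ![t, c₀, c₁, c₂, M 0 0, (M * M) 0 0] * krylov M := by
  ext i j
  rw [mul_diagonal]
  fin_cases i <;> fin_cases j <;> simp [krylov, rankOne6a]

/-- The genericity condition. -/
def cond6a : PolyCond 6 where
  val P Q :=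
    let c : Fin 3 → Fin 6 := ![0, 1, 2]
    let I := fun k => P.submatrix (fun a => triples (a, k)) c
    let J := fun k => Q.submatrix c (fun a => triples (a, k))
    (I 0 * J 1).det * (krylov (I 0 * J 0)).det
  map_val φ P Q := by
    simp only [map_mul, RingHom.map_det, RingHom.mapMatrix_apply, krylov_map, Matrix.map_mul,
      submatrix_map]

/-- The rows φ, φM, φM² form a basis, so φM³ is a combination of them; its coefficients are the last
row of the companion matrix. -/
theorem krylov_mul (M : Matrix (Fin 3) (Fin 3) ℂ) (h : (krylov M).det ≠ 0) :
    ∃ c₀ c₁ c₂ : ℂ, krylov M * M = !![0, 1, 0; 0, 0, 1; c₀, c₁, c₂] * krylov M := by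
  obtain ⟨w, hw⟩ : ∃ w : Fin 3 → ℂ, w ᵥ* krylov M = (M * M * M) 0 :=
    ⟨(M * M * M) 0 ᵥ* (krylov M)⁻¹, by
      rw [vecMul_vecMul, nonsing_inv_mul _ (isUnit_iff_ne_zero.2 h), vecMul_one]⟩
  refine ⟨w 0, w 1, w 2, ?_⟩
  ext i j
  fin_cases i
  · fin_cases j <;> simp [krylov, mul_apply, Fin.sum_univ_three]
  · fin_cases j <;> simp [krylov, mul_apply, Fin.sum_univ_three]
  · have h2 := congrFun hw j
    simp only [vecMul, dotProduct, Fin.sum_univ_three] at h2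
    simp only [Fin.reduceFinMk, mul_apply, Fin.sum_univ_three]
    rw [mul_apply (M := M * M), Fin.sum_univ_three] at h2
    fin_cases j <;> simpa [krylov] using h2.symm

theorem diagonal_nuT6a (ρ : ℂ) : diagonal (nuT6a ρ) = blockDiag' triples
    ![diagonal ![ρ ^ 2, ρ, ρ], (1 : Matrix (Fin 3) (Fin 3) ℂ)] := by
  refine block_ext triples fun k l => ?_
  rw [block_blockDiag']
  ext i j
  fin_cases k <;> fin_cases l <;> fin_cases i <;> fin_cases j <;>
    simp [block, triples, nuT6a]

/-- On the triple where T = 1 the basis is chosen to make the upper right block of the projector 1.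
On the other triple, where T has eigenvalues ρ², ρ, ρ, the Krylov basis of the upper left block
makes that block a companion matrix. There remain three coefficients, two entries of the rank one
projector of T, and t. -/
theorem generic6a {ρ : ℂ} (x : PrincipalOpen (glPoly 6))
    (h : cond6a.val (glGL x).val ((glGL x)⁻¹).val ≠ 0) (t : ℂ) :
    ∃ (v : Fin 6 → ℂ) (Q : Matrix (Fin 6) (Fin 6) ℂ), v 0 = t ∧ Q.det ≠ 0 ∧
      normalS nuS33 x * Q = Q * (slice6a.reflect 1).mat v ∧
      diagonal (nuT6a ρ) * Q = Q * (sliceT6a ρ).mat v := by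
  set c : Fin 3 → Fin 6 := ![0, 1, 2] with hc
  have hci : Function.Injective c := by decide
  set p := (glGL x).val.submatrix id c * ((glGL x)⁻¹).val.submatrix c id with hp
  set b := block triples p with hb
  have hN : (b 0 1).det ≠ 0 := by
    rw [hb, hp, block_normalIdem]; exact left_ne_zero_of_mul h
  have hK : (krylov (b 0 0)).det ≠ 0 := by
    rw [hb, hp, block_normalIdem]; exact right_ne_zero_of_mul h
  have hbb : ∀ k l, b k 0 * b 0 l + b k 1 * b 1 l = b k l := fun k l => by
    rw [← Fin.sum_univ_two fun j => b k j * b j l, hb, ← block_mul, hp, normalIdem_mul_self x hci]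
  obtain ⟨c₀, c₁, c₂, hC⟩ := krylov_mul _ hK
  set v : Fin 6 → ℂ := ![t, c₀, c₁, c₂, b 0 0 0 0, (b 0 0 * b 0 0) 0 0] with hv
  have hC' : krylov (b 0 0) * b 0 0 = companion6a v * krylov (b 0 0) := hC
  set C := companion6a v
  have hKu := isUnit_iff_ne_zero.2 hK
  have hNu := isUnit_iff_ne_zero.2 hN
  set R := (krylov (b 0 0))⁻¹ with hR
  have hMR : b 0 0 * R = R * C := mul_inv_eq_of_mul_eq hK hC'
  have hNN : b 0 1 * (b 0 1)⁻¹ = 1 := mul_nonsing_inv _ hNu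
  have hNN' : (b 0 1)⁻¹ * b 0 1 = 1 := nonsing_inv_mul _ hNu
  refine ⟨v, blockDiag' triples ![R, (b 0 1)⁻¹ * R], rfl, ?_, ?_, ?_⟩
  · rw [det_blockDiag', Fin.prod_univ_two]
    have hRd : R.det ≠ 0 := (isUnit_nonsing_inv_det _ hKu).ne_zero
    exact mul_ne_zero hRd (by
      rw [cons_val_one, cons_val_fin_one, det_mul]
      exact mul_ne_zero (isUnit_nonsing_inv_det _ hNu).ne_zero hRd)
  · refine normalS_mul_eq hci (fun i => by fin_cases i <;> simp [nuS33, hc]) ?_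
    refine mul_blockDiag'_eq triples fun k l => ?_
    rw [slice6a, block_ofBlocks]
    change b k l * _ = _
    fin_cases k <;> fin_cases l
    · exact hMR
    · change b 0 1 * ((b 0 1)⁻¹ * R) = R * 1
      rw [← Matrix.mul_assoc, hNN, Matrix.one_mul, Matrix.mul_one]
    · change b 1 0 * R = (b 0 1)⁻¹ * R * (C - C * C)
      -- The first block row of the idempotent equation determines the lower blocks, the upper right
      -- block being invertible.
      have h1 : b 0 1 * b 1 0 = b 0 0 - b 0 0 * b 0 0 :=
        eq_sub_iff_add_eq'.2 (hbb 0 0)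
      have h2 : R * (C - C * C) = b 0 1 * b 1 0 * R := by
        rw [h1, Matrix.sub_mul, hMR, Matrix.mul_assoc, hMR, ← Matrix.mul_assoc, hMR,
          Matrix.mul_sub, Matrix.mul_assoc]
      rw [Matrix.mul_assoc, h2, Matrix.mul_assoc, ← Matrix.mul_assoc, hNN', Matrix.one_mul]
    · change b 1 1 * ((b 0 1)⁻¹ * R) = (b 0 1)⁻¹ * R * (1 - C)
      have h1 : b 0 1 * b 1 1 = b 0 1 - b 0 0 * b 0 1 := by
        rw [eq_sub_iff_add_eq, add_comm]; exact hbb 0 1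
      have h2 : R * (1 - C) = b 0 1 * b 1 1 * (b 0 1)⁻¹ * R := by
        rw [h1, Matrix.sub_mul, Matrix.mul_assoc (b 0 0), hNN, Matrix.mul_one, Matrix.sub_mul,
          hMR, Matrix.one_mul, Matrix.mul_sub, Matrix.mul_one]
      rw [Matrix.mul_assoc, h2, Matrix.mul_assoc, Matrix.mul_assoc, ← Matrix.mul_assoc (b 0 1)⁻¹,
        hNN', Matrix.one_mul]
  · rw [diagonal_nuT6a, sliceT6a, blockDiag'_mul, blockDiag'_mul]
    congr 1
    funext k
    fin_cases k
    · have h2 : diagonal ![1, 0, 0] * R = R * rankOne6a v :=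
        mul_inv_eq_of_mul_eq hK (krylov_mul_diagonal _ _ _ _ _)
      have h3 := idem_comb_comm h2 ρ (ρ ^ 2)
      rw [← diagonal_comb] at h3
      exact h3
    · exact (Matrix.one_mul _).trans (Matrix.mul_one _).symm

theorem exists_generic6a : (fun x => cond6a.val (glGL x).val ((glGL x)⁻¹).val) ∈
    polyFun (glPoly 6) ∧ ∃ x : PrincipalOpen (glPoly 6),
      cond6a.val (glGL x).val ((glGL x)⁻¹).val ≠ 0 :=
  cond6a.exists_generic
    (P := !![1, 1, 1, 1, 0, 1; 0, 1, 0, 0, -1, 0; 0, 0, 1, 1, 0, 0; 0, 0, -1, 0, 0, 0;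
      0, 0, 0, 0, 1, 0; 0, 1, 0, 0, 0, 1])
    (Q := !![1, 0, -1, 0, 0, -1; 0, 1, 0, 0, 1, 0; 0, 0, 0, -1, 0, 0; 0, 0, 1, 1, 0, 0;
      0, 0, 0, 0, 1, 0; 0, -1, 0, 0, -1, 1]) (by decide +kernel) (by decide +kernel)

/-- The slice for the dimension vector `(3, 3; 3, 2, 1)`. -/
def family6a (ρ : ℂ) (hρ : IsPrimitiveRoot ρ 3) : SliceBase 5 → Rep 6 :=
  sliceFamily (slice6a.reflect 1) (sliceT6a ρ)
    (reflect_mul_self (by norm_num) slice6a_mul_self) (sliceT6a_pow_three hρ)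

theorem isSlice_family6a {ρ : ℂ} (hρ : IsPrimitiveRoot ρ 3) :
    IsSlice (family6a ρ hρ) (normalFamily (hasDimVector_6a hρ).sq (hasDimVector_6a hρ).cube)
      (comp6a ρ) :=
  isSlice_sliceFamily hρ (hasDimVector_6a hρ)
    (fun v => by rw [trace_reflect trace_slice6a, sum_nuS33]; norm_num)
    (fun v => trace_sliceT6a hρ v)
    ⟨_, exists_generic6a.1, exists_generic6a.2, fun x hx t => generic6a x hx t⟩

theorem sliceT6a_eq {ρ : ℂ} {R : Type} [CommRing R] [Algebra ℂ R] (v : Fin 6 → R) :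
    (sliceT6a ρ).mat v = blockDiag' triples ![0, 1] +
      ρ • blockDiag' triples ![1 - rankOne6a v, 0] + ρ ^ 2 • blockDiag' triples ![rankOne6a v, 0] := by
  simp only [blockDiag'_smul, blockDiag'_add, sliceT6a, algebraMap_smul]
  congr 1
  funext k
  fin_cases k <;> simp

theorem sliceT6a_mul_self {ρ : ℂ} (hρ : IsPrimitiveRoot ρ 3) {R : Type} [CommRing R] [Algebra ℂ R]
    (v : Fin 6 → R) : (sliceT6a ρ).mat v * (sliceT6a ρ).mat v = blockDiag' triples ![0, 1] +
      ρ ^ 2 • blockDiag' triples ![1 - rankOne6a v, 0] + ρ • blockDiag' triples ![rankOne6a v, 0] := by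
  simp only [blockDiag'_smul, blockDiag'_add, sliceT6a, algebraMap_smul, blockDiag'_mul]
  congr 1
  funext k
  fin_cases k
  · have h : ρ ^ 2 * ρ ^ 2 = ρ := by linear_combination ρ * hρ.pow_eq_one
    simp only [Fin.zero_eta, Fin.isValue, cons_val_zero, zero_add,
      idem_comb_mul (rankOne6a_mul_self v), h, ← pow_two]
  · simp

/-- The upper left corner of the word algebra contains the companion matrix C and the rank one
projector E of T. The traces of C, C², C³ give the coefficients of C by Newton's identities, and the
traces of EC and EC² are the two remaining parameters. Neither division by functions nor roots are
needed. -/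
theorem recover6a {ρ : ℂ} (hρ : IsPrimitiveRoot ρ 3) (F : Subalgebra ℂ (SliceBase 5 → ℂ))
    (𝔄 : Subalgebra F (Matrix (Fin 6) (Fin 6) (SliceBase 5 → ℂ)))
    (h0 : (fun x => x.1 0) ∈ F)
    (hM : (slice6a.reflect 1).mat (fun i (x : SliceBase 5) => x.1 i) ∈ 𝔄)
    (hN : (sliceT6a ρ).mat (fun i (x : SliceBase 5) => x.1 i) ∈ 𝔄)
    (htr : ∀ A ∈ 𝔄, A.trace ∈ F) (i : Fin 6) : (fun x => x.1 i) ∈ F := by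
  set v : Fin 6 → SliceBase 5 → ℂ := fun i x => x.1 i with hv
  have hp : slice6a.mat v ∈ 𝔄 := mem_of_reflect_mem (by norm_num) hM
  obtain ⟨-, he1, he2⟩ := idempotents_mem hρ (𝔅 := 𝔄.restrictScalars ℂ)
    (e₀ := blockDiag' triples ![0, 1]) (e₁ := blockDiag' triples ![1 - rankOne6a v, 0])
    (e₂ := blockDiag' triples ![rankOne6a v, 0]) (by
      rw [blockDiag'_add, blockDiag'_add, ← blockDiag'_one triples]
      congr 1
      funext k
      fin_cases k <;> simp)
    (by rw [← sliceT6a_eq]; exact hN) (by rw [← sliceT6a_mul_self hρ]; exact mul_mem hN hN)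
  have hE : cornerOne (SliceBase 5 → ℂ) (fun a => triples (a, 0)) ∈ 𝔄 := by
    have := add_mem he1 he2
    rw [blockDiag'_add, Subalgebra.mem_restrictScalars] at this
    rw [cornerOne_eq_blockDiag']
    convert this using 2
    funext k
    fin_cases k <;> simp
  have mC : companion6a v ∈ cornerAlgebra 𝔄 (triples_injective 0) hE := by
    have := submatrix_mem_cornerAlgebra (triples_injective 0) hE hp
    rwa [show (slice6a.mat v).submatrix (fun a => triples (a, 0)) (fun a => triples (a, 0)) =
      companion6a v from block_ofBlocks triples _ 0 0] at this
  have mE : rankOne6a v ∈ cornerAlgebra 𝔄 (triples_injective 0) hE := by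
    have := submatrix_mem_cornerAlgebra (triples_injective 0) hE he2
    rwa [show (blockDiag' triples ![rankOne6a v, 0]).submatrix (fun a => triples (a, 0))
      (fun a => triples (a, 0)) = rankOne6a v from block_blockDiag' triples _ 0 0] at this
  have tr : ∀ A ∈ cornerAlgebra 𝔄 (triples_injective 0) hE, A.trace ∈ F := fun A hA =>
    trace_mem_of_mem_cornerAlgebra htr _ hE hA
  have a3 : v 3 ∈ F := by simpa [companion6a, trace_fin_three] using tr _ mC
  have a2 : v 2 + (v 2 + v 3 * v 3) ∈ F := by
    simpa [companion6a, trace_fin_three] using tr _ (mul_mem mC mC)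
  have a1 := tr _ (mul_mem (mul_mem mC mC) mC)
  have a4 : v 4 ∈ F := by
    simpa [companion6a, rankOne6a, trace_fin_three] using tr _ (mul_mem mE mC)
  have a5 : v 5 ∈ F := by
    simpa [companion6a, rankOne6a, trace_fin_three] using tr _ (mul_mem (mul_mem mE mC) mC)
  have c2 : v 2 ∈ F := (half_mem (b := v 2) (by
    have : v 2 + v 2 = v 2 + (v 2 + v 3 * v 3) - v 3 * v 3 := by ring
    rw [this]
    exact sub_mem a2 (mul_mem a3 a3)) (by simp)).1
  have c1 : v 1 ∈ F := by
    have h1 : (companion6a v * companion6a v * companion6a v).trace -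
        (v 2 * v 3 + v 2 * v 3 + v 2 * v 3) - v 3 * v 3 * v 3 = v 1 + v 1 + v 1 := by
      simp [companion6a, trace_fin_three]
      ring
    have h2 : v 1 = (3 : ℂ)⁻¹ • (v 1 + v 1 + v 1) := by module
    have h3 := mul_mem c2 a3
    rw [h2, ← h1]
    exact F.smul_mem (sub_mem (sub_mem a1 (add_mem (add_mem h3 h3) h3))
      (mul_mem (mul_mem a3 a3) a3)) _
  fin_cases i
  exacts [h0, c1, c2, a3, a4, a5]

theorem dimension_comp6a {ρ : ℂ} (hρ : IsPrimitiveRoot ρ 3)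
    (hs : ∃ (V : Rep 6) (t : ℂˣ), V.IsSimple ∧ V.HasType nuS33 (nuT6a ρ) t) :
    dimension (comp6a ρ) = 6 := by
  have := dimension_eq_of_sliceFamily hρ (D := hasDimVector_6a hρ)
    (parametrizes_normalFamily hρ (hasDimVector_6a hρ) hs) (isSlice_family6a hρ)
    fun F 𝔄 h0 hM hN htr _ _ => recover6a hρ F 𝔄 h0 hM hN htr
  rw [comp6a, this]
  norm_num

end BraidReversal

namespace BraidReversal

open Module Matrix

/-! ### Idempotent three by three block matrices -/

section Idem

variable {A : Type} [Ring A]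

/-- The normal form of an idempotent block matrix with first row `(X, 1, 1)`. -/
def idemBlocks (E G H X : A) : Fin 3 → Fin 3 → A :=
  ![![X, 1, 1], ![G + (H - G - X + 1) * X, H - G - X + 1, H - G - X + 1 - E],
    ![G * (X - 1) - H * X, G - H, E + G - H]]

theorem idemBlocks_mul_self {E G H : A} (X : A) (hE : E * E = E) (hG : E * G = G) (hH : E * H = 0)
    (k l : Fin 3) : ∑ j, idemBlocks E G H X k j * idemBlocks E G H X j l =
      idemBlocks E G H X k l := by
  have hE' : ∀ Y, E * (E * Y) = E * Y := fun Y => by rw [← mul_assoc, hE]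
  have hG' : ∀ Y, E * (G * Y) = G * Y := fun Y => by rw [← mul_assoc, hG]
  have hH' : ∀ Y, E * (H * Y) = 0 := fun Y => by rw [← mul_assoc, hH, zero_mul]
  rw [Fin.sum_univ_three]
  fin_cases k <;> fin_cases l <;>
    simp [idemBlocks, mul_add, add_mul, mul_sub, sub_mul, mul_assoc, hE, hG, hH, hG', hH'] <;>
    abel

/-- With first row (X, 1, 1) the first row of the idempotent equation expresses the third row
through the second. The second row then says that E = b₁₁ − b₁₂ is idempotent and that G = b₁₀ −
b₁₁X equals E(1 − X − b₁₁). So G is fixed by E, and H = G − (1 − X − b₁₁) is killed by E. -/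
theorem eq_idemBlocks {b : Fin 3 → Fin 3 → A} (h : ∀ k l, ∑ j, b k j * b j l = b k l)
    (h1 : b 0 1 = 1) (h2 : b 0 2 = 1) : ∃ E G H : A, E * E = E ∧ E * G = G ∧ E * H = 0 ∧
      E = b 1 1 - b 1 2 ∧ G = b 1 0 - b 1 1 * b 0 0 ∧ b = idemBlocks E G H (b 0 0) := by
  have e00 := h 0 0
  have e01 := h 0 1
  have e02 := h 0 2
  have e11 := h 1 1
  have e12 := h 1 2
  simp only [Fin.sum_univ_three, h1, h2, one_mul, mul_one] at e00 e01 e02 e11 e12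
  obtain ⟨X, hX⟩ : ∃ X, X = b 0 0 := ⟨_, rfl⟩
  obtain ⟨Z, hZ⟩ : ∃ X, X = b 1 0 := ⟨_, rfl⟩
  obtain ⟨W, hW⟩ : ∃ X, X = b 1 1 := ⟨_, rfl⟩
  obtain ⟨E, hE⟩ : ∃ X, X = b 1 1 - b 1 2 := ⟨_, rfl⟩
  have f12 : b 1 2 = W - E := by rw [hE, hW]; abel
  have f20 : b 2 0 = X - X * X - Z := by rw [hX, hZ]; nth_rewrite 1 [← e00]; abel
  have f21 : b 2 1 = 1 - X - W := by rw [hX, hW, ← e01]; abel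
  have f22 : b 2 2 = 1 - X - W + E := by
    have : b 2 2 = 1 - X - (W - E) := by rw [hX, ← f12, ← e02]; abel
    rw [this]; abel
  have g1 : Z - W * X = E * (1 - X - W) := by
    rw [← sub_eq_zero]
    rw [← hZ, ← hW, f12, f21] at e11
    rw [← sub_eq_zero] at e11
    rw [← e11]
    noncomm_ring
  have g2 : E * E = E := by
    rw [← hZ, ← hW, f12, f22, ← sub_eq_zero] at e12
    have : Z - W * X - E * (1 - X - W) = 0 := sub_eq_zero.2 g1
    rw [← sub_eq_zero, ← neg_eq_zero, ← e12, ← sub_eq_zero, ← neg_eq_zero, ← this]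
    noncomm_ring
  have g3 : E * (Z - W * X) = Z - W * X := by rw [g1, ← mul_assoc, g2]
  refine ⟨E, Z - W * X, Z - W * X + X + W - 1, g2, g3, ?_, hE, by rw [hZ, hW, hX], ?_⟩
  · have : Z - W * X + X + W - 1 = Z - W * X - (1 - X - W) := by abel
    rw [this, mul_sub, g3, ← g1, sub_self]
  · funext k l
    fin_cases k <;> fin_cases l <;>
      simp [idemBlocks, h1, h2, f12, f20, f21, f22, ← hX, ← hZ, ← hW] <;> noncomm_ring

theorem idemBlocks_conj {E G H X E' G' H' X' R : A} (hE : E * R = R * E') (hG : G * R = R * G')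
    (hH : H * R = R * H') (hX : X * R = R * X') (k l : Fin 3) :
    idemBlocks E G H X k l * R = R * idemBlocks E' G' H' X' k l := by
  have hW : (H - G - X + 1) * R = R * (H' - G' - X' + 1) := by
    simp only [sub_mul, add_mul, mul_sub, mul_add, hG, hH, hX, one_mul, mul_one]
  fin_cases k <;> fin_cases l
  · exact hX
  · exact (one_mul R).trans (mul_one R).symm
  · exact (one_mul R).trans (mul_one R).symm
  · change (G + (H - G - X + 1) * X) * R = R * (G' + (H' - G' - X' + 1) * X')
    rw [add_mul, mul_add, hG, mul_assoc, hX, ← mul_assoc, hW, mul_assoc]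
  · exact hW
  · change (H - G - X + 1 - E) * R = R * (H' - G' - X' + 1 - E')
    rw [sub_mul, mul_sub, hW, hE]
  · change (G * (X - 1) - H * X) * R = R * (G' * (X' - 1) - H' * X')
    have hX1 : (X - 1) * R = R * (X' - 1) := by rw [sub_mul, mul_sub, hX, one_mul, mul_one]
    rw [sub_mul, mul_assoc, hX1, ← mul_assoc, hG, mul_assoc H, hX, ← mul_assoc, hH]
    simp only [mul_sub, mul_assoc]
  · change (G - H) * R = R * (G' - H')
    rw [sub_mul, mul_sub, hG, hH]
  · change (E + G - H) * R = R * (E' + G' - H')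
    rw [sub_mul, add_mul, mul_sub, mul_add, hE, hG, hH]

theorem map_idemBlocks {B : Type} [Ring B] (φ : A →+* B) (E G H X : A) (k l : Fin 3) :
    φ (idemBlocks E G H X k l) = idemBlocks (φ E) (φ G) (φ H) (φ X) k l := by
  fin_cases k <;> fin_cases l <;> simp [idemBlocks]

end Idem

/-- The basis is a vector y in the kernel of E together with its image g = Gy, which lies in the
image of E and is nonzero by the hypothesis. In this basis E is a coordinate projector, G lives in
the first row with upper right entry 1, and H in the second row. -/
theorem exists_triple_normalForm {E G H : Matrix (Fin 2) (Fin 2) ℂ} (hE : E * E = E)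
    (hG : E * G = G) (hH : E * H = 0) (h : (G * (1 - E)) 0 1 ≠ 0) :
    ∃ (R : Matrix (Fin 2) (Fin 2) ℂ) (γ η₁ η₂ : ℂ), R.det ≠ 0 ∧ E * R = R * !![1, 0; 0, 0] ∧
      G * R = R * !![γ, 1; 0, 0] ∧ H * R = R * !![0, 0; η₁, η₂] := by
  let y : Fin 2 → ℂ := fun i => (1 - E) i 1
  let g : Fin 2 → ℂ := fun i => (G * (1 - E)) i 1
  have hy : E *ᵥ y = 0 := by
    have : E * (1 - E) = 0 := by rw [Matrix.mul_sub, Matrix.mul_one, hE, sub_self]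
    ext i
    exact congrFun (congrFun this i) 1
  have hGy : G *ᵥ y = g := rfl
  have hg : E *ᵥ g = g := by rw [← hGy, mulVec_mulVec, hG]
  have hg0 : g ≠ 0 := fun h0 => h (congrFun h0 0)
  have hy0 : y ≠ 0 := by
    intro h0
    rw [h0, mulVec_zero] at hGy
    exact hg0 hGy.symm
  let R : Matrix (Fin 2) (Fin 2) ℂ := Matrix.of fun i j => (![g, y] : Fin 2 → Fin 2 → ℂ) j i
  have hRw : ∀ w : Fin 2 → ℂ, R *ᵥ w = w 0 • g + w 1 • y := by
    intro w
    ext i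
    simp [R, mulVec, dotProduct, mul_comm]
  have hR : R.det ≠ 0 := by
    intro h0
    obtain ⟨w, hw, hw0⟩ := Matrix.exists_mulVec_eq_zero_iff.2 h0
    rw [hRw] at hw0
    have h1 := congrArg (E *ᵥ ·) hw0
    simp only [mulVec_add, mulVec_smul, hg, hy, smul_zero, add_zero, mulVec_zero] at h1
    have hw1 : w 0 = 0 := (smul_eq_zero.1 h1).resolve_right hg0
    rw [h1, zero_add] at hw0
    have hw2 : w 1 = 0 := (smul_eq_zero.1 hw0).resolve_right hy0
    exact hw (by ext i; fin_cases i <;> assumption)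
  have hu := isUnit_iff_ne_zero.2 hR
  have key : ∀ A : Matrix (Fin 2) (Fin 2) ℂ, A * R = R * (R⁻¹ * (A * R)) := fun A => by
    rw [← Matrix.mul_assoc, mul_nonsing_inv _ hu, Matrix.one_mul]
  have hcancel : ∀ A B : Matrix (Fin 2) (Fin 2) ℂ, R * A = R * B → A = B := fun A B hAB => by
    have := congrArg (R⁻¹ * ·) hAB
    simpa only [← Matrix.mul_assoc, nonsing_inv_mul _ hu, Matrix.one_mul] using this
  have hER : E * R = R * !![1, 0; 0, 0] := by
    ext i j
    fin_cases j
    · have := congrFun hg i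
      simpa [R, mul_apply, mulVec, dotProduct] using this
    · have := congrFun hy i
      simpa [R, mul_apply, mulVec, dotProduct] using this
  set G' := R⁻¹ * (G * R)
  set H' := R⁻¹ * (H * R)
  have hG' : !![1, 0; 0, 0] * G' = G' := hcancel _ _ (by
    rw [← Matrix.mul_assoc, ← hER, Matrix.mul_assoc, ← key, ← Matrix.mul_assoc, hG])
  have hH' : !![1, 0; 0, 0] * H' = 0 := hcancel _ _ (by
    rw [← Matrix.mul_assoc, ← hER, Matrix.mul_assoc, ← key, ← Matrix.mul_assoc, hH,
      Matrix.zero_mul, Matrix.mul_zero])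
  have h10 : G' 1 0 = 0 := by rw [← hG']; simp [mul_apply]
  have h11 : G' 1 1 = 0 := by rw [← hG']; simp [mul_apply]
  have k00 : H' 0 0 = 0 := by simpa [mul_apply] using congrFun (congrFun hH' 0) 0
  have k01 : H' 0 1 = 0 := by simpa [mul_apply] using congrFun (congrFun hH' 0) 1
  have h01 : G' 0 1 = 1 := by
    have h1 : ∀ i, (R * G') i 1 = g i := fun i => by
      rw [← key]
      rfl
    have h2 : G' 0 1 * g 0 = g 0 := by
      have h3 := h1 0
      rw [mul_apply, Fin.sum_univ_two, h11, mul_zero, add_zero, mul_comm] at h3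
      exact h3
    exact mul_right_cancel₀ h (by rw [one_mul]; exact h2)
  refine ⟨R, G' 0 0, H' 1 0, H' 1 1, hR, hER, ?_, ?_⟩
  · rw [key G]
    congr 1
    ext i j
    fin_cases i <;> fin_cases j <;> simp [h10, h11, h01, G']
  · rw [key H]
    congr 1
    ext i j
    fin_cases i <;> fin_cases j <;> simp [k00, k01, H']

end BraidReversal

namespace BraidReversal

open Module Matrix

/-! ### A slice for the dimension vector `(3, 3; 2, 2, 2)` -/

section Slice

variable {R : Type} [CommRing R]

/-- The parameters of the slice. -/
def matX (v : Fin 8 → R) : Matrix (Fin 2) (Fin 2) R := !![v 4, v 5; v 6, v 7]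

/-- The parameters of the slice. -/
def matG (v : Fin 8 → R) : Matrix (Fin 2) (Fin 2) R := !![v 1, 1; 0, 0]

/-- The parameters of the slice. -/
def matH (v : Fin 8 → R) : Matrix (Fin 2) (Fin 2) R := !![0, 0; v 2, v 3]

/-- The blocks of the idempotent of the slice. -/
def blocks6b (v : Fin 8 → R) : Fin 3 → Fin 3 → Matrix (Fin 2) (Fin 2) R :=
  idemBlocks !![1, 0; 0, 0] (matG v) (matH v) (matX v)

end Slice

/-- The idempotent of the slice. -/
def slice6b : PolyMat 8 6 where
  mat v := ofBlocks pairs (blocks6b v)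
  map_mat φ v := by
    rw [map_ofBlocks]
    congr 1
    funext k l
    refine (map_idemBlocks (A := Matrix (Fin 2) (Fin 2) _) (B := Matrix (Fin 2) (Fin 2) _)
      φ.toRingHom.mapMatrix _ _ _ _ k l).trans ?_
    rw [blocks6b]
    congr 1
    all_goals
      ext i j
      fin_cases i <;> fin_cases j <;> simp [matX, matG, matH]

theorem slice6b_mul_self (v : Fin 8 → ℂ) : slice6b.mat v * slice6b.mat v = slice6b.mat v := by
  refine ofBlocks_mul_self pairs fun k l => idemBlocks_mul_self _ ?_ ?_ ?_ k l
  all_goals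
    ext i j
    fin_cases i <;> fin_cases j <;> simp [matG, matH]

theorem trace_slice6b (v : Fin 8 → ℂ) : (slice6b.mat v).trace = 3 := by
  rw [slice6b, trace_ofBlocks, Fin.sum_univ_three]
  change (matX v).trace + (matH v - matG v - matX v + 1).trace +
    (!![1, 0; 0, 0] + matG v - matH v).trace = 3
  simp only [trace_add, trace_sub, trace_one, Fintype.card_fin, trace_fin_two_of, matG, matH, matX]
  push_cast
  ring

/-- The genericity condition, in terms of blocks. -/
def blockCond {R : Type} [CommRing R] (X Y N Z W N₂ : Matrix (Fin 2) (Fin 2) R) : R :=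
  Y.det * N.det * ((Y.det • (Y * Z) - Y * W * Y.adjugate * X) *
    ((Y.det * N.det) • 1 - N.det • (Y * W * Y.adjugate) + Y.det • (Y * N₂ * N.adjugate))) 0 1

theorem map_blockCond {R R' : Type} [CommRing R] [CommRing R'] (φ : R →+* R')
    (X Y N Z W N₂ : Matrix (Fin 2) (Fin 2) R) : φ (blockCond X Y N Z W N₂) =
      blockCond (X.map φ) (Y.map φ) (N.map φ) (Z.map φ) (W.map φ) (N₂.map φ) := by
  have h : ∀ A : Matrix (Fin 2) (Fin 2) R, φ (A 0 1) = φ.mapMatrix A 0 1 := fun A => rfl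
  have hs : ∀ (c : R) (A : Matrix (Fin 2) (Fin 2) R),
      φ.mapMatrix (c • A) = φ c • φ.mapMatrix A := fun c A => by
    ext i j
    simp
  simp only [blockCond, map_mul, h, map_sub, map_add, hs, RingHom.map_det, RingHom.map_adjugate,
    map_one]
  rfl

/-- The genericity condition. -/
def cond6b : PolyCond 6 where
  val P Q :=
    let c : Fin 3 → Fin 6 := ![0, 1, 2]
    let b := fun k l => P.submatrix (fun a => pairs (a, k)) c * Q.submatrix c (fun a => pairs (a, l))
    blockCond (b 0 0) (b 0 1) (b 0 2) (b 1 0) (b 1 1) (b 1 2)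
  map_val φ P Q := by
    simp only [map_blockCond, Matrix.map_mul, submatrix_map]

theorem exists_generic6b : (fun x => cond6b.val (glGL x).val ((glGL x)⁻¹).val) ∈
    polyFun (glPoly 6) ∧ ∃ x : PrincipalOpen (glPoly 6),
      cond6b.val (glGL x).val ((glGL x)⁻¹).val ≠ 0 :=
  cond6b.exists_generic
    (P := !![1, 0, 0, 0, 0, -1; 0, 1, 0, 1, -1, 0; 0, 0, 1, 0, -1, 0; 0, 0, 0, 1, 0, 0;
      0, 0, 0, 0, 1, 0; 0, 0, -1, 0, 1, 1])
    (Q := !![1, 0, 1, 0, 0, 1; 0, 1, 0, -1, 1, 0; 0, 0, 1, 0, 1, 0; 0, 0, 0, 1, 0, 0;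
      0, 0, 0, 0, 1, 0; 0, 0, 1, 0, 0, 1]) (by decide +kernel) (by decide +kernel)

/-- Base change by (1, b₀₁, b₀₂) makes the first block row (X, 1, 1), so the idempotent is given by
E, G, H, X. What remains is simultaneous conjugation of these four 2 × 2 matrices, used up by the
normal form of E, G, H. The parameters are one entry of G, two of H, four of X, and t. -/
theorem exists_blocks_normalForm {b : Fin 3 → Fin 3 → Matrix (Fin 2) (Fin 2) ℂ}
    (hb : ∀ k l, ∑ j, b k j * b j l = b k l)
    (h : blockCond (b 0 0) (b 0 1) (b 0 2) (b 1 0) (b 1 1) (b 1 2) ≠ 0) (t : ℂ) :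
    ∃ (v : Fin 8 → ℂ) (D : Fin 3 → Matrix (Fin 2) (Fin 2) ℂ), v 0 = t ∧ (∀ k, (D k).det ≠ 0) ∧
      ∀ k l, b k l * D l = D k * blocks6b v k l := by
  have hY : (b 0 1).det ≠ 0 := left_ne_zero_of_mul (left_ne_zero_of_mul h)
  have hN : (b 0 2).det ≠ 0 := right_ne_zero_of_mul (left_ne_zero_of_mul h)
  let U : Fin 3 → Matrix (Fin 2) (Fin 2) ℂ := ![1, b 0 1, b 0 2]
  have hU : ∀ k, (U k).det ≠ 0 := by
    intro k
    fin_cases k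
    exacts [by simp [U], hY, hN]
  have hUU : ∀ k, U k * (U k)⁻¹ = 1 := fun k => mul_nonsing_inv _ (isUnit_iff_ne_zero.2 (hU k))
  have hUU' : ∀ k, (U k)⁻¹ * U k = 1 := fun k => nonsing_inv_mul _ (isUnit_iff_ne_zero.2 (hU k))
  let b' : Fin 3 → Fin 3 → Matrix (Fin 2) (Fin 2) ℂ := fun k l => U k * b k l * (U l)⁻¹
  have hU0 : (U 0)⁻¹ = 1 := by
    change (1 : Matrix (Fin 2) (Fin 2) ℂ)⁻¹ = 1
    exact inv_one
  have hb' : ∀ k l, ∑ j, b' k j * b' j l = b' k l := by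
    intro k l
    have : ∀ j, b' k j * b' j l = U k * (b k j * b j l) * (U l)⁻¹ := fun j => by
      calc b' k j * b' j l = U k * b k j * ((U j)⁻¹ * U j) * b j l * (U l)⁻¹ := by
            simp only [b', Matrix.mul_assoc]
        _ = _ := by rw [hUU', Matrix.mul_one]; simp only [Matrix.mul_assoc]
    simp only [this, b', ← hb k l, Finset.mul_sum, Finset.sum_mul]
  obtain ⟨E, G, H, hE, hG, hH, hE1, hG1, hform⟩ := eq_idemBlocks hb'
    (by change 1 * b 0 1 * (U 1)⁻¹ = 1; rw [Matrix.one_mul]; exact hUU 1)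
    (by change 1 * b 0 2 * (U 2)⁻¹ = 1; rw [Matrix.one_mul]; exact hUU 2)
  have hadj : ∀ A : Matrix (Fin 2) (Fin 2) ℂ, A.det ≠ 0 → A.adjugate = A.det • A⁻¹ := fun A hA => by
    rw [inv_def, smul_smul, Ring.inverse_eq_inv', mul_inv_cancel₀ hA, one_smul]
  -- The genericity condition is this one with denominators cleared: adjugates replace the inverses
  -- of the two blocks that are normalised to 1.
  have hgen : (G * (1 - E)) 0 1 ≠ 0 := by
    intro h0
    refine h ?_
    have e1 : (b 0 1).det • (b 0 1 * b 1 0) - b 0 1 * b 1 1 * (b 0 1).adjugate * b 0 0 =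
        (b 0 1).det • G := by
      have hX : b' 0 0 = b 0 0 := by
        simp only [b', hU0, Matrix.mul_one]
        exact Matrix.one_mul _
      have hZ : b' 1 0 = b 0 1 * b 1 0 := by
        simp only [b', hU0, Matrix.mul_one]
        rfl
      have hW : b' 1 1 = b 0 1 * b 1 1 * (b 0 1)⁻¹ := rfl
      rw [hG1, hX, hZ, hW, hadj _ hY, smul_sub, Matrix.mul_smul, Matrix.smul_mul]
    have e2 : ((b 0 1).det * (b 0 2).det) • (1 : Matrix (Fin 2) (Fin 2) ℂ) -
        (b 0 2).det • (b 0 1 * b 1 1 * (b 0 1).adjugate) +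
        (b 0 1).det • (b 0 1 * b 1 2 * (b 0 2).adjugate) =
        ((b 0 1).det * (b 0 2).det) • (1 - E) := by
      have hW : b' 1 1 = b 0 1 * b 1 1 * (b 0 1)⁻¹ := rfl
      have hW2 : b' 1 2 = b 0 1 * b 1 2 * (b 0 2)⁻¹ := rfl
      rw [hE1, hW, hW2, hadj _ hY, hadj _ hN, Matrix.mul_smul, Matrix.mul_smul]
      module
    rw [blockCond, e1, e2, Matrix.smul_mul, Matrix.mul_smul, Matrix.smul_apply, Matrix.smul_apply,
      h0, smul_zero, smul_zero, mul_zero]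
  obtain ⟨R, γ, η₁, η₂, hR, hER, hGR, hHR⟩ := exists_triple_normalForm hE hG hH hgen
  obtain ⟨X', hX'⟩ : ∃ X', b' 0 0 * R = R * X' := ⟨R⁻¹ * (b' 0 0 * R), by
    rw [← Matrix.mul_assoc, mul_nonsing_inv _ (isUnit_iff_ne_zero.2 hR), Matrix.one_mul]⟩
  refine ⟨![t, γ, η₁, η₂, X' 0 0, X' 0 1, X' 1 0, X' 1 1], fun k => (U k)⁻¹ * R, rfl,
    fun k => ?_, fun k l => ?_⟩
  · rw [det_mul]
    exact mul_ne_zero (isUnit_nonsing_inv_det _ (isUnit_iff_ne_zero.2 (hU k))).ne_zero hR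
  · have hX'' : X' = !![X' 0 0, X' 0 1; X' 1 0, X' 1 1] := eta_fin_two X'
    have h1 : b' k l * R = R * blocks6b ![t, γ, η₁, η₂, X' 0 0, X' 0 1, X' 1 0, X' 1 1] k l := by
      rw [hform]
      exact idemBlocks_conj hER hGR hHR (hX'.trans (congrArg _ hX'')) k l
    have h2 : b k l * ((U l)⁻¹ * R) = (U k)⁻¹ * (b' k l * R) := by
      calc b k l * ((U l)⁻¹ * R) = ((U k)⁻¹ * U k) * b k l * (U l)⁻¹ * R := by
            rw [hUU', Matrix.one_mul, Matrix.mul_assoc]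
        _ = _ := by simp only [b', Matrix.mul_assoc]
    rw [h2, h1, Matrix.mul_assoc]

theorem generic6b {ρ : ℂ} (x : PrincipalOpen (glPoly 6))
    (h : cond6b.val (glGL x).val ((glGL x)⁻¹).val ≠ 0) (t : ℂ) :
    ∃ (v : Fin 8 → ℂ) (Q : Matrix (Fin 6) (Fin 6) ℂ), v 0 = t ∧ Q.det ≠ 0 ∧
      normalS nuS33 x * Q = Q * (slice6b.reflect 1).mat v ∧
      diagonal (nuT6b ρ) * Q = Q * (constDiag (nuT6b ρ) 8).mat v := by
  set c : Fin 3 → Fin 6 := ![0, 1, 2] with hc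
  have hci : Function.Injective c := by decide
  have hb : ∀ k l, ∑ j, block pairs ((glGL x).val.submatrix id c * ((glGL x)⁻¹).val.submatrix c id)
      k j * block pairs ((glGL x).val.submatrix id c * ((glGL x)⁻¹).val.submatrix c id) j l =
      block pairs ((glGL x).val.submatrix id c * ((glGL x)⁻¹).val.submatrix c id) k l := by
    intro k l
    rw [← block_mul, normalIdem_mul_self x hci]
  obtain ⟨v, D, hv, hD, hbD⟩ := exists_blocks_normalForm hb
    (by simp only [block_normalIdem]; exact h) t
  refine ⟨v, blockDiag' pairs D, hv, ?_, ?_, ?_⟩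
  · rw [det_blockDiag']
    exact Finset.prod_ne_zero_iff.2 fun k _ => hD k
  · refine normalS_mul_eq hci (fun i => by fin_cases i <;> simp [nuS33, hc]) ?_
    refine mul_blockDiag'_eq pairs fun k l => ?_
    rw [slice6b, block_ofBlocks]
    exact hbD k l
  · exact diagonal_mul_blockDiag' pairs (fun a b k => by
      fin_cases a <;> fin_cases b <;> fin_cases k <;> rfl) _

/-- The slice for the dimension vector `(3, 3; 2, 2, 2)`. -/
def family6b (ρ : ℂ) (hρ : IsPrimitiveRoot ρ 3) : SliceBase 7 → Rep 6 :=
  sliceFamily (slice6b.reflect 1) (constDiag (nuT6b ρ) 8)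
    (reflect_mul_self (by norm_num) slice6b_mul_self)
    (constDiag_pow_three (hasDimVector_6b hρ).cube)

theorem isSlice_family6b {ρ : ℂ} (hρ : IsPrimitiveRoot ρ 3) :
    IsSlice (family6b ρ hρ) (normalFamily (hasDimVector_6b hρ).sq (hasDimVector_6b hρ).cube)
      (comp6b ρ) :=
  isSlice_sliceFamily hρ (hasDimVector_6b hρ)
    (fun v => by rw [trace_reflect trace_slice6b, sum_nuS33]; norm_num)
    (fun v => by rw [constDiag_mat, trace_diagonal])
    ⟨_, exists_generic6b.1, exists_generic6b.2, fun x hx t => generic6b x hx t⟩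

end BraidReversal

/-! ### Recovering the parameters for the dimension vector `(3, 3; 2, 2, 2)` -/

namespace BraidReversal

open Module Matrix

theorem adjugate_eq_sub {R : Type} [CommRing R] (Z : Matrix (Fin 2) (Fin 2) R) :
    Z * (Z.trace • 1 - Z) = Z.det • 1 := by
  have h : Z.trace • 1 - Z = Z.adjugate := by
    rw [adjugate_fin_two, trace_fin_two]
    ext i j
    fin_cases i <;> fin_cases j <;> simp
  rw [h, mul_adjugate]

theorem det_eq_trace {R : Type} [CommRing R] [Algebra ℂ R] (Z : Matrix (Fin 2) (Fin 2) R) :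
    Z.det = (2 : ℂ)⁻¹ • (Z.trace * Z.trace - (Z * Z).trace) := by
  have : Z.trace * Z.trace - (Z * Z).trace = Z.det + Z.det := by
    simp only [trace_fin_two, det_fin_two, mul_apply, Fin.sum_univ_two]
    ring
  rw [this]
  module

/-- Closed paths of blocks at the first corner give X, Z and WZ, where the block from the first to
the second corner is 1. Dividing by det Z makes W available, then G = Z − WX and H = W + G + X − 1.
Traces of words in G, H, X give the parameters through linear systems with nonzero determinant. -/
theorem recover6b {ρ : ℂ} (hρ : IsPrimitiveRoot ρ 3) (F : Subalgebra ℂ (SliceBase 7 → ℂ))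
    (𝔄 : Subalgebra F (Matrix (Fin 6) (Fin 6) (SliceBase 7 → ℂ)))
    (h0 : (fun x => x.1 0) ∈ F)
    (hM : (slice6b.reflect 1).mat (fun i (x : SliceBase 7) => x.1 i) ∈ 𝔄)
    (hN : (constDiag (nuT6b ρ) 8).mat (fun i (x : SliceBase 7) => x.1 i) ∈ 𝔄)
    (htr : ∀ A ∈ 𝔄, A.trace ∈ F)
    (hdiv : ∀ f ∈ polyFun _, ∀ g ∈ F, g ≠ 0 → g * f ∈ F → f ∈ F) (i : Fin 8) :
    (fun x => x.1 i) ∈ F := by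
  set v : Fin 8 → SliceBase 7 → ℂ := fun i x => x.1 i with hv
  have hp : slice6b.mat v ∈ 𝔄 := mem_of_reflect_mem (by norm_num) hM
  have hE := cornerOne_pairs_mem hρ v hN
  have hpoly : ∀ i, v i ∈ polyFun (MvPolynomial.X 0) := fun i => coord_mem_polyFun i
  have hblock : ∀ k l, (slice6b.mat v).submatrix (fun a => pairs (a, k)) (fun a => pairs (a, l)) =
      blocks6b v k l := fun k l => block_ofBlocks pairs (blocks6b v) k l
  set 𝔅 := cornerAlgebra 𝔄 (pairs_injective 0) (hE 0)
  have tr : ∀ A ∈ 𝔅, A.trace ∈ F := fun A hA =>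
    trace_mem_of_mem_cornerAlgebra htr (pairs_injective 0) (hE 0) hA
  have hsmul : ∀ r ∈ F, ∀ A ∈ 𝔅, r • A ∈ 𝔅 := fun r hr A hA => 𝔅.smul_mem hA (⟨r, hr⟩ : F)
  obtain ⟨W, hW⟩ : ∃ W, W = matH v - matG v - matX v + 1 := ⟨_, rfl⟩
  obtain ⟨Z, hZ⟩ : ∃ Z, Z = matG v + W * matX v := ⟨_, rfl⟩
  have b01 : blocks6b v 0 1 = 1 := rfl
  have b10 : blocks6b v 1 0 = Z := by rw [hZ, hW]; rfl
  have b11 : blocks6b v 1 1 = W := by rw [hW]; rfl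
  have mX : matX v ∈ 𝔅 := by
    have := submatrix_mem_cornerAlgebra (pairs_injective 0) (hE 0) hp
    rwa [hblock] at this
  have mZ : Z ∈ 𝔅 := by
    have := submatrix_mul_mem_cornerAlgebra (pairs_injective 0) (hE 0) (hE 1) hp hp
    rw [hblock, hblock] at this
    rwa [b01, b10, Matrix.one_mul] at this
  have mV : W * Z ∈ 𝔅 := by
    have := submatrix_mul_mul_mem_cornerAlgebra (pairs_injective 0) (hE 0) (hE 1) hp hp hp
    rw [hblock, hblock, hblock] at this
    rwa [b01, b10, b11, Matrix.one_mul] at this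
  obtain ⟨δ, hδ⟩ : ∃ δ, δ = Z.det := ⟨_, rfl⟩
  have mδ : δ ∈ F := by
    rw [hδ, det_eq_trace]
    exact F.smul_mem (sub_mem (mul_mem (tr _ mZ) (tr _ mZ)) (tr _ (mul_mem mZ mZ))) _
  -- By Cayley–Hamilton δZ⁻¹ is tr Z − Z, so δW is obtained from WZ inside the corner algebra.
  have mW : δ • W ∈ 𝔅 := by
    have h1 : δ • W = W * Z * (Z.trace • 1 - Z) := by
      rw [Matrix.mul_assoc, adjugate_eq_sub, hδ, Matrix.mul_smul, Matrix.mul_one]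
    rw [h1]
    exact mul_mem mV (sub_mem (hsmul _ (tr _ mZ) _ (one_mem _)) mZ)
  have mG : δ • matG v ∈ 𝔅 := by
    have h1 : δ • matG v = δ • Z - δ • W * matX v := by
      rw [hZ, smul_add, Matrix.smul_mul, add_sub_cancel_right]
    rw [h1]
    exact sub_mem (hsmul _ mδ _ mZ) (mul_mem mW mX)
  have mH : δ • matH v ∈ 𝔅 := by
    have h1 : δ • matH v = δ • W + δ • matG v + δ • matX v - δ • 1 := by
      rw [← smul_add, ← smul_add, ← smul_sub, hW]
      congr 1
      abel
    rw [h1]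
    exact sub_mem (add_mem (add_mem mW mG) (hsmul _ mδ _ mX)) (hsmul _ mδ _ (one_mem _))
  have t1 : δ * v 1 ∈ F := by
    have := tr _ mG
    rwa [trace_smul, matG, trace_fin_two_of, add_zero, smul_eq_mul] at this
  have t3 : δ * v 3 ∈ F := by
    have := tr _ mH
    rwa [trace_smul, matH, trace_fin_two_of, zero_add, smul_eq_mul] at this
  have t2 : δ * (δ * v 2) ∈ F := by
    have := tr _ (mul_mem mG mH)
    simpa [matG, matH, trace_fin_two, mul_apply, Fin.sum_univ_two] using this
  have u1 : v 4 + v 7 ∈ F := by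
    have := tr _ mX
    rwa [matX, trace_fin_two_of] at this
  have u2 : δ * (v 1 * v 4 + v 6) ∈ F := by
    have := tr _ (mul_mem mG mX)
    simpa [matG, matX, trace_fin_two, mul_apply, Fin.sum_univ_two, mul_add, mul_assoc] using this
  have u3 : δ * (v 2 * v 5 + v 3 * v 7) ∈ F := by
    have := tr _ (mul_mem mH mX)
    simpa [matH, matX, trace_fin_two, mul_apply, Fin.sum_univ_two, mul_add, mul_assoc] using this
  have u4 : δ * (δ * (v 2 * v 4 + v 3 * v 6)) ∈ F := by
    have := tr _ (mul_mem (mul_mem mG mH) mX)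
    simpa [matG, matH, matX, trace_fin_two, mul_apply, Fin.sum_univ_two, mul_add, mul_assoc] using this
  -- A sample point (t = 1, X = 2, and G, H the two off-diagonal elementary matrices) at which all
  -- the functions divided by below are nonzero; there det Z = 6.
  obtain ⟨x, hx⟩ := exists_sliceBase (d := 7) ![1, 0, 1, 0, 2, 0, 0, 2] (by simp)
  have hx' : ∀ i, v i x = ![1, 0, 1, 0, 2, 0, 0, 2] i := fun i => congrFun hx i
  have hδx : δ x ≠ 0 := by
    rw [hδ, det_fin_two, hZ, hW]
    simp [matG, matH, matX, mul_apply, Fin.sum_univ_two, hx']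
    norm_num
  have hδ0 : δ ≠ 0 := fun h => hδx (congrFun h x)
  have hd : ∀ f ∈ polyFun (MvPolynomial.X 0), δ * f ∈ F → f ∈ F := fun f hf h =>
    hdiv f hf δ mδ hδ0 h
  have c1 := hd _ (hpoly 1) t1
  have c3 := hd _ (hpoly 3) t3
  have hd2 : ∀ f ∈ polyFun (MvPolynomial.X 0), δ * (δ * f) ∈ F → f ∈ F := fun f hf h =>
    hdiv f hf (δ * δ) (mul_mem mδ mδ) (fun h' => mul_ne_zero hδx hδx (congrFun h' x))
      (by rwa [mul_assoc])
  have c2 := hd2 _ (hpoly 2) t2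
  have d2 := hd _ (add_mem (mul_mem (hpoly 1) (hpoly 4)) (hpoly 6)) u2
  have d3 := hd _ (add_mem (mul_mem (hpoly 2) (hpoly 5)) (mul_mem (hpoly 3) (hpoly 7))) u3
  have d4p := add_mem (mul_mem (hpoly 2) (hpoly 4)) (mul_mem (hpoly 3) (hpoly 6))
  have d4 := hd2 _ d4p u4
  -- The traces of GX and GHX give two linear equations in the first column of X, with determinant
  -- v₂ − v₁v₃.
  have c4 : v 4 ∈ F := hdiv _ (hpoly 4) (v 2 - v 3 * v 1) (sub_mem c2 (mul_mem c3 c1)) (by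
      intro h
      simpa [hx'] using congrFun h x) (by
    have : (v 2 - v 3 * v 1) * v 4 = v 2 * v 4 + v 3 * v 6 - v 3 * (v 1 * v 4 + v 6) := by ring
    rw [this]
    exact sub_mem d4 (mul_mem c3 d2))
  have c6 : v 6 ∈ F := by simpa using sub_mem d2 (mul_mem c1 c4)
  have c7 : v 7 ∈ F := by simpa using sub_mem u1 c4
  have c5 : v 5 ∈ F := hdiv _ (hpoly 5) (v 2) c2 (by
      intro h
      simpa [hx'] using congrFun h x) (by simpa using sub_mem d3 (mul_mem c3 c7))
  fin_cases i
  exacts [h0, c1, c2, c3, c4, c5, c6, c7]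

theorem dimension_comp6b {ρ : ℂ} (hρ : IsPrimitiveRoot ρ 3)
    (hs : ∃ (V : Rep 6) (t : ℂˣ), V.IsSimple ∧ V.HasType nuS33 (nuT6b ρ) t) :
    dimension (comp6b ρ) = 8 := by
  have := dimension_eq_of_sliceFamily hρ (D := hasDimVector_6b hρ)
    (parametrizes_normalFamily hρ (hasDimVector_6b hρ) hs) (isSlice_family6b hρ)
    fun F 𝔄 h0 hM hN htr hdiv _ => recover6b hρ F 𝔄 h0 hM hN htr hdiv
  rw [comp6b, this]
  norm_num

end BraidReversal

namespace BraidReversal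

open Module Matrix

/-! ### Eisenstein integers -/

/-- The ring `ℤ[ω]`, with `ω² = -1 - ω`. -/
abbrev Eis : Type := QuadraticAlgebra ℤ (-1) (-1)

/-- The embedding of `ℤ[ω]` that sends `ω` to a given primitive third root of unity. -/
def eisHom {ρ : ℂ} (hρ : IsPrimitiveRoot ρ 3) : Eis →+* ℂ :=
  (QuadraticAlgebra.lift (R := ℤ) (A := ℂ) (a := -1) (b := -1)
    ⟨ρ, by rw [← pow_two, one_add_add_sq hρ]; simp; ring⟩).toRingHom

variable {ρ : ℂ} (hρ : IsPrimitiveRoot ρ 3)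

theorem eisHom_mk (a b : ℤ) : eisHom hρ ⟨a, b⟩ = a + b * ρ := by
  simp [eisHom, QuadraticAlgebra.lift]

theorem eisHom_ne_zero {z : Eis} (h : z ≠ 0) : eisHom hρ z ≠ 0 := by
  intro h0
  refine h ?_
  obtain ⟨a, b⟩ := z
  rw [eisHom_mk] at h0
  obtain ⟨rfl, rfl⟩ := int_eq_zero_of_add_mul hρ h0
  rfl

/-! ### A certificate for simplicity -/

section Certificate

variable {n : ℕ}

/-- The matrices over `ℤ[ω]` in the algebra spanned by a representation. -/
def Rep.lattice (V : Rep n) : Subring (Matrix (Fin n) (Fin n) Eis) :=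
  (Algebra.adjoin ℂ (Set.range V.mat)).toSubring.comap (eisHom hρ).mapMatrix

variable {hρ} {V : Rep n}

theorem Rep.mem_lattice {A : Matrix (Fin n) (Fin n) Eis} :
    A ∈ V.lattice hρ ↔ A.map (eisHom hρ) ∈ Algebra.adjoin ℂ (Set.range V.mat) := Iff.rfl

theorem map_smul_eis (c : Eis) (A : Matrix (Fin n) (Fin n) Eis) :
    (c • A).map (eisHom hρ) = eisHom hρ c • A.map (eisHom hρ) := by
  ext i j
  simp

theorem Rep.smul_mem_lattice {A : Matrix (Fin n) (Fin n) Eis} (hA : A ∈ V.lattice hρ) (c : Eis) :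
    c • A ∈ V.lattice hρ := by
  rw [Rep.mem_lattice, map_smul_eis]
  exact Subalgebra.smul_mem _ hA _

theorem Rep.mem_lattice_of_smul {A : Matrix (Fin n) (Fin n) Eis} {c : Eis} (hc : c ≠ 0)
    (h : c • A ∈ V.lattice hρ) : A ∈ V.lattice hρ := by
  rw [Rep.mem_lattice, map_smul_eis] at h
  have := Subalgebra.smul_mem _ h (eisHom hρ c)⁻¹
  rwa [smul_smul, inv_mul_cancel₀ (eisHom_ne_zero hρ hc), one_smul] at this

theorem map_mulVec_eis (A : Matrix (Fin n) (Fin n) Eis) (v : Fin n → Eis) :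
    A.map (eisHom hρ) *ᵥ (eisHom hρ ∘ v) = eisHom hρ ∘ (A *ᵥ v) := by
  ext i
  exact (RingHom.map_mulVec (eisHom hρ) A v i).symm

/-- Let N be invariant. If all functionals ψBᵢ vanish on N, then N = 0 since they form a basis of
the dual. Otherwise the rank one matrix uψ, applied after some Bᵢ, puts u into N, and the vectors
Aⱼu span. The matrices U' and Ψ' are inverses up to the nonzero factors c and d, which avoids
denominators. -/
theorem Rep.isSimple_of_certificate [NeZero n] {u ψ : Fin n → Eis}
    (hE : vecMulVec u ψ ∈ V.lattice hρ) (A B : Fin n → Matrix (Fin n) (Fin n) Eis)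
    (hA : ∀ j, A j ∈ V.lattice hρ) (hB : ∀ j, B j ∈ V.lattice hρ)
    (U' Ψ' : Matrix (Fin n) (Fin n) Eis) {c d : Eis} (hc : c ≠ 0) (hd : d ≠ 0)
    (hU : (Matrix.of fun i j => (A j *ᵥ u) i) * U' = c • 1)
    (hΨ : Ψ' * (Matrix.of fun i j => (ψ ᵥ* B i) j) = d • 1) : V.IsSimple := by
  refine Rep.isSimple_of_forall_invariant fun N hN => ?_
  have hall : ∀ M ∈ Algebra.adjoin ℂ (Set.range V.mat), ∀ x ∈ N, M *ᵥ x ∈ N := by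
    intro M hM
    induction hM using Algebra.adjoin_induction with
    | mem M hM => obtain ⟨g, rfl⟩ := hM; exact hN g
    | algebraMap r =>
      intro x hx
      rw [Algebra.algebraMap_eq_smul_one, smul_mulVec, one_mulVec]
      exact N.smul_mem _ hx
    | add M M' _ _ h h' => intro x hx; rw [add_mulVec]; exact N.add_mem (h x hx) (h' x hx)
    | mul M M' _ _ h h' => intro x hx; rw [← mulVec_mulVec]; exact h _ (h' x hx)
  have hlat : ∀ M ∈ V.lattice hρ, ∀ x ∈ N, M.map (eisHom hρ) *ᵥ x ∈ N := fun M hM =>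
    hall _ (Rep.mem_lattice.1 hM)
  by_cases h : ∀ x ∈ N, ∀ i, (eisHom hρ ∘ (ψ ᵥ* B i)) ⬝ᵥ x = 0
  · left
    rw [Submodule.eq_bot_iff]
    intro x hx
    have h1 : (Matrix.of fun i j => (ψ ᵥ* B i) j).map (eisHom hρ) *ᵥ x = 0 :=
      funext fun i => h x hx i
    have h2 : (d • (1 : Matrix (Fin n) (Fin n) Eis)).map (eisHom hρ) *ᵥ x = 0 := by
      rw [← hΨ, Matrix.map_mul, ← mulVec_mulVec, h1, mulVec_zero]
    rw [map_smul_eis, Matrix.map_one _ (map_zero _) (map_one _), smul_mulVec, one_mulVec] at h2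
    exact (smul_eq_zero.1 h2).resolve_left (eisHom_ne_zero hρ hd)
  · right
    push Not at h
    obtain ⟨x, hx, i, hi⟩ := h
    have h1 : (vecMulVec u ψ * B i).map (eisHom hρ) *ᵥ x ∈ N := hlat _ (mul_mem hE (hB i)) x hx
    have h2 : (vecMulVec u ψ * B i).map (eisHom hρ) *ᵥ x =
        ((eisHom hρ ∘ (ψ ᵥ* B i)) ⬝ᵥ x) • (eisHom hρ ∘ u) := by
      rw [vecMulVec_mul]
      ext k
      simp only [mulVec, dotProduct, map_apply, vecMulVec_apply, map_mul, Pi.smul_apply,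
        Function.comp_apply, smul_eq_mul, Finset.sum_mul]
      exact Finset.sum_congr rfl fun _ _ => by ring
    rw [h2] at h1
    have hu : eisHom hρ ∘ u ∈ N := (N.smul_mem_iff hi).1 h1
    have hcol : ∀ j, (fun k => eisHom hρ ((A j *ᵥ u) k)) ∈ N := fun j => by
      have := hlat _ (hA j) _ hu
      rwa [map_mulVec_eis] at this
    rw [eq_top_iff]
    intro z _
    have h3 : (c • (1 : Matrix (Fin n) (Fin n) Eis)).map (eisHom hρ) *ᵥ z ∈ N := by
      rw [← hU, Matrix.map_mul, ← mulVec_mulVec]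
      set w := U'.map (eisHom hρ) *ᵥ z
      have : (Matrix.of fun i j => (A j *ᵥ u) i).map (eisHom hρ) *ᵥ w =
          ∑ j, w j • fun k => eisHom hρ ((A j *ᵥ u) k) := by
        ext k
        simp only [mulVec, dotProduct, map_apply, of_apply, Finset.sum_apply, Pi.smul_apply,
          smul_eq_mul]
        exact Finset.sum_congr rfl fun _ _ => mul_comm _ _
      rw [this]
      exact N.sum_mem fun j _ => N.smul_mem _ (hcol j)
    rw [map_smul_eis, Matrix.map_one _ (map_zero _) (map_one _), smul_mulVec, one_mulVec] at h3
    exact (N.smul_mem_iff (eisHom_ne_zero hρ hc)).1 h3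

end Certificate

/-! ### Simple points of the components -/

section Points

theorem map_mul_eq_one {n : ℕ} {S T : Matrix (Fin n) (Fin n) Eis} (h : S * T = 1) :
    S.map (eisHom hρ) * T.map (eisHom hρ) = 1 := by
  rw [← Matrix.map_mul, h, Matrix.map_one _ (map_zero _) (map_one _)]

/-- The representation of the modular group with a given involution and a diagonal `T`. -/
def pointRep {S : Matrix (Fin 6) (Fin 6) Eis} (hS : S * S = 1) {νT : Fin 6 → ℂ}
    (hT : ∀ i, νT i ^ 3 = 1) : Rep 6 :=
  Rep.ofST (S.map (eisHom hρ)) (diagonal νT) (map_mul_eq_one hρ hS) (diagonal_cube hT)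

variable {S : Matrix (Fin 6) (Fin 6) Eis} (hS : S * S = 1) {νT : Fin 6 → ℂ}
  (hT : ∀ i, νT i ^ 3 = 1)

theorem pointRep_hasType {νS : Fin 6 → ℂ} (h : eisHom hρ S.trace = ∑ i, νS i) :
    (pointRep hρ hS hT).HasType νS νT 1 := by
  refine ⟨?_, ?_, ?_⟩
  · rw [Rep.mat_mul, pointRep, Rep.ofST_bS, map_mul_eq_one hρ hS]
    simp
  · rw [pointRep, Rep.ofST_bS, ← h, AddMonoidHom.map_trace]
    simp
  · rw [pointRep, Rep.ofST_bT, trace_diagonal]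
    simp

theorem mem_lattice_pointRep : S ∈ (pointRep hρ hS hT).lattice hρ :=
  Algebra.subset_adjoin ⟨bS, by rw [pointRep, Rep.ofST_bS]; rfl⟩

theorem diagonal_mem_adjoin_pointRep :
    diagonal νT ∈ Algebra.adjoin ℂ (Set.range (pointRep hρ hS hT).mat) :=
  Algebra.subset_adjoin ⟨bT, by rw [pointRep, Rep.ofST_bT]⟩

theorem map_diagonal_eis (w : Fin 6 → Eis) :
    (diagonal w).map (eisHom hρ) = diagonal (eisHom hρ ∘ w) :=
  diagonal_map (map_zero _)

theorem diagonal_mem_lattice {a b c : Fin 6 → Eis} (h1 : a + b + c = 1)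
    (h2 : ∀ i, νT i = eisHom hρ (a i) + ρ * eisHom hρ (b i) + ρ ^ 2 * eisHom hρ (c i))
    (h3 : ∀ i, νT i ^ 2 = eisHom hρ (a i) + ρ ^ 2 * eisHom hρ (b i) + ρ * eisHom hρ (c i)) :
    diagonal a ∈ (pointRep hρ hS hT).lattice hρ ∧ diagonal b ∈ (pointRep hρ hS hT).lattice hρ ∧
      diagonal c ∈ (pointRep hρ hS hT).lattice hρ := by
  have hd := diagonal_mem_adjoin_pointRep hρ hS hT
  simp only [Rep.mem_lattice, map_diagonal_eis]
  refine idempotents_mem hρ ?_ ?_ ?_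
  · rw [diagonal_add, diagonal_add, ← diagonal_one]
    congr 1
    ext i
    have := congrArg (eisHom hρ) (congrFun h1 i)
    simpa using this
  · rw [← diagonal_smul, ← diagonal_smul, diagonal_add, diagonal_add]
    convert hd using 1
    congr 1
    ext i
    simp [h2]
  · rw [← diagonal_smul, ← diagonal_smul, diagonal_add, diagonal_add]
    convert mul_mem hd hd using 1
    rw [diagonal_mul_diagonal]
    congr 1
    ext i
    rw [← pow_two, h3]
    simp

/-- An involution in the component `6a`. -/
def point6a : Matrix (Fin 6) (Fin 6) Eis :=
  !![-1, 2, 0, 2, 0, 0; 0, -1, 2, 0, 2, 0; 2, 2, -1, 0, 0, 2; 0, 2, -2, 1, -2, 0;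
    -2, -2, 2, 0, 1, -2; 2, 0, -2, -2, -2, 1]

theorem exists_isSimple_6a {ρ : ℂ} (hρ : IsPrimitiveRoot ρ 3) :
    ∃ (V : Rep 6) (t : ℂˣ), V.IsSimple ∧ V.HasType nuS33 (nuT6a ρ) t := by
  have hS : point6a * point6a = 1 := by decide +kernel
  have hT := (hasDimVector_6a hρ).cube
  refine ⟨pointRep hρ hS hT, 1, ?_, pointRep_hasType hρ hS hT ?_⟩
  · have mS := mem_lattice_pointRep hρ hS hT
    have h3 : (ρ ^ 2) ^ 2 = ρ := by linear_combination ρ * hρ.pow_eq_one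
    obtain ⟨m0, m1, m2⟩ := diagonal_mem_lattice hρ hS hT (a := ![0, 0, 0, 1, 1, 1])
      (b := ![0, 1, 1, 0, 0, 0]) (c := ![1, 0, 0, 0, 0, 0]) (by decide)
      (fun i => by fin_cases i <;> simp [nuT6a]) (fun i => by fin_cases i <;> simp [nuT6a, h3])
    have mf := add_mem m1 m2
    set f : Matrix (Fin 6) (Fin 6) Eis := diagonal ![0, 1, 1, 0, 0, 0] + diagonal ![1, 0, 0, 0, 0, 0]
      with hf
    -- The rank one matrix is the projector of T for the simple eigenvalue ρ². Both bases come from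
    -- words alternating between S and the projector f to the eigenvalues ρ and ρ².
    refine Rep.isSimple_of_certificate (hρ := hρ) (u := ![1, 0, 0, 0, 0, 0]) (ψ := ![1, 0, 0, 0, 0, 0]) ?_
      ![1, point6a, f * point6a, point6a * (f * point6a), f * (point6a * (f * point6a)),
        point6a * (f * (point6a * (f * point6a)))]
      ![1, point6a, point6a * f, point6a * f * point6a, point6a * f * point6a * f,
        point6a * f * point6a * f * point6a] ?_ ?_
      !![8, 2, 4, 0, 11, 11; 0, 0, 0, -6, -7, -3; 0, 4, 4, 6, 8, 4; 0, 0, 0, -2, -4, -4;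
        0, 2, 0, 2, 1, 1; 0, 0, 0, 0, -1, -1]
      !![8, 0, 0, 0, 0, 0; 4, 0, 4, 0, 0, 0; 2, 0, 4, 0, 2, 0; 0, 4, -4, 0, 0, 0;
        0, 2, -2, 2, -2, 0; -11, 1, -2, 2, 1, 1] (c := 8) (d := 8) (by decide) (by decide) ?_ ?_
    · have : vecMulVec ![1, 0, 0, 0, 0, 0] ![1, 0, 0, 0, 0, 0] =
          diagonal (![1, 0, 0, 0, 0, 0] : Fin 6 → Eis) := by decide +kernel
      rw [this]
      exact m2
    · have w1 := mul_mem mf mS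
      have w2 := mul_mem mS w1
      have w3 := mul_mem mf w2
      intro j
      fin_cases j
      exacts [one_mem _, mS, w1, w2, w3, mul_mem mS w3]
    · have w1 := mul_mem mS mf
      have w2 := mul_mem w1 mS
      have w3 := mul_mem w2 mf
      intro j
      fin_cases j
      exacts [one_mem _, mS, w1, w2, w3, mul_mem w3 mS]
    · decide +kernel
    · decide +kernel
  · rw [show point6a.trace = 0 by decide +kernel, map_zero, sum_nuS33]

/-- An involution in the component `6c`. -/
def point6c : Matrix (Fin 6) (Fin 6) Eis :=
  !![-1, 0, 0, -2, 0, 2; 0, 3, -2, 0, 2, -4; -2, 0, 1, -2, 0, 2; 0, 2, -2, 1, 2, -4;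
    -2, 0, 0, -2, 1, 2; 0, 2, -2, 0, 2, -3]

theorem exists_isSimple_6c {ρ : ℂ} (hρ : IsPrimitiveRoot ρ 3) :
    ∃ (V : Rep 6) (t : ℂˣ), V.IsSimple ∧ V.HasType nuS42 (nuT6b ρ) t := by
  have hS : point6c * point6c = 1 := by decide +kernel
  have hT := (hasDimVector_6c hρ).cube
  refine ⟨pointRep hρ hS hT, 1, ?_, pointRep_hasType hρ hS hT ?_⟩
  · have mS := mem_lattice_pointRep hρ hS hT
    have h3 : (ρ ^ 2) ^ 2 = ρ := by linear_combination ρ * hρ.pow_eq_one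
    obtain ⟨m0, m1, m2⟩ := diagonal_mem_lattice hρ hS hT (a := ![1, 1, 0, 0, 0, 0])
      (b := ![0, 0, 1, 1, 0, 0]) (c := ![0, 0, 0, 0, 1, 1]) (by decide)
      (fun i => by fin_cases i <;> simp [nuT6b]) (fun i => by fin_cases i <;> simp [nuT6b, h3])
    set e : Matrix (Fin 6) (Fin 6) Eis := diagonal ![1, 1, 0, 0, 0, 0] with he
    set f : Matrix (Fin 6) (Fin 6) Eis := diagonal ![0, 0, 1, 1, 0, 0] with hf
    set g : Matrix (Fin 6) (Fin 6) Eis := diagonal ![0, 0, 0, 0, 1, 1] with hg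
    have l0 := mul_mem m0 mS
    have l1 := mul_mem m1 mS
    have l2 := mul_mem m2 mS
    have r0 := mul_mem mS m0
    have r1 := mul_mem mS m1
    have r2 := mul_mem mS m2
    refine Rep.isSimple_of_certificate (hρ := hρ) (u := ![1, 0, 0, 0, 0, 0]) (ψ := ![1, 0, 0, 0, 0, 0]) ?_
      ![1, f * point6c, g * point6c, e * point6c * (f * point6c), f * point6c * (f * point6c),
        g * point6c * (f * point6c)]
      ![1, point6c * f, point6c * g, point6c * f * (point6c * e), point6c * f * (point6c * f),
        point6c * f * (point6c * g)] ?_ ?_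
      !![4, 0, 0, 0, 0, 0; 0, 0, -2, -1, 0, 0; 0, 0, 0, 0, -2, 0; 0, 1, 0, 0, 0, 0;
        0, 0, 0, 1, 0, 0; 0, 0, 0, 0, 0, 1]
      !![4, 0, 0, 0, 0, 0; 0, 0, 0, -1, 0, 0; 0, -1, 0, 0, 1, 0; 0, -2, 0, 0, 0, 0;
        0, 0, 4, 0, 0, -1; 0, 0, 2, 0, 0, 0] (c := 4) (d := 4) (by decide) (by decide) ?_ ?_
    -- No eigenvalue of T is simple here. The block of S on the first eigenspace is diag(−1, 3), so
    -- 3e − eSe is four times an elementary projector.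
    · refine Rep.mem_lattice_of_smul (c := 4) (by decide) ?_
      have : (4 : Eis) • vecMulVec ![1, 0, 0, 0, 0, 0] ![1, 0, 0, 0, 0, 0] =
          (3 : Eis) • e - e * point6c * e := by decide +kernel
      rw [this]
      exact sub_mem (Rep.smul_mem_lattice m0 3) (mul_mem l0 m0)
    · intro j
      fin_cases j
      exacts [one_mem _, l1, l2, mul_mem l0 l1, mul_mem l1 l1, mul_mem l2 l1]
    · intro j
      fin_cases j
      exacts [one_mem _, r1, r2, mul_mem r1 r0, mul_mem r1 r1, mul_mem r1 r2]
    · decide +kernel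
    · decide +kernel
  · rw [show point6c.trace = 2 by decide +kernel, map_ofNat, sum_nuS42]

end Points

/-! ### The explicit representation -/

section Explicit

/-- The matrix of `σ₁`. -/
def exS1 : Matrix (Fin 6) (Fin 6) Eis :=
  !![⟨1, 1⟩, ⟨-1, 1⟩, ⟨-1, 1⟩, ⟨-1, 1⟩, ⟨1, -1⟩, ⟨1, -1⟩;
    ⟨-1, -2⟩, ⟨-1, 0⟩, ⟨-1, -2⟩, ⟨1, 2⟩, ⟨-1, -2⟩, ⟨1, 2⟩;
    ⟨2, 1⟩, ⟨2, 1⟩, ⟨0, -1⟩, ⟨-2, -1⟩, ⟨-2, -1⟩, ⟨2, 1⟩;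
    ⟨-2, -1⟩, ⟨0, -3⟩, ⟨2, 1⟩, ⟨2, -1⟩, ⟨0, 3⟩, ⟨-2, -1⟩;
    ⟨-1, 1⟩, ⟨1, -1⟩, ⟨3, 3⟩, ⟨1, -1⟩, ⟨1, 3⟩, ⟨-3, -3⟩;
    ⟨-3, 0⟩, ⟨-1, -2⟩, ⟨1, 2⟩, ⟨3, 0⟩, ⟨1, 2⟩, ⟨-3, -2⟩]

/-- The matrix of `σ₂`. -/
def exS2 : Matrix (Fin 6) (Fin 6) Eis :=
  !![⟨1, 1⟩, ⟨-1, 1⟩, ⟨-1, 1⟩, ⟨1, -1⟩, ⟨-1, 1⟩, ⟨-1, 1⟩;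
    ⟨-1, -2⟩, ⟨-1, 0⟩, ⟨-1, -2⟩, ⟨-1, -2⟩, ⟨1, 2⟩, ⟨-1, -2⟩;
    ⟨2, 1⟩, ⟨2, 1⟩, ⟨0, -1⟩, ⟨2, 1⟩, ⟨2, 1⟩, ⟨-2, -1⟩;
    ⟨2, 1⟩, ⟨0, 3⟩, ⟨-2, -1⟩, ⟨2, -1⟩, ⟨0, 3⟩, ⟨-2, -1⟩;
    ⟨1, -1⟩, ⟨-1, 1⟩, ⟨-3, -3⟩, ⟨1, -1⟩, ⟨1, 3⟩, ⟨-3, -3⟩;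
    ⟨3, 0⟩, ⟨1, 2⟩, ⟨-1, -2⟩, ⟨3, 0⟩, ⟨1, 2⟩, ⟨-3, -2⟩]

/-- The matrix of `4σ₁⁻¹`. -/
def exInv1 : Matrix (Fin 6) (Fin 6) Eis :=
  !![⟨0, -1⟩, ⟨-2, -1⟩, ⟨-2, -1⟩, ⟨2, 1⟩, ⟨-2, -1⟩, ⟨-2, -1⟩;
    ⟨1, 2⟩, ⟨-1, 0⟩, ⟨1, 2⟩, ⟨1, 2⟩, ⟨-1, -2⟩, ⟨1, 2⟩;
    ⟨1, -1⟩, ⟨1, -1⟩, ⟨1, 1⟩, ⟨1, -1⟩, ⟨1, -1⟩, ⟨-1, 1⟩;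
    ⟨1, -1⟩, ⟨-3, -3⟩, ⟨-1, 1⟩, ⟨3, 1⟩, ⟨-3, -3⟩, ⟨-1, 1⟩;
    ⟨2, 1⟩, ⟨-2, -1⟩, ⟨0, 3⟩, ⟨2, 1⟩, ⟨-2, -3⟩, ⟨0, 3⟩;
    ⟨3, 0⟩, ⟨-1, -2⟩, ⟨1, 2⟩, ⟨3, 0⟩, ⟨-1, -2⟩, ⟨-1, 2⟩]

/-- The matrix of `4σ₂⁻¹`. -/
def exInv2 : Matrix (Fin 6) (Fin 6) Eis :=
  !![⟨0, -1⟩, ⟨-2, -1⟩, ⟨-2, -1⟩, ⟨-2, -1⟩, ⟨2, 1⟩, ⟨2, 1⟩;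
    ⟨1, 2⟩, ⟨-1, 0⟩, ⟨1, 2⟩, ⟨-1, -2⟩, ⟨1, 2⟩, ⟨-1, -2⟩;
    ⟨1, -1⟩, ⟨1, -1⟩, ⟨1, 1⟩, ⟨-1, 1⟩, ⟨-1, 1⟩, ⟨1, -1⟩;
    ⟨-1, 1⟩, ⟨3, 3⟩, ⟨1, -1⟩, ⟨3, 1⟩, ⟨-3, -3⟩, ⟨-1, 1⟩;
    ⟨-2, -1⟩, ⟨2, 1⟩, ⟨0, -3⟩, ⟨2, 1⟩, ⟨-2, -3⟩, ⟨0, 3⟩;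
    ⟨-3, 0⟩, ⟨1, 2⟩, ⟨-1, -2⟩, ⟨3, 0⟩, ⟨-1, -2⟩, ⟨-1, 2⟩]

/-- The matrix of `σ₂²`. -/
def exSq2 : Matrix (Fin 6) (Fin 6) Eis :=
  !![⟨0, 10⟩, ⟨-4, -2⟩, ⟨8, 10⟩, ⟨0, 6⟩, ⟨-12, -6⟩, ⟨12, 6⟩;
    ⟨2, -8⟩, ⟨10, 0⟩, ⟨2, 4⟩, ⟨-6, -12⟩, ⟨6, 0⟩, ⟨6, 12⟩;
    ⟨2, -2⟩, ⟨-10, -2⟩, ⟨-10, -10⟩, ⟨6, -6⟩, ⟨-6, 6⟩, ⟨-6, -6⟩;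
    ⟨6, 6⟩, ⟨-6, -6⟩, ⟨6, 6⟩, ⟨6, -2⟩, ⟨-18, -6⟩, ⟨14, 10⟩;
    ⟨0, -6⟩, ⟨0, -6⟩, ⟨0, 6⟩, ⟨-4, -14⟩, ⟨-8, -6⟩, ⟨12, 18⟩;
    ⟨6, 0⟩, ⟨-6, 0⟩, ⟨-6, 0⟩, ⟨6, -12⟩, ⟨-10, 4⟩, ⟨2, 8⟩]

/-- The matrix of `16σ₁⁻²`. -/
def exInvSq1 : Matrix (Fin 6) (Fin 6) Eis :=
  !![⟨-10, -10⟩, ⟨-2, 2⟩, ⟨-2, -10⟩, ⟨-6, -6⟩, ⟨-6, 6⟩, ⟨6, -6⟩;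
    ⟨10, 8⟩, ⟨10, 0⟩, ⟨-2, -4⟩, ⟨6, 12⟩, ⟨6, 0⟩, ⟨-6, -12⟩;
    ⟨4, 2⟩, ⟨-8, 2⟩, ⟨0, 10⟩, ⟨12, 6⟩, ⟨-12, -6⟩, ⟨0, 6⟩;
    ⟨0, -6⟩, ⟨0, 6⟩, ⟨0, -6⟩, ⟨8, 2⟩, ⟨-12, 6⟩, ⟨4, -10⟩;
    ⟨6, 6⟩, ⟨6, 6⟩, ⟨-6, -6⟩, ⟨10, 14⟩, ⟨-2, 6⟩, ⟨-6, -18⟩;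
    ⟨6, 0⟩, ⟨-6, 0⟩, ⟨-6, 0⟩, ⟨18, 12⟩, ⟨-14, -4⟩, ⟨-6, -8⟩]

/-- Signs. -/
def exSign : Matrix (Fin 6) (Fin 6) Eis := diagonal ![1, 1, 1, -1, -1, -1]

/-- A cyclic permutation of the first three coordinates. -/
def exCycle : Matrix (Fin 6) (Fin 6) Eis :=
  !![0, 0, 1, 0, 0, 0; 1, 0, 0, 0, 0, 0; 0, 1, 0, 0, 0, 0; 0, 0, 0, 0, 0, 0; 0, 0, 0, 0, 0, 0;
    0, 0, 0, 0, 0, 0]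

theorem exS1_mul_inv : exS1 * exInv1 = (4 : Eis) • 1 := by decide +kernel

theorem exInv_mul_S1 : exInv1 * exS1 = (4 : Eis) • 1 := by decide +kernel

theorem exS2_mul_inv : exS2 * exInv2 = (4 : Eis) • 1 := by decide +kernel

theorem exInv_mul_S2 : exInv2 * exS2 = (4 : Eis) • 1 := by decide +kernel

theorem exSq2_eq : exS2 * exS2 = exSq2 := by decide +kernel

theorem exInvSq1_eq : exInv1 * exInv1 = exInvSq1 := by decide +kernel

theorem exS_eq : exS1 * exS2 * exS1 = (8 : Eis) • exSign := by decide +kernel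

theorem exS_eq' : exS2 * exS1 * exS2 = (8 : Eis) • exSign := by decide +kernel

theorem exT_trace : (exS1 * exS2).trace = 0 := by decide +kernel

theorem map_exS1 : exS1.map (eisHom hρ) = explicitS1 ρ := by
  ext i j
  fin_cases i <;> fin_cases j <;> simp [exS1, explicitS1, eisHom_mk] <;> ring

theorem map_exS2 : exS2.map (eisHom hρ) = explicitS2 ρ := by
  ext i j
  fin_cases i <;> fin_cases j <;> simp [exS2, explicitS2, eisHom_mk] <;> ring

end Explicit

end BraidReversal

namespace BraidReversal

open Module Matrix

section Explicit

variable {ρ : ℂ} (hρ : IsPrimitiveRoot ρ 3)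

theorem map_mul_eq_four {A B : Matrix (Fin 6) (Fin 6) Eis} (h : A * B = (4 : Eis) • 1) :
    A.map (eisHom hρ) * B.map (eisHom hρ) = (4 : ℂ) • 1 := by
  rw [← Matrix.map_mul, h, map_smul_eis, Matrix.map_one _ (map_zero _) (map_one _), map_ofNat]

/-- Multiplication by the matrix of a generator, as a unit. -/
def exUnit {A B : Matrix (Fin 6) (Fin 6) Eis} (h : A * B = (4 : Eis) • 1)
    (h' : B * A = (4 : Eis) • 1) : GL (Fin 6) ℂ where
  val := A.map (eisHom hρ)
  inv := (4 : ℂ)⁻¹ • B.map (eisHom hρ)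
  val_inv := by
    rw [Matrix.mul_smul, map_mul_eq_four hρ h, smul_smul, inv_mul_cancel₀ (by norm_num : (4 : ℂ) ≠ 0), one_smul]
  inv_val := by
    rw [Matrix.smul_mul, map_mul_eq_four hρ h', smul_smul, inv_mul_cancel₀ (by norm_num : (4 : ℂ) ≠ 0), one_smul]

/-- The explicit representation over `ℚ(ρ)`. -/
def explicitRep : Rep 6 :=
  PresentedGroup.toGroup
    (f := ![exUnit hρ exS1_mul_inv exInv_mul_S1, exUnit hρ exS2_mul_inv exInv_mul_S2]) (by
      intro r hr
      rw [Set.mem_singleton_iff.1 hr]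
      simp only [map_mul, map_inv, FreeGroup.lift_apply_of, mul_inv_eq_one]
      refine Units.ext ?_
      change exS1.map (eisHom hρ) * exS2.map (eisHom hρ) * exS1.map (eisHom hρ) =
        exS2.map (eisHom hρ) * exS1.map (eisHom hρ) * exS2.map (eisHom hρ)
      simp only [← Matrix.map_mul]
      rw [exS_eq, exS_eq'])

theorem explicitRep_s1 : (explicitRep hρ).mat s1 = exS1.map (eisHom hρ) := by
  rw [Rep.mat, explicitRep, s1, PresentedGroup.toGroup.of]
  rfl

theorem explicitRep_s2 : (explicitRep hρ).mat s2 = exS2.map (eisHom hρ) := by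
  rw [Rep.mat, explicitRep, s2, PresentedGroup.toGroup.of]
  rfl

theorem explicitRep_bS : (explicitRep hρ).mat bS = ((8 : Eis) • exSign).map (eisHom hρ) := by
  rw [bS, Rep.mat_mul, Rep.mat_mul, explicitRep_s1, explicitRep_s2, ← Matrix.map_mul,
    ← Matrix.map_mul, exS_eq]

theorem trace_map_eis (A : Matrix (Fin 6) (Fin 6) Eis) :
    (A.map (eisHom hρ)).trace = eisHom hρ A.trace :=
  (AddMonoidHom.map_trace (eisHom hρ) A).symm

theorem explicitRep_mem : (∃ c : ℂ, (explicitRep hρ).mat (bS * bS) = c • 1) ∧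
    ((explicitRep hρ).mat bS).trace = 0 ∧ ((explicitRep hρ).mat bT).trace = 0 := by
  refine ⟨⟨eisHom hρ 64, ?_⟩, ?_, ?_⟩
  · rw [Rep.mat_mul, explicitRep_bS, ← Matrix.map_mul,
      show ((8 : Eis) • exSign) * ((8 : Eis) • exSign) = (64 : Eis) • 1 by decide +kernel,
      map_smul_eis, Matrix.map_one _ (map_zero _) (map_one _)]
  · rw [explicitRep_bS, trace_map_eis, show ((8 : Eis) • exSign).trace = 0 by decide +kernel,
      map_zero]
  · rw [bT, Rep.mat_mul, explicitRep_s1, explicitRep_s2, ← Matrix.map_mul, trace_map_eis,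
      exT_trace, map_zero]

/-- A multiple of the projection to the first three coordinates. -/
def exProj : Matrix (Fin 6) (Fin 6) Eis := 1 + exSign

/-- A multiple of the projection to the last three coordinates. -/
def exCoproj : Matrix (Fin 6) (Fin 6) Eis := 1 - exSign

/-- Both factors live in the corner of the first three coordinates: one is σ₁ compressed to it, the
other a path through the complementary corner. Their commutator happens to be a multiple of a cyclic
permutation. -/
theorem exCycle_eq :
    exProj * exS1 * exProj * (exProj * exS1 * exCoproj * (exS1 * exProj)) -
      exProj * exS1 * exCoproj * (exS1 * exProj) * (exProj * exS1 * exProj) =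
      (⟨384, 768⟩ : Eis) • exCycle := by decide +kernel

/-- The powers of a 3-cycle sum to the all-ones matrix, which has rank one; `exProj` is twice the
identity of the corner. -/
theorem exOnes_eq : (2 : Eis) • vecMulVec ![1, 1, 1, 0, 0, 0] ![1, 1, 1, 0, 0, 0] =
    exProj + (2 : Eis) • exCycle + (2 : Eis) • (exCycle * exCycle) := by decide +kernel

theorem explicitRep_isSimple : (explicitRep hρ).IsSimple := by
  have ms : exS1 ∈ (explicitRep hρ).lattice hρ :=
    Algebra.subset_adjoin ⟨s1, explicitRep_s1 hρ⟩
  have mS : exSign ∈ (explicitRep hρ).lattice hρ :=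
    Rep.mem_lattice_of_smul (c := 8) (by decide)
      (Algebra.subset_adjoin ⟨bS, explicitRep_bS hρ⟩)
  have me : exProj ∈ (explicitRep hρ).lattice hρ := add_mem (one_mem _) mS
  have mf : exCoproj ∈ (explicitRep hρ).lattice hρ := sub_mem (one_mem _) mS
  have mc : exCycle ∈ (explicitRep hρ).lattice hρ := by
    refine Rep.mem_lattice_of_smul (c := ⟨384, 768⟩) (by decide) ?_
    rw [← exCycle_eq]
    have h1 := mul_mem (mul_mem me ms) me
    have h2 := mul_mem (mul_mem (mul_mem me ms) mf) (mul_mem ms me)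
    exact sub_mem (mul_mem h1 h2) (mul_mem h2 h1)
  refine Rep.isSimple_of_certificate (hρ := hρ) (u := ![1, 1, 1, 0, 0, 0])
    (ψ := ![1, 1, 1, 0, 0, 0]) ?_
    ![1, exS1, exCycle * exS1, exS1 * exS1, exS1 * (exCycle * exS1), exS1 * (exS1 * exS1)]
    ![1, exS1, exS1 * exCycle, exS1 * exS1, exS1 * exCycle * exS1, exS1 * exS1 * exS1] ?_ ?_
    !![⟨2808, 0⟩, ⟨2808, 0⟩, ⟨2808, 0⟩, ⟨832, -208⟩, ⟨832, -208⟩, ⟨832, -208⟩;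
      0, 0, 0, ⟨936, 936⟩, ⟨0, -936⟩, ⟨-936, 0⟩;
      ⟨648, -216⟩, ⟨-864, -648⟩, ⟨216, 864⟩, ⟨936, 0⟩, ⟨-936, -936⟩, ⟨0, 936⟩;
      0, 0, 0, ⟨0, 468⟩, ⟨-468, -468⟩, ⟨468, 0⟩;
      ⟨324, -108⟩, ⟨108, 432⟩, ⟨-432, -324⟩, ⟨1224, 684⟩, ⟨-684, 540⟩, ⟨-540, -1224⟩;
      0, 0, 0, ⟨13, 26⟩, ⟨13, 26⟩, ⟨13, 26⟩]
    !![⟨24, 0⟩, 0, ⟨-12, -12⟩, ⟨-6, -6⟩, ⟨-6, -12⟩, 0;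
      ⟨24, 0⟩, 0, ⟨0, 12⟩, ⟨6, 0⟩, ⟨12, 6⟩, 0;
      ⟨24, 0⟩, 0, ⟨12, 0⟩, ⟨0, 6⟩, ⟨-6, 6⟩, 0;
      ⟨64, -16⟩, ⟨-8, -4⟩, ⟨-4, -8⟩, ⟨-2, -4⟩, ⟨2, -2⟩, ⟨1, 2⟩;
      ⟨64, -16⟩, ⟨4, 8⟩, ⟨-4, 4⟩, ⟨4, 2⟩, ⟨2, 4⟩, ⟨1, 2⟩;
      ⟨64, -16⟩, ⟨4, -4⟩, ⟨8, 4⟩, ⟨-2, 2⟩, ⟨-4, -2⟩, ⟨1, 2⟩]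
    (c := 8424) (d := 72) (by decide) (by decide) ?_ ?_
  · refine Rep.mem_lattice_of_smul (c := 2) (by decide) ?_
    rw [exOnes_eq]
    exact add_mem (add_mem me (Rep.smul_mem_lattice mc 2)) (Rep.smul_mem_lattice (mul_mem mc mc) 2)
  · have w := mul_mem mc ms
    intro j
    fin_cases j
    exacts [one_mem _, ms, w, mul_mem ms ms, mul_mem ms w, mul_mem ms (mul_mem ms ms)]
  · have w := mul_mem ms mc
    intro j
    fin_cases j
    exacts [one_mem _, ms, w, mul_mem ms ms, mul_mem w ms, mul_mem (mul_mem ms ms) ms]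
  · decide +kernel
  · decide +kernel

/-! ### The traces of the flype and of the braid of `8₁₇` -/

theorem explicitRep_inv_s1 :
    (explicitRep hρ).mat s1⁻¹ = (4 : ℂ)⁻¹ • exInv1.map (eisHom hρ) := by
  refine Rep.mat_inv_eq _ ?_
  rw [explicitRep_s1, Matrix.mul_smul, map_mul_eq_four hρ exS1_mul_inv, smul_smul,
    inv_mul_cancel₀ (by norm_num : (4 : ℂ) ≠ 0), one_smul]

theorem explicitRep_inv_sq_s1 :
    (explicitRep hρ).mat (s1 ^ 2)⁻¹ = (16 : ℂ)⁻¹ • exInvSq1.map (eisHom hρ) := by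
  rw [← inv_pow, pow_two, Rep.mat_mul, explicitRep_inv_s1, smul_mul_smul_comm, ← Matrix.map_mul,
    exInvSq1_eq]
  norm_num

theorem explicitRep_sq_s2 : (explicitRep hρ).mat (s2 ^ 2) = exSq2.map (eisHom hρ) := by
  rw [pow_two, Rep.mat_mul, explicitRep_s2, ← Matrix.map_mul, exSq2_eq]

theorem trace_explicitRep_braid817 :
    ((explicitRep hρ).mat braid817).trace = -7128 * ρ - 1092 := by
  simp only [braid817, Rep.mat_mul, explicitRep_inv_s1, explicitRep_inv_sq_s1, explicitRep_sq_s2,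
    explicitRep_s2, Matrix.smul_mul, Matrix.mul_smul, smul_smul, ← Matrix.map_mul, trace_smul,
    trace_map_eis]
  -- The factor 256 = 16 · 4 · 4 collects the denominators of σ₁⁻² and of the two factors σ₁⁻¹.
  rw [show (exInvSq1 * exS2 * exInv1 * exS2 * exInv1 * exSq2).trace =
    256 * ⟨-1092, -7128⟩ by decide +kernel, map_mul,
    map_ofNat, eisHom_mk]
  push_cast
  norm_num
  ring

theorem trace_explicitRep_reverse_braid817 :
    ((explicitRep hρ).mat (reverse braid817)).trace = 7128 * ρ + 6036 := by
  simp only [braid817, reverse_mul, reverse_inv, reverse_pow, reverse_s1, reverse_s2, ← mul_assoc,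
    Rep.mat_mul, explicitRep_inv_s1, explicitRep_inv_sq_s1, explicitRep_sq_s2,
    explicitRep_s2, Matrix.smul_mul, Matrix.mul_smul, smul_smul, ← Matrix.map_mul, trace_smul,
    trace_map_eis]
  rw [show (exSq2 * exInv1 * exS2 * exInv1 * exS2 * exInvSq1).trace =
    256 * ⟨6036, 7128⟩ by decide +kernel, map_mul,
    map_ofNat, eisHom_mk]
  push_cast
  norm_num
  ring

theorem trace_explicitRep_flype :
    ((explicitRep hρ).mat flype).trace = 648 * ρ - 228 := by
  simp only [flype, Rep.mat_mul, explicitRep_inv_s1, explicitRep_inv_sq_s1, explicitRep_sq_s2,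
    explicitRep_s2, Matrix.smul_mul, Matrix.mul_smul, smul_smul, ← Matrix.map_mul, trace_smul,
    trace_map_eis]
  -- The factor 64 = 4 · 16 collects the denominators of σ₁⁻¹ and σ₁⁻².
  rw [show (exInv1 * exSq2 * exInvSq1 * exS2).trace = 64 * ⟨-228, 648⟩ by decide +kernel, map_mul,
    map_ofNat, eisHom_mk]
  push_cast
  norm_num
  ring

theorem trace_explicitRep_reverse_flype :
    ((explicitRep hρ).mat (reverse flype)).trace = -648 * ρ - 876 := by
  simp only [flype, reverse_mul, reverse_inv, reverse_pow, reverse_s1, reverse_s2, ← mul_assoc,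
    Rep.mat_mul, explicitRep_inv_s1, explicitRep_inv_sq_s1, explicitRep_sq_s2,
    explicitRep_s2, Matrix.smul_mul, Matrix.mul_smul, smul_smul, ← Matrix.map_mul, trace_smul,
    trace_map_eis]
  rw [show (exS2 * exInvSq1 * exSq2 * exInv1).trace = 64 * ⟨-876, -648⟩ by decide +kernel, map_mul,
    map_ofNat, eisHom_mk]
  push_cast
  norm_num
  ring

end Explicit

end BraidReversal

namespace BraidReversal

open Module Matrix

/-! ### The irreducible components with a simple point -/

section Components

variable {ρ : ℂ} (hρ : IsPrimitiveRoot ρ 3)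

include hρ

theorem mk_explicitRep_mem :
    Iss.mk (explicitRep hρ) (explicitRep_isSimple hρ).isSemisimple ∈ comp6b ρ :=
  (mk_mem_comp6b_iff _ _ hρ).2 (explicitRep_mem hρ)

theorem exists_isSimple_6b :
    ∃ (V : Rep 6) (t : ℂˣ), V.IsSimple ∧ V.HasType nuS33 (nuT6b ρ) t := by
  obtain ⟨t, ht⟩ := (mk_mem_issBeta_iff hρ (hasDimVector_6b hρ) _ _).1 (mk_explicitRep_mem hρ)
  exact ⟨_, t, explicitRep_isSimple hρ, ht⟩

theorem isIrreducible_comp6a : IsIrreducible (comp6a ρ) :=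
  (parametrizes_normalFamily hρ (hasDimVector_6a hρ) (exists_isSimple_6a hρ)).isIrreducible

theorem isIrreducible_comp6aMirror : IsIrreducible (comp6aMirror ρ) := by
  rw [comp6aMirror_eq hρ]
  exact isIrreducible_comp6a (isPrimitiveRoot_sq hρ)

theorem isIrreducible_comp6b : IsIrreducible (comp6b ρ) :=
  (parametrizes_normalFamily hρ (hasDimVector_6b hρ) (exists_isSimple_6b hρ)).isIrreducible

theorem isIrreducible_comp6c : IsIrreducible (comp6c ρ) :=
  (parametrizes_normalFamily hρ (hasDimVector_6c hρ) (exists_isSimple_6c hρ)).isIrreducible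

theorem exists_mem_issBeta {n a b x y z : ℕ} {νS νT : Fin n → ℂ}
    (D : HasDimVector ρ νS νT a b x y z)
    (hs : ∃ (V : Rep n) (t : ℂˣ), V.IsSimple ∧ V.HasType νS νT t) :
    ∃ p ∈ issBeta ρ n a b x y z, p.IsSimple := by
  obtain ⟨V, t, hV, ht⟩ := hs
  exact ⟨Iss.mk V hV.isSemisimple, (mk_mem_issBeta_iff hρ D V _).2 ⟨t, ht⟩, V, _, hV, rfl⟩

theorem exists_mem_comp6a : ∃ p ∈ comp6a ρ, p.IsSimple :=
  exists_mem_issBeta hρ (hasDimVector_6a hρ) (exists_isSimple_6a hρ)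

theorem exists_mem_comp6aMirror : ∃ p ∈ comp6aMirror ρ, p.IsSimple := by
  rw [comp6aMirror_eq hρ]
  exact exists_mem_comp6a (isPrimitiveRoot_sq hρ)

theorem exists_mem_comp6b : ∃ p ∈ comp6b ρ, p.IsSimple :=
  exists_mem_issBeta hρ (hasDimVector_6b hρ) (exists_isSimple_6b hρ)

theorem exists_mem_comp6c : ∃ p ∈ comp6c ρ, p.IsSimple :=
  exists_mem_issBeta hρ (hasDimVector_6c hρ) (exists_isSimple_6c hρ)

omit hρ in
theorem mem_components_iff {C : Set (Iss 6)} :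
    C ∈ ({comp6a ρ, comp6aMirror ρ, comp6b ρ, comp6c ρ} : Set (Set (Iss 6))) ↔
      C = comp6a ρ ∨ C = comp6aMirror ρ ∨ C = comp6b ρ ∨ C = comp6c ρ := by
  simp only [Set.mem_insert_iff, Set.mem_singleton_iff]

theorem pairwiseDisjoint_components :
    ({comp6a ρ, comp6aMirror ρ, comp6b ρ, comp6c ρ} : Set (Set (Iss 6))).PairwiseDisjoint id := by
  have h1 := disjoint_6a_mirror hρ
  have h2 := disjoint_6a_6b hρ
  have h3 := disjoint_6a_6c hρ
  have h4 := disjoint_mirror_6b hρ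
  have h5 := disjoint_mirror_6c hρ
  have h6 := disjoint_6b_6c hρ
  intro C hC D hD hne
  rw [mem_components_iff] at hC hD
  rcases hC with rfl | rfl | rfl | rfl <;> rcases hD with rfl | rfl | rfl | rfl <;>
    first
    | exact absurd rfl hne
    | assumption
    | exact Disjoint.symm (by assumption)

theorem exists_component_of_isIrreducible {Z : Set (Iss 6)} (hZ : IsIrreducible Z)
    (hs : ∃ x ∈ Z, x.IsSimple) :
    ∃ C ∈ ({comp6a ρ, comp6aMirror ρ, comp6b ρ, comp6c ρ} : Set (Set (Iss 6))), Z ⊆ C := by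
  rcases subset_of_isIrreducible hρ hZ hs with h | h | h | h
  · exact ⟨_, by simp, h⟩
  · exact ⟨_, by simp, h⟩
  · exact ⟨_, by simp, h⟩
  · exact ⟨_, by simp, h⟩

theorem isIrreducible_component {C : Set (Iss 6)}
    (hC : C ∈ ({comp6a ρ, comp6aMirror ρ, comp6b ρ, comp6c ρ} : Set (Set (Iss 6)))) :
    IsIrreducible C ∧ ∃ x ∈ C, x.IsSimple := by
  rw [mem_components_iff] at hC
  rcases hC with rfl | rfl | rfl | rfl
  · exact ⟨isIrreducible_comp6a hρ, exists_mem_comp6a hρ⟩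
  · exact ⟨isIrreducible_comp6aMirror hρ, exists_mem_comp6aMirror hρ⟩
  · exact ⟨isIrreducible_comp6b hρ, exists_mem_comp6b hρ⟩
  · exact ⟨isIrreducible_comp6c hρ, exists_mem_comp6c hρ⟩

/-- Every irreducible set with a simple point lies in one of four irreducible sets. These are
pairwise disjoint, so none is contained in a larger irreducible set, and they are the maximal ones.
-/
theorem irreducibleComponents_with_simple :
    {Z ∈ irreducibleComponents (Iss 6) | ∃ x ∈ Z, x.IsSimple} =
      {comp6a ρ, comp6aMirror ρ, comp6b ρ, comp6c ρ} := by
  ext Z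
  constructor
  · rintro ⟨hZ, hs⟩
    obtain ⟨C, hC, hZC⟩ := exists_component_of_isIrreducible hρ hZ.1 hs
    rwa [hZC.antisymm (hZ.2 (isIrreducible_component hρ hC).1 hZC)]
  · intro hZ
    obtain ⟨h1, x, hx, hxs⟩ := isIrreducible_component hρ hZ
    refine ⟨⟨h1, fun W hW hZW => ?_⟩, x, hx, hxs⟩
    obtain ⟨C, hC, hWC⟩ := exists_component_of_isIrreducible hρ hW ⟨x, hZW hx, hxs⟩
    have : Z = C := (pairwiseDisjoint_components hρ).elim hZ hC
      (Set.not_disjoint_iff.2 ⟨x, hx, hWC (hZW hx)⟩)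
    rwa [this]

theorem ncard_components :
    ({comp6a ρ, comp6aMirror ρ, comp6b ρ, comp6c ρ} : Set (Set (Iss 6))).ncard = 4 := by
  have hne : ∀ {C D : Set (Iss 6)}, Disjoint C D → C.Nonempty → C ≠ D := by
    rintro C D h hC rfl
    exact hC.ne_empty (disjoint_self.1 h)
  have ha := (isIrreducible_comp6a hρ).1
  have hm := (isIrreducible_comp6aMirror hρ).1
  have hb := (isIrreducible_comp6b hρ).1
  rw [Set.ncard_insert_of_notMem, Set.ncard_insert_of_notMem, Set.ncard_pair]
  · exact hne (disjoint_6b_6c hρ) hb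
  · simp [hne (disjoint_mirror_6b hρ) hm, hne (disjoint_mirror_6c hρ) hm]
  · simp [hne (disjoint_6a_mirror hρ) ha, hne (disjoint_6a_6b hρ) ha, hne (disjoint_6a_6c hρ) ha]

omit hρ in
theorem isOpen_trace_ne_reverse {n : ℕ} (g : B3) :
    IsOpen {x : Iss n | x.trace g ≠ x.trace (reverse g)} := by
  have := isOpen_ne_zero (sub_mem (trace_mem_issRing (n := n) g) (trace_mem_issRing (reverse g)))
  simpa [sub_eq_zero] using this

theorem trace_mk_explicitRep_ne {b : B3} (hb : b ∈ ({flype, braid817} : Set B3)) :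
    (Iss.mk (explicitRep hρ) (explicitRep_isSimple hρ).isSemisimple).trace b ≠
      (Iss.mk (explicitRep hρ) (explicitRep_isSimple hρ).isSemisimple).trace (reverse b) := by
  intro h
  rw [Iss.trace_mk, Iss.trace_mk] at h
  rcases hb with rfl | rfl
  · rw [trace_explicitRep_flype, trace_explicitRep_reverse_flype] at h
    have := int_eq_zero_of_add_mul hρ (u := 648) (v := 1296) (by push_cast; linear_combination h)
    omega
  · rw [trace_explicitRep_braid817, trace_explicitRep_reverse_braid817] at h
    have := int_eq_zero_of_add_mul hρ (u := 7128) (v := 14256)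
      (by push_cast; linear_combination -h)
    omega

theorem nonempty_comp6b_inter {b : B3} (hb : b ∈ ({flype, braid817} : Set B3)) :
    (comp6b ρ ∩ {x | x.trace b ≠ x.trace (reverse b)}).Nonempty :=
  ⟨_, mk_explicitRep_mem hρ, trace_mk_explicitRep_ne hρ hb⟩

end Components

/-! ### Which dimensions and components detect reversal -/

section Reversal

theorem trace_toRepresentation {n : ℕ} (V : Rep n) (g : B3) :
    LinearMap.trace ℂ _ (V.toRepresentation g) = (V.mat g).trace :=
  Matrix.trace_toLin'_eq _

theorem trace_reverse_of_le {n : ℕ} (hn : n ≤ 5) (V : Rep n) (g : B3) :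
    (V.mat g).trace = (V.mat (reverse g)).trace := by
  have := reversalSymmetric_of_finrank_le _ V.toRepresentation (finrank_fin_fun ℂ) hn g
  rwa [trace_toRepresentation, trace_toRepresentation] at this

/-- A proper subrepresentation and its quotient have dimension at most five, where reversal is
invisible, and traces add up. -/
theorem Rep.isSimple_of_trace_ne {V : Rep 6} {g : B3}
    (h : (V.mat g).trace ≠ (V.mat (reverse g)).trace) : V.IsSimple := by
  by_contra hV
  have := reversalSymmetric_of_not_isIrreducible V.toRepresentation (finrank_fin_fun ℂ) hV g
  rw [trace_toRepresentation, trace_toRepresentation] at this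
  exact h this

variable {ρ : ℂ} (hρ : IsPrimitiveRoot ρ 3)

include hρ

theorem isLeast_detecting : IsLeast {n : ℕ | ∃ (V : Rep n) (g : B3),
    (V.mat g).trace ≠ (V.mat (reverse g)).trace} 6 := by
  refine ⟨⟨_, flype, trace_mk_explicitRep_ne hρ (by simp)⟩, ?_⟩
  rintro n ⟨V, g, h⟩
  by_contra! hn
  exact h (trace_reverse_of_le (by omega) V g)

/-- A point that detects reversal is simple, so its component is among the four already found, and
three of these are excluded by symmetry of the traces. -/
theorem detecting_iff {Z : Set (Iss 6)} (hZ : Z ∈ irreducibleComponents (Iss 6)) :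
    (∃ x ∈ Z, ∃ g : B3, x.trace g ≠ x.trace (reverse g)) ↔ Z = comp6b ρ := by
  constructor
  · rintro ⟨x, hx, g, h⟩
    have hs : x.IsSimple := by
      obtain ⟨V, hV, rfl⟩ := x.exists_rep
      exact ⟨V, hV, Rep.isSimple_of_trace_ne h, rfl⟩
    have hmem : Z ∈ ({comp6a ρ, comp6aMirror ρ, comp6b ρ, comp6c ρ} : Set (Set (Iss 6))) :=
      irreducibleComponents_with_simple hρ ▸ ⟨hZ, x, hx, hs⟩
    have hsym := fun hx => h (Iss.trace_reverse_of_mem hρ hx g)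
    rcases (mem_components_iff).1 hmem with rfl | rfl | rfl | rfl
    · exact absurd (Or.inl (Or.inl hx)) hsym
    · exact absurd (Or.inl (Or.inr hx)) hsym
    · rfl
    · exact absurd (Or.inr hx) hsym
  · rintro rfl
    exact ⟨_, mk_explicitRep_mem hρ, flype, trace_mk_explicitRep_ne hρ (by simp)⟩

end Reversal

end BraidReversal

end

theorem mainTheorem3 (ρ : ℂ) (hρ : IsPrimitiveRoot ρ 3) :
    -- the irreducible components of `iss₆ B₃` that contain a simple representation
    {Z ∈ irreducibleComponents (BraidReversal.Iss 6) | ∃ x ∈ Z, x.IsSimple} =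
      {BraidReversal.comp6a ρ, BraidReversal.comp6aMirror ρ, BraidReversal.comp6b ρ,
        BraidReversal.comp6c ρ} ∧
    ({BraidReversal.comp6a ρ, BraidReversal.comp6aMirror ρ, BraidReversal.comp6b ρ,
        BraidReversal.comp6c ρ} : Set (Set (BraidReversal.Iss 6))).ncard = 4 ∧
    -- their dimensions
    BraidReversal.dimension (BraidReversal.comp6a ρ) = 6 ∧
    BraidReversal.dimension (BraidReversal.comp6aMirror ρ) = 6 ∧
    BraidReversal.dimension (BraidReversal.comp6b ρ) = 8 ∧
    BraidReversal.dimension (BraidReversal.comp6c ρ) = 6 ∧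
    -- the three components of dimension 6 do not separate any braid from its reversal
    (∀ x ∈ BraidReversal.comp6a ρ ∪ BraidReversal.comp6aMirror ρ ∪ BraidReversal.comp6c ρ,
      ∀ g : BraidReversal.B3, x.trace g = x.trace (BraidReversal.reverse g)) ∧
    -- on a dense open part of the component 6b, the flype and the braid of `8₁₇` are separated
    -- from their reversals
    (∀ b ∈ ({BraidReversal.flype, BraidReversal.braid817} : Set BraidReversal.B3),
      IsOpen {x : BraidReversal.Iss 6 | x.trace b ≠ x.trace (BraidReversal.reverse b)} ∧
      (BraidReversal.comp6b ρ ∩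
        {x | x.trace b ≠ x.trace (BraidReversal.reverse b)}).Nonempty ∧
      BraidReversal.comp6b ρ ⊆ closure (BraidReversal.comp6b ρ ∩
        {x | x.trace b ≠ x.trace (BraidReversal.reverse b)})) ∧
    -- an explicit simple representation over `ℚ(ρ)` in the component 6b, with its traces
    (∃ (V : BraidReversal.Rep 6) (hV : V.IsSemisimple),
      V.mat BraidReversal.s1 = BraidReversal.explicitS1 ρ ∧
      V.mat BraidReversal.s2 = BraidReversal.explicitS2 ρ ∧
      V.IsSimple ∧ BraidReversal.Iss.mk V hV ∈ BraidReversal.comp6b ρ ∧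
      (V.mat BraidReversal.braid817).trace = -7128 * ρ - 1092 ∧
      (V.mat (BraidReversal.reverse BraidReversal.braid817)).trace = 7128 * ρ + 6036 ∧
      (V.mat BraidReversal.flype).trace = 648 * ρ - 228 ∧
      (V.mat (BraidReversal.reverse BraidReversal.flype)).trace = -648 * ρ - 876) ∧
    -- 6 is the minimal dimension of a representation detecting braid reversal
    IsLeast {n : ℕ | ∃ (V : BraidReversal.Rep n) (g : BraidReversal.B3),
      (V.mat g).trace ≠ (V.mat (BraidReversal.reverse g)).trace} 6 ∧
    -- 6b is the unique irreducible component of `iss₆ B₃` detecting braid reversal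
    (∀ Z ∈ irreducibleComponents (BraidReversal.Iss 6),
      (∃ x ∈ Z, ∃ g : BraidReversal.B3, x.trace g ≠ x.trace (BraidReversal.reverse g)) ↔
        Z = BraidReversal.comp6b ρ) := by
  open BraidReversal in
  refine ⟨irreducibleComponents_with_simple hρ, ncard_components hρ,
    dimension_comp6a hρ (exists_isSimple_6a hρ), ?_, dimension_comp6b hρ (exists_isSimple_6b hρ),
    dimension_comp6c hρ (exists_isSimple_6c hρ), fun x hx g => Iss.trace_reverse_of_mem hρ hx g,
    fun b hb => ⟨isOpen_trace_ne_reverse b, nonempty_comp6b_inter hρ hb,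
      -- A nonempty relatively open subset of an irreducible set is dense, so the explicit point
      -- suffices.
      subset_closure_inter_of_isPreirreducible_of_isOpen (isIrreducible_comp6b hρ).2
        (isOpen_trace_ne_reverse b) (nonempty_comp6b_inter hρ hb)⟩,
    ⟨explicitRep hρ, (explicitRep_isSimple hρ).isSemisimple,
      (explicitRep_s1 hρ).trans (map_exS1 hρ), (explicitRep_s2 hρ).trans (map_exS2 hρ),
      explicitRep_isSimple hρ, mk_explicitRep_mem hρ, trace_explicitRep_braid817 hρ,
      trace_explicitRep_reverse_braid817 hρ, trace_explicitRep_flype hρ,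
      trace_explicitRep_reverse_flype hρ⟩,
    isLeast_detecting hρ, fun Z hZ => detecting_iff hρ hZ⟩
  rw [comp6aMirror_eq hρ]
  exact dimension_comp6a (isPrimitiveRoot_sq hρ) (exists_isSimple_6a (isPrimitiveRoot_sq hρ))
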